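/- Notation. Let $d\ge 0$, $X=(x,\xi)\in\mathbb R^d\times\mathbb R^d$, $\sigma(X,Y)=\xi\cdot y-x\cdot\eta$ for $Y=(y,\eta)$, $\langle\xi\rangle=(1+|\xi|^2)^{1/2}$, and $(\mathcal F f)(X)=(2\pi)^{-d}\int dY\,e^{i\sigma(X,Y)}f(Y)$, so that $\mathcal F=\mathcal F^{-1}$. For $\rho\in[0,1]$, $S^m_\rho$ is the space of smooth $f:\mathbb R^{2d}\to\mathbb C$ with $\sup\langle\xi\rangle^{-m+|\alpha|\rho}|\partial_x^a\partial_\xi^\alpha f|<\infty$ for all multi-indices $a,\alpha$; these suprema are the seminorms of $S^m_\rho$. A family $R_t\in S^m_\rho$ is "$O(s(t))$ in $S^m_\rho$" if each seminorm of $R_t$ is at most a constant, not depending on $t$, times $s(t)$. Let $B=(B_{kl})_{1\le k,l\le d}$ be a magnetic field (a closed two-form $\tfrac12\sum_{k,l} B_{kl}\,dx_k\wedge dx_l$, $B_{lk}=-B_{kl}$) whose components are smooth and bounded with all their derivatives. For $\varepsilon>0$ let $$\gamma_\varepsilon(x,y,z)=\frac1\varepsilon\int_{\langle x-\frac\varepsilon2(y+z),\,x+\frac\varepsilon2(y-z),\,x+\frac\varepsilon2(y+z)\rangle}B$$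 be the scaled flux through the triangle with the indicated corners, and $\gamma_0=0$. For $f\in S^{m_1}_\rho$, $g\in S^{m_2}_\rho$ define, as oscillatory integrals (limits of the integrals for $\chi_1(\delta\,\cdot)f$, $\chi_2(\delta\,\cdot)g$ as $\delta\to0^+$, the same for all Schwartz functions $\chi_1,\chi_2$ with $\chi_1(0)=\chi_2(0)=1$), the magnetic Weyl product $$(f\star g)(X)=\frac1{(2\pi)^{2d}}\int dY\int dZ\,e^{i\sigma(X,Y+Z)}e^{i\frac\varepsilon2\sigma(Y,Z)}\,e^{-i\lambda\gamma_\varepsilon(x,y,z)}\,(\mathcal F^{-1}f)(Y)\,(\mathcal F^{-1}g)(Z)$$ (with $Y=(y,\eta)$, $Z=(z,\zeta)$) and the terms of its $\lambda$-expansion $$(f\star g)_{(k)}(X)=\frac1{(2\pi)^{2d}}\int dY\int dZ\,e^{i\sigma(X,Y+Z)}e^{i\frac\varepsilon2\sigma(Y,Z)}\,\frac{(-i)^k}{k!}\gamma_\varepsilon(x,y,z)^k\,(\mathcal F^{-1}f)(Y)\,(\mathcal F^{-1}g)(Z).$$ The $(n,k)$ terms of the two-parameter expansion are $$(f\star g)_{(n,k)}(X)=\sum_{\substack{k_0+\sum_{j=1}^n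 jk_j=n\\ \sum_{j=1}^n k_j=k}}\frac{i^{k+k_0}}{k_0!\,k_1!\cdots k_n!}\,\mathcal L_0^{k_0}\bigl((\partial_\eta,\partial_y),(\partial_\zeta,\partial_z)\bigr)\prod_{j=1}^n\mathcal L_j^{k_j}(x,-i\partial_\eta,-i\partial_\zeta)\,f(Y)g(Z)\Big|_{Y=Z=X},$$ where $\mathcal L_0(Y,Z)=\tfrac12\sigma(Y,Z)$ and, for $j\ge1$, $$\mathcal L_j(x,y,z)=\frac1{j!}\Bigl(-\frac12\Bigr)^{j+1}\frac1{(j+1)^2}\sum_{k,l=1}^d\ \sum_{m_1,\dots,m_{j-1}=1}^d\partial_{m_1}\cdots\partial_{m_{j-1}}B_{kl}(x)\,y_kz_l\sum_{c=1}^j\binom{j+1}{c}\bigl((1-(-1)^{j+1})c-(1-(-1)^c)(j+1)\bigr)\,y_{m_1}\cdots y_{m_{c-1}}z_{m_c}\cdots z_{m_{j-1}}.$$ For $\varepsilon,\lambda\in(0,1)$ and $\varepsilon_c\in(0,1]$ let $N(\varepsilon,\lambda,\varepsilon_c)=\max\{n_c,k_c\}$, where $\varepsilon^{n_c+1}<\varepsilon_c\le\varepsilon^{n_c}$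 and $\lambda^{k_c+1}<\varepsilon_c\le\lambda^{k_c}$. Theorem. Let $f\in S^{m_1}_\rho$, $g\in S^{m_2}_\rho$ and $m=m_1+m_2$. 1. For all $\varepsilon,\lambda\in[0,1]$ and $n,k\in\mathbb N_0$ the oscillatory integrals above exist, and $f\star g\in S^{m}_\rho$, $(f\star g)_{(k)}\in S^{m-2k\rho}_\rho$, $(f\star g)_{(n,k)}\in S^{m-(n+k)\rho}_\rho$. 2. ($\lambda$-expansion.) For every $K$, $f\star g-\sum_{k=0}^K\lambda^k(f\star g)_{(k)}$ is $O(\lambda^{K+1})$ in $S^{m-2(K+1)\rho}_\rho$, uniformly for $\varepsilon,\lambda\in[0,1]$. 3. ($\varepsilon$-expansion of each term of the $\lambda$-expansion.) For all $k,M$, $(f\star g)_{(k)}-\sum_{n=0}^M\varepsilon^n(f\star g)_{(n,k)}$ is $O(\varepsilon^{M+1})$ in $S^{m-(M+1+k)\rho}_\rho$, uniformly for $\varepsilon\in[0,1]$. 4. (Direct two-parameter expansion, with the same terms.) For every $N$, $f\star g-\sum_{n=0}^N\sum_{k=0}^n\varepsilon^n\lambda^k(f\star g)_{(n,k)}$ is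 $O(\varepsilon^{N+1})$ in $S^{m-(N+1)\rho}_\rho$, uniformly for $\varepsilon,\lambda\in[0,1]$. 5. (Precision.) $f\star g$ is a semiclassical two-parameter symbol of order $m$ with coefficients $(f\star g)_{(n,k)}$: for every $N$ and $\varepsilon,\lambda\in[0,1)$ the difference $f\star g-\sum_{n+k\le N}\varepsilon^n\lambda^k(f\star g)_{(n,k)}$ lies in $S^{m-(N+1)\rho}_\rho$ and is $O(\max\{\varepsilon,\lambda\}^{N+1})$ in $S^m_\rho$. For all $N_\varepsilon,N_\lambda$, whenever $\varepsilon,\lambda\in(0,1)$ and $N:=N(\varepsilon,\lambda,\varepsilon_c)\le\min\{N_\varepsilon,N_\lambda\}$, the difference $f\star g-\sum_{n=0}^{N_\varepsilon}\sum_{k=0}^{N_\lambda}\varepsilon^n\lambda^k(f\star g)_{(n,k)}$ lies in $S^{m-(N+1)\rho}_\rho$, and each of its seminorms there is at most $C\varepsilon_c$ with $C$ independent of $\varepsilon,\lambda,\varepsilon_c$. 6. (Independence of the order.) For a family of functions $a_{n,k}:\mathbb R^{2d}\to\mathbb C$ the following are equivalent: (i) $a_{n,k}=(f\star g)_{(n,k)}$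 for all $n,k$; (ii) expanding $f\star g$ pointwise in powers of $\lambda\to0^+$ for each fixed $\varepsilon\in(0,1]$, and then the coefficient of each $\lambda^k$ in powers of $\varepsilon\to0^+$, gives asymptotic expansions in which $a_{n,k}$ is the coefficient of $\varepsilon^n\lambda^k$; (iii) the same with the roles of $\varepsilon$ and $\lambda$ exchanged (first $\varepsilon\to0^+$ for each fixed $\lambda\in(0,1]$, then $\lambda\to0^+$). -/

import Mathlib

open Filter Topology MeasureTheory

noncomputable section

/-- Configuration space `ℝ^d` with its Euclidean norm. -/
abbrev Cfg (d : ℕ) : Type := EuclideanSpace ℝ (Fin d)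

/-- Phase space `ℝ^d_x × ℝ^d_ξ`; a point is written `X = (x, ξ)`. -/
abbrev Phase (d : ℕ) : Type := Cfg d × Cfg d

/-- The `i`-th standard basis vector of `ℝ^d`. -/
def stdVec {d : ℕ} (i : Fin d) : Cfg d := EuclideanSpace.single i (1 : ℝ)

/-! ### Hörmander symbols -/

/-- Directional derivative of a complex valued function along `v`. -/
def dirDeriv {V : Type*} [NormedAddCommGroup V] [NormedSpace ℝ V] (v : V) (F : V → ℂ) : V → ℂ :=
  fun p => fderiv ℝ F p v

/-- Iterated directional derivatives along the vectors in a list. -/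
def dirDerivs {V : Type*} [NormedAddCommGroup V] [NormedSpace ℝ V] (vs : List V) (F : V → ℂ) :
    V → ℂ :=
  vs.foldr dirDeriv F

/-- `∂_x^I ∂_ξ^J f`; the multi-indices are given as lists of coordinate directions, so that their
lengths are `|I|` and `|J|`. -/
def partialXXi {d : ℕ} (I J : List (Fin d)) (f : Phase d → ℂ) : Phase d → ℂ :=
  dirDerivs (I.map fun i => ((stdVec i, 0) : Phase d))
    (dirDerivs (J.map fun j => ((0, stdVec j) : Phase d)) f)

/-- `⟨ξ⟩ = (1 + |ξ|^2)^{1/2}`. -/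
def japBracket {d : ℕ} (ξ : Cfg d) : ℝ := Real.sqrt (1 + ‖ξ‖ ^ 2)

/-- The seminorm `sup ⟨ξ⟩^{-m + |J| ρ} |∂_x^I ∂_ξ^J f|` is at most `C`. -/
def SymbolBound {d : ℕ} (ρ m : ℝ) (I J : List (Fin d)) (C : ℝ) (f : Phase d → ℂ) : Prop :=
  ∀ X : Phase d, ‖partialXXi I J f X‖ ≤ C * japBracket X.2 ^ (m - J.length * ρ)

/-- The Hörmander class `S^m_ρ` (that is, `S^m_{ρ,0}`). -/
def IsSymbol {d : ℕ} (ρ m : ℝ) (f : Phase d → ℂ) : Prop :=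
  ContDiff ℝ (⊤ : ℕ∞) f ∧ ∀ I J : List (Fin d), ∃ C : ℝ, SymbolBound ρ m I J C f

/-- A family `R t`, `t ∈ S`, with `R t ∈ S^{m t}_ρ`, each of whose seminorms is bounded by a
constant (not depending on `t`) times `s t`. -/
def IsUniformO {d : ℕ} {T : Type*} (S : Set T) (ρ : ℝ) (m : T → ℝ) (R : T → Phase d → ℂ)
    (s : T → ℝ) : Prop :=
  (∀ t ∈ S, IsSymbol ρ (m t) (R t)) ∧
    ∀ I J : List (Fin d), ∃ C : ℝ, ∀ t ∈ S, SymbolBound ρ (m t) I J (C * s t) (R t)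

/-! ### Magnetic fields and fluxes -/

/-- Smooth functions all of whose derivatives (including the zeroth) are bounded. -/
def IsBCInfty {d : ℕ} (b : Cfg d → ℝ) : Prop :=
  ContDiff ℝ (⊤ : ℕ∞) b ∧ ∀ n : ℕ, ∃ C : ℝ, ∀ x, ‖iteratedFDeriv ℝ n b x‖ ≤ C

/-- A magnetic field with `BC^∞` components: a closed two-form `½ ∑ B_{kl} dx_k ∧ dx_l`
(equivalently `B = dA` for a potential `A`). -/
structure IsMagneticField {d : ℕ} (B : Fin d → Fin d → Cfg d → ℝ) : Prop where
  bcInfty : ∀ k l, IsBCInfty (B k l)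
  antisymm : ∀ k l x, B k l x = - B l k x
  closed : ∀ j k l x, fderiv ℝ (B k l) x (stdVec j) + fderiv ℝ (B l j) x (stdVec k)
    + fderiv ℝ (B j k) x (stdVec l) = 0

/-- The flux `Γ^B(a,b,c)`: the integral of the two-form `B` over the oriented triangle with corners
`a, b, c`, parametrized by `(u, v) ↦ a + u (b - a) + v (c - b)`, `0 ≤ v ≤ u ≤ 1`. -/
def flux {d : ℕ} (B : Fin d → Fin d → Cfg d → ℝ) (a b c : Cfg d) : ℝ :=
  ∫ u in (0 : ℝ)..1, ∫ v in (0 : ℝ)..u,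
    ∑ k, ∑ l, B k l (a + u • (b - a) + v • (c - b)) * (b - a) k * (c - b) l

/-- The scaled flux `γ^B_ε(x,y,z)`; it is `0` for `ε = 0`, its limit as `ε → 0`. -/
def scaledFlux {d : ℕ} (B : Fin d → Fin d → Cfg d → ℝ) (ε : ℝ) (x y z : Cfg d) : ℝ :=
  ε⁻¹ * flux B (x - (ε / 2) • (y + z)) (x + (ε / 2) • (y - z)) (x + (ε / 2) • (y + z))

/-! ### Oscillatory integrals and the magnetic Weyl product -/

/-- `σ(X, Y) = ξ · y - x · η` for `X = (x, ξ)`, `Y = (y, η)`. -/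
def sympl {d : ℕ} (X Y : Phase d) : ℝ := inner ℝ X.2 Y.1 - inner ℝ X.1 Y.2

/-- The symplectic Fourier transform (which is its own inverse). -/
def symplFourier {d : ℕ} (f : Phase d → ℂ) (X : Phase d) : ℂ :=
  ((2 * Real.pi : ℝ) : ℂ)⁻¹ ^ d * ∫ Y : Phase d, Complex.exp (Complex.I * (sympl X Y : ℂ)) * f Y

/-- `(2π)^{-2d} ∫ dY ∫ dZ e^{iσ(X,Y+Z)} e^{i(ε/2)σ(Y,Z)} G(x,y,z) (𝓕f)(Y) (𝓕g)(Z)`, absolutely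
convergent for Schwartz functions `f, g` and polynomially bounded continuous `G`. -/
def weylIntegral {d : ℕ} (ε : ℝ) (G : Cfg d → Cfg d → Cfg d → ℂ) (f g : Phase d → ℂ)
    (X : Phase d) : ℂ :=
  ((2 * Real.pi : ℝ) : ℂ)⁻¹ ^ (2 * d) * ∫ Y : Phase d, ∫ Z : Phase d,
    Complex.exp (Complex.I * (sympl X (Y + Z) : ℂ)) *
      Complex.exp (Complex.I * ((ε / 2 * sympl Y Z : ℝ) : ℂ)) *
      G X.1 Y.1 Z.1 * symplFourier f Y * symplFourier g Z

/-- The same integral for functions `f, g` of tempered growth exists as an oscillatory integral and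
has the value `L`: for all Schwartz cutoffs `χ₁, χ₂` equal to `1` at the origin, the absolutely
convergent integrals for `χ₁(δ·) f`, `χ₂(δ·) g` tend to `L` as `δ → 0+`. -/
def IsOscIntegral {d : ℕ} (ε : ℝ) (G : Cfg d → Cfg d → Cfg d → ℂ) (f g : Phase d → ℂ)
    (X : Phase d) (L : ℂ) : Prop :=
  ∀ χ₁ χ₂ : SchwartzMap (Phase d) ℂ, χ₁ 0 = 1 → χ₂ 0 = 1 →
    Tendsto (fun δ : ℝ => weylIntegral ε G (fun Y => χ₁ (δ • Y) * f Y)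
      (fun Z => χ₂ (δ • Z) * g Z) X) (𝓝[>] 0) (𝓝 L)

/-- The value of the oscillatory integral (meaningful when it exists). -/
def oscIntegral {d : ℕ} (ε : ℝ) (G : Cfg d → Cfg d → Cfg d → ℂ) (f g : Phase d → ℂ)
    (X : Phase d) : ℂ :=
  Classical.epsilon fun L => IsOscIntegral ε G f g X L

/-- The magnetic part `e^{-iλγ^B_ε(x,y,z)}` of the twister. -/
def magKernel {d : ℕ} (B : Fin d → Fin d → Cfg d → ℝ) (ε lam : ℝ) (x y z : Cfg d) : ℂ :=
  Complex.exp (-Complex.I * ((lam * scaledFlux B ε x y z : ℝ) : ℂ))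

/-- The coefficient `((-i)^k / k!) γ^B_ε(x,y,z)^k` of `λ^k` in `e^{-iλγ^B_ε(x,y,z)}`. -/
def magKernelTerm {d : ℕ} (B : Fin d → Fin d → Cfg d → ℝ) (k : ℕ) (ε : ℝ) (x y z : Cfg d) : ℂ :=
  (-Complex.I) ^ k / (k.factorial : ℂ) * (scaledFlux B ε x y z : ℂ) ^ k

/-- The magnetic Weyl product of `f` and `g` with parameters `ε, λ`. -/
def magWeyl {d : ℕ} (B : Fin d → Fin d → Cfg d → ℝ) (f g : Phase d → ℂ) (ε lam : ℝ) :
    Phase d → ℂ :=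
  oscIntegral ε (magKernel B ε lam) f g

/-- The `k`-th term of the `λ`-expansion of the magnetic Weyl product; it depends on `ε`. -/
def lamTerm {d : ℕ} (B : Fin d → Fin d → Cfg d → ℝ) (f g : Phase d → ℂ) (k : ℕ) (ε : ℝ) :
    Phase d → ℂ :=
  oscIntegral ε (magKernelTerm B k ε) f g

/-! ### The terms of the two-parameter expansion -/

/-- The unit vectors of `ℝ^{2d}_Y × ℝ^{2d}_Z`, `Y = (y, η)`, `Z = (z, ζ)`. -/
def vecY {d : ℕ} (i : Fin d) : Phase d × Phase d := ((stdVec i, 0), 0)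
def vecEta {d : ℕ} (i : Fin d) : Phase d × Phase d := ((0, stdVec i), 0)
def vecZ {d : ℕ} (i : Fin d) : Phase d × Phase d := (0, (stdVec i, 0))
def vecZeta {d : ℕ} (i : Fin d) : Phase d × Phase d := (0, (0, stdVec i))

/-- `𝓛₀((∂_η,∂_y),(∂_ζ,∂_z)) = ½ (∂_y · ∂_ζ - ∂_η · ∂_z)`, acting on functions of `(Y, Z)`. -/
def opL0 {d : ℕ} (F : Phase d × Phase d → ℂ) : Phase d × Phase d → ℂ := fun p =>
  (1 / 2 : ℂ) * ∑ l : Fin d,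
    (dirDerivs [vecY l, vecZeta l] F p - dirDerivs [vecEta l, vecZ l] F p)

/-- `𝓛_j(x, -i∂_η, -i∂_ζ)` for `j ≥ 1`, acting on functions of `(Y, Z)` with `x` frozen, where
`𝓛_j(x,y,z) = (1/j!) ∑ ∂_{m_1}⋯∂_{m_{j-1}} B_{kl}(x) y_k z_l (-1/2)^{j+1} (j+1)^{-2}
  ∑_{c=1}^{j} binom(j+1,c) ((1-(-1)^{j+1}) c - (1-(-1)^c) (j+1))
    y_{m_1}⋯y_{m_{c-1}} z_{m_c}⋯z_{m_{j-1}}`. -/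
def opLMag {d : ℕ} (B : Fin d → Fin d → Cfg d → ℝ) (x : Cfg d) (j : ℕ)
    (F : Phase d × Phase d → ℂ) : Phase d × Phase d → ℂ := fun p =>
  (1 / (j.factorial : ℂ)) * (-1 / 2 : ℂ) ^ (j + 1) * (1 / ((j : ℂ) + 1) ^ 2) *
    ∑ k : Fin d, ∑ l : Fin d, ∑ μ : Fin (j - 1) → Fin d,
      (iteratedFDeriv ℝ (j - 1) (B k l) x (fun r => stdVec (μ r)) : ℂ) *
        ∑ c ∈ Finset.Icc 1 j, ((j + 1).choose c : ℂ) *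
          ((1 - (-1 : ℂ) ^ (j + 1)) * c - (1 - (-1 : ℂ) ^ c) * (j + 1)) *
          ((-Complex.I) ^ (j + 1) *
            dirDerivs ([vecEta k, vecZeta l]
              ++ ((List.ofFn μ).take (c - 1)).map vecEta
              ++ ((List.ofFn μ).drop (c - 1)).map vecZeta) F p)

/-- `𝓛_j` for all `j ≥ 0` as a differential operator in `(Y, Z)`. -/
def opL {d : ℕ} (B : Fin d → Fin d → Cfg d → ℝ) (x : Cfg d) (j : ℕ)
    (F : Phase d × Phase d → ℂ) : Phase d × Phase d → ℂ :=
  if j = 0 then opL0 F else opLMag B x j F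

/-- The tuples `(k_0, …, k_n)` with `k_0 + ∑_{j=1}^n j k_j = n` and `∑_{j=1}^n k_j = k`
(all entries of such a tuple are at most `n`). -/
def expIndices (n k : ℕ) : Finset (Fin (n + 1) → ℕ) :=
  (Fintype.piFinset fun _ => Finset.range (n + 1)).filter fun κ =>
    κ 0 + ∑ j : Fin (n + 1), (j : ℕ) * κ j = n ∧ ∑ j : Fin n, κ j.succ = k

/-- The composition `𝓛₀^{k_0} 𝓛₁^{k_1} ⋯ 𝓛_n^{k_n}` applied to `F`. -/
def opLProd {d : ℕ} (B : Fin d → Fin d → Cfg d → ℝ) (x : Cfg d) {n : ℕ} (κ : Fin (n + 1) → ℕ)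
    (F : Phase d × Phase d → ℂ) : Phase d × Phase d → ℂ :=
  (List.finRange (n + 1)).foldr (fun (j : Fin (n + 1)) H => (opL B x (j : ℕ))^[κ j] H) F

/-- The `(n,k)` term of the two-parameter expansion of the product of `f` and `g`. -/
def nkTerm {d : ℕ} (B : Fin d → Fin d → Cfg d → ℝ) (f g : Phase d → ℂ) (n k : ℕ)
    (X : Phase d) : ℂ :=
  ∑ κ ∈ expIndices n k,
    Complex.I ^ (k + κ 0) / ((∏ j, (κ j).factorial : ℕ) : ℂ) *
      opLProd B X.1 κ (fun p => f p.1 * g p.2) (X, X)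

/-! ### Two-parameter symbols, precision, asymptotic expansions -/

/-- `F` is a semiclassical two-parameter symbol of order `m` and weight `ρ` on `[0,ε₀) × [0,λ₀)`
with expansion coefficients `a n k`. -/
def IsSemiclassicalSymbol {d : ℕ} (ρ m ε₀ lam₀ : ℝ) (F : ℝ → ℝ → Phase d → ℂ)
    (a : ℕ → ℕ → Phase d → ℂ) : Prop :=
  (∀ ε ∈ Set.Ico 0 ε₀, ∀ lam ∈ Set.Ico 0 lam₀, IsSymbol ρ m (F ε lam)) ∧
  (∀ n k : ℕ, IsSymbol ρ (m - (n + k) * ρ) (a n k)) ∧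
  ∀ N : ℕ,
    (∀ ε ∈ Set.Ico 0 ε₀, ∀ lam ∈ Set.Ico 0 lam₀, IsSymbol ρ (m - (N + 1) * ρ) fun X =>
      F ε lam X - ∑ l ∈ Finset.range (N + 1), ∑ q ∈ Finset.HasAntidiagonal.antidiagonal l,
        (ε : ℂ) ^ q.1 * (lam : ℂ) ^ q.2 * a q.1 q.2 X) ∧
    ∀ I J : List (Fin d), ∃ C : ℝ, ∀ ε ∈ Set.Ico 0 ε₀, ∀ lam ∈ Set.Ico 0 lam₀,
      SymbolBound ρ m I J (C * max ε lam ^ (N + 1)) fun X =>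
        F ε lam X - ∑ l ∈ Finset.range (N + 1), ∑ q ∈ Finset.HasAntidiagonal.antidiagonal l,
          (ε : ℂ) ^ q.1 * (lam : ℂ) ^ q.2 * a q.1 q.2 X

/-- `N = N(ε, λ, ε_c)`: `N = max{n_c, k_c}` with `ε^{n_c+1} < ε_c ≤ ε^{n_c}` and
`λ^{k_c+1} < ε_c ≤ λ^{k_c}`. -/
def IsPrecisionOrder (ε lam εc : ℝ) (N : ℕ) : Prop :=
  ∃ nc kc : ℕ, ε ^ (nc + 1) < εc ∧ εc ≤ ε ^ nc ∧ lam ^ (kc + 1) < εc ∧ εc ≤ lam ^ kc ∧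
    N = max nc kc

/-- The order is defined for all `ε, λ ∈ (0,1)` and all `ε_c ∈ (0,1]`. -/
theorem exists_isPrecisionOrder {ε lam εc : ℝ} (hε : ε ∈ Set.Ioo (0 : ℝ) 1)
    (hlam : lam ∈ Set.Ioo (0 : ℝ) 1) (hc : εc ∈ Set.Ioc (0 : ℝ) 1) :
    ∃ N, IsPrecisionOrder ε lam εc N := by
  obtain ⟨n, hn, hn'⟩ := exists_nat_pow_near_of_lt_one hc.1 hc.2 hε.1 hε.2
  obtain ⟨k, hk, hk'⟩ := exists_nat_pow_near_of_lt_one hc.1 hc.2 hlam.1 hlam.2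
  exact ⟨max n k, n, k, hn, hn', hk, hk', rfl⟩

/-- The resummation up to `n ≤ Nε`, `k ≤ Nlam` is `ε_c`-close to `F` whenever
`N = N(ε, λ, ε_c) ≤ Nε, Nlam`: the difference lies in `S^{m-(N+1)ρ}_ρ`, and its seminorms there are
at most `C ε_c` with `C` independent of `ε, λ, ε_c`. -/
def IsPrecisionClose {d : ℕ} (ρ m : ℝ) (F : ℝ → ℝ → Phase d → ℂ) (a : ℕ → ℕ → Phase d → ℂ)
    (Nε Nlam : ℕ) : Prop :=
  IsUniformO {p : ℝ × ℝ × ℝ × ℕ | p.1 ∈ Set.Ioo (0 : ℝ) 1 ∧ p.2.1 ∈ Set.Ioo (0 : ℝ) 1 ∧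
      IsPrecisionOrder p.1 p.2.1 p.2.2.1 p.2.2.2 ∧ p.2.2.2 ≤ Nε ∧ p.2.2.2 ≤ Nlam}
    ρ (fun p => m - (p.2.2.2 + 1) * ρ)
    (fun p X => F p.1 p.2.1 X - ∑ n ∈ Finset.range (Nε + 1), ∑ k ∈ Finset.range (Nlam + 1),
      (p.1 : ℂ) ^ n * (p.2.1 : ℂ) ^ k * a n k X)
    (fun p => p.2.2.1)

/-- `F t ∼ ∑ t^n a_n` pointwise as `t → 0+`. -/
def HasExpansion {d : ℕ} (F : ℝ → Phase d → ℂ) (a : ℕ → Phase d → ℂ) : Prop :=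
  ∀ (N : ℕ) (X : Phase d),
    (fun t : ℝ => F t X - ∑ n ∈ Finset.range (N + 1), (t : ℂ) ^ n * a n X)
      =o[𝓝[>] 0] fun t : ℝ => t ^ N

/-- `a n k` is the coefficient of `ε^n λ^k` when `F ε λ` is expanded first in `λ` (at fixed `ε`) and
then each resulting term is expanded in `ε`. -/
def IsLamThenEpsExpansion {d : ℕ} (F : ℝ → ℝ → Phase d → ℂ) (a : ℕ → ℕ → Phase d → ℂ) : Prop :=
  ∃ b : ℕ → ℝ → Phase d → ℂ,
    (∀ ε ∈ Set.Ioc (0 : ℝ) 1, HasExpansion (fun lam => F ε lam) (fun k => b k ε)) ∧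
    ∀ k, HasExpansion (b k) (fun n => a n k)

/-- `a n k` is the coefficient of `ε^n λ^k` when `F ε λ` is expanded first in `ε` (at fixed `λ`) and
then each resulting term is expanded in `λ`. -/
def IsEpsThenLamExpansion {d : ℕ} (F : ℝ → ℝ → Phase d → ℂ) (a : ℕ → ℕ → Phase d → ℂ) : Prop :=
  ∃ c : ℕ → ℝ → Phase d → ℂ,
    (∀ lam ∈ Set.Ioc (0 : ℝ) 1, HasExpansion (fun ε => F ε lam) (fun n => c n lam)) ∧
    ∀ n, HasExpansion (c n) (fun k => a n k)

end

/-! Write w = (y, z) and θ = (η, ζ). Partial Fourier inversion in the momenta turns the Weyl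
integral into (2π)^{-2d} ∫dθ ∫dw e^{-i⟨w,θ⟩} G(x, ε, λ, w) f(x - εz/2, ξ + η) g(x + εy/2, ξ + ζ),
where G is e^{-iλγ} or a multiple of γ^k (`weylIntegral_eq_oscInt`). For a smooth G of polynomial
growth in w this is defined by trading (1 + |w|²)^{-K} in the kernel for (1 - Δ_θ)^K on f ⊗ g. The
w-integral then decays in θ by integration by parts, and the result does not depend on K once K is
large (`oscInt`, `eventually_oscInt_eq`). The cutoffs in the definition of the oscillatory integral
are removed by dominated convergence (`tendsto_oscInt_cutoff`).

Everything rests on one exchange: a linear factor of w in the kernel equals -i∂_θ applied to f ⊗ g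
(`oscInt_mulW`). This is a momentum derivative, so each such factor lowers the symbol order by ρ
(`exists_bound_oscInt`, `unifSym_oscInt`). Symbol orders are thus found by counting factors of w.
The same exchange shows that ∂_ε acts as the ε-derivative of the kernel plus i𝓛₀ on f ⊗ g
(`hasFDerivAt_oscInt`), whereas ∂_λ only multiplies the kernel by -iγ.

The flux equals ε ∑ y_k z_l b_{kl}(x, εw) with explicit triangle means b_{kl} (`scaledFlux_eq`). It
can be read in two ways. As ε times two free factors of w, it shows that the λ-Taylor remainder
carries ε^{K+1} λ^{K+1} and gains 2(K+1)ρ. With ε absorbed into εz, it has a single free factor of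
w, and every ∂_ε produces exactly one more (`eKer_fluxKer`, `EKer.dirDeriv_eps`); so n derivatives
in ε of the k-th λ-term gain (n + k)ρ. Taylor's formula, applied to all symbol seminorms at once
(`famBound_taylor`), gives the λ-expansion and the ε-expansion of its terms.

The Taylor coefficients are identified at ε = 0. There a constant kernel gives the value on the
diagonal (`oscInt_one`), and polynomials in w become differential operators (`MulRep`). The moments
of the triangle show that the Taylor coefficients of γ are the polynomials -𝓛_j
(`iteratedDeriv_fluxKer`). The multinomial theorem for γ^k and Leibniz' rule for the two parts of
∂_ε then reproduce the sum over tuples that defines the (n,k) term (`nkTerm_eq`).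

Since γ = O(ε), the (n,k) term vanishes for k > n. Therefore the λ-expansion up to order N, whose
remainder already contains ε^{N+1}, combined with the ε-expansions of its terms, is the direct
two-parameter expansion. The statements by total order and by precision differ from it only by
finitely many terms of the right size. Independence of the order of expansion is uniqueness of
asymptotic coefficients, applied twice. -/

noncomputable section

/-! ### Functions with polynomially bounded derivatives -/

section Growth

variable {E E' F F' H : Type*} [NormedAddCommGroup E] [NormedSpace ℝ E]
  [NormedAddCommGroup E'] [NormedSpace ℝ E'] [NormedAddCommGroup F] [NormedSpace ℝ F]
  [NormedAddCommGroup F'] [NormedSpace ℝ F'] [NormedAddCommGroup H] [NormedSpace ℝ H]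

/-- Smooth functions each of whose derivatives is bounded by a power of the weight `σ`. -/
def PGrowth (σ : E → ℝ) (f : E → F) : Prop :=
  ContDiff ℝ (⊤ : ℕ∞) f ∧
    ∀ n : ℕ, ∃ C : ℝ, ∃ q : ℕ, ∀ e, ‖iteratedFDeriv ℝ n f e‖ ≤ C * σ e ^ q

/-- Smooth functions each of whose derivatives of positive order is bounded by a power of `σ`. -/
def PGrowthDeriv (σ : E → ℝ) (f : E → F) : Prop :=
  ContDiff ℝ (⊤ : ℕ∞) f ∧ PGrowth σ (fderiv ℝ f)

variable {σ : E → ℝ}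

theorem PGrowth.uniform {f : E → F} (hσ : ∀ e, 1 ≤ σ e) (hf : PGrowth σ f) (N : ℕ) :
    ∃ C : ℝ, ∃ q : ℕ, 0 ≤ C ∧ ∀ n ≤ N, ∀ e, ‖iteratedFDeriv ℝ n f e‖ ≤ C * σ e ^ q := by
  choose C q h using hf.2
  refine ⟨∑ n ∈ Finset.range (N + 1), |C n|, ∑ n ∈ Finset.range (N + 1), q n,
    Finset.sum_nonneg fun _ _ => abs_nonneg _, fun n hn e => (h n e).trans ?_⟩
  have hmem : n ∈ Finset.range (N + 1) := by simpa using Nat.lt_succ_of_le hn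
  have h0 : (0 : ℝ) ≤ σ e := zero_le_one.trans (hσ e)
  gcongr
  · exact (le_abs_self _).trans
      (Finset.single_le_sum (f := fun n => |C n|) (fun _ _ => abs_nonneg _) hmem)
  · exact hσ e
  · exact Finset.single_le_sum (f := q) (fun _ _ => Nat.zero_le _) hmem

theorem pGrowth_of_fderiv {f : E → F} (hf : ContDiff ℝ (⊤ : ℕ∞) f)
    (h0 : ∃ C : ℝ, ∃ q : ℕ, ∀ e, ‖f e‖ ≤ C * σ e ^ q) (h : PGrowth σ (fderiv ℝ f)) :
    PGrowth σ f := by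
  refine ⟨hf, fun n => ?_⟩
  cases n with
  | zero => simpa using h0
  | succ n =>
    obtain ⟨C, q, hb⟩ := h.2 n
    exact ⟨C, q, fun e => by rw [← norm_iteratedFDeriv_fderiv]; exact hb e⟩

theorem PGrowth.fderiv {f : E → F} (hf : PGrowth σ f) : PGrowth σ (fderiv ℝ f) := by
  refine ⟨hf.1.fderiv_right (by simp), fun n => ?_⟩
  obtain ⟨C, q, hb⟩ := hf.2 (n + 1)
  exact ⟨C, q, fun e => by rw [norm_iteratedFDeriv_fderiv]; exact hb e⟩

theorem PGrowth.deriv_growth {f : E → F} (hf : PGrowth σ f) : PGrowthDeriv σ f :=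
  ⟨hf.1, hf.fderiv⟩

theorem pGrowth_const (c : F) : PGrowth σ (fun _ : E => c) := by
  refine ⟨contDiff_const, fun n => ⟨‖c‖, 0, fun e => ?_⟩⟩
  cases n with
  | zero => simp
  | succ n => rw [iteratedFDeriv_succ_const]; simp

theorem PGrowth.clm_comp (L : F →L[ℝ] F') {f : E → F} (hf : PGrowth σ f) :
    PGrowth σ (fun e => L (f e)) := by
  refine ⟨L.contDiff.comp hf.1, fun n => ?_⟩
  obtain ⟨C, q, hb⟩ := hf.2 n
  refine ⟨‖L‖ * C, q, fun e => ?_⟩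
  refine (L.norm_iteratedFDeriv_comp_left (f := f) (hf.1.contDiffAt (x := e))
    (by exact_mod_cast le_top)).trans ?_
  rw [mul_assoc]
  gcongr
  exact hb e

theorem PGrowth.dirDeriv {f : E → ℂ} (hf : PGrowth σ f) (v : E) : PGrowth σ (dirDeriv v f) :=
  hf.fderiv.clm_comp (ContinuousLinearMap.apply ℝ ℂ v)

theorem PGrowth.add (hσ : ∀ e, 1 ≤ σ e) {f g : E → F} (hf : PGrowth σ f) (hg : PGrowth σ g) :
    PGrowth σ (fun e => f e + g e) := by
  refine ⟨hf.1.add hg.1, fun n => ?_⟩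
  obtain ⟨C, q, hC, hb⟩ := hf.uniform hσ n
  obtain ⟨C', q', hC', hb'⟩ := hg.uniform hσ n
  refine ⟨C + C', q + q', fun e => ?_⟩
  have h := iteratedFDeriv_add_apply (𝕜 := ℝ) (i := n) (x := e) (f := f) (g := g)
    (hf.1.contDiffAt.of_le (by exact_mod_cast le_top))
    (hg.1.contDiffAt.of_le (by exact_mod_cast le_top))
  have h' : iteratedFDeriv ℝ n (fun e => f e + g e) e
      = iteratedFDeriv ℝ n f e + iteratedFDeriv ℝ n g e := h
  rw [h']
  have h0 : (0 : ℝ) ≤ σ e := zero_le_one.trans (hσ e)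
  refine (norm_add_le _ _).trans ?_
  rw [add_mul]
  gcongr
  · refine (hb n le_rfl e).trans ?_
    gcongr
    · exact hσ e
    · omega
  · refine (hb' n le_rfl e).trans ?_
    gcongr
    · exact hσ e
    · omega

theorem PGrowth.sum (hσ : ∀ e, 1 ≤ σ e) {ι : Type*} {s : Finset ι} {f : ι → E → F}
    (hf : ∀ i ∈ s, PGrowth σ (f i)) : PGrowth σ (fun e => ∑ i ∈ s, f i e) := by
  classical
  induction s using Finset.induction_on with
  | empty => simpa using pGrowth_const (σ := σ) (0 : F)
  | insert a s ha ih =>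
    simp only [Finset.sum_insert ha]
    exact (hf a (by simp)).add hσ (ih fun i hi => hf i (by simp [hi]))

theorem PGrowth.bilin (hσ : ∀ e, 1 ≤ σ e) (L : F →L[ℝ] F' →L[ℝ] H) {f : E → F} {g : E → F'}
    (hf : PGrowth σ f) (hg : PGrowth σ g) : PGrowth σ (fun e => L (f e) (g e)) := by
  refine ⟨(L.isBoundedBilinearMap.contDiff).comp (hf.1.prodMk hg.1), fun n => ?_⟩
  obtain ⟨C, q, hC, hb⟩ := hf.uniform hσ n
  obtain ⟨C', q', hC', hb'⟩ := hg.uniform hσ n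
  refine ⟨‖L‖ * ∑ i ∈ Finset.range (n + 1), (n.choose i : ℝ) * C * C', q + q', fun e => ?_⟩
  have h0 : (0 : ℝ) ≤ σ e := zero_le_one.trans (hσ e)
  refine (L.norm_iteratedFDeriv_le_of_bilinear hf.1 hg.1 e (by exact_mod_cast le_top)).trans ?_
  rw [mul_assoc, Finset.sum_mul]
  refine mul_le_mul_of_nonneg_left (Finset.sum_le_sum fun i hi => ?_)
    (ContinuousLinearMap.opNorm_nonneg L)
  rw [Finset.mem_range] at hi
  calc (n.choose i : ℝ) * ‖iteratedFDeriv ℝ i f e‖ * ‖iteratedFDeriv ℝ (n - i) g e‖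
      ≤ (n.choose i : ℝ) * (C * σ e ^ q) * (C' * σ e ^ q') := by
        gcongr
        · exact hb i (by omega) e
        · exact hb' _ (by omega) e
    _ = _ := by rw [pow_add]; ring

theorem PGrowth.mul (hσ : ∀ e, 1 ≤ σ e) {f g : E → ℂ} (hf : PGrowth σ f) (hg : PGrowth σ g) :
    PGrowth σ (fun e => f e * g e) :=
  hf.bilin hσ (ContinuousLinearMap.mul ℝ ℂ) hg

theorem PGrowth.smul (hσ : ∀ e, 1 ≤ σ e) {f : E → ℝ} {g : E → F} (hf : PGrowth σ f)
    (hg : PGrowth σ g) : PGrowth σ (fun e => f e • g e) :=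
  hf.bilin hσ (ContinuousLinearMap.lsmul ℝ ℝ) hg

theorem PGrowth.const_mul {f : E → ℂ} (hf : PGrowth σ f) (c : ℂ) : PGrowth σ (fun e => c * f e) :=
  hf.clm_comp (ContinuousLinearMap.mul ℝ ℂ c)

theorem PGrowth.pow (hσ : ∀ e, 1 ≤ σ e) {f : E → ℂ} (hf : PGrowth σ f) (k : ℕ) :
    PGrowth σ (fun e => f e ^ k) := by
  induction k with
  | zero => simpa using pGrowth_const (σ := σ) (1 : ℂ)
  | succ k ih => simpa only [pow_succ] using ih.mul hσ hf

theorem PGrowth.ofReal {f : E → ℝ} (hf : PGrowth σ f) : PGrowth σ (fun e => (f e : ℂ)) :=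
  hf.clm_comp Complex.ofRealCLM

/-- The derivative is constant, so no control of the values of L by the weight is needed. This
matters for the position x, which enters compositions although no weight bounds it. -/
theorem pGrowthDeriv_clm (L : E →L[ℝ] F) : PGrowthDeriv σ (fun e => L e) := by
  refine ⟨L.contDiff, ?_⟩
  have : _root_.fderiv ℝ (fun e => L e) = fun _ => L := by
    funext e; exact L.fderiv
  rw [this]
  exact pGrowth_const L

theorem pGrowth_clm (L : E →L[ℝ] F) (h : ∃ C : ℝ, ∃ q : ℕ, ∀ e, ‖L e‖ ≤ C * σ e ^ q) :
    PGrowth σ (fun e => L e) :=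
  pGrowth_of_fderiv L.contDiff h (pGrowthDeriv_clm L).2

theorem PGrowthDeriv.add (hσ : ∀ e, 1 ≤ σ e) {f g : E → F} (hf : PGrowthDeriv σ f)
    (hg : PGrowthDeriv σ g) : PGrowthDeriv σ (fun e => f e + g e) := by
  refine ⟨hf.1.add hg.1, ?_⟩
  have : _root_.fderiv ℝ (fun e => f e + g e) =
      fun e => _root_.fderiv ℝ f e + _root_.fderiv ℝ g e := by
    funext e
    exact fderiv_fun_add (hf.1.differentiable (by simp) e) (hg.1.differentiable (by simp) e)
  rw [this]
  exact hf.2.add hσ hg.2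

/-- Explicit chain rule bound: if the derivatives of `g` at `f e` are bounded by `C`, those of
`g ∘ f` at `e` are bounded by `c C σ(e)^r`, with `c, r` not depending on `g`. -/
theorem norm_iteratedFDeriv_comp_bound (hσ : ∀ e, 1 ≤ σ e) {f : E → E'}
    (hf : PGrowthDeriv σ f) (N : ℕ) :
    ∃ c : ℝ, ∃ r : ℕ, 0 ≤ c ∧ ∀ g : E' → F, ContDiff ℝ (⊤ : ℕ∞) g → ∀ n ≤ N, ∀ e, ∀ C : ℝ, 0 ≤ C →
      (∀ i ≤ N, ‖iteratedFDeriv ℝ i g (f e)‖ ≤ C) →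
        ‖iteratedFDeriv ℝ n (g ∘ f) e‖ ≤ c * C * σ e ^ r := by
  obtain ⟨A, q, hA, hb⟩ := hf.2.uniform hσ N
  refine ⟨N.factorial * (1 + A) ^ N, q * N, by positivity, fun g hg n hn e C hC0 hC => ?_⟩
  have h0 : (0 : ℝ) ≤ σ e := zero_le_one.trans (hσ e)
  -- The Faà di Bruno estimate asks for a D with i-th derivative at most D^i. Taking 1 + A instead
  -- of A makes D ≥ 1, so that D ≤ D^i for i ≥ 1 and D^n ≤ D^N.
  have h1 : 1 ≤ (1 + A) * σ e ^ q :=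
    one_le_mul_of_one_le_of_one_le (by linarith) (one_le_pow₀ (hσ e))
  have key := norm_iteratedFDeriv_comp_le (𝕜 := ℝ) (n := n) (N := ((⊤ : ℕ∞) : WithTop ℕ∞)) hg hf.1
    (by exact_mod_cast le_top) e (C := C) (D := (1 + A) * σ e ^ q)
    (fun i hi => hC i (hi.trans hn)) (fun i h1i hi => ?_)
  · refine key.trans ?_
    have : ((1 + A) * σ e ^ q) ^ n ≤ ((1 + A) * σ e ^ q) ^ N := pow_le_pow_right₀ h1 hn
    calc (n.factorial : ℝ) * C * ((1 + A) * σ e ^ q) ^ n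
        ≤ N.factorial * C * ((1 + A) * σ e ^ q) ^ N := by
          gcongr
      _ = _ := by rw [mul_pow, ← pow_mul]; ring
  · obtain ⟨j, rfl⟩ : ∃ j, i = j + 1 := ⟨i - 1, by omega⟩
    rw [← norm_iteratedFDeriv_fderiv]
    refine (hb j (by omega) e).trans ?_
    calc A * σ e ^ q ≤ (1 + A) * σ e ^ q := by gcongr; linarith
      _ ≤ _ := le_self_pow₀ h1 (by omega)

/-- The inner map enters the chain rule only through its derivatives, and its values only through
the comparison `h` of the weights; hence it may itself be unbounded relative to the weight. -/
theorem PGrowth.comp (hσ : ∀ e, 1 ≤ σ e) {σ' : E' → ℝ} (hσ' : ∀ e, 1 ≤ σ' e) {f : E → E'}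
    {g : E' → F} (hg : PGrowth σ' g) (hf : PGrowthDeriv σ f) {A : ℝ} {r : ℕ}
    (h : ∀ e, σ' (f e) ≤ A * σ e ^ r) : PGrowth σ (fun e => g (f e)) := by
  refine ⟨hg.1.comp hf.1, fun n => ?_⟩
  obtain ⟨c, s, hc, hb⟩ := norm_iteratedFDeriv_comp_bound (F := F) hσ hf n
  obtain ⟨C, q, hC, hb'⟩ := hg.uniform hσ' n
  refine ⟨c * (C * A ^ q), r * q + s, fun e => ?_⟩
  have h0 : (0 : ℝ) ≤ σ' (f e) := zero_le_one.trans (hσ' _)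
  have h1 : (0 : ℝ) ≤ σ e := zero_le_one.trans (hσ _)
  have := hb g hg.1 n le_rfl e (C * (A * σ e ^ r) ^ q)
    (mul_nonneg hC (pow_nonneg (h0.trans (h e)) _)) (fun i hi => (hb' i hi _).trans (by
      gcongr
      exact h e))
  refine this.trans (le_of_eq ?_)
  rw [mul_pow, ← pow_mul, pow_add]
  ring

end Growth

/-! ### Directional derivatives -/

section Directional

variable {E E' : Type*} [NormedAddCommGroup E] [NormedSpace ℝ E] [NormedAddCommGroup E']
  [NormedSpace ℝ E']

theorem smooth_dirDeriv {F : E → ℂ} (hF : ContDiff ℝ (⊤ : ℕ∞) F) (v : E) :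
    ContDiff ℝ (⊤ : ℕ∞) (dirDeriv v F) :=
  (hF.fderiv_right (m := ((⊤ : ℕ∞) : WithTop ℕ∞)) (by simp)).clm_apply contDiff_const

theorem smooth_dirDerivs {F : E → ℂ} (hF : ContDiff ℝ (⊤ : ℕ∞) F) (vs : List E) :
    ContDiff ℝ (⊤ : ℕ∞) (dirDerivs vs F) := by
  induction vs with
  | nil => exact hF
  | cons v vs ih => exact smooth_dirDeriv ih v

theorem dirDerivs_nil (F : E → ℂ) : dirDerivs [] F = F := rfl

theorem dirDerivs_cons (v : E) (vs : List E) (F : E → ℂ) :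
    dirDerivs (v :: vs) F = dirDeriv v (dirDerivs vs F) := rfl

theorem dirDerivs_append (us vs : List E) (F : E → ℂ) :
    dirDerivs (us ++ vs) F = dirDerivs us (dirDerivs vs F) := by
  simp [dirDerivs, List.foldr_append]

theorem dirDeriv_comm {F : E → ℂ} (hF : ContDiff ℝ (⊤ : ℕ∞) F) (v w : E) :
    dirDeriv v (dirDeriv w F) = dirDeriv w (dirDeriv v F) := by
  funext p
  have hd : DifferentiableAt ℝ (fderiv ℝ F) p :=
    ((hF.fderiv_right (m := ((⊤ : ℕ∞) : WithTop ℕ∞)) (by simp)).differentiable (by simp)) p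
  have h1 : ∀ u u' : E, dirDeriv u (dirDeriv u' F) p = fderiv ℝ (fderiv ℝ F) p u u' := by
    intro u u'
    change fderiv ℝ (fun y => fderiv ℝ F y u') p u = _
    rw [fderiv_clm_apply hd (differentiableAt_const _)]
    simp
  rw [h1, h1]
  have hs : IsSymmSndFDerivAt ℝ F p :=
    hF.contDiffAt.isSymmSndFDerivAt (by
      simp only [minSmoothness_of_isRCLikeNormedField]
      exact WithTop.coe_le_coe.2 (le_top : (2 : ℕ∞) ≤ ⊤))
  exact hs v w

theorem dirDerivs_dirDeriv_comm {F : E → ℂ} (hF : ContDiff ℝ (⊤ : ℕ∞) F) (vs : List E) (w : E) :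
    dirDerivs vs (dirDeriv w F) = dirDeriv w (dirDerivs vs F) := by
  induction vs with
  | nil => rfl
  | cons v vs ih =>
    rw [dirDerivs_cons, dirDerivs_cons, ih, dirDeriv_comm (smooth_dirDerivs hF vs)]

theorem dirDerivs_comm {F : E → ℂ} (hF : ContDiff ℝ (⊤ : ℕ∞) F) (us vs : List E) :
    dirDerivs us (dirDerivs vs F) = dirDerivs vs (dirDerivs us F) := by
  induction vs generalizing F with
  | nil => rfl
  | cons v vs ih =>
    rw [dirDerivs_cons, dirDerivs_cons, dirDerivs_dirDeriv_comm (smooth_dirDerivs hF vs), ih hF]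

theorem dirDerivs_perm {F : E → ℂ} (hF : ContDiff ℝ (⊤ : ℕ∞) F) {us vs : List E}
    (h : us.Perm vs) : dirDerivs us F = dirDerivs vs F := by
  induction h with
  | nil => rfl
  | cons x _ ih => rw [dirDerivs_cons, dirDerivs_cons, ih]
  | swap x y l =>
    simp only [dirDerivs_cons]
    exact dirDeriv_comm (smooth_dirDerivs hF l) _ _
  | trans _ _ ih ih' => rw [ih, ih']

theorem dirDeriv_add {F G : E → ℂ} (hF : ContDiff ℝ (⊤ : ℕ∞) F) (hG : ContDiff ℝ (⊤ : ℕ∞) G)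
    (v : E) : dirDeriv v (fun p => F p + G p) = fun p => dirDeriv v F p + dirDeriv v G p := by
  funext p
  simp only [dirDeriv]
  rw [fderiv_fun_add (hF.differentiable (by simp) p) (hG.differentiable (by simp) p)]
  rfl

theorem dirDeriv_const_mul {F : E → ℂ} (hF : ContDiff ℝ (⊤ : ℕ∞) F) (c : ℂ) (v : E) :
    dirDeriv v (fun p => c * F p) = fun p => c * dirDeriv v F p := by
  funext p
  simp only [dirDeriv]
  rw [fderiv_const_mul (hF.differentiable (by simp) p)]
  rfl

theorem dirDeriv_sum {ι : Type*} (s : Finset ι) {F : ι → E → ℂ}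
    (hF : ∀ i ∈ s, ContDiff ℝ (⊤ : ℕ∞) (F i)) (v : E) :
    dirDeriv v (fun p => ∑ i ∈ s, F i p) = fun p => ∑ i ∈ s, dirDeriv v (F i) p := by
  funext p
  simp only [dirDeriv]
  rw [fderiv_fun_sum (fun i hi => (hF i hi).differentiable (by simp) p)]
  simp

theorem dirDeriv_mul {F G : E → ℂ} (hF : ContDiff ℝ (⊤ : ℕ∞) F) (hG : ContDiff ℝ (⊤ : ℕ∞) G)
    (v : E) : dirDeriv v (fun p => F p * G p) =
      fun p => dirDeriv v F p * G p + F p * dirDeriv v G p := by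
  funext p
  simp only [dirDeriv]
  rw [fderiv_fun_mul (hF.differentiable (by simp) p) (hG.differentiable (by simp) p)]
  simp only [add_apply, FunLike.coe_smul, Pi.smul_apply, smul_eq_mul]
  ring

theorem dirDerivs_add {F G : E → ℂ} (hF : ContDiff ℝ (⊤ : ℕ∞) F) (hG : ContDiff ℝ (⊤ : ℕ∞) G)
    (vs : List E) :
    dirDerivs vs (fun p => F p + G p) = fun p => dirDerivs vs F p + dirDerivs vs G p := by
  induction vs with
  | nil => rfl
  | cons v vs ih =>
    rw [dirDerivs_cons, ih, dirDeriv_add (smooth_dirDerivs hF vs) (smooth_dirDerivs hG vs)]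
    rfl

theorem dirDerivs_const_mul {F : E → ℂ} (hF : ContDiff ℝ (⊤ : ℕ∞) F) (c : ℂ) (vs : List E) :
    dirDerivs vs (fun p => c * F p) = fun p => c * dirDerivs vs F p := by
  induction vs with
  | nil => rfl
  | cons v vs ih => rw [dirDerivs_cons, ih, dirDeriv_const_mul (smooth_dirDerivs hF vs)]; rfl

theorem dirDerivs_sum {ι : Type*} (s : Finset ι) {F : ι → E → ℂ}
    (hF : ∀ i ∈ s, ContDiff ℝ (⊤ : ℕ∞) (F i)) (vs : List E) :
    dirDerivs vs (fun p => ∑ i ∈ s, F i p) = fun p => ∑ i ∈ s, dirDerivs vs (F i) p := by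
  induction vs with
  | nil => rfl
  | cons v vs ih =>
    rw [dirDerivs_cons, ih, dirDeriv_sum s fun i hi => smooth_dirDerivs (hF i hi) vs]; rfl

theorem dirDerivs_sub {F G : E → ℂ} (hF : ContDiff ℝ (⊤ : ℕ∞) F) (hG : ContDiff ℝ (⊤ : ℕ∞) G)
    (vs : List E) :
    dirDerivs vs (fun p => F p - G p) = fun p => dirDerivs vs F p - dirDerivs vs G p := by
  have h : (fun p => F p - G p) = fun p => F p + (-1) * G p := by funext p; ring
  rw [h, dirDerivs_add hF (contDiff_const.mul hG), dirDerivs_const_mul hG]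
  funext p; ring

theorem dirDeriv_comp_affine {F : E' → ℂ} (hF : ContDiff ℝ (⊤ : ℕ∞) F) (L : E →L[ℝ] E') (a : E')
    (v : E) : dirDeriv v (fun p => F (a + L p)) = fun p => dirDeriv (L v) F (a + L p) := by
  funext p
  have h : HasFDerivAt (fun p => a + L p) L p := L.hasFDerivAt.const_add a
  have := ((hF.differentiable (by simp) (a + L p)).hasFDerivAt.comp p h).fderiv
  simp only [dirDeriv]
  rw [show (fun p => F (a + L p)) = F ∘ (fun p => a + L p) from rfl, this]
  rfl

theorem dirDerivs_comp_affine {F : E' → ℂ} (hF : ContDiff ℝ (⊤ : ℕ∞) F) (L : E →L[ℝ] E') (a : E')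
    (vs : List E) :
    dirDerivs vs (fun p => F (a + L p)) = fun p => dirDerivs (vs.map L) F (a + L p) := by
  induction vs with
  | nil => rfl
  | cons v vs ih =>
    rw [dirDerivs_cons, ih, dirDeriv_comp_affine (smooth_dirDerivs hF _)]
    rfl

theorem iteratedFDeriv_apply_eq_dirDerivs {F : E → ℂ} (hF : ContDiff ℝ (⊤ : ℕ∞) F) {n : ℕ} (m : Fin n → E) (p : E) :
    iteratedFDeriv ℝ n F p m = dirDerivs (List.ofFn m) F p := by
  induction n generalizing p with
  | zero => simp [dirDerivs]
  | succ n ih =>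
    have hF' : dirDerivs (List.ofFn (Fin.tail m)) F = fun p => iteratedFDeriv ℝ n F p (Fin.tail m) :=
      funext fun p => (ih _ p).symm
    rw [List.ofFn_succ, dirDerivs_cons]
    have h0 : (List.ofFn fun i : Fin n => m i.succ) = List.ofFn (Fin.tail m) := rfl
    rw [h0, hF', iteratedFDeriv_succ_apply_left]
    have hd : DifferentiableAt ℝ (iteratedFDeriv ℝ n F) p :=
      hF.differentiable_iteratedFDeriv (by exact_mod_cast ENat.natCast_lt_top _) p
    have := (ContinuousMultilinearMap.apply ℝ (fun _ : Fin n => E) ℂ (Fin.tail m)).hasFDerivAt.comp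
      p hd.hasFDerivAt
    have h2 := this.fderiv
    have h3 : (fun p => iteratedFDeriv ℝ n F p (Fin.tail m)) =
      (ContinuousMultilinearMap.apply ℝ (fun _ : Fin n => E) ℂ (Fin.tail m)) ∘
        iteratedFDeriv ℝ n F := rfl
    simp only [dirDeriv]
    rw [h3, h2]
    rfl

end Directional

/-! ### Iterated oscillatory integrals with parameters -/

section Oscillatory

instance isAddHaarMeasure_phase (d : ℕ) : (volume : Measure (Phase d)).IsAddHaarMeasure :=
  inferInstanceAs ((volume : Measure (Cfg d)).prod (volume : Measure (Cfg d))).IsAddHaarMeasure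

/-- The pairing `y · η + z · ζ` of `w = (y, z)` and `θ = (η, ζ)`. -/
def pairL (d : ℕ) : Phase d →L[ℝ] Phase d →L[ℝ] ℝ :=
  (innerSL ℝ).bilinearComp (ContinuousLinearMap.fst ℝ (Cfg d) (Cfg d))
      (ContinuousLinearMap.fst ℝ (Cfg d) (Cfg d)) +
    (innerSL ℝ).bilinearComp (ContinuousLinearMap.snd ℝ (Cfg d) (Cfg d))
      (ContinuousLinearMap.snd ℝ (Cfg d) (Cfg d))

theorem pairL_apply {d : ℕ} (w θ : Phase d) :
    pairL d w θ = inner ℝ w.1 θ.1 + inner ℝ w.2 θ.2 := rfl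

/-- The oscillating factor `e^{-i(y·η + z·ζ)}`. -/
def oscKer {d : ℕ} (w θ : Phase d) : ℂ := Complex.exp (-(Complex.I * (pairL d w θ : ℂ)))

theorem norm_oscKer {d : ℕ} (w θ : Phase d) : ‖oscKer w θ‖ = 1 := by
  rw [oscKer, mul_comm, ← neg_mul, ← Complex.ofReal_neg, Complex.norm_exp_ofReal_mul_I]

theorem continuous_oscKer {d : ℕ} : Continuous fun q : Phase d × Phase d => oscKer q.1 q.2 := by
  unfold oscKer
  fun_prop

/-- The integrable weight `(1 + ‖w‖)^{-(2d+1)}` on `ℝ^{2d}`. -/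
def intWeight {d : ℕ} (w : Phase d) : ℝ := ((1 + ‖w‖) ^ (2 * d + 1))⁻¹

theorem intWeight_pos {d : ℕ} (w : Phase d) : 0 < intWeight w := by
  unfold intWeight; positivity

theorem integrable_intWeight (d : ℕ) : Integrable (intWeight (d := d)) := by
  have h := integrable_one_add_norm (E := Phase d) (μ := volume) (r := ((2 * d + 1 : ℕ) : ℝ)) (by
    simp [Module.finrank_prod]; linarith)
  refine h.congr (Eventually.of_forall fun w => ?_)
  simp only [intWeight]
  rw [Real.rpow_neg (by positivity), Real.rpow_natCast]

variable {d : ℕ} {E' : Type*} [NormedAddCommGroup E'] [NormedSpace ℂ E'] 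

theorem norm_sq_le_pairL (θ : Phase d) : ‖θ‖ ^ 2 ≤ pairL d θ θ := by
  rw [pairL_apply, real_inner_self_eq_norm_sq, real_inner_self_eq_norm_sq, Prod.norm_def]
  rcases le_total ‖θ.1‖ ‖θ.2‖ with h | h
  · rw [max_eq_right h]; nlinarith [sq_nonneg ‖θ.1‖]
  · rw [max_eq_left h]; nlinarith [sq_nonneg ‖θ.2‖]

theorem oscKer_eq_fourierChar (w θ : Phase d) :
    oscKer w θ = (Real.fourierChar (-(((2 * Real.pi)⁻¹ • pairL d) w θ)) : ℂ) := by
  rw [Real.fourierChar_apply, oscKer]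
  congr 1
  have : (2 * Real.pi) * (2 * Real.pi)⁻¹ = 1 := mul_inv_cancel₀ (by positivity)
  simp only [smul_apply, smul_eq_mul]
  rw [mul_neg, ← mul_assoc, this]
  push_cast; ring

/-- Decay of the Fourier transform of a function with integrable derivatives. -/
theorem norm_oscIntegral_le (d N : ℕ) (E' : Type*) [NormedAddCommGroup E'] [NormedSpace ℂ E'] :
    ∃ c : ℝ, 0 ≤ c ∧ ∀ (h : Phase d → E') (C : ℝ), ContDiff ℝ (⊤ : ℕ∞) h →
      (∀ k ≤ N, ∀ w, ‖iteratedFDeriv ℝ k h w‖ ≤ C * intWeight w) →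
      ∀ θ, (1 + ‖θ‖) ^ N * ‖∫ w, oscKer w θ • h w‖ ≤ c * C := by
  set I₀ : ℝ := ∫ w : Phase d, intWeight w with hI₀
  have hI₀pos : 0 ≤ I₀ := integral_nonneg fun w => (intWeight_pos w).le
  set L : Phase d →L[ℝ] Phase d →L[ℝ] ℝ := (2 * Real.pi)⁻¹ • pairL d with hL
  refine ⟨2 ^ N * ((2 * Real.pi) ^ N * 2 ^ N * ((N + 1) * I₀) + I₀), by positivity,
    fun h C hh hb θ => ?_⟩
  have hC : 0 ≤ C := by
    have := (norm_nonneg _).trans (hb 0 (Nat.zero_le _) 0)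
    exact nonneg_of_mul_nonneg_left this (intWeight_pos _)
  have hint : ∀ k ≤ N, Integrable (fun w => ‖iteratedFDeriv ℝ k h w‖) := fun k hk => by
    refine ((integrable_intWeight d).const_mul C).mono'
      ((hh.continuous_iteratedFDeriv (m := k) (by exact_mod_cast le_top)).norm.aestronglyMeasurable)
      (Eventually.of_forall fun w => ?_)
    simpa using hb k hk w
  have hintle : ∀ k ≤ N, ∫ w, ‖iteratedFDeriv ℝ k h w‖ ≤ C * I₀ := fun k hk => by
    rw [hI₀, ← integral_const_mul]
    exact integral_mono (hint k hk) ((integrable_intWeight d).const_mul C) (hb k hk)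
  have hF : VectorFourier.fourierIntegral Real.fourierChar volume L.toLinearMap₁₂ h θ
      = ∫ w, oscKer w θ • h w := by
    refine integral_congr_ae (Eventually.of_forall fun w => ?_)
    change Real.fourierChar (-(L w θ)) • h w = oscKer w θ • h w
    rw [oscKer_eq_fourierChar]
    rfl
  -- The estimate is used with both vectors equal to θ: the left side carries |L θ θ|^N ≥
  -- (‖θ‖²/2π)^N and the right side only ‖θ‖^N, so N powers of ‖θ‖ are gained. They are divided out
  -- below, which is why θ = 0 is treated apart.
  have h1 := VectorFourier.pow_mul_norm_iteratedFDeriv_fourierIntegral_le (μ := volume)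
    (K := 0) (N := N) (k := 0) (n := N) L (f := h) (hh.of_le (by exact_mod_cast le_top))
    (fun k n hk hn => by
      have hk0 : k = 0 := by simpa using hk
      subst hk0
      simpa using hint n (by exact_mod_cast hn)) le_rfl le_rfl θ θ
  simp only [norm_iteratedFDeriv_zero, hF, pow_zero, mul_one, Nat.cast_zero, mul_zero,
    zero_add] at h1
  have hS : ∑ p ∈ Finset.range 1 ×ˢ Finset.range (N + 1),
      ∫ v, ‖v‖ ^ p.1 * ‖iteratedFDeriv ℝ p.2 h v‖ ≤ (N + 1) * (C * I₀) := by
    rw [Finset.sum_product]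
    simp only [Finset.range_one, Finset.sum_singleton, pow_zero, one_mul]
    refine (Finset.sum_le_card_nsmul _ _ (C * I₀) fun k hk => hintle k ?_).trans (by simp)
    rw [Finset.mem_range] at hk; omega
  set X := ‖∫ w, oscKer w θ • h w‖ with hX
  have hX0 : X ≤ C * I₀ := by
    refine (norm_integral_le_integral_norm _).trans ?_
    have := hintle 0 (Nat.zero_le _)
    simpa [norm_smul, norm_oscKer] using this
  have hLθ : ‖θ‖ ^ 2 * (2 * Real.pi)⁻¹ ≤ |L θ θ| := by
    rw [hL]
    simp only [smul_apply, smul_eq_mul]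
    rw [abs_of_nonneg (mul_nonneg (by positivity) ((sq_nonneg _).trans (norm_sq_le_pairL θ))),
      mul_comm]
    have := norm_sq_le_pairL θ
    gcongr
  have h2 : ‖θ‖ ^ N * X ≤ (2 * Real.pi) ^ N * 2 ^ N * ((N + 1) * (C * I₀)) := by
    rcases eq_or_lt_of_le (norm_nonneg θ) with h0 | h0
    · rcases Nat.eq_zero_or_pos N with rfl | hN
      · simpa using hX0
      · rw [← h0, zero_pow hN.ne', zero_mul]; positivity
    · have h3 : (‖θ‖ ^ 2 * (2 * Real.pi)⁻¹) ^ N * X ≤ ‖θ‖ ^ N * 2 ^ N * ((N + 1) * (C * I₀)) :=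
        calc _ ≤ |L θ θ| ^ N * X := by gcongr
          _ ≤ _ := h1
          _ ≤ _ := by gcongr
      have h4 : (‖θ‖ ^ 2 * (2 * Real.pi)⁻¹) ^ N * X =
          ‖θ‖ ^ N * ((2 * Real.pi)⁻¹ ^ N * (‖θ‖ ^ N * X)) := by
        rw [mul_pow, ← pow_mul, mul_comm 2 N, pow_mul, sq]; ring
      rw [h4, mul_assoc] at h3
      have h5 := le_of_mul_le_mul_left h3 (pow_pos h0 N)
      have hpi : (0 : ℝ) < (2 * Real.pi) ^ N := by positivity
      rw [inv_pow, inv_mul_le_iff₀ hpi] at h5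
      linarith
  have h6 : (1 + ‖θ‖) ^ N ≤ 2 ^ N * (1 + ‖θ‖ ^ N) := by
    refine (add_pow_le zero_le_one (norm_nonneg θ) N).trans ?_
    rw [one_pow]
    gcongr
    · norm_num
    · omega
  calc (1 + ‖θ‖) ^ N * X ≤ 2 ^ N * (1 + ‖θ‖ ^ N) * X := by gcongr
    _ = 2 ^ N * (‖θ‖ ^ N * X + X) := by ring
    _ ≤ 2 ^ N * ((2 * Real.pi) ^ N * 2 ^ N * ((N + 1) * (C * I₀)) + C * I₀) := by gcongr
    _ = _ := by ring

theorem norm_iteratedFDeriv_comp_affine_le {E F G : Type*} [NormedAddCommGroup E] [NormedSpace ℝ E]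
    [NormedAddCommGroup F] [NormedSpace ℝ F] [NormedAddCommGroup G] [NormedSpace ℝ G]
    {A : F → G} (hA : ContDiff ℝ (⊤ : ℕ∞) A) (L : E →L[ℝ] F) (hL : ‖L‖ ≤ 1) (a : F) (k : ℕ)
    (w : E) :
    ‖iteratedFDeriv ℝ k (fun w => A (a + L w)) w‖ ≤ ‖iteratedFDeriv ℝ k A (a + L w)‖ := by
  have h1 : ContDiff ℝ (⊤ : ℕ∞) (fun q => A (a + q)) := hA.comp (contDiff_const.add contDiff_id)
  have h2 := L.iteratedFDeriv_comp_right h1 w (i := k) (by exact_mod_cast le_top)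
  have h3 : (fun w => A (a + L w)) = (fun q => A (a + q)) ∘ L := rfl
  rw [h3, h2, iteratedFDeriv_comp_add_left]
  refine (ContinuousMultilinearMap.norm_compContinuousLinearMap_le _ _).trans ?_
  refine mul_le_of_le_one_right (norm_nonneg _) ?_
  exact Finset.prod_le_one (fun _ _ => norm_nonneg _) (fun _ _ => hL)

variable {Q : Type*} [NormedAddCommGroup Q] [NormedSpace ℝ Q]

/-- Smooth amplitudes `A(P, θ, w)` with derivatives up to order `N` of growth `p` in `θ` and
integrable in `w`, for parameters `P ∈ U`. -/
def IsAmplitude (U : Set Q) (N p : ℕ) (C : ℝ) (A : Q × Phase d × Phase d → E') : Prop :=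
  ContDiff ℝ (⊤ : ℕ∞) A ∧ ∀ k ≤ N, ∀ P ∈ U, ∀ θ w,
    ‖iteratedFDeriv ℝ k A (P, θ, w)‖ ≤ C * (1 + ‖θ‖) ^ p * intWeight w

/-- The inner integral `∫ e^{-i⟨w,θ⟩} A(P,θ,w) dw`. -/
def oscInner (A : Q × Phase d × Phase d → E') (P : Q) (θ : Phase d) : E' :=
  ∫ w, oscKer w θ • A (P, θ, w)

/-- The iterated integral `∫ dθ ∫ dw e^{-i⟨w,θ⟩} A(P,θ,w)`. -/
def oscOuter (A : Q × Phase d × Phase d → E') (P : Q) : E' := ∫ θ, oscInner A P θ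

theorem IsAmplitude.nonneg {U : Set Q} {N p : ℕ} {C : ℝ} {A : Q × Phase d × Phase d → E'}
    (hA : IsAmplitude U N p C A) {P : Q} (hP : P ∈ U) : 0 ≤ C := by
  have := (norm_nonneg _).trans (hA.2 0 (Nat.zero_le _) P hP 0 0)
  exact nonneg_of_mul_nonneg_left (nonneg_of_mul_nonneg_left this (intWeight_pos _)) (by positivity)

theorem IsAmplitude.mono {U U' : Set Q} {N N' p : ℕ} {C : ℝ} {A : Q × Phase d × Phase d → E'}
    (hA : IsAmplitude U N p C A) (hU : U' ⊆ U) (hN : N' ≤ N) : IsAmplitude U' N' p C A :=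
  ⟨hA.1, fun k hk P hP => hA.2 k (hk.trans hN) P (hU hP)⟩

theorem IsAmplitude.norm_le {U : Set Q} {N p : ℕ} {C : ℝ} {A : Q × Phase d × Phase d → E'}
    (hA : IsAmplitude U N p C A) {P : Q} (hP : P ∈ U) (θ w : Phase d) :
    ‖oscKer w θ • A (P, θ, w)‖ ≤ C * (1 + ‖θ‖) ^ p * intWeight w := by
  rw [norm_smul, norm_oscKer, one_mul]
  simpa using hA.2 0 (Nat.zero_le _) P hP θ w

theorem IsAmplitude.integrable_inner {U : Set Q} {N p : ℕ} {C : ℝ}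
    {A : Q × Phase d × Phase d → E'} (hA : IsAmplitude U N p C A) {P : Q} (hP : P ∈ U)
    (θ : Phase d) : Integrable fun w => oscKer w θ • A (P, θ, w) := by
  refine ((integrable_intWeight d).const_mul (C * (1 + ‖θ‖) ^ p)).mono' ?_
    (Eventually.of_forall fun w => hA.norm_le hP θ w)
  have := hA.1.continuous
  have h2 := continuous_oscKer (d := d)
  exact Continuous.aestronglyMeasurable (by fun_prop)

/-- Integrating by parts in w gives decay (1 + ‖θ‖)^{-(p+2d+1)}. Of these powers p absorb the growth
of the amplitude in θ, and the remaining 2d + 1 make the result integrable over ℝ^{2d}. -/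
theorem norm_oscInner_le (d p : ℕ) (E' : Type*) [NormedAddCommGroup E'] [NormedSpace ℂ E']
    (Q : Type*) [NormedAddCommGroup Q] [NormedSpace ℝ Q] :
    ∃ c : ℝ, 0 ≤ c ∧ ∀ (U : Set Q) (C : ℝ) (A : Q × Phase d × Phase d → E'),
      IsAmplitude U (p + 2 * d + 1) p C A →
        ∀ P ∈ U, ∀ θ, ‖oscInner A P θ‖ ≤ c * C * intWeight θ := by
  obtain ⟨c, hc, h⟩ := norm_oscIntegral_le d (p + 2 * d + 1) E'
  refine ⟨c, hc, fun U C A hA P hP θ => ?_⟩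
  have hsl : (fun w => A (P, θ, w)) = fun w => A ((P, θ, 0) + (ContinuousLinearMap.inr ℝ Q _).comp
      (ContinuousLinearMap.inr ℝ (Phase d) (Phase d)) w) := by
    funext w; simp
  have hL : ‖(ContinuousLinearMap.inr ℝ Q _).comp
      (ContinuousLinearMap.inr ℝ (Phase d) (Phase d))‖ ≤ 1 :=
    ContinuousLinearMap.opNorm_le_bound _ zero_le_one fun w => by
      simp [Prod.norm_def]
  have hsm : ContDiff ℝ (⊤ : ℕ∞) (fun w => A (P, θ, w)) := by
    rw [hsl]
    exact hA.1.comp (contDiff_const.add (ContinuousLinearMap.contDiff _))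
  have key := h (fun w => A (P, θ, w)) (C * (1 + ‖θ‖) ^ p) hsm (fun k hk w => by
    rw [hsl]
    refine (norm_iteratedFDeriv_comp_affine_le hA.1 _ hL _ k w).trans ?_
    simpa using hA.2 k hk P hP θ w) θ
  have hpos : 0 < 1 + ‖θ‖ := by positivity
  rw [add_assoc, pow_add] at key
  have h2 : (1 + ‖θ‖) ^ p * ((1 + ‖θ‖) ^ (2 * d + 1) * ‖oscInner A P θ‖) ≤
      (1 + ‖θ‖) ^ p * (c * C) := by
    calc _ = (1 + ‖θ‖) ^ p * (1 + ‖θ‖) ^ (2 * d + 1) * ‖oscInner A P θ‖ := by ring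
      _ ≤ _ := key
      _ = _ := by ring
  have h3 := le_of_mul_le_mul_left h2 (pow_pos hpos p)
  rw [intWeight, ← div_eq_mul_inv, le_div_iff₀ (by positivity)]
  linarith

theorem stronglyMeasurable_oscInner {A : Q × Phase d × Phase d → E'} (hA : Continuous A) (P : Q) :
    AEStronglyMeasurable (oscInner A P) volume := by
  have h2 := continuous_oscKer (d := d)
  have h : Continuous fun q : Phase d × Phase d => oscKer q.2 q.1 • A (P, q.1, q.2) := by
    fun_prop
  exact (h.stronglyMeasurable.integral_prod_right (ν := volume)).aestronglyMeasurable

theorem IsAmplitude.integrable_outer {U : Set Q} {p : ℕ} {C : ℝ}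
    {A : Q × Phase d × Phase d → E'} (hA : IsAmplitude U (p + 2 * d + 1) p C A) {P : Q}
    (hP : P ∈ U) : Integrable (oscInner A P) := by
  obtain ⟨c, hc, h⟩ := norm_oscInner_le d p E' Q
  exact ((integrable_intWeight d).const_mul (c * C)).mono'
    (stronglyMeasurable_oscInner hA.1.continuous P)
    (Eventually.of_forall fun θ => h U C A hA P hP θ)

theorem norm_oscOuter_le (d p : ℕ) (E' : Type*) [NormedAddCommGroup E'] [NormedSpace ℂ E']
    (Q : Type*) [NormedAddCommGroup Q] [NormedSpace ℝ Q] :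
    ∃ c : ℝ, 0 ≤ c ∧ ∀ (U : Set Q) (C : ℝ) (A : Q × Phase d × Phase d → E'),
      IsAmplitude U (p + 2 * d + 1) p C A → ∀ P ∈ U, ‖oscOuter A P‖ ≤ c * C := by
  obtain ⟨c, hc, h⟩ := norm_oscInner_le d p E' Q
  refine ⟨c * ∫ w : Phase d, intWeight w,
    mul_nonneg hc (integral_nonneg fun w => (intWeight_pos w).le), fun U C A hA P hP => ?_⟩
  refine (norm_integral_le_of_norm_le ((integrable_intWeight d).const_mul (c * C))
    (Eventually.of_forall fun θ => h U C A hA P hP θ)).trans (le_of_eq ?_)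
  rw [integral_const_mul]; ring

theorem oscOuter_add {U : Set Q} {p p' : ℕ} {C C' : ℝ} {A A' : Q × Phase d × Phase d → E'}
    (hA : IsAmplitude U (p + 2 * d + 1) p C A) (hA' : IsAmplitude U (p' + 2 * d + 1) p' C' A')
    {P : Q} (hP : P ∈ U) :
    oscOuter (fun e => A e + A' e) P = oscOuter A P + oscOuter A' P := by
  unfold oscOuter
  rw [← integral_add (hA.integrable_outer hP) (hA'.integrable_outer hP)]
  congr 1; funext θ
  unfold oscInner
  rw [← integral_add (hA.integrable_inner hP θ) (hA'.integrable_inner hP θ)]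
  simp only [smul_add]

theorem oscOuter_const_smul (c : ℂ) (A : Q × Phase d × Phase d → E') (P : Q) :
    oscOuter (fun e => c • A e) P = c • oscOuter A P := by
  unfold oscOuter oscInner
  rw [← integral_smul]
  congr 1; funext θ
  rw [← integral_smul]
  congr 1; funext w
  rw [smul_comm]

/-- Dominated convergence for the iterated integrals. -/
theorem tendsto_oscOuter {ι : Type*} {l : Filter ι} [l.IsCountablyGenerated] {p : ℕ} {C : ℝ}
    {A : ι → Q × Phase d × Phase d → E'} {A₀ : Q × Phase d × Phase d → E'} {P : Q}
    (hA : ∀ i, IsAmplitude {P} (p + 2 * d + 1) p C (A i))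
    (hlim : ∀ θ w, Tendsto (fun i => A i (P, θ, w)) l (𝓝 (A₀ (P, θ, w)))) :
    Tendsto (fun i => oscOuter (A i) P) l (𝓝 (oscOuter A₀ P)) := by
  obtain ⟨c, hc, h⟩ := norm_oscInner_le d p E' Q
  refine tendsto_integral_filter_of_dominated_convergence (fun θ => c * C * intWeight θ)
    (Eventually.of_forall fun i => stronglyMeasurable_oscInner (hA i).1.continuous P)
    (Eventually.of_forall fun i => Eventually.of_forall fun θ => h {P} C (A i) (hA i) P rfl θ)
    ((integrable_intWeight d).const_mul _) (Eventually.of_forall fun θ => ?_)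
  refine tendsto_integral_filter_of_dominated_convergence
    (fun w => C * (1 + ‖θ‖) ^ p * intWeight w)
    (Eventually.of_forall fun i => ((hA i).integrable_inner rfl θ).aestronglyMeasurable)
    (Eventually.of_forall fun i => Eventually.of_forall fun w => (hA i).norm_le rfl θ w)
    ((integrable_intWeight d).const_mul _) (Eventually.of_forall fun w => ?_)
  exact (hlim θ w).const_smul _

end Oscillatory

/-! ### Differentiation in parameters and integration by parts -/

section OscillatoryDeriv

variable {d : ℕ} {Q : Type*} [NormedAddCommGroup Q] [NormedSpace ℝ Q]

/-- The derivative of an amplitude in its parameter. -/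
def paramDeriv (A : Q × Phase d × Phase d → ℂ) : Q × Phase d × Phase d → (Q →L[ℝ] ℂ) :=
  fun e => (fderiv ℝ A e).comp (ContinuousLinearMap.inl ℝ Q (Phase d × Phase d))

theorem IsAmplitude.paramDeriv {U : Set Q} {N p : ℕ} {C : ℝ} {A : Q × Phase d × Phase d → ℂ}
    (hA : IsAmplitude U (N + 1) p C A) : IsAmplitude U N p C (paramDeriv A) := by
  set L : (Q × Phase d × Phase d →L[ℝ] ℂ) →L[ℝ] (Q →L[ℝ] ℂ) :=
    (ContinuousLinearMap.compL ℝ Q (Q × Phase d × Phase d) ℂ).flip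
      (ContinuousLinearMap.inl ℝ Q (Phase d × Phase d)) with hL
  have hLn : ‖L‖ ≤ 1 := by
    refine ContinuousLinearMap.opNorm_le_bound _ zero_le_one fun B => ?_
    refine (ContinuousLinearMap.opNorm_comp_le _ _).trans ?_
    rw [one_mul]
    exact mul_le_of_le_one_right (norm_nonneg _) (ContinuousLinearMap.norm_inl_le_one ℝ _ _)
  have hfd : ContDiff ℝ (⊤ : ℕ∞) (fderiv ℝ A) := hA.1.fderiv_right (by simp)
  refine ⟨L.contDiff.comp hfd, fun k hk P hP θ w => ?_⟩
  refine (L.norm_iteratedFDeriv_comp_left (f := fderiv ℝ A) hfd.contDiffAt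
    (by exact_mod_cast le_top)).trans ?_
  rw [norm_iteratedFDeriv_fderiv]
  exact (mul_le_of_le_one_left (norm_nonneg _) hLn).trans (hA.2 (k + 1) (by omega) P hP θ w)

theorem hasFDerivAt_oscInner {U : Set Q} {N p : ℕ} {C : ℝ} {A : Q × Phase d × Phase d → ℂ}
    (hA : IsAmplitude U (N + 1) p C A) {P : Q} (hU : U ∈ 𝓝 P) (θ : Phase d) :
    HasFDerivAt (fun P => oscInner A P θ) (oscInner (paramDeriv A) P θ) P := by
  refine hasFDerivAt_integral_of_dominated_of_fderiv_le (s := U)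
    (bound := fun w => C * (1 + ‖θ‖) ^ p * intWeight w) hU ?_
    (hA.integrable_inner (mem_of_mem_nhds hU) θ)
    (hA.paramDeriv.integrable_inner (mem_of_mem_nhds hU) θ).aestronglyMeasurable
    (Eventually.of_forall fun w P' hP' => hA.paramDeriv.norm_le hP' θ w)
    ((integrable_intWeight d).const_mul _)
    (Eventually.of_forall fun w P' _ => ?_)
  · filter_upwards [hU] with P' hP'
    exact (hA.integrable_inner hP' θ).aestronglyMeasurable
  · refine HasFDerivAt.const_smul ?_ (oscKer w θ)
    have h1 : HasFDerivAt A (fderiv ℝ A (P', θ, w)) (P', θ, w) :=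
      (hA.1.differentiable (by simp) _).hasFDerivAt
    exact h1.comp P' (hasFDerivAt_prodMk_left P' (θ, w))

/-- One derivative beyond those needed for convergence is required, because the parameter derivative
of the amplitude must again be an amplitude with p + 2d + 1 controlled derivatives. Uniformity of
the bounds on U supplies the dominating function. -/
theorem hasFDerivAt_oscOuter {U : Set Q} {p : ℕ} {C : ℝ} {A : Q × Phase d × Phase d → ℂ}
    (hA : IsAmplitude U (p + 2 * d + 2) p C A) (hUo : IsOpen U) {P : Q} (hP : P ∈ U) :
    HasFDerivAt (oscOuter A) (oscOuter (paramDeriv A) P) P := by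
  have hA' : IsAmplitude U (p + 2 * d + 1) p C A := hA.mono subset_rfl (by omega)
  have hD : IsAmplitude U (p + 2 * d + 1) p C (paramDeriv A) := hA.paramDeriv
  obtain ⟨c, hc, h⟩ := norm_oscInner_le d p (Q →L[ℝ] ℂ) Q
  refine hasFDerivAt_integral_of_dominated_of_fderiv_le (s := U)
    (bound := fun θ => c * C * intWeight θ) (hUo.mem_nhds hP)
    (Eventually.of_forall fun P' => stronglyMeasurable_oscInner hA.1.continuous P')
    (hA'.integrable_outer hP) (hD.integrable_outer hP).aestronglyMeasurable
    (Eventually.of_forall fun θ P' hP' => h U C _ hD P' hP' θ)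
    ((integrable_intWeight d).const_mul _)
    (Eventually.of_forall fun θ P' hP' => hasFDerivAt_oscInner hA (hUo.mem_nhds hP') θ)

theorem oscOuter_paramDeriv_apply {U : Set Q} {p : ℕ} {C : ℝ} {A : Q × Phase d × Phase d → ℂ}
    (hA : IsAmplitude U (p + 2 * d + 2) p C A) {P : Q} (hP : P ∈ U) (v : Q) :
    oscOuter (paramDeriv A) P v = oscOuter (dirDeriv (v, 0) A) P := by
  have hD : IsAmplitude U (p + 2 * d + 1) p C (paramDeriv A) := hA.paramDeriv
  unfold oscOuter
  rw [ContinuousLinearMap.integral_apply (hD.integrable_outer hP)]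
  congr 1; funext θ
  unfold oscInner
  rw [ContinuousLinearMap.integral_apply (hD.integrable_inner hP θ)]
  rfl

/-- The inner integrand differentiated in `θ` along `v`. -/
def thetaDeriv (v : Phase d) (A : Q × Phase d × Phase d → ℂ) : Q × Phase d × Phase d → ℂ :=
  fun e => dirDeriv (0, v, 0) A e + (-Complex.I) • ((pairL d e.2.2 v : ℂ) * A e)

theorem hasDerivAt_oscKer (w θ v : Phase d) (t : ℝ) :
    HasDerivAt (fun t : ℝ => oscKer w (θ + t • v))
      (oscKer w (θ + t • v) * (-Complex.I * (pairL d w v : ℂ))) t := by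
  have h1 : HasDerivAt (fun t : ℝ => -(Complex.I * ((pairL d w θ + t * pairL d w v : ℝ) : ℂ)))
      (-(Complex.I * (pairL d w v : ℝ))) t := by
    have h2 : HasDerivAt (fun t : ℝ => pairL d w θ + t * pairL d w v) (pairL d w v) t := by
      simpa using ((hasDerivAt_id t).mul_const (pairL d w v)).const_add (pairL d w θ)
    exact (h2.ofReal_comp.const_mul Complex.I).neg
  have h3 := h1.cexp
  have h4 : (fun t : ℝ => oscKer w (θ + t • v)) = fun t : ℝ =>
      Complex.exp (-(Complex.I * ((pairL d w θ + t * pairL d w v : ℝ) : ℂ))) := by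
    funext t
    simp [oscKer]
  rw [h4]
  convert h3 using 1
  simp [oscKer]

/-- Integration by parts in the outer variable. -/
theorem oscOuter_thetaDeriv {p : ℕ} {C C' : ℝ} {A : Q × Phase d × Phase d → ℂ} {P : Q}
    {v : Phase d} (hA : IsAmplitude {P} (p + 2 * d + 1) p C A)
    (hA' : IsAmplitude {P} (p + 2 * d + 1) p C' (thetaDeriv v A)) :
    oscOuter (thetaDeriv v A) P = 0 := by
  have hline : ∀ θ : Phase d,
      HasLineDerivAt ℝ (oscInner A P) (oscInner (thetaDeriv v A) P θ) θ v := by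
    intro θ
    -- On the unit ball of t the growth factor 1 + ‖θ + t v‖ is at most R, which makes the
    -- dominating function independent of t.
    set R : ℝ := (1 + ‖θ‖ + ‖v‖) with hR
    have hball : Metric.ball (0 : ℝ) 1 ∈ 𝓝 (0 : ℝ) := Metric.ball_mem_nhds _ one_pos
    have key := hasDerivAt_integral_of_dominated_loc_of_deriv_le (μ := (volume : Measure (Phase d)))
      (F := fun (t : ℝ) w => oscKer w (θ + t • v) • A (P, θ + t • v, w))
      (F' := fun (t : ℝ) w => oscKer w (θ + t • v) • thetaDeriv v A (P, θ + t • v, w))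
      (x₀ := (0 : ℝ)) (s := Metric.ball 0 1)
      (bound := fun w => C' * R ^ p * intWeight w) hball
      (Eventually.of_forall fun t => (hA.integrable_inner rfl _).aestronglyMeasurable)
      (hA.integrable_inner rfl _) (hA'.integrable_inner rfl _).aestronglyMeasurable
      (Eventually.of_forall fun w t ht => ?_) ((integrable_intWeight d).const_mul _)
      (Eventually.of_forall fun w t _ => ?_)
    · have := key.2
      simp only [zero_smul, add_zero] at this
      exact this
    · refine (hA'.norm_le rfl _ w).trans ?_
      have h0 := hA'.nonneg (P := P) rfl
      have ht' : |t| < 1 := by simpa using ht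
      have : 1 + ‖θ + t • v‖ ≤ R := by
        have h1 := norm_add_le θ (t • v)
        rw [norm_smul, Real.norm_eq_abs] at h1
        have h2 : |t| * ‖v‖ ≤ 1 * ‖v‖ := by gcongr
        rw [hR]; linarith
      have h3 := intWeight_pos w
      gcongr
    · have h1 := hasDerivAt_oscKer w θ v t
      have h2 : HasDerivAt (fun t : ℝ => A (P, θ + t • v, w))
          (dirDeriv (0, v, 0) A (P, θ + t • v, w)) t := by
        have h3 : HasFDerivAt A (fderiv ℝ A (P, θ + t • v, w)) (P, θ + t • v, w) :=
          (hA.1.differentiable (by simp) _).hasFDerivAt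
        have h4 : HasDerivAt (fun t : ℝ => ((P, θ + t • v, w) : Q × Phase d × Phase d))
            (0, v, 0) t := by
          refine (hasDerivAt_const t P).prodMk (HasDerivAt.prodMk ?_ (hasDerivAt_const t w))
          simpa using ((hasDerivAt_id t).smul_const v).const_add θ
        exact h3.comp_hasDerivAt t h4
      refine (h1.mul h2).congr_deriv ?_
      change _ = oscKer w (θ + t • v) * (dirDeriv (0, v, 0) A (P, θ + t • v, w) +
        (-Complex.I) * ((pairL d w v : ℂ) * A (P, θ + t • v, w)))
      ring
  -- Integration by parts against the constant 1: an integrable function with integrable line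
  -- derivative has a derivative of integral zero.
  have h := integral_bilinear_hasLineDerivAt_right_eq_neg_left_of_integrable
    (μ := (volume : Measure (Phase d))) (f := fun _ : Phase d => (1 : ℂ)) (f' := fun _ => 0)
    (g := oscInner A P) (g' := oscInner (thetaDeriv v A) P) (v := v)
    (B := ContinuousLinearMap.mul ℝ ℂ) (by simp)
    (by simpa using hA'.integrable_outer rfl) (by simpa using hA.integrable_outer rfl)
    (fun x _ => by simpa using (hasFDerivAt_const (1 : ℂ) x).hasLineDerivAt v)
    (fun x _ => hline x)
  simpa [oscOuter] using h

end OscillatoryDeriv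

/-! ### Amplitudes of the Weyl product -/

/-- Parameters `((ε, λ), X)`. -/
abbrev Par (d : ℕ) : Type := (ℝ × ℝ) × Phase d

/-- Arguments `(x, ((ε, λ), (y, z)))` of a kernel. -/
abbrev KerArg (d : ℕ) : Type := Cfg d × ((ℝ × ℝ) × Phase d)

theorem japBracket_pos {d : ℕ} (ξ : Cfg d) : 0 < japBracket ξ :=
  Real.sqrt_pos.2 (by positivity)

theorem one_le_japBracket {d : ℕ} (ξ : Cfg d) : 1 ≤ japBracket ξ :=
  Real.one_le_sqrt.2 (by nlinarith [sq_nonneg ‖ξ‖])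

theorem continuous_japBracket {d : ℕ} : Continuous (japBracket (d := d)) := by
  unfold japBracket; fun_prop

section Amp

variable {d : ℕ}

/-- The point `((x - ε z / 2, ξ + η), (x + ε y / 2, ξ + ζ))`. -/
def shiftPt (e : Par d × Phase d × Phase d) : Phase d × Phase d :=
  ((e.1.2.1 - (e.1.1.1 / 2) • e.2.2.2, e.1.2.2 + e.2.1.1),
    (e.1.2.1 + (e.1.1.1 / 2) • e.2.2.1, e.1.2.2 + e.2.1.2))

/-- The kernel argument `(x, ((ε, λ), w))`. -/
def kerPt (d : ℕ) : Par d × Phase d × Phase d →L[ℝ] KerArg d :=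
  ((ContinuousLinearMap.fst ℝ _ _).comp ((ContinuousLinearMap.snd ℝ _ _).comp
    (ContinuousLinearMap.fst ℝ (Par d) (Phase d × Phase d)))).prod
  (((ContinuousLinearMap.fst ℝ _ _).comp
    (ContinuousLinearMap.fst ℝ (Par d) (Phase d × Phase d))).prod
   ((ContinuousLinearMap.snd ℝ _ _).comp
    (ContinuousLinearMap.snd ℝ (Par d) (Phase d × Phase d))))

theorem kerPt_apply (e : Par d × Phase d × Phase d) : kerPt d e = (e.1.2.1, (e.1.1, e.2.2)) := rfl

theorem norm_kerPt_le : ‖kerPt d‖ ≤ 1 := by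
  refine ContinuousLinearMap.opNorm_le_bound _ zero_le_one fun e => ?_
  rw [one_mul, kerPt_apply]
  have h1 : ‖e.1‖ ≤ ‖e‖ := norm_fst_le e
  have h2 : ‖e.2‖ ≤ ‖e‖ := norm_snd_le e
  exact max_le (((norm_fst_le e.1.2).trans (norm_snd_le e.1)).trans h1)
    (max_le ((norm_fst_le e.1).trans h1) ((norm_snd_le e.2).trans h2))

/-- The growth weight `1 + ‖((ε, λ), w)‖` on the arguments of kernels. -/
def kerWeight (q : KerArg d) : ℝ := 1 + ‖q.2‖

theorem one_le_kerWeight (q : KerArg d) : 1 ≤ kerWeight q := by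
  unfold kerWeight; linarith [norm_nonneg q.2]

/-- The amplitude `g(x, ε, λ, w) F(x - ε z / 2, ξ + η; x + ε y / 2, ξ + ζ)`. -/
def ampl (g : KerArg d → ℂ) (F : Phase d × Phase d → ℂ) : Par d × Phase d × Phase d → ℂ :=
  fun e => g (kerPt d e) * F (shiftPt e)

/-- The linear part of `shiftPt`. -/
def shiftLin (d : ℕ) : Par d × Phase d × Phase d →L[ℝ] Phase d × Phase d :=
  let X := (ContinuousLinearMap.snd ℝ (ℝ × ℝ) (Phase d)).comp
    (ContinuousLinearMap.fst ℝ (Par d) (Phase d × Phase d))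
  let θ := (ContinuousLinearMap.fst ℝ (Phase d) (Phase d)).comp
    (ContinuousLinearMap.snd ℝ (Par d) (Phase d × Phase d))
  let x := (ContinuousLinearMap.fst ℝ (Cfg d) (Cfg d)).comp X
  let ξ := (ContinuousLinearMap.snd ℝ (Cfg d) (Cfg d)).comp X
  (x.prod (ξ + (ContinuousLinearMap.fst ℝ _ _).comp θ)).prod
    (x.prod (ξ + (ContinuousLinearMap.snd ℝ _ _).comp θ))

/-- The map `w = (y, z) ↦ ((-z / 2, 0), (y / 2, 0))`. -/
def shiftRot (d : ℕ) : Phase d →L[ℝ] Phase d × Phase d :=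
  ((-(1 / 2 : ℝ) • ContinuousLinearMap.snd ℝ (Cfg d) (Cfg d)).prod 0).prod
    (((1 / 2 : ℝ) • ContinuousLinearMap.fst ℝ (Cfg d) (Cfg d)).prod 0)

theorem shiftPt_eq (e : Par d × Phase d × Phase d) :
    shiftPt e = shiftLin d e + e.1.1.1 • shiftRot d e.2.2 := by
  simp only [shiftPt, shiftLin, shiftRot]
  ext <;> simp <;> ring

theorem smooth_shiftPt : ContDiff ℝ (⊤ : ℕ∞) (shiftPt (d := d)) := by
  unfold shiftPt
  fun_prop

theorem pGrowthDeriv_shiftPt :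
    PGrowthDeriv (fun e : Par d × Phase d × Phase d => kerWeight (kerPt d e)) shiftPt := by
  have hσ : ∀ e : Par d × Phase d × Phase d, 1 ≤ kerWeight (kerPt d e) :=
    fun e => one_le_kerWeight _
  have h : (shiftPt (d := d)) = fun e => shiftLin d e + e.1.1.1 • shiftRot d e.2.2 :=
    funext shiftPt_eq
  rw [h]
  refine (pGrowthDeriv_clm (shiftLin d)).add hσ (PGrowth.deriv_growth ?_)
  refine PGrowth.smul hσ ?_ ?_
  · exact pGrowth_clm ((ContinuousLinearMap.fst ℝ ℝ ℝ).comp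
      ((ContinuousLinearMap.fst ℝ (ℝ × ℝ) (Phase d)).comp
        (ContinuousLinearMap.fst ℝ (Par d) (Phase d × Phase d)))) ⟨1, 1, fun e => by
        simp only [kerWeight, kerPt_apply, pow_one, one_mul]
        have h1 : ‖e.1.1.1‖ ≤ ‖e.1.1‖ := norm_fst_le e.1.1
        have h2 : ‖e.1.1‖ ≤ ‖(e.1.1, e.2.2)‖ := norm_fst_le (e.1.1, e.2.2)
        exact h1.trans (h2.trans (by linarith))⟩
  · exact pGrowth_clm ((shiftRot d).comp ((ContinuousLinearMap.snd ℝ (Phase d) (Phase d)).comp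
        (ContinuousLinearMap.snd ℝ (Par d) (Phase d × Phase d)))) ⟨‖shiftRot d‖, 1, fun e => by
        simp only [kerWeight, kerPt_apply, pow_one]
        refine ((shiftRot d).le_opNorm e.2.2).trans ?_
        have h2 : ‖e.2.2‖ ≤ ‖(e.1.1, e.2.2)‖ := norm_snd_le (e.1.1, e.2.2)
        gcongr
        linarith⟩

/-- Bounds `C ⟨ξ⟩^M (1 + ‖(η - ξ, ζ - ξ)‖)^p` for the derivatives of order at most `N` of a
function of `(Y, Z)`, for every choice of the base momentum `ξ`. -/
def DoubleBound (M : ℝ) (p N : ℕ) (C : ℝ) (F : Phase d × Phase d → ℂ) : Prop :=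
  ∀ n ≤ N, ∀ (Y Z : Phase d) (ξ : Cfg d),
    ‖iteratedFDeriv ℝ n F (Y, Z)‖ ≤
      C * japBracket ξ ^ M * (1 + ‖((Y.2 - ξ, Z.2 - ξ) : Phase d)‖) ^ p

/-- Decay `(1 + ‖w‖)^{-r}` of the derivatives of order at most `N` of a kernel. -/
def KerDecay (N r : ℕ) (g : KerArg d → ℂ) : Prop :=
  ContDiff ℝ (⊤ : ℕ∞) g ∧ ∃ C : ℝ, ∃ q : ℕ, 0 ≤ C ∧ ∀ n ≤ N, ∀ (x : Cfg d) (τ : ℝ × ℝ) (w : Phase d),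
    ‖iteratedFDeriv ℝ n g (x, (τ, w))‖ ≤ C * (1 + ‖τ‖) ^ q * ((1 + ‖w‖) ^ r)⁻¹

theorem smooth_ampl {g : KerArg d → ℂ} {F : Phase d × Phase d → ℂ} (hg : ContDiff ℝ (⊤ : ℕ∞) g)
    (hF : ContDiff ℝ (⊤ : ℕ∞) F) : ContDiff ℝ (⊤ : ℕ∞) (ampl g F) :=
  (hg.comp (kerPt d).contDiff).mul (hF.comp smooth_shiftPt)

/-- Since `shiftPt` contains the product ε w, the chain rule costs powers of 1 + ‖((ε, λ), w)‖; s is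
this cost, which the decay of the kernel must absorb in addition to the integrable weight. It
depends on d and N alone, and c, q depend on the kernel but not on F, M, p or U. -/
theorem exists_ampl_order (d N : ℕ) : ∃ s : ℕ, ∀ g : KerArg d → ℂ, KerDecay N (2 * d + 1 + s) g →
    ∃ c : ℝ, ∃ q : ℕ, 0 ≤ c ∧ ∀ (M : ℝ) (p : ℕ) (C : ℝ) (F : Phase d × Phase d → ℂ), 0 ≤ C →
      ContDiff ℝ (⊤ : ℕ∞) F → DoubleBound M p N C F → ∀ (U : Set (Par d)) (a : ℝ),
        (∀ P ∈ U, (1 + ‖P.1‖) ^ q * japBracket P.2.2 ^ M ≤ a) →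
          IsAmplitude U N p (c * C * a) (ampl g F) := by
  obtain ⟨A, s, hA, hcomp⟩ : ∃ c : ℝ, ∃ r : ℕ, 0 ≤ c ∧ ∀ (F : Phase d × Phase d → ℂ),
      ContDiff ℝ (⊤ : ℕ∞) F → ∀ n ≤ N, ∀ e, ∀ C : ℝ, 0 ≤ C →
      (∀ i ≤ N, ‖iteratedFDeriv ℝ i F (shiftPt e)‖ ≤ C) →
        ‖iteratedFDeriv ℝ n (F ∘ shiftPt) e‖ ≤ c * C * kerWeight (kerPt d e) ^ r :=
    norm_iteratedFDeriv_comp_bound (fun e => one_le_kerWeight _) pGrowthDeriv_shiftPt N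
  refine ⟨s, fun g hg => ?_⟩
  obtain ⟨hgs, B, q, hB, hgb⟩ := hg
  refine ⟨∑ k ∈ Finset.range (N + 1), ∑ i ∈ Finset.range (k + 1), (k.choose i : ℝ) * B * A, q + s,
    by positivity, fun M p C F hC hF hFb U a hU => ⟨smooth_ampl hgs hF, fun k hk P hP θ w => ?_⟩⟩
  have hmul := norm_iteratedFDeriv_mul_le (𝕜 := ℝ) (N := ((⊤ : ℕ∞) : WithTop ℕ∞)) (n := k)
    (f := fun e => g (kerPt d e)) (g := F ∘ shiftPt) (hgs.comp (kerPt d).contDiff)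
    (hF.comp smooth_shiftPt) (P, θ, w) (by exact_mod_cast le_top)
  refine hmul.trans ?_
  have hj := Real.rpow_nonneg (japBracket_pos P.2.2).le M
  have hterm : ∀ i ∈ Finset.range (k + 1), (k.choose i : ℝ) *
      ‖iteratedFDeriv ℝ i (fun e => g (kerPt d e)) (P, θ, w)‖ *
      ‖iteratedFDeriv ℝ (k - i) (F ∘ shiftPt) (P, θ, w)‖ ≤
      ((k.choose i : ℝ) * B * A) * (C * a * (1 + ‖θ‖) ^ p * intWeight w) := by
    intro i hi
    rw [Finset.mem_range] at hi
    have h1 : ‖iteratedFDeriv ℝ i (fun e => g (kerPt d e)) (P, θ, w)‖ ≤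
        B * (1 + ‖P.1‖) ^ q * ((1 + ‖w‖) ^ (2 * d + 1 + s))⁻¹ := by
      have := norm_iteratedFDeriv_comp_affine_le hgs (kerPt d) norm_kerPt_le 0 i (P, θ, w)
      simp only [zero_add] at this
      exact this.trans (hgb i (by omega) _ _ _)
    have h2 : ‖iteratedFDeriv ℝ (k - i) (F ∘ shiftPt) (P, θ, w)‖ ≤
        A * (C * japBracket P.2.2 ^ M * (1 + ‖θ‖) ^ p) * ((1 + ‖P.1‖) ^ s * (1 + ‖w‖) ^ s) := by
      refine (hcomp F hF (k - i) (by omega) (P, θ, w)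
        (C * japBracket P.2.2 ^ M * (1 + ‖θ‖) ^ p) (by positivity) fun i hi => ?_).trans ?_
      -- With ξ as base momentum, the momenta of the two shifted points differ from it exactly by η
      -- and ζ, so the bound is ⟨ξ⟩^M times a power of 1 + ‖θ‖.
      · refine (hFb i hi _ _ P.2.2).trans (le_of_eq ?_)
        simp [shiftPt]
      · rw [← mul_pow]
        have h0 : 0 ≤ kerWeight (kerPt d (P, θ, w)) := zero_le_one.trans (one_le_kerWeight _)
        gcongr
        simp only [kerWeight, kerPt_apply, Prod.norm_def]
        have := mul_nonneg (norm_nonneg P.1) (norm_nonneg w)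
        have h3 := norm_nonneg P.1
        have h4 := norm_nonneg w
        simp only [Prod.norm_def] at this h3 h4
        rcases max_cases (max ‖P.1.1‖ ‖P.1.2‖) (max ‖w.1‖ ‖w.2‖) with h | h <;> rw [h.1] <;>
          nlinarith
    calc _ ≤ (k.choose i : ℝ) * (B * (1 + ‖P.1‖) ^ q * ((1 + ‖w‖) ^ (2 * d + 1 + s))⁻¹) *
        (A * (C * japBracket P.2.2 ^ M * (1 + ‖θ‖) ^ p) * ((1 + ‖P.1‖) ^ s * (1 + ‖w‖) ^ s)) := by
          gcongr
      _ = ((k.choose i : ℝ) * B * A) * (C * ((1 + ‖P.1‖) ^ (q + s) * japBracket P.2.2 ^ M) *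
          (1 + ‖θ‖) ^ p * intWeight w) := by
          rw [intWeight, pow_add _ (2 * d + 1) s, pow_add _ q s, mul_inv]
          have : (1 + ‖w‖) ^ s ≠ 0 := by positivity
          field_simp
      _ ≤ _ := by
          have := hU P hP
          have h5 := intWeight_pos w
          gcongr
  refine (Finset.sum_le_sum hterm).trans ?_
  rw [← Finset.sum_mul]
  have ha : 0 ≤ a := le_trans (by positivity) (hU P hP)
  have h5 := intWeight_pos w
  calc _ ≤ (∑ k ∈ Finset.range (N + 1), ∑ i ∈ Finset.range (k + 1), (k.choose i : ℝ) * B * A) *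
      (C * a * (1 + ‖θ‖) ^ p * intWeight w) := by
        gcongr
        exact Finset.single_le_sum
          (f := fun k => ∑ i ∈ Finset.range (k + 1), (k.choose i : ℝ) * B * A)
          (fun _ _ => by positivity) (by simpa using Nat.lt_succ_of_le hk)
    _ = _ := by ring

end Amp

/-! ### Oscillatory integrals with decaying kernels -/

section DecayingKernels

variable {d : ℕ}

/-- Smooth functions of `(Y, Z)` with `DoubleBound`s of all orders. -/
def IsDouble (M : ℝ) (p : ℕ) (F : Phase d × Phase d → ℂ) : Prop :=
  ContDiff ℝ (⊤ : ℕ∞) F ∧ ∀ N : ℕ, ∃ C : ℝ, 0 ≤ C ∧ DoubleBound M p N C F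

theorem IsDouble.mono {M : ℝ} {p p' : ℕ} {F : Phase d × Phase d → ℂ} (hF : IsDouble M p F)
    (hp : p ≤ p') : IsDouble M p' F := by
  refine ⟨hF.1, fun N => ?_⟩
  obtain ⟨C, hC, h⟩ := hF.2 N
  refine ⟨C, hC, fun n hn Y Z ξ => (h n hn Y Z ξ).trans ?_⟩
  have := Real.rpow_nonneg (japBracket_pos ξ).le M
  gcongr
  linarith [norm_nonneg ((Y.2 - ξ, Z.2 - ξ) : Phase d)]

theorem IsDouble.add {M : ℝ} {p : ℕ} {F F' : Phase d × Phase d → ℂ} (hF : IsDouble M p F)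
    (hF' : IsDouble M p F') : IsDouble M p (fun e => F e + F' e) := by
  refine ⟨hF.1.add hF'.1, fun N => ?_⟩
  obtain ⟨C, hC, h⟩ := hF.2 N
  obtain ⟨C', hC', h'⟩ := hF'.2 N
  refine ⟨C + C', add_nonneg hC hC', fun n hn Y Z ξ => ?_⟩
  have h1 : iteratedFDeriv ℝ n (fun e => F e + F' e) (Y, Z)
      = iteratedFDeriv ℝ n F (Y, Z) + iteratedFDeriv ℝ n F' (Y, Z) :=
    iteratedFDeriv_add_apply (hF.1.contDiffAt.of_le (by exact_mod_cast le_top))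
      (hF'.1.contDiffAt.of_le (by exact_mod_cast le_top))
  rw [h1]
  refine (norm_add_le _ _).trans ((add_le_add (h n hn Y Z ξ) (h' n hn Y Z ξ)).trans (le_of_eq ?_))
  ring

theorem IsDouble.clm_fderiv {M : ℝ} {p : ℕ} {F : Phase d × Phase d → ℂ} (hF : IsDouble M p F)
    (v : Phase d × Phase d) : IsDouble M p (dirDeriv v F) := by
  refine ⟨smooth_dirDeriv hF.1 v, fun N => ?_⟩
  obtain ⟨C, hC, h⟩ := hF.2 (N + 1)
  refine ⟨‖v‖ * C, by positivity, fun n hn Y Z ξ => ?_⟩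
  have hfd : ContDiff ℝ (⊤ : ℕ∞) (fderiv ℝ F) := hF.1.fderiv_right (by simp)
  refine (norm_iteratedFDeriv_clm_apply_const (n := n) (hfd.contDiffAt (x := (Y, Z)))
    (by exact_mod_cast le_top)).trans ?_
  rw [norm_iteratedFDeriv_fderiv, mul_assoc, mul_assoc]
  gcongr
  rw [← mul_assoc]
  exact h (n + 1) (by omega) Y Z ξ

theorem IsDouble.const_mul {M : ℝ} {p : ℕ} {F : Phase d × Phase d → ℂ} (hF : IsDouble M p F)
    (c : ℂ) : IsDouble M p (fun e => c * F e) := by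
  refine ⟨contDiff_const.mul hF.1, fun N => ?_⟩
  obtain ⟨C, hC, h⟩ := hF.2 N
  refine ⟨‖c‖ * C, by positivity, fun n hn Y Z ξ => ?_⟩
  have h1 : iteratedFDeriv ℝ n (fun e => c * F e) (Y, Z) = c • iteratedFDeriv ℝ n F (Y, Z) :=
    iteratedFDeriv_const_smul_apply (a := c)
      (hF.1.contDiffAt.of_le (by exact_mod_cast le_top))
  rw [h1, norm_smul, mul_assoc, mul_assoc]
  gcongr
  rw [← mul_assoc]
  exact h n hn Y Z ξ

theorem isDouble_zero (M : ℝ) (p : ℕ) : IsDouble M p (fun _ : Phase d × Phase d => 0) := by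
  refine ⟨contDiff_const, fun N => ⟨0, le_rfl, fun n _ Y Z ξ => ?_⟩⟩
  have : iteratedFDeriv ℝ n (fun _ : Phase d × Phase d => (0 : ℂ)) = 0 := iteratedFDeriv_fun_zero
  rw [this]
  simp

theorem IsDouble.sum {M : ℝ} {p : ℕ} {ι : Type*} (s : Finset ι) {F : ι → Phase d × Phase d → ℂ}
    (hF : ∀ i ∈ s, IsDouble M p (F i)) : IsDouble M p (fun e => ∑ i ∈ s, F i e) := by
  classical
  induction s using Finset.induction_on with
  | empty => simpa using isDouble_zero M p
  | insert a s ha ih =>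
    simp only [Finset.sum_insert ha]
    exact (hF a (by simp)).add (ih fun i hi => hF i (by simp [hi]))

theorem IsAmplitude.add {Q : Type*} [NormedAddCommGroup Q] [NormedSpace ℝ Q] {U : Set Q} {N p : ℕ}
    {C C' : ℝ} {A A' : Q × Phase d × Phase d → ℂ} (hA : IsAmplitude U N p C A)
    (hA' : IsAmplitude U N p C' A') : IsAmplitude U N p (C + C') (fun e => A e + A' e) := by
  refine ⟨hA.1.add hA'.1, fun k hk P hP θ w => ?_⟩
  have h1 : iteratedFDeriv ℝ k (fun e => A e + A' e) (P, θ, w) =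
      iteratedFDeriv ℝ k A (P, θ, w) + iteratedFDeriv ℝ k A' (P, θ, w) :=
    iteratedFDeriv_add_apply (hA.1.contDiffAt.of_le (by exact_mod_cast le_top))
      (hA'.1.contDiffAt.of_le (by exact_mod_cast le_top))
  rw [h1]
  exact (norm_add_le _ _).trans ((add_le_add (hA.2 k hk P hP θ w)
    (hA'.2 k hk P hP θ w)).trans (le_of_eq (by ring)))

theorem IsAmplitude.const_smul {Q : Type*} [NormedAddCommGroup Q] [NormedSpace ℝ Q] {U : Set Q}
    {N p : ℕ} {C : ℝ} {A : Q × Phase d × Phase d → ℂ} (hA : IsAmplitude U N p C A) (c : ℂ) :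
    IsAmplitude U N p (‖c‖ * C) (fun e => c • A e) := by
  refine ⟨hA.1.const_smul c, fun k hk P hP θ w => ?_⟩
  rw [show (fun e => c • A e) = c • A from rfl, iteratedFDeriv_const_smul_apply
    (hA.1.contDiffAt.of_le (by exact_mod_cast le_top)), norm_smul, mul_assoc, mul_assoc]
  gcongr
  rw [← mul_assoc]
  exact hA.2 k hk P hP θ w

theorem exists_isAmplitude_sum {Q : Type*} [NormedAddCommGroup Q] [NormedSpace ℝ Q] {P : Q}
    {p : ℕ} {ι : Type*} (s : Finset ι) {A : ι → Q × Phase d × Phase d → ℂ}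
    (hA : ∀ i ∈ s, ∃ C, IsAmplitude {P} (p + 2 * d + 2) p C (A i)) :
    (∃ C, IsAmplitude {P} (p + 2 * d + 2) p C (fun e => ∑ i ∈ s, A i e)) ∧
      oscOuter (fun e => ∑ i ∈ s, A i e) P = ∑ i ∈ s, oscOuter (A i) P := by
  classical
  induction s using Finset.induction_on with
  | empty =>
    refine ⟨⟨0, by simpa using contDiff_const, fun k _ P _ θ w => ?_⟩, by simp [oscOuter, oscInner]⟩
    have : iteratedFDeriv ℝ k (fun _ : Q × Phase d × Phase d => (0 : ℂ)) = 0 :=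
      iteratedFDeriv_fun_zero
    simp [this]
  | insert a s ha ih =>
    obtain ⟨⟨C, h⟩, h'⟩ := ih fun i hi => hA i (by simp [hi])
    obtain ⟨C', hC'⟩ := hA a (by simp)
    simp only [Finset.sum_insert ha]
    refine ⟨⟨_, hC'.add h⟩, ?_⟩
    rw [oscOuter_add (hC'.mono subset_rfl (by omega)) (h.mono subset_rfl (by omega)) rfl, h']

/-- The decay needed of a kernel for amplitudes of growth `p`. -/
def ampOrder (d p : ℕ) : ℕ := Classical.choose (exists_ampl_order d (p + 2 * d + 2))

/-- Kernels which decay fast enough for amplitudes of growth `p`. -/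
def Adm (p : ℕ) (g : KerArg d → ℂ) : Prop :=
  KerDecay (p + 2 * d + 2) (2 * d + 1 + ampOrder d p) g

theorem Adm.isAmplitude {p : ℕ} {g : KerArg d → ℂ} (hg : Adm p g) :
    ∃ c : ℝ, ∃ q : ℕ, 0 ≤ c ∧ ∀ (M C : ℝ) (F : Phase d × Phase d → ℂ), 0 ≤ C →
      ContDiff ℝ (⊤ : ℕ∞) F → DoubleBound M p (p + 2 * d + 2) C F → ∀ (U : Set (Par d)) (a : ℝ),
        (∀ P ∈ U, (1 + ‖P.1‖) ^ q * japBracket P.2.2 ^ M ≤ a) →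
          IsAmplitude U (p + 2 * d + 2) p (c * C * a) (ampl g F) := by
  obtain ⟨c, q, hc, h⟩ := Classical.choose_spec (exists_ampl_order d (p + 2 * d + 2)) g hg
  exact ⟨c, q, hc, fun M C F hC hF hb U a hU => h M p C F hC hF hb U a hU⟩

theorem Adm.isAmplitude_singleton {p : ℕ} {g : KerArg d → ℂ} (hg : Adm p g) {M : ℝ}
    {F : Phase d × Phase d → ℂ} (hF : IsDouble M p F) (P : Par d) :
    ∃ C, IsAmplitude {P} (p + 2 * d + 2) p C (ampl g F) := by
  obtain ⟨c, q, hc, h⟩ := hg.isAmplitude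
  obtain ⟨C, hC, hb⟩ := hF.2 (p + 2 * d + 2)
  exact ⟨_, h M C F hC hF.1 hb {P} ((1 + ‖P.1‖) ^ q * japBracket P.2.2 ^ M) (by simp)⟩

/-- The amplitude constant depends on the parameters through a continuous function, so one of its
strict sublevel sets is an open set with a uniform constant. -/
theorem Adm.isAmplitude_nhds {p : ℕ} {g : KerArg d → ℂ} (hg : Adm p g) {M : ℝ}
    {F : Phase d × Phase d → ℂ} (hF : IsDouble M p F) (P : Par d) :
    ∃ U : Set (Par d), IsOpen U ∧ P ∈ U ∧ ∃ C, IsAmplitude U (p + 2 * d + 2) p C (ampl g F) := by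
  obtain ⟨c, q, hc, h⟩ := hg.isAmplitude
  obtain ⟨C, hC, hb⟩ := hF.2 (p + 2 * d + 2)
  have hcont : Continuous fun P : Par d => (1 + ‖P.1‖) ^ q * japBracket P.2.2 ^ M := by
    have h1 : Continuous fun P : Par d => japBracket P.2.2 :=
      continuous_japBracket.comp (by fun_prop)
    exact (by fun_prop : Continuous fun P : Par d => (1 + ‖P.1‖) ^ q).mul
      (h1.rpow_const fun P => Or.inl (japBracket_pos _).ne')
  refine ⟨{P' | (1 + ‖P'.1‖) ^ q * japBracket P'.2.2 ^ M <
      (1 + ‖P.1‖) ^ q * japBracket P.2.2 ^ M + 1}, isOpen_lt hcont continuous_const, ?_, _,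
    h M C F hC hF.1 hb _ _ fun P' hP' => (le_of_lt hP')⟩
  simp

/-- The oscillatory integral of a decaying kernel. -/
def oscJ (g : KerArg d → ℂ) (F : Phase d × Phase d → ℂ) (P : Par d) : ℂ := oscOuter (ampl g F) P

/-- Obtained from the parameter set {P}, on which the amplitude constant is itself the claimed
function of P. -/
theorem norm_oscJ_le {p : ℕ} {g : KerArg d → ℂ} (hg : Adm p g) {M : ℝ}
    {F : Phase d × Phase d → ℂ} (hF : IsDouble M p F) :
    ∃ C : ℝ, ∃ q : ℕ, 0 ≤ C ∧ ∀ P, ‖oscJ g F P‖ ≤ C * (1 + ‖P.1‖) ^ q * japBracket P.2.2 ^ M := by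
  obtain ⟨c, q, hc, h⟩ := hg.isAmplitude
  obtain ⟨C, hC, hb⟩ := hF.2 (p + 2 * d + 2)
  obtain ⟨c', hc', h'⟩ := norm_oscOuter_le d p ℂ (Par d)
  refine ⟨c' * (c * C), q, by positivity, fun P => ?_⟩
  have := h' {P} _ _ ((h M C F hC hF.1 hb {P} ((1 + ‖P.1‖) ^ q * japBracket P.2.2 ^ M)
    (by simp)).mono subset_rfl (by omega)) P rfl
  refine this.trans (le_of_eq ?_)
  ring

theorem oscJ_add_left {p : ℕ} {g g' : KerArg d → ℂ} (hg : Adm p g) (hg' : Adm p g') {M : ℝ}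
    {F : Phase d × Phase d → ℂ} (hF : IsDouble M p F) (P : Par d) :
    oscJ (fun a => g a + g' a) F P = oscJ g F P + oscJ g' F P := by
  obtain ⟨C, h⟩ := hg.isAmplitude_singleton hF P
  obtain ⟨C', h'⟩ := hg'.isAmplitude_singleton hF P
  have := oscOuter_add (h.mono subset_rfl (by omega)) (h'.mono subset_rfl (by omega)) (P := P) rfl
  rw [oscJ, oscJ, oscJ, ← this]
  congr 1; funext e
  simp only [ampl]; ring

theorem oscJ_add_right {p : ℕ} {g : KerArg d → ℂ} (hg : Adm p g) {M : ℝ}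
    {F F' : Phase d × Phase d → ℂ} (hF : IsDouble M p F) (hF' : IsDouble M p F') (P : Par d) :
    oscJ g (fun a => F a + F' a) P = oscJ g F P + oscJ g F' P := by
  obtain ⟨C, h⟩ := hg.isAmplitude_singleton hF P
  obtain ⟨C', h'⟩ := hg.isAmplitude_singleton hF' P
  have := oscOuter_add (h.mono subset_rfl (by omega)) (h'.mono subset_rfl (by omega)) (P := P) rfl
  rw [oscJ, oscJ, oscJ, ← this]
  congr 1; funext e
  simp only [ampl]; ring

theorem oscJ_const_mul_left (c : ℂ) (g : KerArg d → ℂ) (F : Phase d × Phase d → ℂ) (P : Par d) :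
    oscJ (fun a => c * g a) F P = c * oscJ g F P := by
  rw [oscJ, oscJ, ← smul_eq_mul c, ← oscOuter_const_smul]
  congr 1; funext e
  simp only [ampl, smul_eq_mul]; ring

theorem oscJ_const_mul_right (c : ℂ) (g : KerArg d → ℂ) (F : Phase d × Phase d → ℂ) (P : Par d) :
    oscJ g (fun a => c * F a) P = c * oscJ g F P := by
  rw [oscJ, oscJ, ← smul_eq_mul c, ← oscOuter_const_smul]
  congr 1; funext e
  simp only [ampl, smul_eq_mul]; ring

theorem oscJ_zero_right (g : KerArg d → ℂ) (P : Par d) : oscJ g (fun _ => 0) P = 0 := by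
  simpa using oscJ_const_mul_right 0 g (fun _ => 0) P

theorem oscJ_sum_right {p : ℕ} {g : KerArg d → ℂ} (hg : Adm p g) {M : ℝ} {ι : Type*}
    (s : Finset ι) {F : ι → Phase d × Phase d → ℂ} (hF : ∀ i ∈ s, IsDouble M p (F i)) (P : Par d) :
    oscJ g (fun a => ∑ i ∈ s, F i a) P = ∑ i ∈ s, oscJ g (F i) P := by
  classical
  induction s using Finset.induction_on with
  | empty => simpa using oscJ_zero_right g P
  | insert a s ha ih =>
    simp only [Finset.sum_insert ha]
    rw [oscJ_add_right hg (hF a (by simp)) (IsDouble.sum s fun i hi => hF i (by simp [hi])),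
      ih fun i hi => hF i (by simp [hi])]

theorem hasFDerivAt_shiftPt (e : Par d × Phase d × Phase d) :
    HasFDerivAt shiftPt (shiftLin d + (e.1.1.1 • (shiftRot d).comp
      ((ContinuousLinearMap.snd ℝ (Phase d) (Phase d)).comp
        (ContinuousLinearMap.snd ℝ (Par d) (Phase d × Phase d))) +
      (((ContinuousLinearMap.fst ℝ ℝ ℝ).comp
      ((ContinuousLinearMap.fst ℝ (ℝ × ℝ) (Phase d)).comp
        (ContinuousLinearMap.fst ℝ (Par d) (Phase d × Phase d))))).smulRight
          (shiftRot d e.2.2))) e := by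
  rw [show (shiftPt (d := d)) = fun e => shiftLin d e + e.1.1.1 • shiftRot d e.2.2 from
    funext shiftPt_eq]
  refine (shiftLin d).hasFDerivAt.add ?_
  exact HasFDerivAt.fun_smul
    ((((ContinuousLinearMap.fst ℝ ℝ ℝ).comp
      ((ContinuousLinearMap.fst ℝ (ℝ × ℝ) (Phase d)).comp
        (ContinuousLinearMap.fst ℝ (Par d) (Phase d × Phase d))))).hasFDerivAt (x := e))
    (((shiftRot d).comp ((ContinuousLinearMap.snd ℝ (Phase d) (Phase d)).comp
        (ContinuousLinearMap.snd ℝ (Par d) (Phase d × Phase d)))).hasFDerivAt (x := e))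

theorem dirDeriv_ampl {g : KerArg d → ℂ} {F : Phase d × Phase d → ℂ}
    (hg : ContDiff ℝ (⊤ : ℕ∞) g) (hF : ContDiff ℝ (⊤ : ℕ∞) F) (v e : Par d × Phase d × Phase d) :
    dirDeriv v (ampl g F) e = dirDeriv (kerPt d v) g (kerPt d e) * F (shiftPt e) +
      g (kerPt d e) * fderiv ℝ F (shiftPt e)
        (shiftLin d v + (e.1.1.1 • shiftRot d v.2.2 + v.1.1.1 • shiftRot d e.2.2)) := by
  have h1 : HasFDerivAt (fun e => g (kerPt d e)) ((fderiv ℝ g (kerPt d e)).comp (kerPt d)) e :=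
    (hg.differentiable (by simp) _).hasFDerivAt.comp e (kerPt d).hasFDerivAt
  have h2 : HasFDerivAt (fun e => F (shiftPt e)) _ e :=
    (hF.differentiable (by simp) _).hasFDerivAt.comp e (hasFDerivAt_shiftPt e)
  have h3 := (h1.mul h2).fderiv
  rw [dirDeriv, show ampl g F = fun e => g (kerPt d e) * F (shiftPt e) from rfl]
  have h4 : (fun e => g (kerPt d e) * F (shiftPt e)) =
    (fun e => g (kerPt d e)) * fun e => F (shiftPt e) := rfl
  rw [h4, h3]
  simp [dirDeriv]
  ring

/-- The direction in `(Y, Z)` of a direction in `θ = (η, ζ)`. -/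
def thetaDir (v : Phase d) : Phase d × Phase d := ((0, v.1), (0, v.2))

/-- Multiplication of a kernel by `⟨w, v⟩`. -/
def mulW (v : Phase d) (G : KerArg d → ℂ) : KerArg d → ℂ := fun a => (pairL d a.2.2 v : ℂ) * G a

theorem thetaDeriv_ampl {g : KerArg d → ℂ} {F : Phase d × Phase d → ℂ}
    (hg : ContDiff ℝ (⊤ : ℕ∞) g) (hF : ContDiff ℝ (⊤ : ℕ∞) F) (v : Phase d) :
    thetaDeriv v (ampl g F) = fun e => ampl g (dirDeriv (thetaDir v) F) e +
      (-Complex.I) • ampl (mulW v g) F e := by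
  funext e
  simp only [thetaDeriv, dirDeriv_ampl hg hF]
  have h1 : kerPt d ((0 : Par d), v, (0 : Phase d)) = 0 := rfl
  have h2 : shiftLin d ((0 : Par d), v, (0 : Phase d)) = thetaDir v := by
    simp [shiftLin, thetaDir]
  rw [h1, h2]
  simp [dirDeriv, ampl, mulW, kerPt_apply]
  ring

/-- Multiplication of the kernel by `⟨w, v⟩` is the derivative `-i v · ∂_θ` of the symbols. -/
theorem oscJ_mulW {p : ℕ} {g : KerArg d → ℂ} {v : Phase d} (hg : Adm p g)
    (hg' : Adm p (mulW v g)) {M : ℝ} {F : Phase d × Phase d → ℂ} (hF : IsDouble M p F)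
    (P : Par d) :
    oscJ (mulW v g) F P = oscJ g (fun e => -Complex.I * dirDeriv (thetaDir v) F e) P := by
  obtain ⟨C, h⟩ := hg.isAmplitude_singleton hF P
  obtain ⟨C₁, h₁⟩ := hg.isAmplitude_singleton (hF.clm_fderiv (thetaDir v)) P
  obtain ⟨C₂, h₂⟩ := hg'.isAmplitude_singleton hF P
  have hth := thetaDeriv_ampl hg.1 hF.1 v
  have h₃ := h₂.const_smul (-Complex.I)
  have h₄ := h₁.add h₃
  rw [← hth] at h₄
  have key := oscOuter_thetaDeriv (h.mono subset_rfl (by omega)) (h₄.mono subset_rfl (by omega))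
  rw [hth, oscOuter_add (h₁.mono subset_rfl (by omega)) (h₃.mono subset_rfl (by omega)) rfl,
    oscOuter_const_smul] at key
  rw [oscJ_const_mul_right]
  change oscJ g (dirDeriv (thetaDir v) F) P + (-Complex.I) • oscJ (mulW v g) F P = 0 at key
  rw [smul_eq_mul] at key
  have : oscJ g (dirDeriv (thetaDir v) F) P = Complex.I * oscJ (mulW v g) F P := by
    linear_combination key
  rw [this, ← mul_assoc]
  simp

/-- Parameter directions as directions of the kernel arguments. -/
def kerDir (v : Par d) : KerArg d := (v.2.1, (v.1, 0))

theorem shiftRot_eq (w : Phase d) :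
    shiftRot d w = ∑ l : Fin d, ((-(1 / 2 : ℝ) * w.2 l) • vecY l + ((1 / 2 : ℝ) * w.1 l) • vecZ l) := by
  have hb : ∀ u : Cfg d, ∑ l : Fin d, u l • (stdVec l : Cfg d) = u := fun u => by
    have := (EuclideanSpace.basisFun (Fin d) ℝ).sum_repr u
    simpa [stdVec] using this
  rw [Finset.sum_add_distrib]
  have h1 : ∑ l : Fin d, (-(1 / 2 : ℝ) * w.2 l) • (vecY l : Phase d × Phase d) =
      ((-(1 / 2 : ℝ) • w.2, 0), 0) := by
    simp only [vecY, mul_smul, ← Finset.smul_sum]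
    rw [← hb w.2]
    simp [Prod.ext_iff, Prod.fst_sum, Prod.snd_sum, hb]
  have h2 : ∑ l : Fin d, ((1 / 2 : ℝ) * w.1 l) • (vecZ l : Phase d × Phase d) =
      (0, ((1 / 2 : ℝ) • w.1, 0)) := by
    simp only [vecZ, mul_smul, ← Finset.smul_sum]
    rw [← hb w.1]
    simp [Prod.ext_iff, Prod.fst_sum, Prod.snd_sum, hb]
  rw [h1, h2]
  simp [shiftRot]

theorem pairL_left (w : Phase d) (l : Fin d) : pairL d w ((stdVec l, 0) : Phase d) = w.1 l := by
  simp [pairL_apply, stdVec, EuclideanSpace.inner_single_right]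

theorem pairL_right (w : Phase d) (l : Fin d) : pairL d w ((0, stdVec l) : Phase d) = w.2 l := by
  simp [pairL_apply, stdVec, EuclideanSpace.inner_single_right]

/-- Three contributions: the kernel, the common translation of both phase space points by the
X-direction, and the ε-dependence of the shift. The last one brings the factors -z_l/2 with ∂_{y_l}
and y_l/2 with ∂_{z_l}, from which 𝓛₀ arises after integration by parts. -/
theorem dirDeriv_param_ampl {g : KerArg d → ℂ} {F : Phase d × Phase d → ℂ}
    (hg : ContDiff ℝ (⊤ : ℕ∞) g) (hF : ContDiff ℝ (⊤ : ℕ∞) F) (v : Par d) :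
    dirDeriv (v, 0) (ampl g F) = fun e => (ampl (dirDeriv (kerDir v) g) F e +
      ampl g (dirDeriv (v.2, v.2) F) e) + ((v.1.1 / 2 : ℝ) : ℂ) • ∑ l : Fin d,
        ((-1 : ℂ) • ampl (mulW (0, stdVec l) g) (dirDeriv (vecY l) F) e +
          ampl (mulW (stdVec l, 0) g) (dirDeriv (vecZ l) F) e) := by
  funext e
  rw [dirDeriv_ampl hg hF]
  have h1 : kerPt d (v, (0 : Phase d × Phase d)) = kerDir v := rfl
  have h2 : shiftLin d (v, (0 : Phase d × Phase d)) = (v.2, v.2) := by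
    simp [shiftLin]
  have h3 : shiftRot d ((v, (0 : Phase d × Phase d)) : Par d × Phase d × Phase d).2.2 = 0 := by
    simp
  rw [h1, h2, h3, shiftRot_eq e.2.2]
  simp only [smul_zero, zero_add, map_add, map_smul, map_sum, dirDeriv, ampl, mulW, pairL_left,
    pairL_right, kerPt_apply, smul_eq_mul, Complex.real_smul]
  rw [mul_add, ← add_assoc]
  congr 1
  rw [Finset.mul_sum, Finset.mul_sum, Finset.mul_sum]
  refine Finset.sum_congr rfl fun l _ => ?_
  push_cast
  ring

/-- The differential of an oscillatory integral in its parameters. -/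
theorem hasFDerivAt_oscJ {p : ℕ} {g : KerArg d → ℂ} (hg : Adm p g)
    (hg₁ : ∀ v, Adm p (dirDeriv (kerDir v) g)) (hg₂ : ∀ v, Adm p (mulW v g)) {M : ℝ}
    {F : Phase d × Phase d → ℂ} (hF : IsDouble M p F) (P : Par d) :
    ∃ L : Par d →L[ℝ] ℂ, HasFDerivAt (oscJ g F) L P ∧ ∀ v,
      L v = oscJ (dirDeriv (kerDir v) g) F P + oscJ g (dirDeriv (v.2, v.2) F) P +
        v.1.1 * oscJ g (fun e => Complex.I * opL0 F e) P := by
  obtain ⟨U, hU, hPU, C, hA⟩ := hg.isAmplitude_nhds hF P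
  refine ⟨_, hasFDerivAt_oscOuter hA hU hPU, fun v => ?_⟩
  rw [oscOuter_paramDeriv_apply hA hPU, dirDeriv_param_ampl hg.1 hF.1]
  obtain ⟨C₁, h₁⟩ := (hg₁ v).isAmplitude_singleton hF P
  obtain ⟨C₂, h₂⟩ := hg.isAmplitude_singleton (hF.clm_fderiv (v.2, v.2)) P
  have h₃ : ∀ l ∈ (Finset.univ : Finset (Fin d)), ∃ C, IsAmplitude {P} (p + 2 * d + 2) p C
      (fun e => (-1 : ℂ) • ampl (mulW (0, stdVec l) g) (dirDeriv (vecY l) F) e +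
        ampl (mulW (stdVec l, 0) g) (dirDeriv (vecZ l) F) e) := fun l _ => by
    obtain ⟨C₃, h₃⟩ := (hg₂ (0, stdVec l)).isAmplitude_singleton (hF.clm_fderiv (vecY l)) P
    obtain ⟨C₄, h₄⟩ := (hg₂ (stdVec l, 0)).isAmplitude_singleton (hF.clm_fderiv (vecZ l)) P
    exact ⟨_, (h₃.const_smul (-1)).add h₄⟩
  obtain ⟨⟨C₄, h₄⟩, hsum⟩ := exists_isAmplitude_sum Finset.univ h₃
  rw [oscOuter_add ((h₁.add h₂).mono subset_rfl (by omega))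
      ((h₄.const_smul _).mono subset_rfl (by omega)) rfl,
    oscOuter_add (h₁.mono subset_rfl (by omega)) (h₂.mono subset_rfl (by omega)) rfl,
    oscOuter_const_smul, hsum]
  -- Replacing z_l by -i∂_{ζ_l} and y_l by -i∂_{η_l} turns -z_l ∂_{y_l} + y_l ∂_{z_l} into
  -- i(∂_{y_l}∂_{ζ_l} - ∂_{η_l}∂_{z_l}), a summand of 2i𝓛₀.
  have hterm : ∀ l : Fin d, oscOuter (fun e =>
      (-1 : ℂ) • ampl (mulW (0, stdVec l) g) (dirDeriv (vecY l) F) e +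
        ampl (mulW (stdVec l, 0) g) (dirDeriv (vecZ l) F) e) P =
      Complex.I * oscJ g (fun e => dirDerivs [vecY l, vecZeta l] F e -
        dirDerivs [vecEta l, vecZ l] F e) P := fun l => by
    obtain ⟨C₃, h₃⟩ := (hg₂ (0, stdVec l)).isAmplitude_singleton (hF.clm_fderiv (vecY l)) P
    obtain ⟨C₄, h₄⟩ := (hg₂ (stdVec l, 0)).isAmplitude_singleton (hF.clm_fderiv (vecZ l)) P
    rw [oscOuter_add ((h₃.const_smul _).mono subset_rfl (by omega))
      (h₄.mono subset_rfl (by omega)) rfl, oscOuter_const_smul]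
    change (-1 : ℂ) • oscJ (mulW (0, stdVec l) g) (dirDeriv (vecY l) F) P +
      oscJ (mulW (stdVec l, 0) g) (dirDeriv (vecZ l) F) P = _
    rw [oscJ_mulW hg (hg₂ _) (hF.clm_fderiv _), oscJ_mulW hg (hg₂ _) (hF.clm_fderiv _)]
    have e1 : dirDeriv (thetaDir ((0, stdVec l) : Phase d)) (dirDeriv (vecY l) F) =
        dirDerivs [vecY l, vecZeta l] F := dirDeriv_comm hF.1 _ _
    have e2 : dirDeriv (thetaDir ((stdVec l, 0) : Phase d)) (dirDeriv (vecZ l) F) =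
        dirDerivs [vecEta l, vecZ l] F := rfl
    rw [e1, e2]
    have e3 : (fun e => dirDerivs [vecY l, vecZeta l] F e - dirDerivs [vecEta l, vecZ l] F e) =
      fun e => dirDerivs [vecY l, vecZeta l] F e + (-1) * dirDerivs [vecEta l, vecZ l] F e := by
      funext e; ring
    have d1 : IsDouble M p (dirDerivs [vecY l, vecZeta l] F) := (hF.clm_fderiv _).clm_fderiv _
    have d2 : IsDouble M p (dirDerivs [vecEta l, vecZ l] F) := (hF.clm_fderiv _).clm_fderiv _
    rw [e3, oscJ_add_right hg d1 (d2.const_mul _), oscJ_const_mul_right, oscJ_const_mul_right,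
      oscJ_const_mul_right, smul_eq_mul]
    ring
  simp only [hterm]
  have e5 : (fun e => Complex.I * opL0 F e) = fun e => Complex.I * ((1 / 2 : ℂ) * ∑ l : Fin d,
    (dirDerivs [vecY l, vecZeta l] F e - dirDerivs [vecEta l, vecZ l] F e)) := rfl
  have d3 : ∀ l ∈ (Finset.univ : Finset (Fin d)), IsDouble M p (fun e =>
      dirDerivs [vecY l, vecZeta l] F e - dirDerivs [vecEta l, vecZ l] F e) := fun l _ => by
    have d1 : IsDouble M p (dirDerivs [vecY l, vecZeta l] F) := (hF.clm_fderiv _).clm_fderiv _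
    have d2 : IsDouble M p (dirDerivs [vecEta l, vecZ l] F) := (hF.clm_fderiv _).clm_fderiv _
    simpa [sub_eq_add_neg] using d1.add (d2.const_mul (-1))
  rw [e5, oscJ_const_mul_right, oscJ_const_mul_right, oscJ_sum_right hg _ d3, ← Finset.mul_sum]
  rw [smul_eq_mul]
  push_cast
  change oscJ _ F P + oscJ g _ P + _ = _
  ring

end DecayingKernels

/-! ### Regularization of kernels of polynomial growth -/

section Regularization

variable {d : ℕ}

theorem norm_iteratedFDeriv_clm_le {E F : Type*} [NormedAddCommGroup E] [NormedSpace ℝ E]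
    [NormedAddCommGroup F] [NormedSpace ℝ F] (L : E →L[ℝ] F) {σ : E → ℝ} (hσ : ∀ e, 1 ≤ σ e)
    {C : ℝ} (hC : 0 ≤ C) (h : ∀ e, ‖L e‖ ≤ C * σ e) (j : ℕ) (e : E) :
    ‖iteratedFDeriv ℝ j (fun e => L e) e‖ ≤ (C + ‖L‖) * σ e := by
  have h1 := hσ e
  have h2 : ‖L‖ ≤ ‖L‖ * σ e := le_mul_of_one_le_right (norm_nonneg _) h1
  have h3 : 0 ≤ C * σ e := mul_nonneg hC (zero_le_one.trans h1)
  rw [add_mul]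
  cases j with
  | zero => simpa using (h e).trans (by linarith [norm_nonneg L])
  | succ i =>
    rw [← norm_iteratedFDeriv_fderiv]
    have : fderiv ℝ (fun e => L e) = fun _ => L := by funext e; exact L.fderiv
    rw [this]
    cases i with
    | zero => simpa using h2.trans (by linarith)
    | succ i =>
      rw [iteratedFDeriv_succ_const]
      simp only [Pi.zero_apply, norm_zero]
      linarith [norm_nonneg L]

/-- `1 + |y|² + |z|²`. -/
def sqWeight (w : Phase d) : ℝ := 1 + ‖w.1‖ ^ 2 + ‖w.2‖ ^ 2

theorem one_le_sqWeight (w : Phase d) : 1 ≤ sqWeight w := by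
  unfold sqWeight; nlinarith [sq_nonneg ‖w.1‖, sq_nonneg ‖w.2‖]

/-- The norm of a pair is a maximum and not smooth. The quadratic weight is smooth, corresponds to
the operator 1 - Δ_θ, and by this comparison decays as well as (1 + ‖w‖)². -/
theorem sq_le_sqWeight (w : Phase d) : (1 + ‖w‖) ^ 2 ≤ 2 * sqWeight w := by
  rw [Prod.norm_def, sqWeight]
  rcases max_cases ‖w.1‖ ‖w.2‖ with h | h <;> rw [h.1] <;>
    nlinarith [sq_nonneg ‖w.1‖, sq_nonneg ‖w.2‖, sq_nonneg (1 - ‖w.1‖), sq_nonneg (1 - ‖w.2‖)]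

/-- The factor `(1 + |y|² + |z|²)^{-K}` on the arguments of kernels. -/
def invWeight (d K : ℕ) (a : KerArg d) : ℂ := ((sqWeight a.2.2 : ℂ) ^ K)⁻¹

/-- The kernel `(1 + |y|² + |z|²)^{-K} G`. -/
def regKer (K : ℕ) (G : KerArg d → ℂ) : KerArg d → ℂ := fun a => invWeight d K a * G a

/-- The derivative of `1 + |y|² + |z|²`. -/
def sqWeightDeriv (d : ℕ) : KerArg d →L[ℝ] KerArg d →L[ℝ] ℂ :=
  (2 : ℝ) • ((ContinuousLinearMap.compL ℝ (KerArg d) ℝ ℂ Complex.ofRealCLM).comp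
    ((pairL d).bilinearComp
      ((ContinuousLinearMap.snd ℝ (ℝ × ℝ) (Phase d)).comp
        (ContinuousLinearMap.snd ℝ (Cfg d) ((ℝ × ℝ) × Phase d)))
      ((ContinuousLinearMap.snd ℝ (ℝ × ℝ) (Phase d)).comp
        (ContinuousLinearMap.snd ℝ (Cfg d) ((ℝ × ℝ) × Phase d)))))

theorem sqWeightDeriv_apply (a b : KerArg d) :
    sqWeightDeriv d a b = 2 * (pairL d a.2.2 b.2.2 : ℂ) := by
  simp [sqWeightDeriv, ContinuousLinearMap.bilinearComp_apply]

theorem hasFDerivAt_sqWeight (a : KerArg d) :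
    HasFDerivAt (fun a : KerArg d => (sqWeight a.2.2 : ℂ)) (sqWeightDeriv d a) a := by
  have h0 : HasFDerivAt (fun a : KerArg d => a.2.2) ((ContinuousLinearMap.snd ℝ (ℝ × ℝ) (Phase d)).comp
        (ContinuousLinearMap.snd ℝ (Cfg d) ((ℝ × ℝ) × Phase d))) a :=
    ((ContinuousLinearMap.snd ℝ (ℝ × ℝ) (Phase d)).comp
        (ContinuousLinearMap.snd ℝ (Cfg d) ((ℝ × ℝ) × Phase d))).hasFDerivAt
  have h3 := (((hasFDerivAt_const (1 : ℝ) a).add h0.fst.norm_sq).add h0.snd.norm_sq)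
  have h4 := Complex.ofRealCLM.hasFDerivAt.comp a h3
  refine h4.congr_fderiv ?_
  refine ContinuousLinearMap.ext fun b => ?_
  simp [sqWeightDeriv_apply, pairL_apply]
  ring

theorem sqWeight_ne_zero (w : Phase d) : (sqWeight w : ℂ) ≠ 0 := by
  have := one_le_sqWeight w
  exact_mod_cast (by linarith : sqWeight w ≠ 0)

theorem smooth_invWeight (K : ℕ) : ContDiff ℝ (⊤ : ℕ∞) (invWeight d K) := by
  unfold invWeight
  refine ContDiff.inv ?_ fun a => pow_ne_zero _ (sqWeight_ne_zero _)
  refine ContDiff.pow ?_ _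
  have h : ContDiff ℝ (⊤ : ℕ∞) fun a : KerArg d => sqWeight a.2.2 := by
    unfold sqWeight
    exact (contDiff_const.add ((contDiff_norm_sq ℝ).comp (by fun_prop))).add
      ((contDiff_norm_sq ℝ).comp (by fun_prop))
  exact Complex.ofRealCLM.contDiff.comp h

theorem fderiv_invWeight (K : ℕ) : fderiv ℝ (invWeight d K) =
    fun a => (-(K : ℂ) * invWeight d (K + 1) a) • sqWeightDeriv d a := by
  funext a
  have h1 : HasFDerivAt (fun a : KerArg d => (sqWeight a.2.2 : ℂ) ^ K) _ a :=
    (hasFDerivAt_sqWeight a).pow K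
  have h2 := (hasDerivAt_inv (pow_ne_zero K (sqWeight_ne_zero a.2.2))).comp_hasFDerivAt (𝕜 := ℝ) a h1
  have h3 : HasFDerivAt (invWeight d K) _ a := h2
  rw [h3.fderiv]
  refine ContinuousLinearMap.ext fun b => ?_
  have h0 := sqWeight_ne_zero a.2.2
  rcases K with _ | K
  · simp
  · simp [invWeight, sqWeightDeriv_apply]
    field_simp
    ring

theorem norm_invWeight (K : ℕ) (a : KerArg d) : ‖invWeight d K a‖ = (sqWeight a.2.2 ^ K)⁻¹ := by
  have := one_le_sqWeight a.2.2
  rw [invWeight, norm_inv, norm_pow, Complex.norm_real, Real.norm_of_nonneg (by linarith)]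

/-- One derivative of the K-th inverse power is a linear function of w times the (K+1)-st, hence the
induction runs over all K simultaneously. The gain from K + 1 is thrown away: growth by one power of
‖w‖ per derivative is harmless, as K will be taken large. -/
theorem norm_iteratedFDeriv_invWeight_le (n : ℕ) : ∀ K : ℕ, ∃ C : ℝ, 0 ≤ C ∧ ∀ a : KerArg d,
    ‖iteratedFDeriv ℝ n (invWeight d K) a‖ ≤ C * (1 + ‖a.2.2‖) ^ n * (sqWeight a.2.2 ^ K)⁻¹ := by
  induction n using Nat.strong_induction_on with
  | _ n ih =>
  intro K
  rcases n with _ | n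
  · exact ⟨1, zero_le_one, fun a => by simp [norm_invWeight]⟩
  · have hL : ∀ a : KerArg d, ‖sqWeightDeriv d a‖ ≤ (2 * ‖pairL d‖) * (1 + ‖a.2.2‖) := fun a => by
      refine ContinuousLinearMap.opNorm_le_bound _ (by positivity) fun b => ?_
      rw [sqWeightDeriv_apply, norm_mul, Complex.norm_real, Complex.norm_ofNat]
      have h1 := (pairL d).le_opNorm₂ a.2.2 b.2.2
      have h2 : ‖b.2.2‖ ≤ ‖b‖ := (norm_snd_le b.2).trans (norm_snd_le b)
      calc _ ≤ 2 * (‖pairL d‖ * ‖a.2.2‖ * ‖b‖) := by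
            gcongr
            exact h1.trans (by gcongr)
        _ ≤ _ := by
          have : ‖a.2.2‖ ≤ 1 + ‖a.2.2‖ := by linarith
          calc _ = 2 * ‖pairL d‖ * ‖a.2.2‖ * ‖b‖ := by ring
            _ ≤ _ := by gcongr
    have hLb := fun j a => norm_iteratedFDeriv_clm_le (sqWeightDeriv d)
      (σ := fun a : KerArg d => 1 + ‖a.2.2‖) (fun a => by linarith [norm_nonneg a.2.2])
      (C := 2 * ‖pairL d‖) (by positivity) hL j a
    choose C hC hb using fun i : Fin (n + 1) => ih i (by omega) (K + 1)
    set B : ℝ := 2 * ‖pairL d‖ + ‖sqWeightDeriv d‖ with hB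
    have hB0 : 0 ≤ B := by positivity
    refine ⟨K * ∑ i : Fin (n + 1), (n.choose i : ℝ) * C i * B, mul_nonneg (by positivity)
      (Finset.sum_nonneg fun i _ => mul_nonneg (mul_nonneg (by positivity) (hC i)) hB0),
      fun a => ?_⟩
    rw [← norm_iteratedFDeriv_fderiv, fderiv_invWeight]
    have h1 : (fun a => (-(K : ℂ) * invWeight d (K + 1) a) • sqWeightDeriv d a) =
        (-(K : ℂ)) • fun a => invWeight d (K + 1) a • sqWeightDeriv d a := by
      funext a
      rw [Pi.smul_apply, mul_smul]
    have hsm : ContDiff ℝ (⊤ : ℕ∞) fun a => invWeight d (K + 1) a • sqWeightDeriv d a :=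
      (smooth_invWeight (K + 1)).smul (sqWeightDeriv d).contDiff
    rw [h1, iteratedFDeriv_const_smul_apply (hsm.contDiffAt.of_le (by exact_mod_cast le_top)),
      norm_smul, norm_neg, Complex.norm_natCast, mul_assoc, mul_assoc]
    gcongr
    refine (norm_iteratedFDeriv_smul_le (𝕜 := ℝ) (smooth_invWeight (K + 1))
      (sqWeightDeriv d).contDiff a (n := n) (N := ((⊤ : ℕ∞) : WithTop ℕ∞))
      (by exact_mod_cast le_top)).trans ?_
    rw [Finset.sum_range, Finset.sum_mul]
    refine Finset.sum_le_sum fun i _ => ?_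
    have hw : 1 ≤ 1 + ‖a.2.2‖ := by linarith [norm_nonneg a.2.2]
    have hs := one_le_sqWeight a.2.2
    have hs0 : 0 < sqWeight a.2.2 := by linarith
    have hC0 := hC i
    calc (n.choose i : ℝ) * ‖iteratedFDeriv ℝ i (invWeight d (K + 1)) a‖ *
          ‖iteratedFDeriv ℝ (n - i) (fun a => sqWeightDeriv d a) a‖
        ≤ (n.choose i : ℝ) * (C i * (1 + ‖a.2.2‖) ^ (i : ℕ) * (sqWeight a.2.2 ^ (K + 1))⁻¹) *
          (B * (1 + ‖a.2.2‖)) := by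
          gcongr
          · exact hb i a
          · exact hLb _ a
      _ ≤ (n.choose i : ℝ) * (C i * (1 + ‖a.2.2‖) ^ n * (sqWeight a.2.2 ^ K)⁻¹) *
          (B * (1 + ‖a.2.2‖)) := by
          gcongr
          · omega
          · omega
      _ = _ := by ring

theorem exists_kerDecay_regKer {G : KerArg d → ℂ} (hG : PGrowth kerWeight G) (N r : ℕ) :
    ∃ K₀ : ℕ, ∀ K ≥ K₀, KerDecay N r (regKer K G) := by
  obtain ⟨B, q, hB, hb⟩ := hG.uniform one_le_kerWeight N
  -- The weight to the power -K decays like (1 + ‖w‖)^{-2K}; it has to beat the growth q of G, the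
  -- loss of at most N powers through derivatives, and the requested decay r.
  refine ⟨q + N + r, fun K hK => ⟨(smooth_invWeight K).mul hG.1, ?_⟩⟩
  choose C hC hc using fun i : ℕ => norm_iteratedFDeriv_invWeight_le (d := d) i K
  refine ⟨∑ n ∈ Finset.range (N + 1), ∑ i ∈ Finset.range (n + 1), (n.choose i : ℝ) * C i * B * 2 ^ K,
    q, Finset.sum_nonneg fun n _ => Finset.sum_nonneg fun i _ =>
      mul_nonneg (mul_nonneg (mul_nonneg (by positivity) (hC i)) hB) (by positivity),
    fun n hn x τ w => ?_⟩
  have hw : 1 ≤ 1 + ‖w‖ := by linarith [norm_nonneg w]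
  have hs := one_le_sqWeight w
  have hs0 : 0 < sqWeight w := by linarith
  have hterm : ∀ i ∈ Finset.range (n + 1), (n.choose i : ℝ) *
      ‖iteratedFDeriv ℝ i (invWeight d K) (x, (τ, w))‖ *
        ‖iteratedFDeriv ℝ (n - i) G (x, (τ, w))‖ ≤
      ((n.choose i : ℝ) * C i * B * 2 ^ K) * ((1 + ‖τ‖) ^ q * ((1 + ‖w‖) ^ r)⁻¹) := by
    intro i hi
    rw [Finset.mem_range] at hi
    have h1 : kerWeight ((x, (τ, w)) : KerArg d) ≤ (1 + ‖τ‖) * (1 + ‖w‖) := by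
      have h2 : ‖((τ, w) : (ℝ × ℝ) × Phase d)‖ ≤ ‖τ‖ + ‖w‖ := by
        rw [Prod.norm_def]
        exact max_le (by linarith [norm_nonneg w]) (by linarith [norm_nonneg τ])
      have h3 := mul_nonneg (norm_nonneg τ) (norm_nonneg w)
      simp only [kerWeight]
      nlinarith
    have h0 : 0 ≤ kerWeight ((x, (τ, w)) : KerArg d) := zero_le_one.trans (one_le_kerWeight _)
    have hC0 := hC i
    have hsK : (sqWeight w ^ K)⁻¹ ≤ 2 ^ K * ((1 + ‖w‖) ^ (q + N + r))⁻¹ := by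
      rw [← div_eq_mul_inv, inv_le_comm₀ (by positivity) (by positivity), inv_div,
        div_le_iff₀ (by positivity), ← mul_pow]
      calc (1 + ‖w‖) ^ (q + N + r) ≤ (1 + ‖w‖) ^ (2 * K) := pow_le_pow_right₀ hw (by omega)
        _ = ((1 + ‖w‖) ^ 2) ^ K := by rw [pow_mul]
        _ ≤ (sqWeight w * 2) ^ K := by
          gcongr
          linarith [sq_le_sqWeight w]
    calc _ ≤ (n.choose i : ℝ) * (C i * (1 + ‖w‖) ^ N * (2 ^ K * ((1 + ‖w‖) ^ (q + N + r))⁻¹)) *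
          (B * ((1 + ‖τ‖) * (1 + ‖w‖)) ^ q) := by
          gcongr
          · refine (hc i _).trans ?_
            gcongr
            omega
          · refine (hb _ (by omega) _).trans ?_
            gcongr
      _ = _ := by
          rw [pow_add, pow_add, mul_pow, mul_inv, mul_inv]
          have : (1 + ‖w‖) ^ N ≠ 0 := by positivity
          have : (1 + ‖w‖) ^ q ≠ 0 := by positivity
          field_simp
  refine (norm_iteratedFDeriv_mul_le (𝕜 := ℝ) (N := ((⊤ : ℕ∞) : WithTop ℕ∞)) (n := n)
    (smooth_invWeight K) hG.1 (x, (τ, w)) (by exact_mod_cast le_top)).trans ?_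
  refine (Finset.sum_le_sum hterm).trans ?_
  rw [← Finset.sum_mul, mul_assoc]
  gcongr
  exact Finset.single_le_sum
    (f := fun n => ∑ i ∈ Finset.range (n + 1), (n.choose i : ℝ) * C i * B * 2 ^ K)
    (fun n _ => Finset.sum_nonneg fun i _ =>
      mul_nonneg (mul_nonneg (mul_nonneg (by positivity) (hC i)) hB) (by positivity))
    (by simpa using Nat.lt_succ_of_le hn)

theorem eventually_adm_regKer {G : KerArg d → ℂ} (hG : PGrowth kerWeight G) (p : ℕ) :
    ∀ᶠ K : ℕ in atTop, Adm p (regKer K G) := by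
  obtain ⟨K₀, h⟩ := exists_kerDecay_regKer hG (p + 2 * d + 2) (2 * d + 1 + ampOrder d p)
  exact eventually_atTop.2 ⟨K₀, h⟩

end Regularization

/-! ### Differential operators with constant coefficients -/

section DiffOp

variable {V : Type*} [NormedAddCommGroup V] [NormedSpace ℝ V]

/-- The operator `∑ c ∂_{v_1} ⋯ ∂_{v_n}`, for a list of coefficients and directions. -/
def diffOp (L : List (ℂ × List V)) (F : V → ℂ) : V → ℂ :=
  fun p => (L.map fun t => t.1 * dirDerivs t.2 F p).sum

theorem diffOp_cons (t : ℂ × List V) (L : List (ℂ × List V)) (F : V → ℂ) :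
    diffOp (t :: L) F = fun p => t.1 * dirDerivs t.2 F p + diffOp L F p := by
  funext p; simp [diffOp]

/-- Operators which agree on smooth functions with a constant coefficient differential operator. -/
def IsDiffOp (D : (V → ℂ) → V → ℂ) : Prop :=
  ∃ L : List (ℂ × List V), ∀ F, ContDiff ℝ (⊤ : ℕ∞) F → D F = diffOp L F

theorem isDiffOp_dirDerivs (vs : List V) : IsDiffOp (dirDerivs vs) :=
  ⟨[(1, vs)], fun F _ => by funext p; simp [diffOp]⟩

theorem isDiffOp_id : IsDiffOp (fun F : V → ℂ => F) := isDiffOp_dirDerivs []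

theorem isDiffOp_zero : IsDiffOp (fun _ : V → ℂ => fun _ => (0 : ℂ)) :=
  ⟨[], fun F _ => by funext p; simp [diffOp]⟩

theorem isDiffOp_dirDeriv (v : V) : IsDiffOp (dirDeriv v) := isDiffOp_dirDerivs [v]

theorem IsDiffOp.add {D D' : (V → ℂ) → V → ℂ} (h : IsDiffOp D) (h' : IsDiffOp D') :
    IsDiffOp (fun F p => D F p + D' F p) := by
  obtain ⟨L, hL⟩ := h
  obtain ⟨L', hL'⟩ := h'
  exact ⟨L ++ L', fun F hF => by funext p; simp [hL F hF, hL' F hF, diffOp]⟩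

theorem IsDiffOp.const_mul {D : (V → ℂ) → V → ℂ} (h : IsDiffOp D) (c : ℂ) :
    IsDiffOp (fun F p => c * D F p) := by
  obtain ⟨L, hL⟩ := h
  refine ⟨L.map fun t => (c * t.1, t.2), fun F hF => ?_⟩
  funext p
  simp [hL F hF, diffOp, Function.comp_def, ← List.sum_map_mul_left, mul_assoc]

theorem IsDiffOp.sum {ι : Type*} (s : Finset ι) {D : ι → (V → ℂ) → V → ℂ}
    (h : ∀ i ∈ s, IsDiffOp (D i)) : IsDiffOp (fun F p => ∑ i ∈ s, D i F p) := by
  classical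
  induction s using Finset.induction_on with
  | empty => simpa using isDiffOp_zero
  | insert a s ha ih =>
    simp only [Finset.sum_insert ha]
    exact (h a (by simp)).add (ih fun i hi => h i (by simp [hi]))

theorem smooth_diffOp (L : List (ℂ × List V)) {F : V → ℂ} (hF : ContDiff ℝ (⊤ : ℕ∞) F) :
    ContDiff ℝ (⊤ : ℕ∞) (diffOp L F) := by
  induction L with
  | nil => exact contDiff_const
  | cons t L ih => rw [diffOp_cons]; exact (contDiff_const.mul (smooth_dirDerivs hF _)).add ih

theorem IsDiffOp.smooth {D : (V → ℂ) → V → ℂ} (h : IsDiffOp D) {F : V → ℂ}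
    (hF : ContDiff ℝ (⊤ : ℕ∞) F) : ContDiff ℝ (⊤ : ℕ∞) (D F) := by
  obtain ⟨L, hL⟩ := h
  rw [hL F hF]
  exact smooth_diffOp L hF

theorem IsDiffOp.map_add {D : (V → ℂ) → V → ℂ} (h : IsDiffOp D) {F G : V → ℂ}
    (hF : ContDiff ℝ (⊤ : ℕ∞) F) (hG : ContDiff ℝ (⊤ : ℕ∞) G) :
    D (fun p => F p + G p) = fun p => D F p + D G p := by
  obtain ⟨L, hL⟩ := h
  rw [hL F hF, hL G hG, hL _ (hF.add hG)]
  induction L with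
  | nil => funext p; simp [diffOp]
  | cons t L ih =>
    have ih' : diffOp L (fun p => F p + G p) = fun p => diffOp L F p + diffOp L G p := by
      clear ih hL
      induction L with
      | nil => funext p; simp [diffOp]
      | cons t L ih =>
        rw [diffOp_cons, diffOp_cons, diffOp_cons, dirDerivs_add hF hG, ih]
        funext p; ring
    rw [diffOp_cons, diffOp_cons, diffOp_cons, dirDerivs_add hF hG, ih']
    funext p; ring

theorem IsDiffOp.map_const_mul {D : (V → ℂ) → V → ℂ} (h : IsDiffOp D) {F : V → ℂ}
    (hF : ContDiff ℝ (⊤ : ℕ∞) F) (c : ℂ) : D (fun p => c * F p) = fun p => c * D F p := by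
  obtain ⟨L, hL⟩ := h
  rw [hL F hF, hL _ (contDiff_const.mul hF)]
  clear hL
  induction L with
  | nil => funext p; simp [diffOp]
  | cons t L ih =>
    rw [diffOp_cons, diffOp_cons, dirDerivs_const_mul hF, ih]
    funext p; ring

theorem IsDiffOp.map_zero {D : (V → ℂ) → V → ℂ} (h : IsDiffOp D) :
    D (fun _ => 0) = fun _ => 0 := by
  have := h.map_const_mul (contDiff_const (c := (0 : ℂ))) 0
  simpa using this

theorem IsDiffOp.dirDerivs_comm {D : (V → ℂ) → V → ℂ} (h : IsDiffOp D) {F : V → ℂ}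
    (hF : ContDiff ℝ (⊤ : ℕ∞) F) (vs : List V) : dirDerivs vs (D F) = D (dirDerivs vs F) := by
  obtain ⟨L, hL⟩ := h
  rw [hL F hF, hL _ (smooth_dirDerivs hF vs)]
  clear hL
  induction L with
  | nil => exact (isDiffOp_dirDerivs vs).map_zero
  | cons t L ih =>
    rw [diffOp_cons, diffOp_cons, dirDerivs_add (contDiff_const.mul (smooth_dirDerivs hF _))
      (smooth_diffOp L hF), ih, dirDerivs_const_mul (smooth_dirDerivs hF _), _root_.dirDerivs_comm hF]

theorem IsDiffOp.comm {D D' : (V → ℂ) → V → ℂ} (h : IsDiffOp D) (h' : IsDiffOp D') {F : V → ℂ}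
    (hF : ContDiff ℝ (⊤ : ℕ∞) F) : D (D' F) = D' (D F) := by
  obtain ⟨L, hL⟩ := h
  rw [hL F hF, hL _ (h'.smooth hF)]
  clear hL
  induction L with
  | nil => exact h'.map_zero.symm
  | cons t L ih =>
    rw [diffOp_cons, diffOp_cons, h'.map_add (contDiff_const.mul (smooth_dirDerivs hF _))
      (smooth_diffOp L hF), ih, h'.map_const_mul (smooth_dirDerivs hF _), h'.dirDerivs_comm hF]

theorem IsDiffOp.comp {D D' : (V → ℂ) → V → ℂ} (h : IsDiffOp D) (h' : IsDiffOp D') :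
    IsDiffOp (fun F => D (D' F)) := by
  obtain ⟨L, hL⟩ := h'
  -- The composition is written in the opposite order, where prepending the directions of L to those
  -- of D gives the list explicitly; commutation of the two operators then returns the original
  -- order.
  have key : ∀ L : List (ℂ × List V), IsDiffOp (fun F => diffOp L (D F)) := by
    intro L
    induction L with
    | nil => exact isDiffOp_zero
    | cons t L ih =>
      have h2 : IsDiffOp (fun F => dirDerivs t.2 (D F)) := by
        obtain ⟨L', hL'⟩ := h
        refine ⟨L'.map fun s => (s.1, t.2 ++ s.2), fun F hF => ?_⟩
        simp only [hL' F hF]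
        clear hL'
        induction L' with
        | nil => exact (isDiffOp_dirDerivs t.2).map_zero
        | cons s L' ih =>
          rw [diffOp_cons, List.map_cons, diffOp_cons, dirDerivs_add
            (contDiff_const.mul (smooth_dirDerivs hF _)) (smooth_diffOp L' hF), ih,
            dirDerivs_const_mul (smooth_dirDerivs hF _), dirDerivs_append]
      simp only [diffOp_cons]
      exact (h2.const_mul t.1).add ih
  obtain ⟨L₁, h₁⟩ := key L
  refine ⟨L₁, fun F hF => ?_⟩
  rw [← h₁ F hF]
  change D (D' F) = diffOp L (D F)
  rw [hL F hF]
  exact h.comm ⟨L, fun _ _ => rfl⟩ hF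

theorem IsDiffOp.iterate {D : (V → ℂ) → V → ℂ} (h : IsDiffOp D) (k : ℕ) : IsDiffOp (D^[k]) := by
  induction k with
  | zero => exact isDiffOp_id
  | succ k ih => rw [Function.iterate_succ]; exact ih.comp h

end DiffOp

/-! ### Oscillatory integrals of kernels of polynomial growth -/

section OscIntegrals

variable {d : ℕ}

theorem isDiffOp_opL0 : IsDiffOp (opL0 (d := d)) := by
  have h : IsDiffOp (fun (F : Phase d × Phase d → ℂ) p => (1 / 2 : ℂ) * ∑ l : Fin d,
      (dirDerivs [vecY l, vecZeta l] F p + (-1) * dirDerivs [vecEta l, vecZ l] F p)) :=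
    IsDiffOp.const_mul (IsDiffOp.sum _ fun l _ =>
      (isDiffOp_dirDerivs _).add ((isDiffOp_dirDerivs _).const_mul _)) _
  have e : (opL0 (d := d)) = fun F p => (1 / 2 : ℂ) * ∑ l : Fin d,
      (dirDerivs [vecY l, vecZeta l] F p + (-1) * dirDerivs [vecEta l, vecZ l] F p) := by
    funext F p
    simp only [opL0, sub_eq_add_neg, neg_one_mul]
  rw [e]
  exact h

theorem IsDouble.dirDerivs {M : ℝ} {p : ℕ} {F : Phase d × Phase d → ℂ} (hF : IsDouble M p F)
    (vs : List (Phase d × Phase d)) : IsDouble M p (dirDerivs vs F) := by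
  induction vs with
  | nil => exact hF
  | cons v vs ih => exact ih.clm_fderiv v

theorem IsDouble.diffOp {M : ℝ} {p : ℕ} {F : Phase d × Phase d → ℂ} (hF : IsDouble M p F)
    {D : (Phase d × Phase d → ℂ) → Phase d × Phase d → ℂ} (h : IsDiffOp D) :
    IsDouble M p (D F) := by
  obtain ⟨L, hL⟩ := h
  rw [hL F hF.1]
  clear hL
  induction L with
  | nil => exact isDouble_zero M p
  | cons t L ih => rw [diffOp_cons]; exact ((hF.dirDerivs t.2).const_mul t.1).add ih

/-- The operator `1 - Δ_θ`. -/
def thetaLap (F : Phase d × Phase d → ℂ) : Phase d × Phase d → ℂ := fun e =>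
  F e + ∑ l : Fin d, (-1 : ℂ) * (dirDerivs [vecEta l, vecEta l] F e + dirDerivs [vecZeta l, vecZeta l] F e)

theorem isDiffOp_thetaLap : IsDiffOp (thetaLap (d := d)) :=
  isDiffOp_id.add (IsDiffOp.sum _ fun _ _ =>
    ((isDiffOp_dirDerivs _).add (isDiffOp_dirDerivs _)).const_mul _)

theorem PGrowth.mulW {G : KerArg d → ℂ} (hG : PGrowth kerWeight G) (v : Phase d) :
    PGrowth kerWeight (mulW v G) := by
  refine PGrowth.mul one_le_kerWeight (PGrowth.ofReal ?_) hG
  exact pGrowth_clm (((pairL d).flip v).comp ((ContinuousLinearMap.snd ℝ (ℝ × ℝ) (Phase d)).comp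
    (ContinuousLinearMap.snd ℝ (Cfg d) _))) ⟨‖(pairL d).flip v‖, 1, fun e => by
      refine (((pairL d).flip v).le_opNorm e.2.2).trans ?_
      rw [pow_one, kerWeight]
      gcongr
      linarith [norm_snd_le e.2]⟩

theorem regKer_mulW (K : ℕ) (v : Phase d) (G : KerArg d → ℂ) :
    regKer K (mulW v G) = mulW v (regKer K G) := by
  funext a; simp only [regKer, mulW]; ring

theorem regKer_add (K : ℕ) (G G' : KerArg d → ℂ) :
    regKer K (fun a => G a + G' a) = fun a => regKer K G a + regKer K G' a := by
  funext a; simp only [regKer]; ring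

theorem regKer_const_mul (K : ℕ) (c : ℂ) (G : KerArg d → ℂ) :
    regKer K (fun a => c * G a) = fun a => c * regKer K G a := by
  funext a; simp only [regKer]; ring

/-- The regularizing weight depends on w only, and directions coming from parameters have no
w-component. -/
theorem regKer_dirDeriv (K : ℕ) {G : KerArg d → ℂ} (hG : ContDiff ℝ (⊤ : ℕ∞) G) (v : Par d) :
    regKer K (dirDeriv (kerDir v) G) = dirDeriv (kerDir v) (regKer K G) := by
  rw [show regKer K G = fun a => invWeight d K a * G a from rfl,
    dirDeriv_mul (smooth_invWeight K) hG]
  funext a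
  have : dirDeriv (kerDir v) (invWeight d K) a = 0 := by
    simp [dirDeriv, fderiv_invWeight, sqWeightDeriv_apply, kerDir]
  simp [this, regKer]

theorem norm_sq_eq_sum_pairL (w : Phase d) : ‖w.1‖ ^ 2 + ‖w.2‖ ^ 2 =
    ∑ l : Fin d, (pairL d w (stdVec l, 0) ^ 2 + pairL d w (0, stdVec l) ^ 2) := by
  simp only [pairL_left, pairL_right]
  rw [Finset.sum_add_distrib, EuclideanSpace.norm_sq_eq, EuclideanSpace.norm_sq_eq]
  simp

/-- Passing from K to K + 1 is compensated by the factor 1 + ∑ w_i². It is written as iterated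
multiplications so that each w_i² can be exchanged for -∂_{θ_i}², which together form 1 - Δ_θ. -/
theorem regKer_succ (K : ℕ) (G : KerArg d → ℂ) : regKer K G = fun a =>
    regKer (K + 1) G a + ∑ l : Fin d, (mulW (stdVec l, 0) (mulW (stdVec l, 0) (regKer (K + 1) G)) a +
      mulW (0, stdVec l) (mulW (0, stdVec l) (regKer (K + 1) G)) a) := by
  funext a
  have h0 := sqWeight_ne_zero a.2.2
  have h1 : (sqWeight a.2.2 : ℂ) = 1 + ∑ l : Fin d,
      ((pairL d a.2.2 (stdVec l, 0) : ℂ) ^ 2 + (pairL d a.2.2 (0, stdVec l) : ℂ) ^ 2) := by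
    rw [sqWeight, add_assoc, norm_sq_eq_sum_pairL]
    push_cast; rfl
  have h2 : ∑ l : Fin d, (mulW (stdVec l, 0) (mulW (stdVec l, 0) (regKer (K + 1) G)) a +
      mulW (0, stdVec l) (mulW (0, stdVec l) (regKer (K + 1) G)) a) =
      (∑ l : Fin d, ((pairL d a.2.2 (stdVec l, 0) : ℂ) ^ 2 + (pairL d a.2.2 (0, stdVec l) : ℂ) ^ 2))
        * regKer (K + 1) G a := by
    rw [Finset.sum_mul]
    exact Finset.sum_congr rfl fun l _ => by simp only [mulW]; ring
  rw [h2, eq_sub_of_add_eq' h1.symm, regKer, regKer, invWeight, invWeight]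
  field_simp
  ring

theorem Adm.add {p : ℕ} {g g' : KerArg d → ℂ} (hg : Adm p g) (hg' : Adm p g') :
    Adm p (fun a => g a + g' a) := by
  obtain ⟨h, C, q, hC, hb⟩ := hg
  obtain ⟨h', C', q', hC', hb'⟩ := hg'
  refine ⟨h.add h', C + C', q + q', add_nonneg hC hC', fun n hn x τ w => ?_⟩
  have h1 : iteratedFDeriv ℝ n (fun e => g e + g' e) (x, (τ, w)) =
      iteratedFDeriv ℝ n g (x, (τ, w)) + iteratedFDeriv ℝ n g' (x, (τ, w)) :=
    iteratedFDeriv_add_apply (h.contDiffAt.of_le (by exact_mod_cast le_top))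
      (h'.contDiffAt.of_le (by exact_mod_cast le_top))
  have hτ : 1 ≤ 1 + ‖τ‖ := by linarith [norm_nonneg τ]
  rw [h1]
  refine (norm_add_le _ _).trans ((add_le_add ((hb n hn x τ w).trans ?_)
    ((hb' n hn x τ w).trans ?_)).trans (le_of_eq (by rw [add_mul, add_mul])))
  · gcongr
    omega
  · gcongr
    omega

theorem Adm.zero (p : ℕ) : Adm p (fun _ : KerArg d => 0) := by
  refine ⟨contDiff_const, 0, 0, le_rfl, fun n _ x τ w => ?_⟩
  have : iteratedFDeriv ℝ n (fun _ : KerArg d => (0 : ℂ)) = 0 := iteratedFDeriv_fun_zero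
  simp [this]

theorem adm_sum {p : ℕ} {ι : Type*} (s : Finset ι) {g : ι → KerArg d → ℂ}
    (hg : ∀ i ∈ s, Adm p (g i)) : Adm p (fun a => ∑ i ∈ s, g i a) := by
  classical
  induction s using Finset.induction_on with
  | empty => simpa using Adm.zero p
  | insert a s ha ih =>
    simp only [Finset.sum_insert ha]
    exact (hg a (by simp)).add (ih fun i hi => hg i (by simp [hi]))

theorem oscJ_sum_left {p : ℕ} {ι : Type*} (s : Finset ι) {g : ι → KerArg d → ℂ}
    (hg : ∀ i ∈ s, Adm p (g i)) {M : ℝ} {F : Phase d × Phase d → ℂ} (hF : IsDouble M p F)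
    (P : Par d) : oscJ (fun a => ∑ i ∈ s, g i a) F P = ∑ i ∈ s, oscJ (g i) F P := by
  classical
  induction s using Finset.induction_on with
  | empty => simpa using oscJ_const_mul_left 0 (fun _ => 0) F P
  | insert a s ha ih =>
    simp only [Finset.sum_insert ha]
    rw [oscJ_add_left (hg a (by simp)) (adm_sum s fun i hi => hg i (by simp [hi])) hF,
      ih fun i hi => hg i (by simp [hi])]

theorem oscJ_mulW_mulW {p : ℕ} {g : KerArg d → ℂ} {v : Phase d} (hg : Adm p g)
    (hg' : Adm p (mulW v g)) (hg'' : Adm p (mulW v (mulW v g))) {M : ℝ}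
    {F : Phase d × Phase d → ℂ} (hF : IsDouble M p F) (P : Par d) :
    oscJ (mulW v (mulW v g)) F P =
      oscJ g (fun e => (-1 : ℂ) * dirDerivs [thetaDir v, thetaDir v] F e) P := by
  rw [oscJ_mulW hg' hg'' hF, oscJ_const_mul_right, oscJ_mulW hg hg' (hF.clm_fderiv _),
    oscJ_const_mul_right, oscJ_const_mul_right, ← mul_assoc]
  congr 1
  simp

theorem oscJ_regKer_succ {p K : ℕ} {G : KerArg d → ℂ} (h : Adm p (regKer (K + 1) G))
    (h₁ : ∀ l, Adm p (mulW (stdVec l, 0) (regKer (K + 1) G)))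
    (h₂ : ∀ l, Adm p (mulW (0, stdVec l) (regKer (K + 1) G)))
    (h₃ : ∀ l, Adm p (mulW (stdVec l, 0) (mulW (stdVec l, 0) (regKer (K + 1) G))))
    (h₄ : ∀ l, Adm p (mulW (0, stdVec l) (mulW (0, stdVec l) (regKer (K + 1) G)))) {M : ℝ}
    {F : Phase d × Phase d → ℂ} (hF : IsDouble M p F) (P : Par d) :
    oscJ (regKer K G) F P = oscJ (regKer (K + 1) G) (thetaLap F) P := by
  have hd : ∀ l : Fin d, ∀ v w : Fin d → Phase d × Phase d, IsDouble M p
      (fun e => (-1 : ℂ) * (dirDerivs [v l, v l] F e + dirDerivs [w l, w l] F e)) := fun l v w =>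
    ((hF.dirDerivs _).add (hF.dirDerivs _)).const_mul _
  have e : thetaLap F = fun e => F e + ∑ l : Fin d, (-1 : ℂ) * (dirDerivs [vecEta l, vecEta l] F e +
    dirDerivs [vecZeta l, vecZeta l] F e) := rfl
  rw [regKer_succ K G, oscJ_add_left h (adm_sum _ fun l _ => (h₃ l).add (h₄ l)) hF,
    oscJ_sum_left _ (fun l _ => (h₃ l).add (h₄ l)) hF, e,
    oscJ_add_right h hF (IsDouble.sum _ fun l _ => hd l vecEta vecZeta),
    oscJ_sum_right h _ fun l _ => hd l vecEta vecZeta]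
  congr 1
  refine Finset.sum_congr rfl fun l _ => ?_
  rw [oscJ_add_left (h₃ l) (h₄ l) hF, oscJ_mulW_mulW h (h₁ l) (h₃ l) hF,
    oscJ_mulW_mulW h (h₂ l) (h₄ l) hF, oscJ_const_mul_right, oscJ_const_mul_right,
    oscJ_const_mul_right, oscJ_add_right h (hF.dirDerivs _) (hF.dirDerivs _), mul_add]
  rfl

theorem adm_const_mul {p : ℕ} {g : KerArg d → ℂ} (hg : Adm p g) (c : ℂ) :
    Adm p (fun a => c * g a) := by
  obtain ⟨h, C, q, hC, hb⟩ := hg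
  refine ⟨contDiff_const.mul h, ‖c‖ * C, q, by positivity, fun n hn x τ w => ?_⟩
  rw [show (fun a => c * g a) = c • g from rfl, iteratedFDeriv_const_smul_apply
    (h.contDiffAt.of_le (by exact_mod_cast le_top)), norm_smul, mul_assoc, mul_assoc]
  gcongr
  rw [← mul_assoc]
  exact hb n hn x τ w

theorem eventually_adm_mulW {G : KerArg d → ℂ} (hG : PGrowth kerWeight G) (p : ℕ) :
    ∀ᶠ K : ℕ in atTop, ∀ v, Adm p (mulW v (regKer K G)) := by
  have h₁ : ∀ᶠ K : ℕ in atTop, ∀ l : Fin d, Adm p (regKer K (mulW (stdVec l, 0) G)) :=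
    eventually_all.2 fun l => eventually_adm_regKer (hG.mulW _) p
  have h₂ : ∀ᶠ K : ℕ in atTop, ∀ l : Fin d, Adm p (regKer K (mulW (0, stdVec l) G)) :=
    eventually_all.2 fun l => eventually_adm_regKer (hG.mulW _) p
  filter_upwards [h₁, h₂] with K h₁ h₂ v
  have hv : mulW v (regKer K G) = fun a => ∑ l : Fin d,
      ((v.1 l : ℂ) * mulW (stdVec l, 0) (regKer K G) a +
        (v.2 l : ℂ) * mulW (0, stdVec l) (regKer K G) a) := by
    funext a
    simp only [mulW, pairL_left, pairL_right]
    rw [pairL_apply, PiLp.inner_apply, PiLp.inner_apply, ← Finset.sum_add_distrib]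
    push_cast
    rw [Finset.sum_mul]
    refine Finset.sum_congr rfl fun l _ => ?_
    simp only [RCLike.inner_apply, conj_trivial]
    push_cast
    ring
  rw [hv]
  simp only [regKer_mulW] at h₁ h₂
  exact adm_sum _ fun l _ => (adm_const_mul (h₁ l) _).add (adm_const_mul (h₂ l) _)

theorem KerDecay.dirDeriv {N r : ℕ} {g : KerArg d → ℂ} (hg : KerDecay (N + 1) r g) (v : KerArg d) :
    KerDecay N r (dirDeriv v g) := by
  obtain ⟨h, C, q, hC, hb⟩ := hg
  refine ⟨smooth_dirDeriv h v, ‖v‖ * C, q, by positivity, fun n hn x τ w => ?_⟩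
  have hfd : ContDiff ℝ (⊤ : ℕ∞) (fderiv ℝ g) := h.fderiv_right (by simp)
  refine (norm_iteratedFDeriv_clm_apply_const (n := n) (hfd.contDiffAt (x := (x, (τ, w))))
    (by exact_mod_cast le_top)).trans ?_
  rw [norm_iteratedFDeriv_fderiv, mul_assoc, mul_assoc]
  gcongr
  rw [← mul_assoc]
  exact hb (n + 1) (by omega) x τ w

theorem eventually_adm_dirDeriv {G : KerArg d → ℂ} (hG : PGrowth kerWeight G) (p : ℕ) :
    ∀ᶠ K : ℕ in atTop, ∀ v, Adm p (dirDeriv v (regKer K G)) := by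
  obtain ⟨K₀, h⟩ := exists_kerDecay_regKer hG (p + 2 * d + 2 + 1) (2 * d + 1 + ampOrder d p)
  exact eventually_atTop.2 ⟨K₀, fun K hK v => (h K hK).dirDeriv v⟩

/-- For large K all kernels occurring in the integrations by parts decay fast enough, so the
regularized value is independent of K. The threshold depends on G and p only, not on F or on the
parameters. -/
theorem eventually_oscJ_regKer_succ {G : KerArg d → ℂ} (hG : PGrowth kerWeight G) (p : ℕ) :
    ∀ᶠ K : ℕ in atTop, ∀ (M : ℝ) (F : Phase d × Phase d → ℂ), IsDouble M p F → ∀ P : Par d,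
      oscJ (regKer K G) F P = oscJ (regKer (K + 1) G) (thetaLap F) P := by
  have h₁ : ∀ᶠ K : ℕ in atTop, ∀ l : Fin d,
      Adm p (regKer K (mulW (stdVec l, 0) (mulW (stdVec l, 0) G))) :=
    eventually_all.2 fun l => eventually_adm_regKer ((hG.mulW _).mulW _) p
  have h₂ : ∀ᶠ K : ℕ in atTop, ∀ l : Fin d,
      Adm p (regKer K (mulW (0, stdVec l) (mulW (0, stdVec l) G))) :=
    eventually_all.2 fun l => eventually_adm_regKer ((hG.mulW _).mulW _) p
  have h₃ : ∀ᶠ K : ℕ in atTop, ((∀ l : Fin d,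
      Adm p (regKer K (mulW (stdVec l, 0) (mulW (stdVec l, 0) G)))) ∧ (∀ l : Fin d,
      Adm p (regKer K (mulW (0, stdVec l) (mulW (0, stdVec l) G))))) ∧
      Adm p (regKer K G) ∧ ∀ v, Adm p (mulW v (regKer K G)) :=
    (h₁.and h₂).and ((eventually_adm_regKer hG p).and (eventually_adm_mulW hG p))
  -- Admissibility is needed for the kernels regularized at K + 1, since the kernel at K is
  -- expressed through them.
  filter_upwards [(tendsto_add_atTop_nat 1).eventually h₃] with K hK M F hF P
  obtain ⟨⟨h₁, h₂⟩, h₃, h₄⟩ := hK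
  simp only [regKer_mulW] at h₁ h₂
  exact oscJ_regKer_succ h₃ (fun l => h₄ _) (fun l => h₄ _) h₁ h₂ hF P

/-- The oscillatory integral
`(2π)^{-2d} ∫ dθ ∫ dw e^{-i⟨w,θ⟩} G(x, ε, λ, w) F(x - ε z / 2, ξ + η; x + ε y / 2, ξ + ζ)`. -/
def oscInt (G : KerArg d → ℂ) (F : Phase d × Phase d → ℂ) (P : Par d) : ℂ :=
  ((2 * Real.pi : ℝ) : ℂ)⁻¹ ^ (2 * d) *
    limUnder atTop fun K : ℕ => oscJ (regKer K G) (thetaLap^[K] F) P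

/-- The sequence in the definition is eventually constant, so its limit is any late member. As the
threshold is uniform in F and P, identities between several oscillatory integrals can be checked at
one common K. -/
theorem eventually_oscInt_eq {G : KerArg d → ℂ} (hG : PGrowth kerWeight G) (p : ℕ) :
    ∀ᶠ K : ℕ in atTop, ∀ (M : ℝ) (F : Phase d × Phase d → ℂ), IsDouble M p F → ∀ P : Par d,
      oscInt G F P = ((2 * Real.pi : ℝ) : ℂ)⁻¹ ^ (2 * d) * oscJ (regKer K G) (thetaLap^[K] F) P := by
  obtain ⟨K₀, h⟩ := eventually_atTop.1 (eventually_oscJ_regKer_succ hG p)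
  refine eventually_atTop.2 ⟨K₀, fun K hK M F hF P => ?_⟩
  rw [oscInt]
  congr 1
  refine Tendsto.limUnder_eq (tendsto_atTop_of_eventually_const (i₀ := K) fun K' hK' => ?_)
  induction K', hK' using Nat.le_induction with
  | base => rfl
  | succ K' hK' ih =>
    rw [← ih, Function.iterate_succ_apply']
    exact (h K' (hK.trans hK') M _ (hF.diffOp (isDiffOp_thetaLap.iterate K')) P).symm

theorem oscInt_add_left {G G' : KerArg d → ℂ} (hG : PGrowth kerWeight G)
    (hG' : PGrowth kerWeight G') {M : ℝ} {p : ℕ} {F : Phase d × Phase d → ℂ}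
    (hF : IsDouble M p F) (P : Par d) :
    oscInt (fun a => G a + G' a) F P = oscInt G F P + oscInt G' F P := by
  obtain ⟨K, h1, h2, h3, h4, h5⟩ := ((eventually_oscInt_eq hG p).and ((eventually_oscInt_eq hG' p).and
    ((eventually_oscInt_eq (hG.add one_le_kerWeight hG') p).and
      ((eventually_adm_regKer hG p).and (eventually_adm_regKer hG' p))))).exists
  rw [h1 M F hF, h2 M F hF, h3 M F hF, regKer_add,
    oscJ_add_left h4 h5 (hF.diffOp (isDiffOp_thetaLap.iterate K)), mul_add]

theorem oscInt_const_mul_left (c : ℂ) {G : KerArg d → ℂ} (hG : PGrowth kerWeight G) {M : ℝ} {p : ℕ}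
    {F : Phase d × Phase d → ℂ} (hF : IsDouble M p F) (P : Par d) :
    oscInt (fun a => c * G a) F P = c * oscInt G F P := by
  obtain ⟨K, h1, h2⟩ := ((eventually_oscInt_eq hG p).and
    (eventually_oscInt_eq (hG.const_mul c) p)).exists
  rw [h1 M F hF, h2 M F hF, regKer_const_mul, oscJ_const_mul_left]
  ring

theorem oscInt_sum_left {ι : Type*} (s : Finset ι) {G : ι → KerArg d → ℂ}
    (hG : ∀ i ∈ s, PGrowth kerWeight (G i)) {M : ℝ} {p : ℕ} {F : Phase d × Phase d → ℂ}
    (hF : IsDouble M p F) (P : Par d) :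
    oscInt (fun a => ∑ i ∈ s, G i a) F P = ∑ i ∈ s, oscInt (G i) F P := by
  classical
  induction s using Finset.induction_on with
  | empty => simpa using oscInt_const_mul_left 0 (pGrowth_const (σ := kerWeight) (0 : ℂ)) hF P
  | insert a s ha ih =>
    simp only [Finset.sum_insert ha]
    rw [oscInt_add_left (hG a (by simp))
      (PGrowth.sum one_le_kerWeight fun i hi => hG i (by simp [hi])) hF,
      ih fun i hi => hG i (by simp [hi])]

theorem oscInt_add_right {G : KerArg d → ℂ} (hG : PGrowth kerWeight G) {M : ℝ} {p : ℕ}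
    {F F' : Phase d × Phase d → ℂ} (hF : IsDouble M p F) (hF' : IsDouble M p F') (P : Par d) :
    oscInt G (fun e => F e + F' e) P = oscInt G F P + oscInt G F' P := by
  obtain ⟨K, h1, h2⟩ := ((eventually_oscInt_eq hG p).and (eventually_adm_regKer hG p)).exists
  have hD := isDiffOp_thetaLap (d := d).iterate K
  rw [h1 M F hF, h1 M F' hF', h1 M _ (hF.add hF'), hD.map_add hF.1 hF'.1,
    oscJ_add_right h2 (hF.diffOp hD) (hF'.diffOp hD), mul_add]

theorem oscInt_const_mul_right {G : KerArg d → ℂ} (hG : PGrowth kerWeight G) (c : ℂ) {M : ℝ} {p : ℕ}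
    {F : Phase d × Phase d → ℂ} (hF : IsDouble M p F) (P : Par d) :
    oscInt G (fun e => c * F e) P = c * oscInt G F P := by
  obtain ⟨K, h1⟩ := (eventually_oscInt_eq hG p).exists
  have hD := isDiffOp_thetaLap (d := d).iterate K
  rw [h1 M F hF, h1 M _ (hF.const_mul c), hD.map_const_mul hF.1, oscJ_const_mul_right]
  ring

theorem oscInt_sum_right {G : KerArg d → ℂ} (hG : PGrowth kerWeight G) {M : ℝ} {p : ℕ}
    {ι : Type*} (s : Finset ι) {F : ι → Phase d × Phase d → ℂ} (hF : ∀ i ∈ s, IsDouble M p (F i))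
    (P : Par d) : oscInt G (fun e => ∑ i ∈ s, F i e) P = ∑ i ∈ s, oscInt G (F i) P := by
  classical
  induction s using Finset.induction_on with
  | empty => simpa using oscInt_const_mul_right hG 0 (isDouble_zero M p) P
  | insert a s ha ih =>
    simp only [Finset.sum_insert ha]
    rw [oscInt_add_right hG (hF a (by simp)) (IsDouble.sum s fun i hi => hF i (by simp [hi])),
      ih fun i hi => hF i (by simp [hi])]

/-- Multiplication of the kernel by `⟨w, v⟩` is the derivative `-i v · ∂_θ` of the symbols. -/
theorem oscInt_mulW {G : KerArg d → ℂ} (hG : PGrowth kerWeight G) (v : Phase d) {M : ℝ} {p : ℕ}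
    {F : Phase d × Phase d → ℂ} (hF : IsDouble M p F) (P : Par d) :
    oscInt (mulW v G) F P = oscInt G (fun e => -Complex.I * dirDeriv (thetaDir v) F e) P := by
  obtain ⟨K, h1, h2, h3, h4⟩ := ((eventually_oscInt_eq hG p).and
    ((eventually_oscInt_eq (hG.mulW v) p).and
      ((eventually_adm_regKer hG p).and (eventually_adm_mulW hG p)))).exists
  have hD := isDiffOp_thetaLap (d := d).iterate K
  rw [h1 M _ ((hF.clm_fderiv _).const_mul _), h2 M F hF, regKer_mulW,
    oscJ_mulW h3 (h4 v) (hF.diffOp hD), hD.map_const_mul (smooth_dirDeriv hF.1 _)]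
  rw [show dirDeriv (thetaDir v) (thetaLap^[K] F) = thetaLap^[K] (dirDeriv (thetaDir v) F) from
    (isDiffOp_dirDeriv _).comm hD hF.1]

theorem norm_oscInt_le {G : KerArg d → ℂ} (hG : PGrowth kerWeight G) {M : ℝ} {p : ℕ}
    {F : Phase d × Phase d → ℂ} (hF : IsDouble M p F) :
    ∃ C : ℝ, ∃ q : ℕ, 0 ≤ C ∧
      ∀ P, ‖oscInt G F P‖ ≤ C * (1 + ‖P.1‖) ^ q * japBracket P.2.2 ^ M := by
  obtain ⟨K, h1, h2⟩ := ((eventually_oscInt_eq hG p).and (eventually_adm_regKer hG p)).exists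
  obtain ⟨C, q, hC, h⟩ := norm_oscJ_le h2 (hF.diffOp (isDiffOp_thetaLap.iterate K))
  refine ⟨‖((2 * Real.pi : ℝ) : ℂ)⁻¹ ^ (2 * d)‖ * C, q, by positivity, fun P => ?_⟩
  rw [h1 M F hF, norm_mul, mul_assoc, mul_assoc]
  gcongr
  rw [← mul_assoc]
  exact h P

/-- The differential of an oscillatory integral in its parameters. -/
theorem hasFDerivAt_oscInt {G : KerArg d → ℂ} (hG : PGrowth kerWeight G) {M : ℝ} {p : ℕ}
    {F : Phase d × Phase d → ℂ} (hF : IsDouble M p F) (P : Par d) :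
    ∃ L : Par d →L[ℝ] ℂ, HasFDerivAt (oscInt G F) L P ∧ ∀ v,
      L v = oscInt (dirDeriv (kerDir v) G) F P + oscInt G (dirDeriv (v.2, v.2) F) P +
        v.1.1 * oscInt G (fun e => Complex.I * opL0 F e) P := by
  -- The admissible K depends on v through the differentiated kernel, so each direction is treated
  -- separately; uniqueness of the Fréchet derivative identifies the resulting maps.
  have key : ∀ v, ∃ L : Par d →L[ℝ] ℂ, HasFDerivAt (oscInt G F) L P ∧
      L v = oscInt (dirDeriv (kerDir v) G) F P + oscInt G (dirDeriv (v.2, v.2) F) P +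
        v.1.1 * oscInt G (fun e => Complex.I * opL0 F e) P := fun v => by
    obtain ⟨K, h1, h2, h3, h4, h5⟩ := ((eventually_oscInt_eq hG p).and
      ((eventually_oscInt_eq (hG.dirDeriv (kerDir v)) p).and ((eventually_adm_regKer hG p).and
        ((eventually_adm_mulW hG p).and (eventually_adm_dirDeriv hG p))))).exists
    have hD := isDiffOp_thetaLap (d := d).iterate K
    obtain ⟨L, hL, hLv⟩ := hasFDerivAt_oscJ h3 (fun v => h5 _) h4 (hF.diffOp hD) P
    refine ⟨(((2 * Real.pi : ℝ) : ℂ)⁻¹ ^ (2 * d)) • L, ?_, ?_⟩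
    · rw [show oscInt G F = fun P => ((2 * Real.pi : ℝ) : ℂ)⁻¹ ^ (2 * d) *
        oscJ (regKer K G) (thetaLap^[K] F) P from funext (h1 M F hF)]
      exact hL.const_mul _
    · rw [h2 M F hF, h1 M _ (hF.clm_fderiv _), h1 M _ ((hF.diffOp isDiffOp_opL0).const_mul _),
        regKer_dirDeriv K hG.1, hD.map_const_mul (isDiffOp_opL0.smooth hF.1),
        show thetaLap^[K] (dirDeriv (v.2, v.2) F) = dirDeriv (v.2, v.2) (thetaLap^[K] F) from
          hD.comm (isDiffOp_dirDeriv _) hF.1, hD.comm isDiffOp_opL0 hF.1]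
      simp only [smul_apply, smul_eq_mul, hLv]
      ring
  obtain ⟨L, hL, -⟩ := key 0
  refine ⟨L, hL, fun v => ?_⟩
  obtain ⟨L', hL', h'⟩ := key v
  rw [hL.unique hL', h']

/-- The kernel matters only at the given parameters and position. -/
theorem oscInt_congr {G G' : KerArg d → ℂ} (F : Phase d × Phase d → ℂ) (P : Par d)
    (h : ∀ w, G (P.2.1, (P.1, w)) = G' (P.2.1, (P.1, w))) : oscInt G F P = oscInt G' F P := by
  simp only [oscInt, oscJ, oscOuter, oscInner, ampl, regKer, kerPt_apply, h]

end OscIntegrals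

/-! ### Symbol estimates for oscillatory integrals -/

section SymbolEstimates

variable {d : ℕ}

theorem dirDeriv_oscInt {G : KerArg d → ℂ} (hG : PGrowth kerWeight G) {M : ℝ} {p : ℕ}
    {F : Phase d × Phase d → ℂ} (hF : IsDouble M p F) (v : Par d) :
    dirDeriv v (oscInt G F) = fun P => oscInt (dirDeriv (kerDir v) G) F P +
      oscInt G (dirDeriv (v.2, v.2) F) P +
        v.1.1 * oscInt G (fun e => Complex.I * opL0 F e) P := by
  funext P
  obtain ⟨L, hL, h⟩ := hasFDerivAt_oscInt hG hF P
  rw [dirDeriv, hL.fderiv, h]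

/-- Directional derivatives are again combinations of oscillatory integrals, with differentiated
kernel or differentiated F. The induction on the order of differentiability therefore has to range
over all G and F. -/
theorem smooth_oscInt {G : KerArg d → ℂ} (hG : PGrowth kerWeight G) {M : ℝ} {p : ℕ}
    {F : Phase d × Phase d → ℂ} (hF : IsDouble M p F) : ContDiff ℝ (⊤ : ℕ∞) (oscInt G F) := by
  refine contDiff_infty.2 fun n => ?_
  induction n generalizing G F with
  | zero =>
    rw [Nat.cast_zero, contDiff_zero]
    refine continuous_iff_continuousAt.2 fun P => ?_
    obtain ⟨L, hL, -⟩ := hasFDerivAt_oscInt hG hF P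
    exact hL.continuousAt
  | succ n ih =>
    rw [Nat.cast_add, Nat.cast_one, contDiff_succ_iff_fderiv_apply]
    refine ⟨fun P => ?_, by simp, fun v => ?_⟩
    · obtain ⟨L, hL, -⟩ := hasFDerivAt_oscInt hG hF P
      exact hL.differentiableAt
    · change ContDiff ℝ n (dirDeriv v (oscInt G F))
      rw [dirDeriv_oscInt hG hF]
      exact ((ih (hG.dirDeriv _) hF).add (ih hG (hF.clm_fderiv _))).add
        (contDiff_const.mul (ih hG ((hF.diffOp isDiffOp_opL0).const_mul _)))

/-- Sums of products of `r` linear functions of `w` and a kernel of polynomial growth. -/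
inductive WKer : ℕ → (KerArg d → ℂ) → Prop
  | base {G : KerArg d → ℂ} (hG : PGrowth kerWeight G) : WKer 0 G
  | mulW {r : ℕ} {G : KerArg d → ℂ} (v : Phase d) (hG : WKer r G) : WKer (r + 1) (mulW v G)
  | add {r : ℕ} {G G' : KerArg d → ℂ} (hG : WKer r G) (hG' : WKer r G') :
      WKer r (fun a => G a + G' a)

theorem WKer.pGrowth {r : ℕ} {G : KerArg d → ℂ} (hG : WKer r G) : PGrowth kerWeight G := by
  induction hG with
  | base hG => exact hG
  | mulW v _ ih => exact ih.mulW v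
  | add _ _ ih ih' => exact ih.add one_le_kerWeight ih'

theorem dirDeriv_mulW {G : KerArg d → ℂ} (hG : ContDiff ℝ (⊤ : ℕ∞) G) (u : Phase d) (v : KerArg d) :
    dirDeriv v (mulW u G) = fun a => mulW u (dirDeriv v G) a + (pairL d v.2.2 u : ℂ) * G a := by
  funext a
  have h1 : HasFDerivAt (fun a : KerArg d => (pairL d a.2.2 u : ℂ))
      (Complex.ofRealCLM.comp (((pairL d).flip u).comp ((ContinuousLinearMap.snd ℝ (ℝ × ℝ) (Phase d)).comp
    (ContinuousLinearMap.snd ℝ (Cfg d) _)))) a :=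
    (Complex.ofRealCLM.comp (((pairL d).flip u).comp ((ContinuousLinearMap.snd ℝ (ℝ × ℝ)
      (Phase d)).comp (ContinuousLinearMap.snd ℝ (Cfg d) _)))).hasFDerivAt
  have h2 := (h1.mul (hG.differentiable (by simp) a).hasFDerivAt).fderiv
  rw [dirDeriv, show mulW u G = (fun a : KerArg d => (pairL d a.2.2 u : ℂ)) * G from rfl, h2]
  simp [mulW, dirDeriv]
  ring

/-- Parameter directions do not differentiate the linear factors in w, so none of them is lost. -/
theorem WKer.dirDeriv_kerDir {r : ℕ} {G : KerArg d → ℂ} (hG : WKer r G) (v : Par d) :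
    WKer r (dirDeriv (kerDir v) G) := by
  induction hG with
  | base hG => exact .base (hG.dirDeriv _)
  | mulW u hG ih =>
    rw [dirDeriv_mulW hG.pGrowth.1]
    simpa [kerDir] using ih.mulW u
  | add hG hG' ih ih' =>
    rw [dirDeriv_add hG.pGrowth.1 hG'.pGrowth.1]
    exact ih.add ih'

theorem WKer.mul {r : ℕ} {G : KerArg d → ℂ} (hG : WKer r G) {H : KerArg d → ℂ}
    (hH : PGrowth kerWeight H) : WKer r (fun a => G a * H a) := by
  induction hG with
  | base hG => exact .base (hG.mul one_le_kerWeight hH)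
  | @mulW r G v _ ih =>
    have : (fun a => _root_.mulW v G a * H a) = _root_.mulW v (fun a => G a * H a) := by
      funext a; simp only [_root_.mulW]; ring
    rw [this]
    exact ih.mulW v
  | add _ _ ih ih' =>
    simp only [add_mul]
    exact ih.add ih'

/-- Coordinate directions in position. -/
def IsPosDir (v : Phase d × Phase d) : Prop := ∃ l, v = vecY l ∨ v = vecZ l

/-- Coordinate directions in momentum. -/
def IsMomDir (v : Phase d × Phase d) : Prop := ∃ l, v = vecEta l ∨ v = vecZeta l

/-- Symbols of two phase space variables of total order `M`, up to powers of the differences of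
the momenta. -/
def BiSym (ρ M : ℝ) (F : Phase d × Phase d → ℂ) : Prop :=
  ContDiff ℝ (⊤ : ℕ∞) F ∧ ∀ us vs : List (Phase d × Phase d), (∀ u ∈ us, IsPosDir u) →
    (∀ v ∈ vs, IsMomDir v) →
      ∃ p, IsDouble (M - vs.length * ρ) p (dirDerivs us (dirDerivs vs F))

variable {ρ : ℝ}

theorem BiSym.isDouble {M : ℝ} {F : Phase d × Phase d → ℂ} (hF : BiSym ρ M F) :
    ∃ p, IsDouble M p F := by
  simpa [dirDerivs_nil] using hF.2 [] [] (by simp) (by simp)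

theorem BiSym.add {M : ℝ} {F F' : Phase d × Phase d → ℂ} (hF : BiSym ρ M F) (hF' : BiSym ρ M F') :
    BiSym ρ M (fun e => F e + F' e) := by
  refine ⟨hF.1.add hF'.1, fun us vs hu hv => ?_⟩
  obtain ⟨p, h⟩ := hF.2 us vs hu hv
  obtain ⟨p', h'⟩ := hF'.2 us vs hu hv
  rw [dirDerivs_add hF.1 hF'.1, dirDerivs_add (smooth_dirDerivs hF.1 _) (smooth_dirDerivs hF'.1 _)]
  exact ⟨p + p', (h.mono (by omega)).add (h'.mono (by omega))⟩

theorem BiSym.const_mul {M : ℝ} {F : Phase d × Phase d → ℂ} (hF : BiSym ρ M F) (c : ℂ) :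
    BiSym ρ M (fun e => c * F e) := by
  refine ⟨contDiff_const.mul hF.1, fun us vs hu hv => ?_⟩
  obtain ⟨p, h⟩ := hF.2 us vs hu hv
  rw [dirDerivs_const_mul hF.1, dirDerivs_const_mul (smooth_dirDerivs hF.1 _)]
  exact ⟨p, h.const_mul c⟩

theorem BiSym.pos {M : ℝ} {F : Phase d × Phase d → ℂ} (hF : BiSym ρ M F) {u : Phase d × Phase d}
    (h : IsPosDir u) : BiSym ρ M (dirDeriv u F) := by
  refine ⟨smooth_dirDeriv hF.1 u, fun us vs hu hv => ?_⟩
  obtain ⟨p, h⟩ := hF.2 (us ++ [u]) vs (fun w hw => by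
    rcases List.mem_append.1 hw with hw | hw
    · exact hu w hw
    · rwa [List.mem_singleton.1 hw]) hv
  refine ⟨p, ?_⟩
  rwa [dirDerivs_dirDeriv_comm hF.1, ← show dirDerivs [u] (dirDerivs vs F) =
    dirDeriv u (dirDerivs vs F) from rfl, ← dirDerivs_append]

theorem BiSym.mom {M : ℝ} {F : Phase d × Phase d → ℂ} (hF : BiSym ρ M F) {v : Phase d × Phase d}
    (h : IsMomDir v) : BiSym ρ (M - ρ) (dirDeriv v F) := by
  refine ⟨smooth_dirDeriv hF.1 v, fun us vs hu hv => ?_⟩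
  obtain ⟨p, h⟩ := hF.2 us (vs ++ [v]) hu (fun w hw => by
    rcases List.mem_append.1 hw with hw | hw
    · exact hv w hw
    · rwa [List.mem_singleton.1 hw])
  refine ⟨p, ?_⟩
  rw [dirDerivs_append] at h
  rw [List.length_append, List.length_singleton] at h
  have e : M - ρ - vs.length * ρ = M - ((vs.length + 1 : ℕ) : ℝ) * ρ := by push_cast; ring
  rw [e]
  exact h

theorem BiSym.zero (M : ℝ) : BiSym ρ M (fun _ : Phase d × Phase d => 0) := by
  refine ⟨contDiff_const, fun us vs _ _ => ⟨0, ?_⟩⟩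
  rw [(isDiffOp_dirDerivs vs).map_zero, (isDiffOp_dirDerivs us).map_zero]
  exact isDouble_zero _ _

theorem BiSym.sum {M : ℝ} {ι : Type*} (s : Finset ι) {F : ι → Phase d × Phase d → ℂ}
    (h : ∀ i ∈ s, BiSym ρ M (F i)) : BiSym ρ M (fun e => ∑ i ∈ s, F i e) := by
  classical
  induction s using Finset.induction_on with
  | empty => simpa using BiSym.zero M
  | insert a s ha ih =>
    simp only [Finset.sum_insert ha]
    exact (h a (by simp)).add (ih fun i hi => h i (by simp [hi]))

theorem BiSym.opL0 {M : ℝ} {F : Phase d × Phase d → ℂ} (hF : BiSym ρ M F) :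
    BiSym ρ (M - ρ) (opL0 F) := by
  refine BiSym.const_mul (BiSym.sum _ fun l _ => ?_) _
  simp only [sub_eq_add_neg (dirDerivs _ F _), neg_eq_neg_one_mul (dirDerivs _ F _)]
  refine BiSym.add ?_ (BiSym.const_mul ?_ _)
  · exact (hF.mom (v := vecZeta l) ⟨l, .inr rfl⟩).pos (u := vecY l) ⟨l, .inl rfl⟩
  · exact (hF.pos (u := vecZ l) ⟨l, .inr rfl⟩).mom (v := vecEta l) ⟨l, .inl rfl⟩

theorem BiSym.opL0_iterate {M : ℝ} {F : Phase d × Phase d → ℂ} (hF : BiSym ρ M F) (k : ℕ) :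
    BiSym ρ (M - k * ρ) (_root_.opL0^[k] F) := by
  induction k with
  | zero => simpa using hF
  | succ k ih =>
    rw [Function.iterate_succ_apply']
    convert ih.opL0 using 1
    push_cast; ring

theorem stdVec_sum (u : Cfg d) : ∑ l : Fin d, u l • (stdVec l : Cfg d) = u := by
  have := (EuclideanSpace.basisFun (Fin d) ℝ).sum_repr u
  simpa [stdVec] using this

theorem thetaDir_eq (v : Phase d) :
    thetaDir v = ∑ l : Fin d, (v.1 l • vecEta l + v.2 l • vecZeta l) := by
  rw [Finset.sum_add_distrib]
  have h1 : ∑ l : Fin d, v.1 l • (vecEta l : Phase d × Phase d) = ((0, v.1), 0) := by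
    simp only [vecEta]
    conv_rhs => rw [← stdVec_sum v.1]
    simp [Prod.ext_iff, Prod.fst_sum, Prod.snd_sum]
  have h2 : ∑ l : Fin d, v.2 l • (vecZeta l : Phase d × Phase d) = (0, (0, v.2)) := by
    simp only [vecZeta]
    conv_rhs => rw [← stdVec_sum v.2]
    simp [Prod.ext_iff, Prod.fst_sum, Prod.snd_sum]
  rw [h1, h2]
  simp [thetaDir]

theorem BiSym.thetaDir {M : ℝ} {F : Phase d × Phase d → ℂ} (hF : BiSym ρ M F) (v : Phase d) :
    BiSym ρ (M - ρ) (dirDeriv (thetaDir v) F) := by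
  have : dirDeriv (_root_.thetaDir v) F = fun e => ∑ l : Fin d,
      ((v.1 l : ℂ) * dirDeriv (vecEta l) F e + (v.2 l : ℂ) * dirDeriv (vecZeta l) F e) := by
    funext e
    simp [dirDeriv, thetaDir_eq v]
  rw [this]
  exact BiSym.sum _ fun l _ => ((hF.mom ⟨l, .inl rfl⟩).const_mul _).add
    ((hF.mom ⟨l, .inr rfl⟩).const_mul _)

/-- The parameter square `[0,1] × [0,1]`. -/
def unitSq : Set (ℝ × ℝ) := Set.Icc 0 1 ×ˢ Set.Icc 0 1

theorem norm_le_one_of_mem_unitSq {τ : ℝ × ℝ} (h : τ ∈ unitSq) : ‖τ‖ ≤ 1 := by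
  obtain ⟨h1, h2⟩ := h
  rw [Prod.norm_def, Real.norm_of_nonneg h1.1, Real.norm_of_nonneg h2.1]
  exact max_le h1.2 h2.2

/-- The source of all gains in symbol order: every linear factor of w in the kernel becomes a
momentum derivative of F, and each of these lowers the order by ρ. Compactness of the parameter
square makes the constant uniform. -/
theorem exists_bound_oscInt {r : ℕ} {G : KerArg d → ℂ} (hG : WKer r G) :
    ∀ {M : ℝ} {F : Phase d × Phase d → ℂ}, BiSym ρ M F → ∃ C : ℝ, 0 ≤ C ∧ ∀ τ ∈ unitSq,
      ∀ X : Phase d, ‖oscInt G F (τ, X)‖ ≤ C * japBracket X.2 ^ (M - r * ρ) := by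
  induction hG with
  | base hG =>
    intro M F hF
    obtain ⟨p, hF⟩ := hF.isDouble
    obtain ⟨C, q, hC, h⟩ := norm_oscInt_le hG hF
    -- On the unit square 1 + ‖τ‖ ≤ 2.
    refine ⟨C * 2 ^ q, by positivity, fun τ hτ X => (h (τ, X)).trans ?_⟩
    have h1 := norm_le_one_of_mem_unitSq hτ
    have h2 := Real.rpow_nonneg (japBracket_pos X.2).le M
    simp only [Nat.cast_zero, zero_mul, sub_zero]
    gcongr
    linarith
  | mulW v hG ih =>
    intro M F hF
    obtain ⟨p, hF'⟩ := hF.isDouble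
    obtain ⟨C, hC, h⟩ := ih ((hF.thetaDir v).const_mul (-Complex.I))
    refine ⟨C, hC, fun τ hτ X => ?_⟩
    rw [oscInt_mulW hG.pGrowth v hF']
    refine (h τ hτ X).trans (le_of_eq ?_)
    push_cast; ring_nf
  | add hG hG' ih ih' =>
    intro M F hF
    obtain ⟨p, hF'⟩ := hF.isDouble
    obtain ⟨C, hC, h⟩ := ih hF
    obtain ⟨C', hC', h'⟩ := ih' hF
    refine ⟨C + C', add_nonneg hC hC', fun τ hτ X => ?_⟩
    rw [oscInt_add_left hG.pGrowth hG'.pGrowth hF', add_mul]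
    exact (norm_add_le _ _).trans (add_le_add (h τ hτ X) (h' τ hτ X))

/-- Coordinate directions of the position and of the momentum in parameter space. -/
def parX (i : Fin d) : Par d := (0, (stdVec i, 0))
def parXi (i : Fin d) : Par d := (0, (0, stdVec i))

theorem dirDeriv_parX_oscInt {G : KerArg d → ℂ} (hG : PGrowth kerWeight G) {M : ℝ} {p : ℕ}
    {F : Phase d × Phase d → ℂ} (hF : IsDouble M p F) (i : Fin d) :
    dirDeriv (parX i) (oscInt G F) = fun P => oscInt (dirDeriv (kerDir (parX i)) G) F P +
      (oscInt G (dirDeriv (vecY i) F) P + oscInt G (dirDeriv (vecZ i) F) P) := by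
  rw [dirDeriv_oscInt hG hF]
  funext P
  have : dirDeriv ((parX i).2, (parX i).2) F =
      fun e => dirDeriv (vecY i) F e + dirDeriv (vecZ i) F e := by
    funext e
    simp [dirDeriv, parX, vecY, vecZ, ← map_add]
  rw [this, oscInt_add_right hG (hF.clm_fderiv _) (hF.clm_fderiv _)]
  simp [parX]

theorem dirDeriv_parXi_oscInt {G : KerArg d → ℂ} (hG : PGrowth kerWeight G) {M : ℝ} {p : ℕ}
    {F : Phase d × Phase d → ℂ} (hF : IsDouble M p F) (i : Fin d) :
    dirDeriv (parXi i) (oscInt G F) = fun P =>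
      oscInt G (dirDeriv (vecEta i) F) P + oscInt G (dirDeriv (vecZeta i) F) P := by
  rw [dirDeriv_oscInt hG hF]
  funext P
  have h1 : dirDeriv ((parXi i).2, (parXi i).2) F =
      fun e => dirDeriv (vecEta i) F e + dirDeriv (vecZeta i) F e := by
    funext e
    simp [dirDeriv, parXi, vecEta, vecZeta, ← map_add]
  have h2 : dirDeriv (kerDir (parXi i)) G = fun a => 0 * G a := by
    funext e
    have : kerDir (parXi i) = 0 := rfl
    simp [dirDeriv, this]
  rw [h1, h2, oscInt_add_right hG (hF.clm_fderiv _) (hF.clm_fderiv _),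
    oscInt_const_mul_left 0 hG hF]
  simp [parXi]

/-- Smooth functions of `(τ, X)` which are symbols of `X`, uniformly for `τ` in the unit square. -/
def UnifSym (ρ M : ℝ) (H : Par d → ℂ) : Prop :=
  ContDiff ℝ (⊤ : ℕ∞) H ∧ ∀ I J : List (Fin d), ∃ C : ℝ, 0 ≤ C ∧ ∀ τ ∈ unitSq, ∀ X : Phase d,
    ‖dirDerivs (I.map parX) (dirDerivs (J.map parXi) H) (τ, X)‖ ≤
      C * japBracket X.2 ^ (M - J.length * ρ)

theorem UnifSym.add {M : ℝ} {H H' : Par d → ℂ} (h : UnifSym ρ M H) (h' : UnifSym ρ M H') :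
    UnifSym ρ M (fun P => H P + H' P) := by
  refine ⟨h.1.add h'.1, fun I J => ?_⟩
  obtain ⟨C, hC, hb⟩ := h.2 I J
  obtain ⟨C', hC', hb'⟩ := h'.2 I J
  rw [dirDerivs_add h.1 h'.1, dirDerivs_add (smooth_dirDerivs h.1 _) (smooth_dirDerivs h'.1 _)]
  refine ⟨C + C', add_nonneg hC hC', fun τ hτ X => ?_⟩
  rw [add_mul]
  exact (norm_add_le _ _).trans (add_le_add (hb τ hτ X) (hb' τ hτ X))

theorem UnifSym.const_mul {M : ℝ} {H : Par d → ℂ} (h : UnifSym ρ M H) (c : ℂ) :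
    UnifSym ρ M (fun P => c * H P) := by
  refine ⟨contDiff_const.mul h.1, fun I J => ?_⟩
  obtain ⟨C, hC, hb⟩ := h.2 I J
  rw [dirDerivs_const_mul h.1, dirDerivs_const_mul (smooth_dirDerivs h.1 _)]
  refine ⟨‖c‖ * C, by positivity, fun τ hτ X => ?_⟩
  rw [norm_mul, mul_assoc]
  gcongr
  exact hb τ hτ X

theorem unifSym_zero (M : ℝ) : UnifSym ρ M (fun _ : Par d => 0) := by
  refine ⟨contDiff_const, fun I J => ⟨0, le_rfl, fun τ _ X => ?_⟩⟩
  rw [(isDiffOp_dirDerivs _).map_zero, (isDiffOp_dirDerivs _).map_zero]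
  simp

theorem UnifSym.sum {M : ℝ} {ι : Type*} (s : Finset ι) {H : ι → Par d → ℂ}
    (h : ∀ i ∈ s, UnifSym ρ M (H i)) : UnifSym ρ M (fun e => ∑ i ∈ s, H i e) := by
  classical
  induction s using Finset.induction_on with
  | empty => simpa using unifSym_zero M
  | insert a s ha ih =>
    simp only [Finset.sum_insert ha]
    exact (h a (by simp)).add (ih fun i hi => h i (by simp [hi]))

/-- Derivatives in x fall on the kernel, keeping its r factors of w, or on the positions in F.
Derivatives in ξ do not see the kernel and become momentum derivatives of F, each of order -ρ. Both
kinds stay in the class to which the pointwise bound applies. -/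
theorem unifSym_oscInt {r : ℕ} {G : KerArg d → ℂ} (hG : WKer r G) {M : ℝ}
    {F : Phase d × Phase d → ℂ} (hF : BiSym ρ M F) : UnifSym ρ (M - r * ρ) (oscInt G F) := by
  obtain ⟨p, hFd⟩ := hF.isDouble
  refine ⟨smooth_oscInt hG.pGrowth hFd, fun I J => ?_⟩
  clear hFd p
  induction J generalizing G M F with
  | nil =>
    simp only [List.map_nil, dirDerivs_nil, List.length_nil, Nat.cast_zero, zero_mul, sub_zero]
    induction I generalizing G F with
    | nil => exact exists_bound_oscInt hG hF
    | cons i I ih =>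
      obtain ⟨p, hFd⟩ := hF.isDouble
      have h1 := hF.pos (u := vecY i) ⟨i, .inl rfl⟩
      have h2 := hF.pos (u := vecZ i) ⟨i, .inr rfl⟩
      obtain ⟨C₀, hC₀, hb₀⟩ := ih (hG.dirDeriv_kerDir (parX i)) hF
      obtain ⟨C₁, hC₁, hb₁⟩ := ih hG h1
      obtain ⟨C₂, hC₂, hb₂⟩ := ih hG h2
      refine ⟨C₀ + (C₁ + C₂), by positivity, fun τ hτ X => ?_⟩
      have hs := smooth_oscInt hG.pGrowth hFd
      have s0 := smooth_oscInt (hG.dirDeriv_kerDir (parX i)).pGrowth hFd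
      have s1 := smooth_oscInt hG.pGrowth (hFd.clm_fderiv (vecY i))
      have s2 := smooth_oscInt hG.pGrowth (hFd.clm_fderiv (vecZ i))
      -- The first direction is moved innermost, where it acts on the oscillatory integral itself
      -- and the derivative formula applies.
      rw [List.map_cons, dirDerivs_cons, ← dirDerivs_dirDeriv_comm hs,
        dirDeriv_parX_oscInt hG.pGrowth hFd, dirDerivs_add s0 (s1.add s2), dirDerivs_add s1 s2]
      refine (norm_add_le _ _).trans ((add_le_add (hb₀ τ hτ X) ((norm_add_le _ _).trans
        (add_le_add (hb₁ τ hτ X) (hb₂ τ hτ X)))).trans (le_of_eq (by ring)))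
  | cons i J ih =>
    obtain ⟨p, hFd⟩ := hF.isDouble
    have h1 := hF.mom (v := vecEta i) ⟨i, .inl rfl⟩
    have h2 := hF.mom (v := vecZeta i) ⟨i, .inr rfl⟩
    obtain ⟨C₁, hC₁, hb₁⟩ := ih hG h1
    obtain ⟨C₂, hC₂, hb₂⟩ := ih hG h2
    refine ⟨C₁ + C₂, by positivity, fun τ hτ X => ?_⟩
    have hs := smooth_oscInt hG.pGrowth hFd
    have s1 := smooth_oscInt hG.pGrowth (hFd.clm_fderiv (vecEta i))
    have s2 := smooth_oscInt hG.pGrowth (hFd.clm_fderiv (vecZeta i))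
    rw [List.map_cons, dirDerivs_cons, ← dirDerivs_dirDeriv_comm hs,
      dirDeriv_parXi_oscInt hG.pGrowth hFd, dirDerivs_add s1 s2,
      dirDerivs_add (smooth_dirDerivs s1 _) (smooth_dirDerivs s2 _)]
    refine (norm_add_le _ _).trans ((add_le_add (hb₁ τ hτ X) (hb₂ τ hτ X)).trans (le_of_eq ?_))
    simp only [List.length_cons]
    push_cast
    ring_nf

end SymbolEstimates

/-! ### Tensor products of symbols -/

section Tensor

variable {d : ℕ} {ρ : ℝ}

theorem IsSymbol.dirDeriv_x {m : ℝ} {f : Phase d → ℂ} (hf : IsSymbol ρ m f) (i : Fin d) :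
    IsSymbol ρ m (dirDeriv ((stdVec i, 0) : Phase d) f) := by
  refine ⟨smooth_dirDeriv hf.1 _, fun I J => ?_⟩
  obtain ⟨C, h⟩ := hf.2 (I ++ [i]) J
  refine ⟨C, fun X => (le_of_eq ?_).trans (h X)⟩
  rw [partialXXi, partialXXi, dirDerivs_dirDeriv_comm hf.1, List.map_append, dirDerivs_append]
  rfl

theorem IsSymbol.dirDeriv_xi {m : ℝ} {f : Phase d → ℂ} (hf : IsSymbol ρ m f) (i : Fin d) :
    IsSymbol ρ (m - ρ) (dirDeriv ((0, stdVec i) : Phase d) f) := by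
  refine ⟨smooth_dirDeriv hf.1 _, fun I J => ?_⟩
  obtain ⟨C, h⟩ := hf.2 I (J ++ [i])
  refine ⟨C, fun X => ?_⟩
  have e : m - ρ - J.length * ρ = m - ((J ++ [i]).length : ℕ) * ρ := by
    rw [List.length_append, List.length_singleton]; push_cast; ring
  rw [e]
  refine (le_of_eq ?_).trans (h X)
  rw [partialXXi, partialXXi, List.map_append, dirDerivs_append]
  rfl

theorem IsSymbol.mono {m m' : ℝ} (hm : m ≤ m') {f : Phase d → ℂ} (hf : IsSymbol ρ m f) :
    IsSymbol ρ m' f := by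
  refine ⟨hf.1, fun I J => ?_⟩
  obtain ⟨C, h⟩ := hf.2 I J
  refine ⟨|C|, fun X => (h X).trans ?_⟩
  have h0 := Real.rpow_nonneg (japBracket_pos X.2).le (m - J.length * ρ)
  gcongr
  · exact le_abs_self C
  · exact one_le_japBracket _

theorem fderiv_eq_sum_dirDeriv (f : Phase d → ℂ) (X : Phase d) : fderiv ℝ f X =
    ∑ i : Fin d, (((EuclideanSpace.proj i : Cfg d →L[ℝ] ℝ).comp
        (ContinuousLinearMap.fst ℝ (Cfg d) (Cfg d))).smulRight (dirDeriv ((stdVec i, 0) : Phase d) f X) +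
      ((EuclideanSpace.proj i : Cfg d →L[ℝ] ℝ).comp
        (ContinuousLinearMap.snd ℝ (Cfg d) (Cfg d))).smulRight (dirDeriv ((0, stdVec i) : Phase d) f X)) := by
  refine ContinuousLinearMap.ext fun v => ?_
  have hv : v = ∑ i : Fin d, (v.1 i • ((stdVec i, 0) : Phase d) + v.2 i • ((0, stdVec i) : Phase d)) := by
    rw [Finset.sum_add_distrib]
    have h1 : ∑ l : Fin d, v.1 l • ((stdVec l, 0) : Phase d) = (v.1, 0) := by
      conv_rhs => rw [← stdVec_sum v.1]
      simp [Prod.ext_iff, Prod.fst_sum, Prod.snd_sum]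
    have h2 : ∑ l : Fin d, v.2 l • ((0, stdVec l) : Phase d) = (0, v.2) := by
      conv_rhs => rw [← stdVec_sum v.2]
      simp [Prod.ext_iff, Prod.fst_sum, Prod.snd_sum]
    rw [h1, h2]; simp
  conv_lhs => rw [hv]
  simp only [map_sum, map_add, map_smul]
  simp [dirDeriv]

/-- Passage from coordinate seminorms to full derivatives. The improvement in ξ is dropped: for ρ ≥
0 a momentum derivative of order m - ρ is also of order m. -/
theorem IsSymbol.exists_bound (hρ : 0 ≤ ρ) (n : ℕ) : ∀ {m : ℝ} {f : Phase d → ℂ},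
    IsSymbol ρ m f → ∃ C : ℝ, 0 ≤ C ∧ ∀ X, ‖iteratedFDeriv ℝ n f X‖ ≤ C * japBracket X.2 ^ m := by
  induction n with
  | zero =>
    intro m f hf
    obtain ⟨C, h⟩ := hf.2 [] []
    refine ⟨|C|, abs_nonneg _, fun X => ?_⟩
    have := h X
    simp only [partialXXi, List.map_nil, dirDerivs_nil, List.length_nil, Nat.cast_zero, zero_mul,
      sub_zero] at this
    rw [norm_iteratedFDeriv_zero]
    refine this.trans ?_
    have h0 := Real.rpow_nonneg (japBracket_pos X.2).le m
    gcongr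
    exact le_abs_self C
  | succ n ih =>
    intro m f hf
    choose C hC h using fun i : Fin d => ih (hf.dirDeriv_x i)
    choose C' hC' h' using fun i : Fin d => ih ((hf.dirDeriv_xi i).mono (m' := m) (by linarith))
    let L₁ : Fin d → ℂ →L[ℝ] (Phase d →L[ℝ] ℂ) := fun i => ContinuousLinearMap.smulRightL ℝ _ _
      ((EuclideanSpace.proj i : Cfg d →L[ℝ] ℝ).comp (ContinuousLinearMap.fst ℝ (Cfg d) (Cfg d)))
    let L₂ : Fin d → ℂ →L[ℝ] (Phase d →L[ℝ] ℂ) := fun i => ContinuousLinearMap.smulRightL ℝ _ _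
      ((EuclideanSpace.proj i : Cfg d →L[ℝ] ℝ).comp (ContinuousLinearMap.snd ℝ (Cfg d) (Cfg d)))
    refine ⟨∑ i, (‖L₁ i‖ * C i + ‖L₂ i‖ * C' i), Finset.sum_nonneg fun i _ => ?_,
      fun X => ?_⟩
    · have := hC i
      have := hC' i
      positivity
    have hs₁ : ∀ i, ContDiff ℝ n fun X => L₁ i (dirDeriv ((stdVec i, 0) : Phase d) f X) := fun i =>
      (L₁ i).contDiff.comp ((smooth_dirDeriv hf.1 _).of_le (by exact_mod_cast le_top))
    have hs₂ : ∀ i, ContDiff ℝ n fun X => L₂ i (dirDeriv ((0, stdVec i) : Phase d) f X) := fun i =>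
      (L₂ i).contDiff.comp ((smooth_dirDeriv hf.1 _).of_le (by exact_mod_cast le_top))
    have e : fderiv ℝ f = fun X => ∑ i : Fin d, (L₁ i (dirDeriv ((stdVec i, 0) : Phase d) f X) +
        L₂ i (dirDeriv ((0, stdVec i) : Phase d) f X)) := funext fun X => fderiv_eq_sum_dirDeriv f X
    rw [← norm_iteratedFDeriv_fderiv, e, show iteratedFDeriv ℝ n (fun X => ∑ i : Fin d, (L₁ i (dirDeriv ((stdVec i, 0) : Phase d) f X) +
        L₂ i (dirDeriv ((0, stdVec i) : Phase d) f X))) X = _ from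
        iteratedFDeriv_fun_sum_apply fun i _ => ((hs₁ i).add (hs₂ i)).contDiffAt,
      Finset.sum_mul]
    refine (norm_sum_le _ _).trans (Finset.sum_le_sum fun i _ => ?_)
    have e2 : iteratedFDeriv ℝ n (fun X => L₁ i (dirDeriv ((stdVec i, 0) : Phase d) f X) +
        L₂ i (dirDeriv ((0, stdVec i) : Phase d) f X)) X =
        iteratedFDeriv ℝ n (fun X => L₁ i (dirDeriv ((stdVec i, 0) : Phase d) f X)) X +
        iteratedFDeriv ℝ n (fun X => L₂ i (dirDeriv ((0, stdVec i) : Phase d) f X)) X :=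
      iteratedFDeriv_add_apply (hs₁ i).contDiffAt (hs₂ i).contDiffAt
    rw [e2, add_mul, mul_assoc, mul_assoc]
    refine (norm_add_le _ _).trans (add_le_add ?_ ?_)
    · refine ((L₁ i).norm_iteratedFDeriv_comp_left (n := n)
        ((smooth_dirDeriv hf.1 _).contDiffAt (x := X)) (by exact_mod_cast le_top)).trans ?_
      gcongr
      exact h i X
    · refine ((L₂ i).norm_iteratedFDeriv_comp_left (n := n)
        ((smooth_dirDeriv hf.1 _).contDiffAt (x := X)) (by exact_mod_cast le_top)).trans ?_
      gcongr
      exact h' i X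

theorem japBracket_le_mul (ξ η : Cfg d) : japBracket η ≤ japBracket ξ * (1 + ‖η - ξ‖) := by
  have h1 : ‖η‖ ≤ ‖ξ‖ + ‖η - ξ‖ := by
    have := norm_add_le ξ (η - ξ)
    simpa using this
  have h2 := norm_nonneg (η - ξ)
  have h3 := norm_nonneg ξ
  rw [japBracket, japBracket, Real.sqrt_le_left (by positivity), mul_pow,
    Real.sq_sqrt (by positivity)]
  have h4 : ‖η‖ ^ 2 ≤ (‖ξ‖ + ‖η - ξ‖) ^ 2 := by gcongr
  nlinarith [mul_nonneg h2 (sq_nonneg (‖ξ‖ - 1)), mul_nonneg (sq_nonneg ‖η - ξ‖) (sq_nonneg ‖ξ‖),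
    mul_nonneg h2 (sq_nonneg ‖ξ‖)]

/-- Peetre's inequality. -/
theorem japBracket_rpow_le (ξ η : Cfg d) (m : ℝ) :
    japBracket η ^ m ≤ japBracket ξ ^ m * (1 + ‖η - ξ‖) ^ ⌈|m|⌉₊ := by
  have h1 : 1 ≤ 1 + ‖η - ξ‖ := by linarith [norm_nonneg (η - ξ)]
  have h2 : (1 + ‖η - ξ‖) ^ |m| ≤ (1 + ‖η - ξ‖) ^ ⌈|m|⌉₊ := by
    rw [← Real.rpow_natCast]
    exact Real.rpow_le_rpow_of_exponent_le h1 (Nat.le_ceil _)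
  have h0 := Real.rpow_nonneg (japBracket_pos ξ).le m
  refine le_trans ?_ (mul_le_mul_of_nonneg_left h2 h0)
  rcases le_total 0 m with hm | hm
  · rw [abs_of_nonneg hm, ← Real.mul_rpow (japBracket_pos ξ).le (by linarith)]
    exact Real.rpow_le_rpow (japBracket_pos η).le (japBracket_le_mul ξ η) hm
  -- For negative exponents the basic inequality is used with ξ and η exchanged, because t ↦ t^m is
  -- then decreasing.
  · rw [abs_of_nonpos hm]
    have h3 := japBracket_le_mul η ξ
    rw [norm_sub_rev] at h3
    have h4 : (japBracket η * (1 + ‖η - ξ‖)) ^ m ≤ japBracket ξ ^ m :=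
      Real.rpow_le_rpow_of_nonpos (japBracket_pos ξ) h3 hm
    rw [Real.mul_rpow (japBracket_pos η).le (by linarith)] at h4
    rw [Real.rpow_neg (by linarith), ← div_eq_mul_inv, le_div_iff₀ (by positivity)]
    exact h4

/-- Peetre's inequality replaces the two momenta by an arbitrary common ξ, at the price of ⌈|m₁|⌉ +
⌈|m₂|⌉ powers of the differences. -/
theorem isDouble_tensor (hρ : 0 ≤ ρ) {m₁ m₂ : ℝ} {f g : Phase d → ℂ} (hf : IsSymbol ρ m₁ f)
    (hg : IsSymbol ρ m₂ g) :
    IsDouble (m₁ + m₂) (⌈|m₁|⌉₊ + ⌈|m₂|⌉₊) (fun e : Phase d × Phase d => f e.1 * g e.2) := by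
  refine ⟨(hf.1.comp contDiff_fst).mul (hg.1.comp contDiff_snd), fun N => ?_⟩
  choose C hC hb using fun n : ℕ => hf.exists_bound hρ n
  choose C' hC' hb' using fun n : ℕ => hg.exists_bound hρ n
  refine ⟨∑ n ∈ Finset.range (N + 1), ∑ i ∈ Finset.range (n + 1), (n.choose i : ℝ) * C i * C' (n - i),
    Finset.sum_nonneg fun n _ => Finset.sum_nonneg fun i _ =>
      mul_nonneg (mul_nonneg (by positivity) (hC _)) (hC' _), fun n hn Y Z ξ => ?_⟩
  refine (norm_iteratedFDeriv_mul_le (𝕜 := ℝ) (N := ((⊤ : ℕ∞) : WithTop ℕ∞)) (n := n)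
    (hf.1.comp contDiff_fst) (hg.1.comp contDiff_snd) (Y, Z) (by exact_mod_cast le_top)).trans ?_
  have hterm : ∀ i ∈ Finset.range (n + 1), (n.choose i : ℝ) *
      ‖iteratedFDeriv ℝ i (f ∘ Prod.fst) (Y, Z)‖ *
        ‖iteratedFDeriv ℝ (n - i) (g ∘ Prod.snd) (Y, Z)‖ ≤
      ((n.choose i : ℝ) * C i * C' (n - i)) * (japBracket ξ ^ (m₁ + m₂) *
        (1 + ‖((Y.2 - ξ, Z.2 - ξ) : Phase d)‖) ^ (⌈|m₁|⌉₊ + ⌈|m₂|⌉₊)) := by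
    intro i hi
    have h1 : ‖iteratedFDeriv ℝ i (f ∘ Prod.fst) (Y, Z)‖ ≤ C i * japBracket Y.2 ^ m₁ := by
      have := norm_iteratedFDeriv_comp_affine_le hf.1 (ContinuousLinearMap.fst ℝ (Phase d) (Phase d))
        (ContinuousLinearMap.norm_fst_le _ _ _) 0 i (Y, Z)
      simp only [zero_add] at this
      exact this.trans (hb i Y)
    have h2 : ‖iteratedFDeriv ℝ (n - i) (g ∘ Prod.snd) (Y, Z)‖ ≤
        C' (n - i) * japBracket Z.2 ^ m₂ := by
      have := norm_iteratedFDeriv_comp_affine_le hg.1 (ContinuousLinearMap.snd ℝ (Phase d) (Phase d))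
        (ContinuousLinearMap.norm_snd_le _ _ _) 0 (n - i) (Y, Z)
      simp only [zero_add] at this
      exact this.trans (hb' (n - i) Z)
    have h3 : ‖Y.2 - ξ‖ ≤ ‖((Y.2 - ξ, Z.2 - ξ) : Phase d)‖ := norm_fst_le (Y.2 - ξ, Z.2 - ξ)
    have h4 : ‖Z.2 - ξ‖ ≤ ‖((Y.2 - ξ, Z.2 - ξ) : Phase d)‖ := norm_snd_le (Y.2 - ξ, Z.2 - ξ)
    have h5 := Real.rpow_nonneg (japBracket_pos ξ).le m₁
    have h6 := Real.rpow_nonneg (japBracket_pos ξ).le m₂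
    have hCi := hC i
    have hCi' := hC' (n - i)
    have h7 := Real.rpow_nonneg (japBracket_pos Y.2).le m₁
    have h8 := Real.rpow_nonneg (japBracket_pos Z.2).le m₂
    calc _ ≤ (n.choose i : ℝ) * (C i * (japBracket ξ ^ m₁ *
            (1 + ‖((Y.2 - ξ, Z.2 - ξ) : Phase d)‖) ^ ⌈|m₁|⌉₊)) *
          (C' (n - i) * (japBracket ξ ^ m₂ *
            (1 + ‖((Y.2 - ξ, Z.2 - ξ) : Phase d)‖) ^ ⌈|m₂|⌉₊)) := by
          gcongr
          · refine h1.trans (mul_le_mul_of_nonneg_left ((japBracket_rpow_le ξ Y.2 m₁).trans ?_) hCi)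
            gcongr
          · refine h2.trans (mul_le_mul_of_nonneg_left ((japBracket_rpow_le ξ Z.2 m₂).trans ?_) hCi')
            gcongr
      _ = _ := by
          rw [Real.rpow_add (japBracket_pos ξ), pow_add]; ring
  refine (Finset.sum_le_sum hterm).trans ?_
  rw [← Finset.sum_mul, mul_assoc]
  have h5 := Real.rpow_nonneg (japBracket_pos ξ).le (m₁ + m₂)
  gcongr
  exact Finset.single_le_sum
    (f := fun n => ∑ i ∈ Finset.range (n + 1), (n.choose i : ℝ) * C i * C' (n - i))
    (fun n _ => Finset.sum_nonneg fun i _ => mul_nonneg (mul_nonneg (by positivity) (hC _)) (hC' _))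
    (by simpa using Nat.lt_succ_of_le hn)

theorem dirDeriv_tensor_left {f g : Phase d → ℂ} (hf : ContDiff ℝ (⊤ : ℕ∞) f)
    (hg : ContDiff ℝ (⊤ : ℕ∞) g) (v : Phase d) :
    dirDeriv ((v, 0) : Phase d × Phase d) (fun e => f e.1 * g e.2) =
      fun e => dirDeriv v f e.1 * g e.2 := by
  have h1 := dirDeriv_mul (hf.comp (contDiff_fst (E := Phase d) (F := Phase d)))
    (hg.comp (contDiff_snd (E := Phase d) (F := Phase d))) (v, 0)
  have h2 := dirDeriv_comp_affine hf (ContinuousLinearMap.fst ℝ (Phase d) (Phase d)) 0 (v, 0)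
  have h3 := dirDeriv_comp_affine hg (ContinuousLinearMap.snd ℝ (Phase d) (Phase d)) 0 (v, 0)
  simp only [zero_add, ContinuousLinearMap.coe_fst', ContinuousLinearMap.coe_snd'] at h2 h3
  simp only [Function.comp_def] at h1
  rw [h1, h2, h3]
  funext e
  simp [dirDeriv]

theorem dirDeriv_tensor_right {f g : Phase d → ℂ} (hf : ContDiff ℝ (⊤ : ℕ∞) f)
    (hg : ContDiff ℝ (⊤ : ℕ∞) g) (v : Phase d) :
    dirDeriv ((0, v) : Phase d × Phase d) (fun e => f e.1 * g e.2) =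
      fun e => f e.1 * dirDeriv v g e.2 := by
  have h1 := dirDeriv_mul (hf.comp (contDiff_fst (E := Phase d) (F := Phase d)))
    (hg.comp (contDiff_snd (E := Phase d) (F := Phase d))) (0, v)
  have h2 := dirDeriv_comp_affine hf (ContinuousLinearMap.fst ℝ (Phase d) (Phase d)) 0 (0, v)
  have h3 := dirDeriv_comp_affine hg (ContinuousLinearMap.snd ℝ (Phase d) (Phase d)) 0 (0, v)
  simp only [zero_add, ContinuousLinearMap.coe_fst', ContinuousLinearMap.coe_snd'] at h2 h3
  simp only [Function.comp_def] at h1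
  rw [h1, h2, h3]
  funext e
  simp [dirDeriv]

/-- Each coordinate derivative hits only one factor and leaves a symbol, of order lower by ρ for
momentum directions. By induction the claim reduces to the case without derivatives. -/
theorem biSym_tensor (hρ : 0 ≤ ρ) {m₁ m₂ : ℝ} {f g : Phase d → ℂ} (hf : IsSymbol ρ m₁ f)
    (hg : IsSymbol ρ m₂ g) : BiSym ρ (m₁ + m₂) (fun e : Phase d × Phase d => f e.1 * g e.2) := by
  have hsm : ∀ {m₁ m₂ : ℝ} {f g : Phase d → ℂ}, IsSymbol ρ m₁ f → IsSymbol ρ m₂ g →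
      ContDiff ℝ (⊤ : ℕ∞) (fun e : Phase d × Phase d => f e.1 * g e.2) := fun hf hg =>
    (hf.1.comp contDiff_fst).mul (hg.1.comp contDiff_snd)
  refine ⟨hsm hf hg, fun us vs hu hv => ?_⟩
  induction vs generalizing m₁ m₂ f g with
  | nil =>
    simp only [dirDerivs_nil, List.length_nil, Nat.cast_zero, zero_mul, sub_zero]
    induction us generalizing f g with
    | nil => exact ⟨_, isDouble_tensor hρ hf hg⟩
    | cons u us ih =>
      rw [dirDerivs_cons, ← dirDerivs_dirDeriv_comm (hsm hf hg)]
      obtain ⟨l, rfl | rfl⟩ := hu u (by simp)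
      · rw [vecY, dirDeriv_tensor_left hf.1 hg.1]
        exact ih (fun u hu' => hu u (List.mem_cons_of_mem _ hu')) (hf.dirDeriv_x l) hg
      · rw [vecZ, dirDeriv_tensor_right hf.1 hg.1]
        exact ih (fun u hu' => hu u (List.mem_cons_of_mem _ hu')) hf (hg.dirDeriv_x l)
  | cons v vs ih =>
    rw [dirDerivs_cons, ← dirDerivs_dirDeriv_comm (hsm hf hg)]
    have hv' : ∀ w ∈ vs, IsMomDir w := fun w hw => hv w (by simp [hw])
    have e : m₁ + m₂ - ((v :: vs).length : ℕ) * ρ = m₁ + m₂ - ρ - vs.length * ρ := by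
      simp only [List.length_cons]; push_cast; ring
    rw [e]
    obtain ⟨l, rfl | rfl⟩ := hv v (by simp)
    · rw [vecEta, dirDeriv_tensor_left hf.1 hg.1]
      have := ih (hf.dirDeriv_xi l) hg hv'
      rwa [show m₁ - ρ + m₂ = m₁ + m₂ - ρ by ring] at this
    · rw [vecZeta, dirDeriv_tensor_right hf.1 hg.1]
      have := ih hf (hg.dirDeriv_xi l) hv'
      rwa [show m₁ + (m₂ - ρ) = m₁ + m₂ - ρ by ring] at this

end Tensor

/-! ### Cutoffs -/

section Cutoff

variable {d : ℕ}

/-- Smooth functions all of whose derivatives are bounded. -/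
def BddDerivs {V : Type*} [NormedAddCommGroup V] [NormedSpace ℝ V] (χ : V → ℂ) : Prop :=
  ContDiff ℝ (⊤ : ℕ∞) χ ∧ ∀ n : ℕ, ∃ C : ℝ, ∀ x, ‖iteratedFDeriv ℝ n χ x‖ ≤ C

/-- Every derivative falling on χ(δ ·) produces a factor δ, so in the limit only the term with all
derivatives on F survives. -/
theorem tendsto_dirDerivs_cutoff {V : Type*} [NormedAddCommGroup V] [NormedSpace ℝ V]
    (vs : List V) : ∀ {χ F : V → ℂ}, ContDiff ℝ (⊤ : ℕ∞) χ → ContDiff ℝ (⊤ : ℕ∞) F → ∀ e : V,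
      Tendsto (fun δ : ℝ => dirDerivs vs (fun e => χ (δ • e) * F e) e) (𝓝 0)
        (𝓝 (χ 0 * dirDerivs vs F e)) := by
  induction vs with
  | nil =>
    intro χ F hχ hF e
    have : Continuous fun δ : ℝ => χ (δ • e) * F e :=
      (hχ.continuous.comp (by fun_prop)).mul continuous_const
    simpa [dirDerivs_nil] using this.tendsto 0
  | cons v vs ih =>
    intro χ F hχ hF e
    have hsm : ∀ δ : ℝ, ∀ χ' : V → ℂ, ContDiff ℝ (⊤ : ℕ∞) χ' →
        ContDiff ℝ (⊤ : ℕ∞) fun e : V => χ' (δ • e) := fun δ χ' h => h.comp (by fun_prop)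
    have key : ∀ δ : ℝ, dirDerivs (v :: vs) (fun e => χ (δ • e) * F e) e =
        δ * dirDerivs vs (fun e => dirDeriv v χ (δ • e) * F e) e +
          dirDerivs vs (fun e => χ (δ • e) * dirDeriv v F e) e := fun δ => by
      rw [dirDerivs_cons, ← dirDerivs_dirDeriv_comm ((hsm δ χ hχ).mul hF),
        dirDeriv_mul (hsm δ χ hχ) hF]
      have h1 := dirDeriv_comp_affine hχ (δ • ContinuousLinearMap.id ℝ V) 0 v
      simp only [zero_add, smul_apply, ContinuousLinearMap.id_apply] at h1
      rw [h1]
      have h2 : (fun p => dirDeriv (δ • v) χ (δ • p) * F p + χ (δ • p) * dirDeriv v F p) =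
          fun p => δ * (dirDeriv v χ (δ • p) * F p) + χ (δ • p) * dirDeriv v F p := by
        funext p
        simp [dirDeriv, mul_assoc]
      have h3 := smooth_dirDeriv hχ v
      have h4 := smooth_dirDeriv hF v
      rw [h2, dirDerivs_add (contDiff_const.mul ((hsm δ _ h3).mul hF)) ((hsm δ χ hχ).mul h4),
        dirDerivs_const_mul ((hsm δ _ h3).mul hF)]
    simp only [key]
    have h1 := ih (smooth_dirDeriv hχ v) hF e
    have h2 := ih hχ (smooth_dirDeriv hF v) e
    have h3 : Tendsto (fun δ : ℝ => (δ : ℂ)) (𝓝 0) (𝓝 0) := by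
      simpa using (Complex.continuous_ofReal.tendsto (0 : ℝ))
    have := (h3.mul h1).add h2
    rw [dirDerivs_cons, ← dirDerivs_dirDeriv_comm hF]
    simpa using this

theorem IsDiffOp.tendsto_cutoff {V : Type*} [NormedAddCommGroup V] [NormedSpace ℝ V]
    {D : (V → ℂ) → V → ℂ} (hD : IsDiffOp D) {χ F : V → ℂ} (hχ : ContDiff ℝ (⊤ : ℕ∞) χ)
    (hF : ContDiff ℝ (⊤ : ℕ∞) F) (e : V) :
    Tendsto (fun δ : ℝ => D (fun e => χ (δ • e) * F e) e) (𝓝 0) (𝓝 (χ 0 * D F e)) := by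
  obtain ⟨L, hL⟩ := hD
  have h : ∀ δ : ℝ, D (fun e => χ (δ • e) * F e) = diffOp L (fun e => χ (δ • e) * F e) :=
    fun δ => hL _ ((hχ.comp (by fun_prop)).mul hF)
  simp only [h, hL F hF]
  clear hL h
  induction L with
  | nil => simp [diffOp]
  | cons t L ih =>
    simp only [diffOp_cons]
    have := ((tendsto_dirDerivs_cutoff t.2 hχ hF e).const_mul t.1).add ih
    rw [mul_add]
    convert this using 2
    ring

theorem DoubleBound.dirDeriv {M : ℝ} {p N : ℕ} {C : ℝ} {F : Phase d × Phase d → ℂ}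
    (hF : ContDiff ℝ (⊤ : ℕ∞) F) (h : DoubleBound M p (N + 1) C F) (v : Phase d × Phase d) :
    DoubleBound M p N (‖v‖ * C) (dirDeriv v F) := by
  intro n hn Y Z ξ
  have hfd : ContDiff ℝ (⊤ : ℕ∞) (fderiv ℝ F) := hF.fderiv_right (by simp)
  refine (norm_iteratedFDeriv_clm_apply_const (n := n) (hfd.contDiffAt (x := (Y, Z)))
    (by exact_mod_cast le_top)).trans ?_
  rw [norm_iteratedFDeriv_fderiv, mul_assoc, mul_assoc]
  gcongr
  rw [← mul_assoc]
  exact h (n + 1) (by omega) Y Z ξ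

theorem exists_doubleBound_dirDerivs (M : ℝ) (p : ℕ) (vs : List (Phase d × Phase d)) : ∀ N : ℕ,
    ∃ N' : ℕ, ∃ c : ℝ, 0 ≤ c ∧ ∀ (C : ℝ) (F : Phase d × Phase d → ℂ), ContDiff ℝ (⊤ : ℕ∞) F →
      DoubleBound M p N' C F → DoubleBound M p N (c * C) (dirDerivs vs F) := by
  induction vs with
  | nil => exact fun N => ⟨N, 1, zero_le_one, fun C F _ h => by simpa [dirDerivs_nil] using h⟩
  | cons v vs ih =>
    intro N
    obtain ⟨N', c, hc, h⟩ := ih (N + 1)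
    refine ⟨N', ‖v‖ * c, by positivity, fun C F hF hb => ?_⟩
    have := (h C F hF hb).dirDeriv (smooth_dirDerivs hF vs) v
    rwa [← mul_assoc] at this

/-- The order N' and the factor c do not depend on F. This uniformity is needed when F runs through
a family of cut-off functions. -/
theorem IsDiffOp.exists_doubleBound {D : (Phase d × Phase d → ℂ) → Phase d × Phase d → ℂ}
    (hD : IsDiffOp D) (M : ℝ) (p N : ℕ) : ∃ N' : ℕ, ∃ c : ℝ, 0 ≤ c ∧
      ∀ (C : ℝ) (F : Phase d × Phase d → ℂ), 0 ≤ C → ContDiff ℝ (⊤ : ℕ∞) F →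
        DoubleBound M p N' C F → DoubleBound M p N (c * C) (D F) := by
  obtain ⟨L, hL⟩ := hD
  have key : ∃ N' : ℕ, ∃ c : ℝ, 0 ≤ c ∧ ∀ (C : ℝ) (F : Phase d × Phase d → ℂ), 0 ≤ C →
      ContDiff ℝ (⊤ : ℕ∞) F → DoubleBound M p N' C F → DoubleBound M p N (c * C) (diffOp L F) := by
    clear hL
    induction L with
    | nil =>
      refine ⟨0, 0, le_rfl, fun C F _ _ _ n _ Y Z ξ => ?_⟩
      have : iteratedFDeriv ℝ n (diffOp [] F) = 0 := iteratedFDeriv_fun_zero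
      rw [this]; simp
    | cons t L ih =>
      obtain ⟨N₁, c₁, hc₁, h₁⟩ := ih
      obtain ⟨N₂, c₂, hc₂, h₂⟩ := exists_doubleBound_dirDerivs M p t.2 N
      refine ⟨N₁ + N₂, ‖t.1‖ * c₂ + c₁, by positivity, fun C F hC hF hb n hn Y Z ξ => ?_⟩
      have h₁' := h₁ C F hC hF (fun n hn => hb n (by omega)) n hn Y Z ξ
      have h₂' := h₂ C F hF (fun n hn => hb n (by omega)) n hn Y Z ξ
      have e1 : iteratedFDeriv ℝ n (diffOp (t :: L) F) (Y, Z) =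
          t.1 • iteratedFDeriv ℝ n (dirDerivs t.2 F) (Y, Z) + iteratedFDeriv ℝ n (diffOp L F) (Y, Z) := by
        have e2 : diffOp (t :: L) F = t.1 • dirDerivs t.2 F + diffOp L F := diffOp_cons t L F
        have e3 : ContDiffAt ℝ n (t.1 • dirDerivs t.2 F) (Y, Z) :=
          ((smooth_dirDerivs hF t.2).const_smul t.1).contDiffAt.of_le (by exact_mod_cast le_top)
        rw [e2, iteratedFDeriv_add_apply e3
          ((smooth_diffOp L hF).contDiffAt.of_le (by exact_mod_cast le_top)),
          iteratedFDeriv_const_smul_apply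
            ((smooth_dirDerivs hF t.2).contDiffAt.of_le (by exact_mod_cast le_top))]
      rw [e1]
      refine (norm_add_le _ _).trans ?_
      rw [norm_smul]
      calc _ ≤ ‖t.1‖ * (c₂ * C * japBracket ξ ^ M *
            (1 + ‖((Y.2 - ξ, Z.2 - ξ) : Phase d)‖) ^ p) + c₁ * C * japBracket ξ ^ M *
            (1 + ‖((Y.2 - ξ, Z.2 - ξ) : Phase d)‖) ^ p := by gcongr
        _ = _ := by ring
  obtain ⟨N', c, hc, h⟩ := key
  exact ⟨N', c, hc, fun C F hC hF hb => by rw [hL F hF]; exact h C F hC hF hb⟩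

/-- Scaling by δ multiplies the i-th derivative of χ by at most |δ|^i ≤ 1, so the constant is
uniform in δ. -/
theorem exists_doubleBound_cutoff {χ : Phase d × Phase d → ℂ} (hχ : BddDerivs χ) (N : ℕ) :
    ∃ c : ℝ, 0 ≤ c ∧ ∀ (M : ℝ) (p : ℕ) (C : ℝ) (F : Phase d × Phase d → ℂ), 0 ≤ C →
      ContDiff ℝ (⊤ : ℕ∞) F → DoubleBound M p N C F → ∀ δ : ℝ, |δ| ≤ 1 →
        DoubleBound M p N (c * C) (fun e => χ (δ • e) * F e) := by
  choose A hA using hχ.2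
  have hA0 : ∀ n, 0 ≤ A n := fun n => (norm_nonneg _).trans (hA n 0)
  refine ⟨∑ n ∈ Finset.range (N + 1), ∑ i ∈ Finset.range (n + 1), (n.choose i : ℝ) * A i,
    Finset.sum_nonneg fun n _ => Finset.sum_nonneg fun i _ => mul_nonneg (by positivity) (hA0 i),
    fun M p C F hC hF hb δ hδ n hn Y Z ξ => ?_⟩
  have hsm : ContDiff ℝ (⊤ : ℕ∞) fun e : Phase d × Phase d => χ (δ • e) := hχ.1.comp (by fun_prop)
  refine (norm_iteratedFDeriv_mul_le (𝕜 := ℝ) (N := ((⊤ : ℕ∞) : WithTop ℕ∞)) (n := n)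
    hsm hF (Y, Z) (by exact_mod_cast le_top)).trans ?_
  have h5 := Real.rpow_nonneg (japBracket_pos ξ).le M
  have hterm : ∀ i ∈ Finset.range (n + 1), (n.choose i : ℝ) *
      ‖iteratedFDeriv ℝ i (fun e : Phase d × Phase d => χ (δ • e)) (Y, Z)‖ *
        ‖iteratedFDeriv ℝ (n - i) F (Y, Z)‖ ≤ ((n.choose i : ℝ) * A i) * (C * japBracket ξ ^ M *
        (1 + ‖((Y.2 - ξ, Z.2 - ξ) : Phase d)‖) ^ p) := by
    intro i _
    have h1 : ‖iteratedFDeriv ℝ i (fun e : Phase d × Phase d => χ (δ • e)) (Y, Z)‖ ≤ A i := by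
      have hL : ‖δ • ContinuousLinearMap.id ℝ (Phase d × Phase d)‖ ≤ 1 := by
        refine ContinuousLinearMap.opNorm_le_bound _ zero_le_one fun e => ?_
        simp only [smul_apply, ContinuousLinearMap.id_apply, norm_smul, Real.norm_eq_abs]
        gcongr
      have := norm_iteratedFDeriv_comp_affine_le hχ.1 _ hL 0 i (Y, Z)
      simp only [zero_add, smul_apply, ContinuousLinearMap.id_apply] at this
      exact this.trans (hA i _)
    have := hA0 i
    gcongr
    exact hb (n - i) (by omega) Y Z ξ
  refine (Finset.sum_le_sum hterm).trans ?_
  rw [← Finset.sum_mul, mul_assoc, mul_assoc, mul_assoc]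
  gcongr
  exact Finset.single_le_sum (f := fun n => ∑ i ∈ Finset.range (n + 1), (n.choose i : ℝ) * A i)
    (fun n _ => Finset.sum_nonneg fun i _ => mul_nonneg (by positivity) (hA0 i))
    (by simpa using Nat.lt_succ_of_le hn)

theorem IsDouble.cutoff {M : ℝ} {p : ℕ} {F : Phase d × Phase d → ℂ} (hF : IsDouble M p F)
    {χ : Phase d × Phase d → ℂ} (hχ : BddDerivs χ) {δ : ℝ} (hδ : |δ| ≤ 1) :
    IsDouble M p (fun e => χ (δ • e) * F e) := by
  refine ⟨(hχ.1.comp (by fun_prop)).mul hF.1, fun N => ?_⟩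
  obtain ⟨c, hc, h⟩ := exists_doubleBound_cutoff hχ N
  obtain ⟨C, hC, hb⟩ := hF.2 N
  exact ⟨c * C, by positivity, h M p C F hC hF.1 hb δ hδ⟩

/-- Dominated convergence after regularization at one fixed K: the amplitudes of the cut-off
functions obey a common bound and converge pointwise. -/
theorem tendsto_oscInt_cutoff {G : KerArg d → ℂ} (hG : PGrowth kerWeight G) {M : ℝ} {p : ℕ}
    {F : Phase d × Phase d → ℂ} (hF : IsDouble M p F) {χ : Phase d × Phase d → ℂ}
    (hχ : BddDerivs χ) (P : Par d) :
    Tendsto (fun δ : ℝ => oscInt G (fun e => χ (δ • e) * F e) P) (𝓝 0) (𝓝 (χ 0 * oscInt G F P)) := by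
  obtain ⟨K, h1, h2⟩ := ((eventually_oscInt_eq hG p).and (eventually_adm_regKer hG p)).exists
  have hD := isDiffOp_thetaLap (d := d).iterate K
  obtain ⟨N', c', hc', hb'⟩ := hD.exists_doubleBound M p (p + 2 * d + 2)
  obtain ⟨c'', hc'', hb''⟩ := exists_doubleBound_cutoff hχ N'
  obtain ⟨C, hC, hb⟩ := hF.2 N'
  obtain ⟨c, q, hc, hA⟩ := h2.isAmplitude
  -- Clamping δ to [-1, 1] makes the amplitude bound valid for every δ, as `tendsto_oscOuter`
  -- requires, and changes nothing near 0.
  set r : ℝ → ℝ := fun δ => max (-1) (min δ 1) with hr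
  have hr1 : ∀ δ, |r δ| ≤ 1 := fun δ => abs_le.2 ⟨le_max_left _ _,
    max_le (by norm_num) (min_le_right _ _)⟩
  have hr0 : Tendsto r (𝓝 0) (𝓝 0) := by
    have : Continuous r := by fun_prop
    have h := this.tendsto 0
    simpa [hr] using h
  have hev : ∀ᶠ δ : ℝ in 𝓝 0, r δ = δ := by
    filter_upwards [Icc_mem_nhds (show (-1 : ℝ) < 0 by norm_num) (show (0 : ℝ) < 1 by norm_num)]
      with δ hδ
    simp only [hr, min_eq_left hδ.2, max_eq_right hδ.1]
  have hsm : ∀ δ : ℝ, ContDiff ℝ (⊤ : ℕ∞) fun e => χ (δ • e) * F e := fun δ =>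
    (hχ.1.comp (by fun_prop)).mul hF.1
  have hamp : ∀ δ : ℝ, IsAmplitude {P} (p + 2 * d + 1) p
      (c * (c' * (c'' * C)) * ((1 + ‖P.1‖) ^ q * japBracket P.2.2 ^ M))
      (ampl (regKer K G) (thetaLap^[K] fun e => χ (r δ • e) * F e)) := fun δ =>
    (hA M _ _ (by positivity) (hD.smooth (hsm _))
      (hb' _ _ (by positivity) (hsm _) (hb'' M p C F hC hF.1 hb _ (hr1 δ))) {P} _
        (by simp)).mono subset_rfl (by omega)
  have hlim := tendsto_oscOuter (l := 𝓝 (0 : ℝ)) (A₀ := ampl (regKer K G)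
    fun e => χ 0 * thetaLap^[K] F e) hamp fun θ w =>
      (((hD.tendsto_cutoff hχ.1 hF.1 (shiftPt (P, θ, w))).comp hr0).const_mul _)
  have hlim' := hlim.const_mul (((2 * Real.pi : ℝ) : ℂ)⁻¹ ^ (2 * d))
  have e : ((2 * Real.pi : ℝ) : ℂ)⁻¹ ^ (2 * d) * oscOuter (ampl (regKer K G)
      fun e => χ 0 * thetaLap^[K] F e) P = χ 0 * oscInt G F P := by
    rw [h1 M F hF]
    change _ * oscJ (regKer K G) (fun e => χ 0 * thetaLap^[K] F e) P = _
    rw [oscJ_const_mul_right]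
    ring
  rw [e] at hlim'
  refine hlim'.congr' ?_
  filter_upwards [hev] with δ hδ
  rw [h1 M _ (hF.cutoff hχ (δ := δ) (hδ ▸ hr1 δ)), hδ]
  rfl

end Cutoff

/-! ### Absolutely convergent oscillatory integrals -/

section Absolute

variable {d : ℕ}

/-- Functions of `(Y, Z)` all of whose derivatives are integrable in the momenta. -/
def ThetaDecay (F : Phase d × Phase d → ℂ) : Prop :=
  ContDiff ℝ (⊤ : ℕ∞) F ∧ ∀ vs : List (Phase d × Phase d), ∃ C : ℝ, ∀ e,
    ‖dirDerivs vs F e‖ ≤ C * intWeight (e.1.2, e.2.2)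

theorem ThetaDecay.diffOp {F : Phase d × Phase d → ℂ} (hF : ThetaDecay F)
    {D : (Phase d × Phase d → ℂ) → Phase d × Phase d → ℂ} (hD : IsDiffOp D) : ThetaDecay (D F) := by
  refine ⟨hD.smooth hF.1, fun vs => ?_⟩
  rw [hD.dirDerivs_comm hF.1]
  obtain ⟨L, hL⟩ := hD
  rw [hL _ (smooth_dirDerivs hF.1 vs)]
  clear hL
  induction L with
  | nil => exact ⟨0, fun e => by simp [_root_.diffOp]⟩
  | cons t L ih =>
    obtain ⟨C, hC⟩ := ih
    obtain ⟨C', hC'⟩ := hF.2 (t.2 ++ vs)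
    refine ⟨‖t.1‖ * C' + C, fun e => ?_⟩
    rw [diffOp_cons]
    refine (norm_add_le _ _).trans ?_
    rw [norm_mul, add_mul, mul_assoc]
    have := hC' e
    rw [dirDerivs_append] at this
    gcongr
    exact hC e

/-- The integral `∫ e^{-i⟨w,θ⟩} F(x - ε z / 2, ξ + η; x + ε y / 2, ξ + ζ) dθ`. -/
def thetaInt (F : Phase d × Phase d → ℂ) (P : Par d) (w : Phase d) : ℂ :=
  ∫ θ, oscKer w θ * F (shiftPt (P, θ, w))

theorem ThetaDecay.exists_norm_le {F : Phase d × Phase d → ℂ} (hF : ThetaDecay F) :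
    ∃ C : ℝ, ∀ (P : Par d) (θ w : Phase d),
      ‖F (shiftPt (P, θ, w))‖ ≤ C * intWeight ((P.2.2, P.2.2) + θ) := by
  obtain ⟨C, hC⟩ := hF.2 []
  exact ⟨C, fun P θ w => hC _⟩

theorem ThetaDecay.integrable {F : Phase d × Phase d → ℂ} (hF : ThetaDecay F) (P : Par d)
    (w : Phase d) : Integrable fun θ => oscKer w θ * F (shiftPt (P, θ, w)) := by
  obtain ⟨C, hC⟩ := hF.exists_norm_le
  have h1 : Continuous fun θ : Phase d => oscKer w θ := by
    unfold oscKer; fun_prop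
  have h0 : Continuous fun θ : Phase d => shiftPt (P, θ, w) := by
    unfold shiftPt; fun_prop
  have h2 : Continuous fun θ : Phase d => F (shiftPt (P, θ, w)) := hF.1.continuous.comp h0
  have h3 : Integrable fun θ : Phase d => C * intWeight ((P.2.2, P.2.2) + θ) :=
    ((integrable_intWeight d).comp_add_left (P.2.2, P.2.2)).const_mul C
  refine h3.mono' (h1.mul h2).aestronglyMeasurable (Eventually.of_forall fun θ => ?_)
  rw [norm_mul, norm_oscKer, one_mul]
  exact hC P θ w

theorem thetaInt_dirDeriv {F : Phase d × Phase d → ℂ} (hF : ThetaDecay F) (P : Par d)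
    (v w : Phase d) :
    thetaInt (dirDeriv (thetaDir v) F) P w = Complex.I * (pairL d w v : ℂ) * thetaInt F P w := by
  have hk : ∀ θ : Phase d, HasLineDerivAt ℝ (fun θ => oscKer w θ)
      (oscKer w θ * (-Complex.I * (pairL d w v : ℂ))) θ v := fun θ => by
    have := hasDerivAt_oscKer w θ v 0
    simpa [HasLineDerivAt] using this
  have hF' : ∀ θ : Phase d, HasLineDerivAt ℝ (fun θ => F (shiftPt (P, θ, w)))
      (dirDeriv (thetaDir v) F (shiftPt (P, θ, w))) θ v := fun θ => by
    have h1 : ∀ t : ℝ, shiftPt (P, θ + t • v, w) = shiftPt (P, θ, w) + t • thetaDir v := fun t => by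
      simp [shiftPt, thetaDir, add_assoc]
    have h2 : HasDerivAt (fun t : ℝ => shiftPt (P, θ, w) + t • thetaDir v) (thetaDir v) 0 := by
      simpa using ((hasDerivAt_id (0 : ℝ)).smul_const (thetaDir v)).const_add (shiftPt (P, θ, w))
    have h3 : HasFDerivAt F (fderiv ℝ F (shiftPt (P, θ, w)))
        (shiftPt (P, θ, w) + (0 : ℝ) • thetaDir v) := by
      simpa using (hF.1.differentiable (by simp) (shiftPt (P, θ, w))).hasFDerivAt
    have h4 := h3.comp_hasDerivAt (0 : ℝ) h2
    simp only [HasLineDerivAt, h1]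
    exact h4
  have h0 := hF.integrable P w
  have h1 := (hF.diffOp (isDiffOp_dirDeriv (thetaDir v))).integrable P w
  have h2 : Integrable fun θ => oscKer w θ * (-Complex.I * (pairL d w v : ℂ)) *
      F (shiftPt (P, θ, w)) := by
    refine (h0.const_mul (-Complex.I * (pairL d w v : ℂ))).congr (Eventually.of_forall fun θ => ?_)
    simp only; ring
  have key := integral_bilinear_hasLineDerivAt_right_eq_neg_left_of_integrable (μ := volume)
    (B := ContinuousLinearMap.mul ℝ ℂ) (v := v) h2 h1 h0 (fun θ _ => hk θ) (fun θ _ => hF' θ)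
  simp only [ContinuousLinearMap.mul_apply'] at key
  rw [thetaInt, key, thetaInt, ← integral_const_mul, ← integral_neg]
  refine integral_congr_ae (Eventually.of_forall fun θ => ?_)
  simp only; ring

theorem thetaInt_add {F F' : Phase d × Phase d → ℂ} (hF : ThetaDecay F) (hF' : ThetaDecay F')
    (P : Par d) (w : Phase d) :
    thetaInt (fun e => F e + F' e) P w = thetaInt F P w + thetaInt F' P w := by
  simp only [thetaInt, mul_add]
  exact integral_add (hF.integrable P w) (hF'.integrable P w)

theorem thetaInt_const_mul (c : ℂ) (F : Phase d × Phase d → ℂ) (P : Par d) (w : Phase d) :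
    thetaInt (fun e => c * F e) P w = c * thetaInt F P w := by
  simp only [thetaInt, ← integral_const_mul]
  congr 1; funext θ; ring

theorem ThetaDecay.add {F F' : Phase d × Phase d → ℂ} (hF : ThetaDecay F) (hF' : ThetaDecay F') :
    ThetaDecay (fun e => F e + F' e) := by
  refine ⟨hF.1.add hF'.1, fun vs => ?_⟩
  obtain ⟨C, hC⟩ := hF.2 vs
  obtain ⟨C', hC'⟩ := hF'.2 vs
  refine ⟨C + C', fun e => ?_⟩
  rw [dirDerivs_add hF.1 hF'.1, add_mul]
  exact (norm_add_le _ _).trans (add_le_add (hC e) (hC' e))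

theorem thetaDecay_zero : ThetaDecay (fun _ : Phase d × Phase d => 0) := by
  refine ⟨contDiff_const, fun vs => ⟨0, fun e => ?_⟩⟩
  rw [(isDiffOp_dirDerivs vs).map_zero]; simp

theorem thetaInt_sum {ι : Type*} (s : Finset ι) {F : ι → Phase d × Phase d → ℂ}
    (hF : ∀ i ∈ s, ThetaDecay (F i)) (P : Par d) (w : Phase d) :
    ThetaDecay (fun e => ∑ i ∈ s, F i e) ∧
      thetaInt (fun e => ∑ i ∈ s, F i e) P w = ∑ i ∈ s, thetaInt (F i) P w := by
  classical
  induction s using Finset.induction_on with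
  | empty => simpa [thetaInt] using thetaDecay_zero
  | insert a s ha ih =>
    simp only [Finset.sum_insert ha]
    obtain ⟨h1, h2⟩ := ih fun i hi => hF i (by simp [hi])
    exact ⟨(hF a (by simp)).add h1, by rw [thetaInt_add (hF a (by simp)) h1, h2]⟩

/-- Integration by parts in θ turns 1 - Δ_θ into multiplication by 1 + |y|² + |z|², exactly the
factor removed from the kernel by one step of regularization. -/
theorem thetaInt_thetaLap {F : Phase d × Phase d → ℂ} (hF : ThetaDecay F) (P : Par d)
    (w : Phase d) : thetaInt (thetaLap F) P w = (sqWeight w : ℂ) * thetaInt F P w := by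
  have hd : ∀ vs, ThetaDecay (dirDerivs vs F) := fun vs => hF.diffOp (isDiffOp_dirDerivs vs)
  have hterm : ∀ l ∈ (Finset.univ : Finset (Fin d)), ThetaDecay (fun e => (-1 : ℂ) *
      (dirDerivs [vecEta l, vecEta l] F e + dirDerivs [vecZeta l, vecZeta l] F e)) := fun l _ =>
    hF.diffOp (((isDiffOp_dirDerivs [vecEta l, vecEta l]).add
      (isDiffOp_dirDerivs [vecZeta l, vecZeta l])).const_mul (-1))
  have e : thetaLap F = fun e => F e + ∑ l : Fin d, (-1 : ℂ) * (dirDerivs [vecEta l, vecEta l] F e +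
    dirDerivs [vecZeta l, vecZeta l] F e) := rfl
  have h2 : ∀ v : Phase d, thetaInt (dirDerivs [thetaDir v, thetaDir v] F) P w =
      -(pairL d w v : ℂ) ^ 2 * thetaInt F P w := fun v => by
    change thetaInt (dirDeriv (thetaDir v) (dirDeriv (thetaDir v) F)) P w = _
    rw [thetaInt_dirDeriv (hF.diffOp (isDiffOp_dirDeriv _)), thetaInt_dirDeriv hF]
    linear_combination ((pairL d w v : ℂ) ^ 2 * thetaInt F P w) * Complex.I_sq
  rw [e, thetaInt_add hF (thetaInt_sum _ hterm P w).1, (thetaInt_sum _ hterm P w).2]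
  have h3 : ∀ l : Fin d, thetaInt (fun e => (-1 : ℂ) *
      (dirDerivs [vecEta l, vecEta l] F e + dirDerivs [vecZeta l, vecZeta l] F e)) P w =
      ((pairL d w (stdVec l, 0) : ℂ) ^ 2 + (pairL d w (0, stdVec l) : ℂ) ^ 2) * thetaInt F P w :=
    fun l => by
      rw [thetaInt_const_mul, thetaInt_add (hd _) (hd _)]
      have e1 := h2 (stdVec l, 0)
      have e2 := h2 (0, stdVec l)
      change thetaInt (dirDerivs [vecEta l, vecEta l] F) P w = _ at e1
      change thetaInt (dirDerivs [vecZeta l, vecZeta l] F) P w = _ at e2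
      rw [e1, e2]; ring
  simp only [h3]
  rw [← Finset.sum_mul, sqWeight, add_assoc, norm_sq_eq_sum_pairL]
  push_cast
  ring

theorem thetaInt_thetaLap_iterate {F : Phase d × Phase d → ℂ} (hF : ThetaDecay F) (P : Par d)
    (w : Phase d) (K : ℕ) :
    thetaInt (thetaLap^[K] F) P w = (sqWeight w : ℂ) ^ K * thetaInt F P w := by
  induction K with
  | zero => simp
  | succ K ih =>
    rw [Function.iterate_succ_apply', thetaInt_thetaLap (hF.diffOp (isDiffOp_thetaLap.iterate K)),
      ih, pow_succ]
    ring

/-- For functions decaying in the momenta the oscillatory integral is an iterated integral. -/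
theorem oscInt_eq_integral {G : KerArg d → ℂ} (hG : PGrowth kerWeight G) {M : ℝ} {p : ℕ}
    {F : Phase d × Phase d → ℂ} (hF : IsDouble M p F) (hF' : ThetaDecay F) (P : Par d) :
    oscInt G F P = ((2 * Real.pi : ℝ) : ℂ)⁻¹ ^ (2 * d) *
      ∫ w, G (P.2.1, (P.1, w)) * thetaInt F P w := by
  obtain ⟨K, h1, h2⟩ := ((eventually_oscInt_eq hG p).and (eventually_adm_regKer hG p)).exists
  have hD := isDiffOp_thetaLap (d := d).iterate K
  rw [h1 M F hF, oscJ, oscOuter]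
  congr 1
  simp only [oscInner]
  have hFD := hF'.diffOp hD
  obtain ⟨C, hC⟩ := hFD.exists_norm_le
  obtain ⟨hs, C', q, hC', hb⟩ := h2
  have hkb : ∀ w, ‖regKer K G (P.2.1, (P.1, w))‖ ≤ C' * (1 + ‖P.1‖) ^ q * intWeight w := fun w => by
    have := hb 0 (Nat.zero_le _) P.2.1 P.1 w
    rw [norm_iteratedFDeriv_zero] at this
    refine this.trans ?_
    rw [intWeight]
    have : 1 ≤ 1 + ‖w‖ := by linarith [norm_nonneg w]
    exact mul_le_mul_of_nonneg_left (inv_anti₀ (by positivity)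
      (pow_le_pow_right₀ this (by omega))) (by positivity)
  -- Fubini applies because F and its derivatives decay in θ while the regularized kernel decays in
  -- w. After the swap the K-th power of the weight cancels and the unregularized kernel remains.
  rw [integral_integral_swap]
  · refine integral_congr_ae (Eventually.of_forall fun w => ?_)
    have e1 : ∀ θ, oscKer w θ • ampl (regKer K G) (thetaLap^[K] F) (P, θ, w) =
        regKer K G (P.2.1, (P.1, w)) * (oscKer w θ * (thetaLap^[K] F) (shiftPt (P, θ, w))) :=
      fun θ => by simp only [ampl, kerPt_apply, smul_eq_mul]; ring
    simp only [e1]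
    rw [integral_const_mul]
    change _ * thetaInt (thetaLap^[K] F) P w = _
    rw [thetaInt_thetaLap_iterate hF', regKer, invWeight]
    have := sqWeight_ne_zero w
    field_simp
  · have hi : Integrable (fun u : Phase d × Phase d => (C * intWeight ((P.2.2, P.2.2) + u.1)) *
        (C' * (1 + ‖P.1‖) ^ q * intWeight u.2)) (volume.prod volume) :=
      Integrable.mul_prod (((integrable_intWeight d).comp_add_left (P.2.2, P.2.2)).const_mul C)
        ((integrable_intWeight d).const_mul _)
    refine Integrable.mono' hi ?_ (Eventually.of_forall fun u => ?_)
    · have h3 : Continuous fun u : Phase d × Phase d => oscKer u.2 u.1 := by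
        unfold oscKer; fun_prop
      have h4 : Continuous fun u : Phase d × Phase d =>
          ampl (regKer K G) (thetaLap^[K] F) (P, u.1, u.2) :=
        (smooth_ampl hs hFD.1).continuous.comp
          (by fun_prop : Continuous fun u : Phase d × Phase d => (P, u.1, u.2))
      exact (h3.smul h4).aestronglyMeasurable
    · simp only [Function.uncurry, norm_smul, norm_oscKer, one_mul, ampl, norm_mul, kerPt_apply]
      rw [mul_comm]
      exact mul_le_mul (hC P u.1 u.2) (hkb u.2) (norm_nonneg _) ((norm_nonneg _).trans (hC P u.1 u.2))

end Absolute

/-! ### Fourier inversion -/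

section Inversion

variable {V : Type*} [NormedAddCommGroup V] [InnerProductSpace ℝ V] [MeasurableSpace V]
  [BorelSpace V] [FiniteDimensional ℝ V]

open scoped FourierTransform in
/-- The Fourier inversion formula without `2π` in the exponents. -/
theorem fourier_inversion_two_pi {h : V → ℂ} (hc : Continuous h) (hi : Integrable h)
    (hi' : Integrable fun η => ∫ v, Complex.exp (-(Complex.I * (inner ℝ v η : ℝ))) * h v) (a : V) :
    ∫ η, Complex.exp (Complex.I * (inner ℝ a η : ℝ)) *
      ∫ v, Complex.exp (-(Complex.I * (inner ℝ v η : ℝ))) * h v =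
      ((2 * Real.pi : ℝ) : ℂ) ^ Module.finrank ℝ V * h a := by
  have hpi : (0 : ℝ) < 2 * Real.pi := by positivity
  have h1 : 𝓕 h = fun w => ∫ v, Complex.exp (-(Complex.I * (inner ℝ v ((2 * Real.pi) • w) : ℝ))) * h v := by
    funext w
    rw [Real.fourier_eq]
    refine integral_congr_ae (Eventually.of_forall fun v => ?_)
    simp only [Circle.smul_def, Real.fourierChar_apply, smul_eq_mul, real_inner_smul_right]
    congr 2
    push_cast; ring
  have h2 : Integrable (𝓕 h) := by
    rw [h1]
    exact hi'.comp_smul hpi.ne'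
  have h3 := hi.fourierInv_fourier_eq h2 hc.continuousAt (v := a)
  rw [Real.fourierInv_eq, h1] at h3
  have h4 := Measure.integral_comp_smul (volume : Measure V) (fun η => Complex.exp (Complex.I * (inner ℝ a η : ℝ)) *
      ∫ v, Complex.exp (-(Complex.I * (inner ℝ v η : ℝ))) * h v) (2 * Real.pi)
  rw [show (∫ x : V, Complex.exp (Complex.I * (inner ℝ a ((2 * Real.pi) • x) : ℝ)) *
      ∫ v, Complex.exp (-(Complex.I * (inner ℝ v ((2 * Real.pi) • x) : ℝ))) * h v) = h a from ?_] at h4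
  · rw [h4, abs_of_pos (by positivity), Complex.real_smul]
    push_cast
    have : ((2 : ℂ) * Real.pi) ≠ 0 := by
      simp [Real.pi_ne_zero]
    field_simp
  · rw [← h3]
    refine integral_congr_ae (Eventually.of_forall fun w => ?_)
    simp only [Circle.smul_def, Real.fourierChar_apply, smul_eq_mul, real_inner_smul_right]
    congr 2
    rw [real_inner_comm]
    push_cast; ring

end Inversion

/-! ### Rapidly decaying functions and the Weyl integral -/

section Rapid

/-- Smooth functions which decay rapidly together with all their derivatives. -/
def RapidDecay {V : Type*} [NormedAddCommGroup V] [NormedSpace ℝ V] (h : V → ℂ) : Prop :=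
  ContDiff ℝ (⊤ : ℕ∞) h ∧ ∀ n N : ℕ, ∃ C : ℝ, 0 ≤ C ∧
    ∀ x, ‖iteratedFDeriv ℝ n h x‖ ≤ C * ((1 + ‖x‖) ^ N)⁻¹

variable {V : Type*} [NormedAddCommGroup V] [NormedSpace ℝ V]

theorem SchwartzMap.rapidDecay (χ : SchwartzMap V ℂ) : RapidDecay (fun x => χ x) := by
  refine ⟨χ.smooth ⊤, fun n N => ?_⟩
  refine ⟨2 ^ N * (Finset.Iic (N, n)).sup (fun m => SchwartzMap.seminorm ℝ m.1 m.2) χ,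
    by positivity, fun x => ?_⟩
  have := SchwartzMap.one_add_le_sup_seminorm_apply (𝕜 := ℝ) (m := (N, n)) le_rfl le_rfl χ x
  rw [← div_eq_mul_inv, le_div_iff₀' (by positivity)]
  exact this

theorem SchwartzMap.rapidDecay_comp_smul (χ : SchwartzMap V ℂ) {δ : ℝ} (hδ : δ ≠ 0) :
    RapidDecay (fun x => χ (δ • x)) :=
  (SchwartzMap.compCLMOfContinuousLinearEquiv ℝ
    (ContinuousLinearEquiv.smulLeft (Units.mk0 δ hδ) : V ≃L[ℝ] V) χ).rapidDecay

theorem RapidDecay.mul {χ f : V → ℂ} (hχ : RapidDecay χ) (hf : PGrowth (fun x : V => 1 + ‖x‖) f) :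
    RapidDecay (fun x => χ x * f x) := by
  refine ⟨hχ.1.mul hf.1, fun n N => ?_⟩
  obtain ⟨B, q, hB, hb⟩ := hf.uniform (fun x => by linarith [norm_nonneg x]) n
  choose C hC hc using fun i : ℕ => hχ.2 i (N + q)
  refine ⟨∑ i ∈ Finset.range (n + 1), (n.choose i : ℝ) * C i * B, Finset.sum_nonneg fun i _ =>
    mul_nonneg (mul_nonneg (by positivity) (hC i)) hB, fun x => ?_⟩
  refine (norm_iteratedFDeriv_mul_le (𝕜 := ℝ) (N := ((⊤ : ℕ∞) : WithTop ℕ∞)) (n := n)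
    hχ.1 hf.1 x (by exact_mod_cast le_top)).trans ?_
  rw [Finset.sum_mul]
  refine Finset.sum_le_sum fun i _ => ?_
  have hCi := hC i
  calc _ ≤ (n.choose i : ℝ) * (C i * ((1 + ‖x‖) ^ (N + q))⁻¹) * (B * (1 + ‖x‖) ^ q) := by
        gcongr
        · exact hc i x
        · exact hb (n - i) (by omega) x
    _ = _ := by
        rw [pow_add, mul_inv]
        have : (1 + ‖x‖) ^ q ≠ 0 := by positivity
        field_simp

theorem RapidDecay.norm_le {h : V → ℂ} (hh : RapidDecay h) (N : ℕ) :
    ∃ C : ℝ, 0 ≤ C ∧ ∀ x, ‖h x‖ ≤ C * ((1 + ‖x‖) ^ N)⁻¹ := by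
  obtain ⟨C, hC, hb⟩ := hh.2 0 N
  exact ⟨C, hC, fun x => by simpa using hb x⟩

variable {d : ℕ}

/-- Peetre's inequality with base momentum 0, where the bracket equals 1. -/
theorem IsSymbol.pGrowth {ρ m : ℝ} (hρ : 0 ≤ ρ) {f : Phase d → ℂ} (hf : IsSymbol ρ m f) :
    PGrowth (fun X : Phase d => 1 + ‖X‖) f := by
  refine ⟨hf.1, fun n => ?_⟩
  obtain ⟨C, hC, hb⟩ := hf.exists_bound hρ n
  refine ⟨C, ⌈|m|⌉₊, fun X => (hb X).trans ?_⟩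
  have h1 := japBracket_rpow_le 0 X.2 m
  have h2 : japBracket (0 : Cfg d) = 1 := by simp [japBracket]
  rw [h2, Real.one_rpow, one_mul, sub_zero] at h1
  gcongr
  refine h1.trans ?_
  exact pow_le_pow_left₀ (by positivity) (add_le_add le_rfl (norm_snd_le X)) _

theorem norm_iteratedFDeriv_tensor_le {f g : Phase d → ℂ} (hf : ContDiff ℝ (⊤ : ℕ∞) f)
    (hg : ContDiff ℝ (⊤ : ℕ∞) g) (n : ℕ) (e : Phase d × Phase d) :
    ‖iteratedFDeriv ℝ n (fun e : Phase d × Phase d => f e.1 * g e.2) e‖ ≤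
      ∑ i ∈ Finset.range (n + 1), (n.choose i : ℝ) * ‖iteratedFDeriv ℝ i f e.1‖ *
        ‖iteratedFDeriv ℝ (n - i) g e.2‖ := by
  refine (norm_iteratedFDeriv_mul_le (𝕜 := ℝ) (N := ((⊤ : ℕ∞) : WithTop ℕ∞)) (n := n)
    (hf.comp contDiff_fst) (hg.comp contDiff_snd) e (by exact_mod_cast le_top)).trans ?_
  refine Finset.sum_le_sum fun i _ => ?_
  have h1 := norm_iteratedFDeriv_comp_affine_le hf (ContinuousLinearMap.fst ℝ (Phase d) (Phase d))
    (ContinuousLinearMap.norm_fst_le _ _ _) 0 i e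
  have h2 := norm_iteratedFDeriv_comp_affine_le hg (ContinuousLinearMap.snd ℝ (Phase d) (Phase d))
    (ContinuousLinearMap.norm_snd_le _ _ _) 0 (n - i) e
  simp only [zero_add] at h1 h2
  gcongr
  · exact h1
  · exact h2

theorem RapidDecay.tensor {f g : Phase d → ℂ} (hf : RapidDecay f) (hg : RapidDecay g) (n N : ℕ) :
    ∃ C : ℝ, 0 ≤ C ∧ ∀ e : Phase d × Phase d,
      ‖iteratedFDeriv ℝ n (fun e : Phase d × Phase d => f e.1 * g e.2) e‖ ≤
        C * (((1 + ‖e.1‖) ^ N)⁻¹ * ((1 + ‖e.2‖) ^ N)⁻¹) := by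
  choose C hC hc using fun i : ℕ => hf.2 i N
  choose C' hC' hc' using fun i : ℕ => hg.2 i N
  refine ⟨∑ i ∈ Finset.range (n + 1), (n.choose i : ℝ) * C i * C' (n - i),
    Finset.sum_nonneg fun i _ => mul_nonneg (mul_nonneg (by positivity) (hC i)) (hC' _), fun e => ?_⟩
  refine (norm_iteratedFDeriv_tensor_le hf.1 hg.1 n e).trans ?_
  rw [Finset.sum_mul]
  refine Finset.sum_le_sum fun i _ => ?_
  have hCi := hC i
  calc _ ≤ (n.choose i : ℝ) * (C i * ((1 + ‖e.1‖) ^ N)⁻¹) * (C' (n - i) * ((1 + ‖e.2‖) ^ N)⁻¹) := by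
        gcongr
        · exact hc i _
        · exact hc' _ _
    _ = _ := by ring

theorem one_add_norm_prod_le {A B : Type*} [NormedAddCommGroup A] [NormedAddCommGroup B] (a : A)
    (b : B) : 1 + ‖(a, b)‖ ≤ (1 + ‖a‖) * (1 + ‖b‖) := by
  have h1 := norm_nonneg a
  have h2 := norm_nonneg b
  have h3 : ‖(a, b)‖ ≤ ‖a‖ + ‖b‖ := by
    rw [Prod.norm_def]; exact max_le (by simp) (by simp)
  nlinarith [mul_nonneg h1 h2]

theorem RapidDecay.thetaDecay {f g : Phase d → ℂ} (hf : RapidDecay f) (hg : RapidDecay g) :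
    ThetaDecay (fun e : Phase d × Phase d => f e.1 * g e.2) := by
  have hs : ContDiff ℝ (⊤ : ℕ∞) (fun e : Phase d × Phase d => f e.1 * g e.2) :=
    (hf.1.comp contDiff_fst).mul (hg.1.comp contDiff_snd)
  refine ⟨hs, fun vs => ?_⟩
  obtain ⟨C, hC, hb⟩ := hf.tensor hg vs.length (2 * d + 1)
  refine ⟨C * ∏ i, ‖vs.get i‖, fun e => ?_⟩
  have h1 := iteratedFDeriv_apply_eq_dirDerivs hs vs.get e
  rw [List.ofFn_get] at h1
  rw [← h1]
  refine (ContinuousMultilinearMap.le_opNorm _ _).trans ?_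
  rw [mul_right_comm]
  gcongr
  refine (hb e).trans ?_
  rw [intWeight, ← mul_inv, ← mul_pow]
  gcongr
  refine (one_add_norm_prod_le e.1.2 e.2.2).trans ?_
  gcongr
  · exact norm_snd_le e.1
  · exact norm_snd_le e.2

theorem RapidDecay.bddDerivs_tensor {f g : Phase d → ℂ} (hf : RapidDecay f) (hg : RapidDecay g) :
    BddDerivs (fun e : Phase d × Phase d => f e.1 * g e.2) := by
  refine ⟨(hf.1.comp contDiff_fst).mul (hg.1.comp contDiff_snd), fun n => ?_⟩
  obtain ⟨C, hC, hb⟩ := hf.tensor hg n 0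
  exact ⟨C, fun x => by simpa using hb x⟩

theorem symplFourier_eq (f : Phase d → ℂ) (X : Phase d) : symplFourier f X =
    ((2 * Real.pi : ℝ) : ℂ)⁻¹ ^ d * ∫ Y : Phase d, oscKer Y ((-X.2, X.1) : Phase d) • f Y := by
  rw [symplFourier]
  congr 1
  refine integral_congr_ae (Eventually.of_forall fun Y => ?_)
  simp only [oscKer, smul_eq_mul, sympl, pairL_apply, inner_neg_right]
  congr 2
  rw [real_inner_comm, real_inner_comm X.1]
  push_cast; ring

theorem RapidDecay.integrable {f : Phase d → ℂ} (hf : RapidDecay f) : Integrable f := by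
  obtain ⟨C, hC, hb⟩ := hf.norm_le (2 * d + 1)
  exact ((integrable_intWeight d).const_mul C).mono' hf.1.continuous.aestronglyMeasurable
    (Eventually.of_forall hb)

theorem RapidDecay.symplFourier_le {f : Phase d → ℂ} (hf : RapidDecay f) (N : ℕ) :
    ∃ C : ℝ, 0 ≤ C ∧ ∀ X, ‖symplFourier f X‖ ≤ C * ((1 + ‖X‖) ^ N)⁻¹ := by
  obtain ⟨c, hc, h⟩ := norm_oscIntegral_le d N ℂ
  choose C hC hb using fun i : ℕ => hf.2 i (2 * d + 1)
  have hle : ∀ k ≤ N, C k ≤ ∑ i ∈ Finset.range (N + 1), C i := fun k hk =>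
    Finset.single_le_sum (f := C) (fun i _ => hC i) (by simpa using Nat.lt_succ_of_le hk)
  refine ⟨‖((2 * Real.pi : ℝ) : ℂ)⁻¹ ^ d‖ * (c * ∑ i ∈ Finset.range (N + 1), C i),
    mul_nonneg (norm_nonneg _) (mul_nonneg hc (Finset.sum_nonneg fun i _ => hC i)), fun X => ?_⟩
  have h1 := h f _ hf.1 (fun k hk w => (hb k w).trans (mul_le_mul_of_nonneg_right (hle k hk)
    (by positivity))) ((-X.2, X.1) : Phase d)
  have h2 : ‖((-X.2, X.1) : Phase d)‖ = ‖X‖ := by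
    rw [Prod.norm_def, Prod.norm_def, norm_neg, max_comm]
  rw [h2] at h1
  rw [symplFourier_eq, norm_mul, mul_assoc]
  gcongr
  rw [← div_eq_mul_inv, le_div_iff₀' (by positivity)]
  exact h1

theorem RapidDecay.continuous_symplFourier {f : Phase d → ℂ} (hf : RapidDecay f) :
    Continuous (symplFourier f) := by
  unfold symplFourier
  refine continuous_const.mul (continuous_of_dominated (bound := fun Y => ‖f Y‖) (fun X => ?_)
    (fun X => Eventually.of_forall fun Y => ?_) hf.integrable.norm
    (Eventually.of_forall fun Y => ?_))
  · have h1 : Continuous fun Y : Phase d => Complex.exp (Complex.I * (sympl X Y : ℂ)) := by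
      unfold sympl; fun_prop
    exact (h1.mul hf.1.continuous).aestronglyMeasurable
  · rw [norm_mul, mul_comm Complex.I, Complex.norm_exp_ofReal_mul_I, one_mul]
  · unfold sympl; fun_prop

theorem integrable_cfg (d : ℕ) : Integrable fun η : Cfg d => ((1 + ‖η‖) ^ (d + 1))⁻¹ := by
  have h := integrable_one_add_norm (E := Cfg d) (μ := volume) (r := ((d + 1 : ℕ) : ℝ)) (by
    simp)
  refine h.congr (Eventually.of_forall fun w => ?_)
  simp only
  rw [Real.rpow_neg (by positivity), Real.rpow_natCast]

theorem inv_pow_norm_snd (u : Phase d) (N : ℕ) : ((1 + ‖u‖) ^ N)⁻¹ ≤ ((1 + ‖u.2‖) ^ N)⁻¹ := by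
  gcongr
  exact norm_snd_le u

/-- Partial Fourier inversion in the momentum. -/
theorem RapidDecay.integral_symplFourier {f : Phase d → ℂ} (hf : RapidDecay f) (y a : Cfg d) :
    ∫ η, Complex.exp (-(Complex.I * (inner ℝ a η : ℝ))) * symplFourier f (y, η) =
      ∫ η, Complex.exp (-(Complex.I * (inner ℝ y η : ℝ))) * f (a, η) := by
  set φ : Cfg d → ℂ := fun v => ∫ η, Complex.exp (-(Complex.I * (inner ℝ y η : ℝ))) * f (v, η) with hφ
  obtain ⟨C, hC, hb⟩ := hf.norm_le (d + 1)
  have hnorm : ∀ r : ℝ, ‖Complex.exp (-(Complex.I * (r : ℂ)))‖ = 1 := fun r => by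
    rw [mul_comm, ← neg_mul, ← Complex.ofReal_neg, Complex.norm_exp_ofReal_mul_I]
  have hcont : Continuous φ := by
    refine continuous_of_dominated (bound := fun η => C * ((1 + ‖η‖) ^ (d + 1))⁻¹) (fun v => ?_)
      (fun v => Eventually.of_forall fun η => ?_) ((integrable_cfg d).const_mul C)
      (Eventually.of_forall fun η => ?_)
    · have h2 : Continuous fun η : Cfg d => f (v, η) := hf.1.continuous.comp (by fun_prop)
      exact ((by fun_prop : Continuous fun η : Cfg d =>
        Complex.exp (-(Complex.I * (inner ℝ y η : ℝ)))).mul h2).aestronglyMeasurable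
    · rw [norm_mul, hnorm, one_mul]
      exact (hb _).trans (mul_le_mul_of_nonneg_left (inv_pow_norm_snd (v, η) _) hC)
    · have h2 : Continuous fun v : Cfg d => f (v, η) := hf.1.continuous.comp (by fun_prop)
      exact continuous_const.mul h2
  have hint2 : Integrable (fun Y : Phase d => Complex.exp (-(Complex.I * (inner ℝ y Y.2 : ℝ))) * f Y)
      (volume.prod volume) := by
    refine hf.integrable.norm.mono' ?_ (Eventually.of_forall fun Y => ?_)
    · exact ((by fun_prop : Continuous fun Y : Phase d =>
        Complex.exp (-(Complex.I * (inner ℝ y Y.2 : ℝ)))).mul hf.1.continuous).aestronglyMeasurable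
    · rw [norm_mul, hnorm, one_mul]
  have hint : Integrable φ := hint2.integral_prod_left
  -- The function φ is the Fourier transform of f in the momentum only; transforming it in the
  -- position as well gives (2π)^d times the symplectic transform at (y, -η). Fourier inversion in
  -- the position therefore undoes half of the transform.
  have hsym : ∀ η : Cfg d, ∫ v, Complex.exp (-(Complex.I * (inner ℝ v η : ℝ))) * φ v =
      ((2 * Real.pi : ℝ) : ℂ) ^ d * symplFourier f (y, -η) := fun η => by
    have hpi : ((2 * Real.pi : ℝ) : ℂ) ≠ 0 := by
      exact_mod_cast (by positivity : (2 * Real.pi : ℝ) ≠ 0)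
    rw [symplFourier, ← mul_assoc, ← mul_pow, mul_inv_cancel₀ hpi, one_pow, one_mul,
      Measure.volume_eq_prod, integral_prod]
    · refine integral_congr_ae (Eventually.of_forall fun v => ?_)
      simp only [hφ]
      rw [← integral_const_mul]
      refine integral_congr_ae (Eventually.of_forall fun η' => ?_)
      simp only [sympl, inner_neg_left]
      rw [← mul_assoc, ← Complex.exp_add, real_inner_comm v η]
      congr 2
      push_cast; ring
    · refine hf.integrable.norm.mono' ?_ (Eventually.of_forall fun Y => ?_)
      · have h1 : Continuous fun Y : Phase d => Complex.exp (Complex.I * (sympl (y, -η) Y : ℂ)) := by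
          unfold sympl; fun_prop
        exact (h1.mul hf.1.continuous).aestronglyMeasurable
      · rw [norm_mul, mul_comm Complex.I, Complex.norm_exp_ofReal_mul_I, one_mul]
  have hi' : Integrable fun η => ∫ v, Complex.exp (-(Complex.I * (inner ℝ v η : ℝ))) * φ v := by
    simp only [hsym]
    refine Integrable.const_mul ?_ _
    obtain ⟨C', hC', hb'⟩ := hf.symplFourier_le (d + 1)
    refine ((integrable_cfg d).const_mul C').mono' ?_ (Eventually.of_forall fun η => ?_)
    · exact (hf.continuous_symplFourier.comp
        (by fun_prop : Continuous fun η : Cfg d => (y, -η))).aestronglyMeasurable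
    · refine (hb' _).trans (mul_le_mul_of_nonneg_left ?_ hC')
      have := inv_pow_norm_snd (y, -η) (d + 1)
      simpa using this
  have key := fourier_inversion_two_pi hcont hint hi' a
  simp only [hsym] at key
  -- The sign of η in the symplectic transform is removed by reflecting the integration variable.
  rw [← integral_neg_eq_self]
  have hpi : ((2 * Real.pi : ℝ) : ℂ) ^ d ≠ 0 :=
    pow_ne_zero _ (by exact_mod_cast (by positivity : (2 * Real.pi : ℝ) ≠ 0))
  have e1 : ∀ η : Cfg d, Complex.exp (Complex.I * (inner ℝ a η : ℝ)) *
      (((2 * Real.pi : ℝ) : ℂ) ^ d * symplFourier f (y, -η)) = ((2 * Real.pi : ℝ) : ℂ) ^ d *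
      (Complex.exp (-(Complex.I * (inner ℝ a (-η) : ℝ))) * symplFourier f (y, -η)) := fun η => by
    rw [inner_neg_right]
    push_cast
    rw [mul_neg, neg_neg]
    ring
  simp only [e1] at key
  rw [integral_const_mul, finrank_euclideanSpace_fin] at key
  exact mul_left_cancel₀ hpi key

/-- The exchange of the two middle factors preserves the product measure. -/
theorem measurePreserving_middle {α : Type*} [MeasureSpace α] [SigmaFinite (volume : Measure α)] :
    MeasurePreserving (fun q : (α × α) × (α × α) => ((q.1.1, q.2.1), (q.1.2, q.2.2))) := by
  have m1 : MeasurePreserving (MeasurableEquiv.prodAssoc : (α × α) × (α × α) ≃ᵐ α × (α × (α × α))) :=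
    volume_preserving_prodAssoc
  have a1 : MeasurePreserving (MeasurableEquiv.prodAssoc : (α × α) × α ≃ᵐ α × (α × α)) :=
    volume_preserving_prodAssoc
  have m2 := (MeasurePreserving.id (volume : Measure α)).prod a1.symm
  have m3 := (MeasurePreserving.id (volume : Measure α)).prod
    ((Measure.measurePreserving_swap (μ := (volume : Measure α)) (ν := (volume : Measure α))).prod
      (MeasurePreserving.id (volume : Measure α)))
  have m4 := (MeasurePreserving.id (volume : Measure α)).prod a1
  exact m1.symm.comp (m4.comp (m3.comp (m2.comp m1)))

/-- The exchange of the two middle factors as an equivalence. -/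
def middleEquiv (α : Type*) [MeasurableSpace α] : (α × α) × (α × α) ≃ᵐ (α × α) × (α × α) where
  toFun q := ((q.1.1, q.2.1), (q.1.2, q.2.2))
  invFun q := ((q.1.1, q.2.1), (q.1.2, q.2.2))
  left_inv _ := rfl
  right_inv _ := rfl
  measurable_toFun := by
    change Measurable fun q : (α × α) × (α × α) => ((q.1.1, q.2.1), (q.1.2, q.2.2))
    fun_prop
  measurable_invFun := by
    change Measurable fun q : (α × α) × (α × α) => ((q.1.1, q.2.1), (q.1.2, q.2.2))
    fun_prop

end Rapid

/-! ### The Weyl integral as an oscillatory integral -/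

section Weyl

variable {d : ℕ}

/-- The integrand of the Weyl integral. -/
theorem weyl_phase (ε : ℝ) (X Y Z : Phase d) :
    Complex.exp (Complex.I * (sympl X (Y + Z) : ℂ)) *
      Complex.exp (Complex.I * ((ε / 2 * sympl Y Z : ℝ) : ℂ)) =
    Complex.exp (Complex.I * (inner ℝ X.2 Y.1 : ℝ)) * Complex.exp (Complex.I * (inner ℝ X.2 Z.1 : ℝ)) *
      (Complex.exp (-(Complex.I * (inner ℝ (X.1 - (ε / 2) • Z.1) Y.2 : ℝ))) *
        Complex.exp (-(Complex.I * (inner ℝ (X.1 + (ε / 2) • Y.1) Z.2 : ℝ)))) := by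
  simp only [← Complex.exp_add]
  congr 1
  simp only [sympl, Prod.fst_add, Prod.snd_add, inner_add_right, inner_sub_left, inner_add_left,
    real_inner_smul_left]
  rw [real_inner_comm Y.2 Z.1]
  push_cast; ring

theorem norm_exp_I_mul_ofReal (r : ℝ) : ‖Complex.exp (Complex.I * (r : ℂ))‖ = 1 := by
  rw [mul_comm, Complex.norm_exp_ofReal_mul_I]

theorem norm_exp_neg_I_mul_ofReal (r : ℝ) : ‖Complex.exp (-(Complex.I * (r : ℂ)))‖ = 1 := by
  rw [mul_comm, ← neg_mul, ← Complex.ofReal_neg, Complex.norm_exp_ofReal_mul_I]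

/-- Translation of the momentum in a Fourier integral. -/
theorem exp_mul_integral_shift (h : Cfg d → ℂ) (y ξ : Cfg d) :
    Complex.exp (Complex.I * (inner ℝ ξ y : ℝ)) *
      ∫ η, Complex.exp (-(Complex.I * (inner ℝ y η : ℝ))) * h η =
    ∫ η, Complex.exp (-(Complex.I * (inner ℝ y η : ℝ))) * h (ξ + η) := by
  rw [← integral_add_left_eq_self _ ξ, ← integral_const_mul]
  refine integral_congr_ae (Eventually.of_forall fun η => ?_)
  simp only
  rw [← mul_assoc, ← Complex.exp_add, inner_add_right, real_inner_comm y ξ]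
  congr 2
  push_cast; ring

theorem thetaInt_tensor (f g : Phase d → ℂ) (P : Par d) (w : Phase d) :
    thetaInt (fun e => f e.1 * g e.2) P w =
      (∫ η, Complex.exp (-(Complex.I * (inner ℝ w.1 η : ℝ))) *
        f (P.2.1 - (P.1.1 / 2) • w.2, P.2.2 + η)) *
      ∫ ζ, Complex.exp (-(Complex.I * (inner ℝ w.2 ζ : ℝ))) *
        g (P.2.1 + (P.1.1 / 2) • w.1, P.2.2 + ζ) := by
  rw [thetaInt, Measure.volume_eq_prod, ← integral_prod_mul]
  refine integral_congr_ae (Eventually.of_forall fun θ => ?_)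
  simp only [oscKer, shiftPt, pairL_apply]
  rw [mul_mul_mul_comm, ← Complex.exp_add]
  congr 2
  push_cast; ring

theorem PGrowth.exists_frozen_le {G : KerArg d → ℂ} (hG : PGrowth kerWeight G) (τ : ℝ × ℝ) :
    ∃ (C : ℝ) (q : ℕ), 0 ≤ C ∧ ∀ x w, ‖G (x, (τ, w))‖ ≤ C * (1 + ‖w‖) ^ q := by
  obtain ⟨B, q, hB, hb⟩ := hG.uniform one_le_kerWeight 0
  refine ⟨B * (1 + ‖τ‖) ^ q, q, by positivity, fun x w => ?_⟩
  have h1 := hb 0 le_rfl (x, (τ, w))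
  rw [norm_iteratedFDeriv_zero] at h1
  refine h1.trans ?_
  rw [mul_assoc, ← mul_pow]
  gcongr
  · unfold kerWeight; positivity
  · exact one_add_norm_prod_le τ w

/-- For fixed (y, z) the phase splits into separate Fourier kernels in the two momenta, at the
positions x - εz/2 and x + εy/2. Partial Fourier inversion restores f and g at these positions, and
e^{iξ·y}, e^{iξ·z} translate their momenta by ξ. This is the origin of `shiftPt`. -/
theorem weylIntegral_eq_oscInt {G : KerArg d → ℂ} (hG : PGrowth kerWeight G) {f g : Phase d → ℂ}
    (hf : RapidDecay f) (hg : RapidDecay g) {M : ℝ} {p : ℕ}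
    (hF : IsDouble M p (fun e : Phase d × Phase d => f e.1 * g e.2)) (τ : ℝ × ℝ) (X : Phase d) :
    weylIntegral τ.1 (fun x y z => G (x, (τ, (y, z)))) f g X =
      oscInt G (fun e => f e.1 * g e.2) (τ, X) := by
  rw [oscInt_eq_integral hG hF (hf.thetaDecay hg), weylIntegral]
  congr 1
  set Φ : Phase d × Phase d → ℂ := fun q =>
    Complex.exp (Complex.I * (sympl X (q.1 + q.2) : ℂ)) *
      Complex.exp (Complex.I * ((τ.1 / 2 * sympl q.1 q.2 : ℝ) : ℂ)) *
      G (X.1, (τ, (q.1.1, q.2.1))) * symplFourier f q.1 * symplFourier g q.2 with hΦ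
  have hΦc : Continuous Φ := by
    have h1 : Continuous fun q : Phase d × Phase d =>
        Complex.exp (Complex.I * (sympl X (q.1 + q.2) : ℂ)) := by
      unfold sympl; fun_prop
    have h2 : Continuous fun q : Phase d × Phase d =>
        Complex.exp (Complex.I * ((τ.1 / 2 * sympl q.1 q.2 : ℝ) : ℂ)) := by
      unfold sympl; fun_prop
    have h3 : Continuous fun q : Phase d × Phase d => G (X.1, (τ, (q.1.1, q.2.1))) :=
      hG.1.continuous.comp (by fun_prop)
    exact (((h1.mul h2).mul h3).mul (hf.continuous_symplFourier.comp continuous_fst)).mul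
      (hg.continuous_symplFourier.comp continuous_snd)
  have hΦi : Integrable Φ := by
    obtain ⟨C, q, hC, hCb⟩ := hG.exists_frozen_le τ
    obtain ⟨C₁, hC₁, hb₁⟩ := hf.symplFourier_le (q + (2 * d + 1))
    obtain ⟨C₂, hC₂, hb₂⟩ := hg.symplFourier_le (q + (2 * d + 1))
    have hi : Integrable (fun u : Phase d × Phase d => (C * C₁ * intWeight u.1) *
        (C₂ * intWeight u.2)) (volume.prod volume) :=
      Integrable.mul_prod ((integrable_intWeight d).const_mul _)
        ((integrable_intWeight d).const_mul _)
    refine hi.mono' hΦc.aestronglyMeasurable (Eventually.of_forall fun u => ?_)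
    simp only [hΦ, norm_mul, norm_exp_I_mul_ofReal, one_mul]
    have h3 : (1 + ‖((u.1.1, u.2.1) : Phase d)‖) ^ q ≤ (1 + ‖u.1‖) ^ q * (1 + ‖u.2‖) ^ q := by
      rw [← mul_pow]
      have h4 := one_add_norm_prod_le u.1.1 u.2.1
      have h5 := norm_fst_le u.1
      have h6 := norm_fst_le u.2
      refine pow_le_pow_left₀ (by positivity) (h4.trans ?_) _
      gcongr
    calc _ ≤ (C * ((1 + ‖u.1‖) ^ q * (1 + ‖u.2‖) ^ q)) *
          (C₁ * ((1 + ‖u.1‖) ^ (q + (2 * d + 1)))⁻¹) *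
          (C₂ * ((1 + ‖u.2‖) ^ (q + (2 * d + 1)))⁻¹) := by
          gcongr
          · exact (hCb _ _).trans (mul_le_mul_of_nonneg_left h3 hC)
          · exact hb₁ _
          · exact hb₂ _
      _ = _ := by
          unfold intWeight
          rw [pow_add, pow_add]
          have h7 : (1 + ‖u.1‖) ≠ 0 := by positivity
          have h8 : (1 + ‖u.2‖) ≠ 0 := by positivity
          field_simp
          ring
  -- The variables are regrouped from ((y, η), (z, ζ)) to ((y, z), (η, ζ)), so that the momenta are
  -- integrated first.
  have hmid : MeasurePreserving (middleEquiv (Cfg d)) := measurePreserving_middle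
  have hΦi' : Integrable (fun q => Φ (middleEquiv (Cfg d) q)) := hmid.integrable_comp_of_integrable hΦi
  calc _ = ∫ q, Φ q := by
        rw [Measure.volume_eq_prod (Phase d) (Phase d)]
        exact (integral_prod Φ hΦi).symm
    _ = ∫ q, Φ (middleEquiv (Cfg d) q) :=
        (hmid.integral_comp (middleEquiv (Cfg d)).measurableEmbedding Φ).symm
    _ = ∫ w, ∫ θ, Φ (middleEquiv (Cfg d) (w, θ)) := by
        rw [Measure.volume_eq_prod (Phase d) (Phase d)]
        exact integral_prod _ hΦi'
    _ = _ := by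
        refine integral_congr_ae (Eventually.of_forall fun w => ?_)
        simp only
        rw [thetaInt_tensor]
        have e1 : ∀ θ : Phase d, Φ (middleEquiv (Cfg d) (w, θ)) =
            (G (X.1, (τ, w)) * (Complex.exp (Complex.I * (inner ℝ X.2 w.1 : ℝ)) *
              Complex.exp (Complex.I * (inner ℝ X.2 w.2 : ℝ)))) *
            ((Complex.exp (-(Complex.I * (inner ℝ (X.1 - (τ.1 / 2) • w.2) θ.1 : ℝ))) *
                symplFourier f (w.1, θ.1)) *
              (Complex.exp (-(Complex.I * (inner ℝ (X.1 + (τ.1 / 2) • w.1) θ.2 : ℝ))) *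
                symplFourier g (w.2, θ.2))) := fun θ => by
          change Φ ((w.1, θ.1), (w.2, θ.2)) = _
          simp only [hΦ]
          rw [weyl_phase]
          ring
        simp only [e1]
        rw [integral_const_mul, Measure.volume_eq_prod (Cfg d) (Cfg d), integral_prod_mul
          (fun η => Complex.exp (-(Complex.I * (inner ℝ (X.1 - (τ.1 / 2) • w.2) η : ℝ))) *
                symplFourier f (w.1, η))
          (fun η => Complex.exp (-(Complex.I * (inner ℝ (X.1 + (τ.1 / 2) • w.1) η : ℝ))) *
                symplFourier g (w.2, η)),
          hf.integral_symplFourier, hg.integral_symplFourier,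
          ← exp_mul_integral_shift (fun η => f (X.1 - (τ.1 / 2) • w.2, η)),
          ← exp_mul_integral_shift (fun η => g (X.1 + (τ.1 / 2) • w.1, η))]
        ring

/-- The oscillatory Weyl integral exists and is given by the regularized integral. -/
theorem isOscIntegral_oscInt {G : KerArg d → ℂ} (hG : PGrowth kerWeight G) {ρ m₁ m₂ : ℝ}
    (hρ : 0 ≤ ρ) {f g : Phase d → ℂ} (hf : IsSymbol ρ m₁ f) (hg : IsSymbol ρ m₂ g)
    (τ : ℝ × ℝ) (X : Phase d) :
    IsOscIntegral τ.1 (fun x y z => G (x, (τ, (y, z)))) f g X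
      (oscInt G (fun e => f e.1 * g e.2) (τ, X)) := by
  intro χ₁ χ₂ h₁ h₂
  have hF := isDouble_tensor hρ hf hg
  have hχ : BddDerivs (fun e : Phase d × Phase d => χ₁ e.1 * χ₂ e.2) :=
    χ₁.rapidDecay.bddDerivs_tensor χ₂.rapidDecay
  have h := (tendsto_oscInt_cutoff hG hF hχ (τ, X)).mono_left
    (nhdsWithin_le_nhds (s := Set.Ioi (0 : ℝ)))
  have e0 : (χ₁ ((0 : Phase d × Phase d).1) * χ₂ ((0 : Phase d × Phase d).2)) = 1 := by
    simp [h₁, h₂]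
  rw [e0, one_mul] at h
  refine h.congr' ?_
  filter_upwards [Ioc_mem_nhdsGT (zero_lt_one' ℝ)] with δ hδ
  have hδ' : δ ≠ 0 := hδ.1.ne'
  have r1 := (χ₁.rapidDecay_comp_smul hδ').mul (hf.pGrowth hρ)
  have r2 := (χ₂.rapidDecay_comp_smul hδ').mul (hg.pGrowth hρ)
  have e1 : (fun e : Phase d × Phase d => χ₁ (δ • e).1 * χ₂ (δ • e).2 * (f e.1 * g e.2)) =
      fun e => (χ₁ (δ • e.1) * f e.1) * (χ₂ (δ • e.2) * g e.2) := by
    funext e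
    simp only [Prod.smul_fst, Prod.smul_snd]; ring
  simp only [e1]
  have hF' := hF.cutoff hχ (δ := δ) (by rw [abs_of_pos hδ.1]; exact hδ.2)
  rw [e1] at hF'
  exact (weylIntegral_eq_oscInt hG r1 r2 hF' τ X).symm

theorem exists_schwartz_eq_one (V : Type*) [NormedAddCommGroup V] [NormedSpace ℝ V]
    [FiniteDimensional ℝ V] : ∃ χ : SchwartzMap V ℂ, χ 0 = 1 := by
  let φ : ContDiffBump (0 : V) := ⟨1, 2, one_pos, one_lt_two⟩
  have h : HasCompactSupport fun x => (φ x : ℂ) := φ.hasCompactSupport.comp_left Complex.ofReal_zero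
  refine ⟨h.toSchwartzMap (Complex.ofRealCLM.contDiff.comp φ.contDiff), ?_⟩
  change ((φ 0 : ℝ) : ℂ) = 1
  rw [φ.one_of_mem_closedBall (by simp [φ]), Complex.ofReal_one]

/-- Uniqueness of limits, once some Schwartz cutoff equal to 1 at the origin exists; without one
every number would satisfy the defining property. -/
theorem oscIntegral_eq {ε : ℝ} {G : Cfg d → Cfg d → Cfg d → ℂ} {f g : Phase d → ℂ} {X : Phase d}
    {L : ℂ} (h : IsOscIntegral ε G f g X L) : oscIntegral ε G f g X = L := by
  obtain ⟨χ, hχ⟩ := exists_schwartz_eq_one (Phase d)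
  have h' : IsOscIntegral ε G f g X (oscIntegral ε G f g X) :=
    Classical.epsilon_spec (p := fun L => IsOscIntegral ε G f g X L) ⟨L, h⟩
  exact tendsto_nhds_unique (h' χ χ hχ hχ) (h χ χ hχ hχ)


/-! ### The diagonal value at `ε = 0` -/

theorem hasCompactSupport_dirDerivs {V : Type*} [NormedAddCommGroup V] [NormedSpace ℝ V]
    {F : V → ℂ} (hF : HasCompactSupport F) (vs : List V) : HasCompactSupport (dirDerivs vs F) := by
  induction vs with
  | nil => exact hF
  | cons v vs ih =>
    rw [dirDerivs_cons]
    exact (ih.fderiv (𝕜 := ℝ)).comp_left (g := fun L : V →L[ℝ] ℂ => L v) rfl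

theorem thetaDecay_of_hasCompactSupport {F : Phase d × Phase d → ℂ} (hs : ContDiff ℝ (⊤ : ℕ∞) F)
    (hF : HasCompactSupport F) : ThetaDecay F := by
  refine ⟨hs, fun vs => ?_⟩
  have hc : Continuous fun e : Phase d × Phase d =>
      (((1 + ‖((e.1.2, e.2.2) : Phase d)‖) ^ (2 * d + 1) : ℝ) : ℂ) * dirDerivs vs F e :=
    (by fun_prop : Continuous fun e : Phase d × Phase d =>
      (((1 + ‖((e.1.2, e.2.2) : Phase d)‖) ^ (2 * d + 1) : ℝ) : ℂ)).mul
      (smooth_dirDerivs hs vs).continuous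
  obtain ⟨C, hC⟩ := (hasCompactSupport_dirDerivs hF vs).mul_left.exists_bound_of_continuous hc
  refine ⟨C, fun e => ?_⟩
  have h1 : ‖(((1 + ‖((e.1.2, e.2.2) : Phase d)‖) ^ (2 * d + 1) : ℝ) : ℂ) * dirDerivs vs F e‖ ≤ C :=
    hC e
  have h2 : (0 : ℝ) < (1 + ‖((e.1.2, e.2.2) : Phase d)‖) ^ (2 * d + 1) := by positivity
  rw [norm_mul, Complex.norm_real, Real.norm_of_nonneg h2.le] at h1
  rw [intWeight, ← div_eq_mul_inv, le_div_iff₀' h2]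
  exact h1

theorem RapidDecay.of_hasCompactSupport {V : Type*} [NormedAddCommGroup V] [NormedSpace ℝ V]
    {h : V → ℂ} (hs : ContDiff ℝ (⊤ : ℕ∞) h) (hh : HasCompactSupport h) : RapidDecay h :=
  (hh.toSchwartzMap hs).rapidDecay

theorem oscKer_comm (w θ : Phase d) : oscKer w θ = oscKer θ w := by
  simp only [oscKer, pairL_apply, real_inner_comm]

/-- Fourier inversion at the origin for the pairing of phase space with itself. -/
theorem RapidDecay.integral_oscKer {h : Phase d → ℂ} (hh : RapidDecay h) :
    ∫ w, ∫ θ, oscKer w θ * h θ = ((2 * Real.pi : ℝ) : ℂ) ^ (2 * d) * h 0 := by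
  -- Phase space carries the maximum norm; its Euclidean version is an inner product space whose
  -- inner product is the pairing `pairL`, so the inversion formula applies there.
  let E := WithLp 2 (Cfg d × Cfg d)
  have hmp : MeasurePreserving (MeasurableEquiv.toLp 2 (Cfg d × Cfg d)).symm :=
    WithLp.volume_preserving_ofLp _ _
  have hcE : Continuous (WithLp.ofLp : E → Phase d) := WithLp.prod_continuous_ofLp 2 _ _
  have e1 : ∀ η : E, ∫ v : E, Complex.exp (-(Complex.I * (inner ℝ v η : ℝ))) * h (WithLp.ofLp v) =
      ∫ θ, oscKer (WithLp.ofLp η) θ * h θ := fun η => by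
    rw [← hmp.integral_comp' (fun θ => oscKer (WithLp.ofLp η) θ * h θ)]
    refine integral_congr_ae (Eventually.of_forall fun v => ?_)
    simp only [oscKer, pairL_apply]
    rw [real_inner_comm η v, WithLp.prod_inner_apply]
    rfl
  have hi' : Integrable fun w : Phase d => ∫ θ, oscKer w θ * h θ := by
    obtain ⟨c, hc, hb⟩ := norm_oscIntegral_le d (2 * d + 1) ℂ
    choose C hC hCb using fun n : ℕ => hh.2 n (2 * d + 1)
    have hd := hb h (∑ i ∈ Finset.range (2 * d + 2), C i) hh.1 fun k hk w => (hCb k w).trans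
      (mul_le_mul_of_nonneg_right (Finset.single_le_sum (f := C) (fun i _ => hC i)
        (Finset.mem_range.2 (by omega))) (by positivity))
    refine ((integrable_intWeight d).const_mul (c * ∑ i ∈ Finset.range (2 * d + 2), C i)).mono'
      (Continuous.aestronglyMeasurable ?_) (Eventually.of_forall fun w => ?_)
    · refine continuous_of_dominated (bound := fun θ => ‖h θ‖) (fun w => ?_)
        (fun w => Eventually.of_forall fun θ => ?_) hh.integrable.norm
        (Eventually.of_forall fun θ => ?_)
      · have : Continuous fun θ : Phase d => oscKer w θ := by
          unfold oscKer; fun_prop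
        exact (this.mul hh.1.continuous).aestronglyMeasurable
      · rw [norm_mul, norm_oscKer, one_mul]
      · unfold oscKer; fun_prop
    · rw [intWeight, ← div_eq_mul_inv, le_div_iff₀' (by positivity)]
      simp only [oscKer_comm w]
      exact hd w
  have key := fourier_inversion_two_pi (V := E) (h := fun v => h (WithLp.ofLp v))
    (hh.1.continuous.comp hcE) ((hmp.integrable_comp_emb
      (MeasurableEquiv.toLp 2 (Cfg d × Cfg d)).symm.measurableEmbedding).2 hh.integrable) (by
      simp only [e1]
      exact (hmp.integrable_comp_emb
        (MeasurableEquiv.toLp 2 (Cfg d × Cfg d)).symm.measurableEmbedding).2 hi') 0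
  simp only [e1, inner_zero_left, Complex.ofReal_zero, mul_zero, Complex.exp_zero, one_mul] at key
  have e2 := hmp.integral_comp' (fun w => ∫ θ, oscKer w θ * h θ)
  rw [← e2]
  refine Eq.trans key ?_
  congr 2
  simp [Module.finrank_prod, two_mul, E, (WithLp.linearEquiv 2 ℝ (Cfg d × Cfg d)).finrank_eq]

/-- At `ε = 0` the oscillatory integral with constant kernel restricts to the diagonal. -/
theorem oscInt_one {M : ℝ} {p : ℕ} {F : Phase d × Phase d → ℂ} (hF : IsDouble M p F)
    (lam : ℝ) (X : Phase d) : oscInt (fun _ => 1) F ((0, lam), X) = F (X, X) := by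
  let φ : ContDiffBump (0 : Phase d × Phase d) := ⟨1, 2, one_pos, one_lt_two⟩
  let χ : Phase d × Phase d → ℂ := fun e => (φ e : ℂ)
  have hχs : ContDiff ℝ (⊤ : ℕ∞) χ := Complex.ofRealCLM.contDiff.comp φ.contDiff
  have hχc : HasCompactSupport χ := φ.hasCompactSupport.comp_left Complex.ofReal_zero
  have hχ : BddDerivs χ := ⟨hχs, fun n => by
    obtain ⟨C, -, hb⟩ := (RapidDecay.of_hasCompactSupport hχs hχc).2 n 0
    exact ⟨C, fun x => by simpa using hb x⟩⟩
  have hχ0 : χ 0 = 1 := by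
    change ((φ 0 : ℝ) : ℂ) = 1
    rw [φ.one_of_mem_closedBall (by simp [φ]), Complex.ofReal_one]
  have h1 := (tendsto_oscInt_cutoff (pGrowth_const (σ := kerWeight) (1 : ℂ)) hF hχ
    ((0, lam), X)).mono_left (nhdsWithin_le_nhds (s := Set.Ioi (0 : ℝ)))
  rw [hχ0, one_mul] at h1
  have h2 : Tendsto (fun δ : ℝ => χ (δ • (X, X)) * F (X, X)) (𝓝[>] 0) (𝓝 (F (X, X))) := by
    have hc : Continuous fun δ : ℝ => χ (δ • (X, X)) * F (X, X) :=
      (hχs.continuous.comp (by fun_prop)).mul continuous_const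
    have := (hc.tendsto 0).mono_left (nhdsWithin_le_nhds (s := Set.Ioi (0 : ℝ)))
    simpa [hχ0] using this
  refine tendsto_nhds_unique h1 (h2.congr' ?_)
  filter_upwards [Ioc_mem_nhdsGT (zero_lt_one' ℝ)] with δ hδ
  have hs : ContDiff ℝ (⊤ : ℕ∞) fun e => χ (δ • e) * F e := (hχs.comp (by fun_prop)).mul hF.1
  have hc : HasCompactSupport fun e => χ (δ • e) * F e := by
    refine HasCompactSupport.mul_right ?_
    exact hχc.comp_smul hδ.1.ne'
  have hF' := hF.cutoff hχ (δ := δ) (by rw [abs_of_pos hδ.1]; exact hδ.2)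
  rw [oscInt_eq_integral (pGrowth_const _) hF' (thetaDecay_of_hasCompactSupport hs hc)]
  -- At ε = 0 the shifted point no longer depends on w. The θ-integral is thus the Fourier transform
  -- of one fixed function, and integrating it over w gives (2π)^{2d} times the value at θ = 0,
  -- which is the point (X, X).
  let ι : Phase d → Phase d × Phase d := fun θ => ((X.1, X.2 + θ.1), (X.1, X.2 + θ.2))
  have hι : Isometry ι := Isometry.of_dist_eq fun a b => by
    simp [ι, Prod.dist_eq]
  have hιs : ContDiff ℝ (⊤ : ℕ∞) ι := by
    unfold ι; fun_prop
  have hr : RapidDecay fun θ => χ (δ • ι θ) * F (ι θ) :=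
    RapidDecay.of_hasCompactSupport (hs.comp hιs) (hc.comp_isClosedEmbedding hι.isClosedEmbedding)
  have e1 : ∀ w, thetaInt (fun e => χ (δ • e) * F e) ((0, lam), X) w =
      ∫ θ, oscKer w θ * (χ (δ • ι θ) * F (ι θ)) := fun w => by
    simp [thetaInt, shiftPt, ι]
  simp only [one_mul, e1]
  rw [hr.integral_oscKer, ← mul_assoc, ← mul_pow, inv_mul_cancel₀, one_pow, one_mul]
  · simp [ι]
  · exact_mod_cast (by positivity : (2 * Real.pi : ℝ) ≠ 0)

end Weyl

/-! ### Smooth parametric integrals -/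

section Parametric

variable {E F : Type} [NormedAddCommGroup E] [NormedSpace ℝ E] [NormedAddCommGroup F]
  [NormedSpace ℝ F]

/-- The derivative of `A` in its second argument. -/
def sndDeriv (A : ℝ × E → F) (p : ℝ × E) : E →L[ℝ] F :=
  (fderiv ℝ A p).comp (ContinuousLinearMap.inr ℝ ℝ E)

theorem contDiff_sndDeriv {A : ℝ × E → F} (hA : ContDiff ℝ (⊤ : ℕ∞) A) :
    ContDiff ℝ (⊤ : ℕ∞) (sndDeriv A) :=
  (hA.fderiv_right (m := ((⊤ : ℕ∞) : WithTop ℕ∞)) (by simp)).clm_comp contDiff_const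

theorem PGrowth.sndDeriv {σ : ℝ × E → ℝ} {A : ℝ × E → F} (hA : PGrowth σ A) :
    PGrowth σ (sndDeriv A) :=
  hA.fderiv.clm_comp ((ContinuousLinearMap.compL ℝ E (ℝ × E) F).flip (ContinuousLinearMap.inr ℝ ℝ E))

variable [FiniteDimensional ℝ E]

theorem hasFDerivAt_integral_smooth {A : ℝ × E → F} (hA : ContDiff ℝ (⊤ : ℕ∞) A) (e : E) :
    HasFDerivAt (fun e => ∫ t in (0 : ℝ)..1, A (t, e)) (∫ t in (0 : ℝ)..1, sndDeriv A (t, e)) e := by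
  have hA' := contDiff_sndDeriv hA
  have hK : IsCompact (Set.Icc (0 : ℝ) 1 ×ˢ Metric.closedBall e 1) :=
    isCompact_Icc.prod (isCompact_closedBall e 1)
  obtain ⟨C, hC⟩ := hK.exists_bound_of_continuousOn hA'.continuous.continuousOn
  have hm : ∀ e' : E, Continuous fun t : ℝ => A (t, e') := fun e' =>
    hA.continuous.comp (by fun_prop)
  have hm' : Continuous fun t : ℝ => _root_.sndDeriv A (t, e) := hA'.continuous.comp (by fun_prop)
  refine (intervalIntegral.hasFDerivAt_integral_of_dominated_of_fderiv_le (μ := volume)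
    (F' := fun e t => _root_.sndDeriv A (t, e)) (bound := fun _ => C) (Metric.closedBall_mem_nhds e one_pos)
    (Eventually.of_forall fun e' => (hm e').aestronglyMeasurable)
    ((hm e).intervalIntegrable 0 1) hm'.aestronglyMeasurable ?_ intervalIntegrable_const ?_)
  · refine Eventually.of_forall fun t ht e' he' => ?_
    rw [Set.uIoc_of_le zero_le_one] at ht
    exact hC (t, e') ⟨⟨ht.1.le, ht.2⟩, he'⟩
  · refine Eventually.of_forall fun t _ e' _ => ?_
    exact ((hA.differentiable (by simp) (t, e')).hasFDerivAt).comp e'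
      (hasFDerivAt_prodMk_right t e')

theorem contDiff_integral_smooth {A : ℝ × E → F} (hA : ContDiff ℝ (⊤ : ℕ∞) A) :
    ContDiff ℝ (⊤ : ℕ∞) (fun e => ∫ t in (0 : ℝ)..1, A (t, e)) := by
  refine contDiff_infty.2 fun n => ?_
  induction n generalizing F with
  | zero =>
    rw [Nat.cast_zero, contDiff_zero]
    exact continuous_iff_continuousAt.2 fun e => (hasFDerivAt_integral_smooth hA e).continuousAt
  | succ n ih =>
    rw [Nat.cast_add, Nat.cast_one, contDiff_succ_iff_hasFDerivAt]
    exact ⟨_, ih (contDiff_sndDeriv hA), hasFDerivAt_integral_smooth hA⟩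

/-- Differentiation under the integral gives an integral of the same type with values in linear
maps, so the induction on the order runs over all target spaces. On [0,1] the weight in the
integration variable is at most 2. -/
theorem pGrowth_integral {σ : E → ℝ} (hσ : ∀ e, 1 ≤ σ e) {A : ℝ × E → F}
    (hA : PGrowth (fun p : ℝ × E => (1 + ‖p.1‖) * σ p.2) A) :
    PGrowth σ (fun e => ∫ t in (0 : ℝ)..1, A (t, e)) := by
  refine ⟨contDiff_integral_smooth hA.1, fun n => ?_⟩
  induction n generalizing F with
  | zero =>
    have hσ' : ∀ p : ℝ × E, 1 ≤ (1 + ‖p.1‖) * σ p.2 := fun p =>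
      one_le_mul_of_one_le_of_one_le (by linarith [norm_nonneg p.1]) (hσ _)
    obtain ⟨C, q, hC, hb⟩ := hA.uniform hσ' 0
    refine ⟨C * 2 ^ q, q, fun e => ?_⟩
    rw [norm_iteratedFDeriv_zero]
    refine (intervalIntegral.norm_integral_le_of_norm_le_const (C := C * 2 ^ q * σ e ^ q)
      fun t ht => ?_).trans (by simp)
    rw [Set.uIoc_of_le zero_le_one] at ht
    have h1 := hb 0 le_rfl (t, e)
    rw [norm_iteratedFDeriv_zero] at h1
    refine h1.trans ?_
    rw [mul_pow, ← mul_assoc]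
    have h2 : ‖t‖ ≤ 1 := by rw [Real.norm_of_nonneg ht.1.le]; exact ht.2
    have h3 := zero_le_one.trans (hσ e)
    have h4 : 1 + ‖t‖ ≤ 2 := by linarith
    gcongr
  | succ n ih =>
    obtain ⟨C, q, hb⟩ := ih hA.sndDeriv
    refine ⟨C, q, fun e => ?_⟩
    rw [← norm_iteratedFDeriv_fderiv]
    have : fderiv ℝ (fun e => ∫ t in (0 : ℝ)..1, A (t, e)) =
        fun e => ∫ t in (0 : ℝ)..1, _root_.sndDeriv A (t, e) :=
      funext fun e => (hasFDerivAt_integral_smooth hA.1 e).fderiv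
    rw [this]
    exact hb e

end Parametric

/-! ### The scaled flux -/

section Flux

variable {d : ℕ}

theorem IsBCInfty.pGrowth {b : Cfg d → ℝ} (hb : IsBCInfty b) : PGrowth (fun _ => (1 : ℝ)) b :=
  ⟨hb.1, fun n => by
    obtain ⟨C, hC⟩ := hb.2 n
    exact ⟨C, 0, fun x => by simpa using hC x⟩⟩

/-- The mean of `b` over the triangle with corners `x - (y+z)/2, x + (y-z)/2, x + (y+z)/2`
(with total mass `1/2`). -/
def triMean (b : Cfg d → ℝ) (p : Cfg d × Phase d) : ℝ :=
  ∫ u in (0 : ℝ)..1, ∫ s in (0 : ℝ)..1,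
    u * b (p.1 + (u - 1 / 2) • p.2.1 + (u * s - 1 / 2) • p.2.2)

/-- The weight `1 + ‖w‖` on pairs `(x, w)`. -/
def posWeight (p : Cfg d × Phase d) : ℝ := 1 + ‖p.2‖

theorem one_le_posWeight (p : Cfg d × Phase d) : 1 ≤ posWeight p := by
  unfold posWeight; linarith [norm_nonneg p.2]

/-- Growth occurs in w only. Since b and its derivatives are bounded, the position x in its argument
needs no weight, and the chain rule costs only the polynomial coefficients in the integration
variables and the factors of w. -/
theorem pGrowth_triMean {b : Cfg d → ℝ} (hb : IsBCInfty b) : PGrowth posWeight (triMean b) := by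
  have hσ1 : ∀ p : ℝ × (Cfg d × Phase d), 1 ≤ (1 + ‖p.1‖) * posWeight p.2 := fun p =>
    one_le_mul_of_one_le_of_one_le (by linarith [norm_nonneg p.1]) (one_le_posWeight _)
  have hσ2 : ∀ p : ℝ × (ℝ × (Cfg d × Phase d)),
      1 ≤ (1 + ‖p.1‖) * ((1 + ‖p.2.1‖) * posWeight p.2.2) := fun p =>
    one_le_mul_of_one_le_of_one_le (by linarith [norm_nonneg p.1]) (hσ1 _)
  refine pGrowth_integral one_le_posWeight (A := fun q : ℝ × (Cfg d × Phase d) =>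
    ∫ s in (0 : ℝ)..1, q.1 * b (q.2.1 + (q.1 + -(1 / 2)) • q.2.2.1 + (q.1 * s + -(1 / 2)) • q.2.2.2)) ?_
  refine pGrowth_integral hσ1 (A := fun q : ℝ × (ℝ × (Cfg d × Phase d)) =>
    q.2.1 * b (q.2.2.1 + (q.2.1 + -(1 / 2)) • q.2.2.2.1 + (q.2.1 * q.1 + -(1 / 2)) • q.2.2.2.2)) ?_
  set σ : ℝ × (ℝ × (Cfg d × Phase d)) → ℝ := fun p =>
    (1 + ‖p.1‖) * ((1 + ‖p.2.1‖) * posWeight p.2.2) with hσ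
  have hs : PGrowth σ (fun q : ℝ × (ℝ × (Cfg d × Phase d)) => q.1) :=
    pGrowth_clm (ContinuousLinearMap.fst ℝ ℝ (ℝ × (Cfg d × Phase d))) ⟨1, 1, fun q => by
      have h1 := hσ1 q.2
      have h2 := norm_nonneg q.1
      simp only [hσ, ContinuousLinearMap.coe_fst', one_mul, pow_one]
      nlinarith⟩
  have hu : PGrowth σ (fun q : ℝ × (ℝ × (Cfg d × Phase d)) => q.2.1) :=
    pGrowth_clm ((ContinuousLinearMap.fst ℝ ℝ (Cfg d × Phase d)).comp
      (ContinuousLinearMap.snd ℝ ℝ (ℝ × (Cfg d × Phase d)))) ⟨1, 1, fun q => by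
        have h1 := one_le_posWeight q.2.2
        have h2 := norm_nonneg q.1
        have h3 := norm_nonneg q.2.1
        have h4 : 1 + ‖q.2.1‖ ≤ (1 + ‖q.2.1‖) * posWeight q.2.2 := by nlinarith
        simp only [hσ, ContinuousLinearMap.comp_apply, ContinuousLinearMap.coe_fst',
          ContinuousLinearMap.coe_snd', one_mul, pow_one]
        nlinarith⟩
  have hw : PGrowth σ (fun q : ℝ × (ℝ × (Cfg d × Phase d)) => q.2.2.2) :=
    pGrowth_clm ((ContinuousLinearMap.snd ℝ (Cfg d) (Phase d)).comp
      ((ContinuousLinearMap.snd ℝ ℝ (Cfg d × Phase d)).comp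
        (ContinuousLinearMap.snd ℝ ℝ (ℝ × (Cfg d × Phase d)))))
      ⟨1, 1, fun q => by
        have h2 := norm_nonneg q.1
        have h3 := norm_nonneg q.2.1
        have h5 := norm_nonneg q.2.2.2
        have h4 : posWeight q.2.2 ≤ (1 + ‖q.2.1‖) * posWeight q.2.2 := by
          have := one_le_posWeight q.2.2
          nlinarith
        simp only [hσ, ContinuousLinearMap.comp_apply, ContinuousLinearMap.coe_snd', one_mul,
          pow_one]
        have : ‖q.2.2.2‖ ≤ posWeight q.2.2 := by unfold posWeight; linarith
        nlinarith⟩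
  have hx : PGrowthDeriv σ (fun q : ℝ × (ℝ × (Cfg d × Phase d)) => q.2.2.1) :=
    pGrowthDeriv_clm ((ContinuousLinearMap.fst ℝ (Cfg d) (Phase d)).comp
      ((ContinuousLinearMap.snd ℝ ℝ (Cfg d × Phase d)).comp
        (ContinuousLinearMap.snd ℝ ℝ (ℝ × (Cfg d × Phase d)))))
  have hy : PGrowth σ (fun q : ℝ × (ℝ × (Cfg d × Phase d)) => q.2.2.2.1) :=
    hw.clm_comp (ContinuousLinearMap.fst ℝ _ _)
  have hz : PGrowth σ (fun q : ℝ × (ℝ × (Cfg d × Phase d)) => q.2.2.2.2) :=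
    hw.clm_comp (ContinuousLinearMap.snd ℝ _ _)
  have h1 : PGrowth σ (fun q : ℝ × (ℝ × (Cfg d × Phase d)) => (q.2.1 + -(1 / 2)) • q.2.2.2.1) := by
    exact (hu.add hσ2 (pGrowth_const (-(1 / 2) : ℝ))).smul hσ2 hy
  have h2 : PGrowth σ (fun q : ℝ × (ℝ × (Cfg d × Phase d)) =>
      (q.2.1 * q.1 + -(1 / 2)) • q.2.2.2.2) := by
    exact ((hu.smul hσ2 hs).add hσ2 (pGrowth_const (-(1 / 2) : ℝ))).smul hσ2 hz
  have h3 := ((hx.add hσ2 h1.deriv_growth).add hσ2 h2.deriv_growth)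
  have h4 := hb.pGrowth.comp hσ2 (fun _ => le_rfl) h3 (A := 1) (r := 0) (fun q => by simp)
  exact hu.smul hσ2 h4

/-- The substitution v = us replaces the triangle by a fixed square, where differentiation under the
integral is available. -/
theorem intervalIntegral_triangle (h : ℝ → ℝ → ℝ) :
    ∫ u in (0 : ℝ)..1, ∫ v in (0 : ℝ)..u, h u v =
      ∫ u in (0 : ℝ)..1, ∫ s in (0 : ℝ)..1, u * h u (u * s) := by
  refine intervalIntegral.integral_congr fun u _ => ?_
  rw [intervalIntegral.integral_const_mul, intervalIntegral.mul_integral_comp_mul_left]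
  simp

theorem intervalIntegral_sum_sum {ι κ : Type*} [Fintype ι] [Fintype κ] (c : ι → κ → ℝ)
    {h : ι → κ → ℝ → ℝ} (hh : ∀ k l, Continuous (h k l)) :
    ∫ t in (0 : ℝ)..1, ∑ k, ∑ l, c k l * h k l t = ∑ k, ∑ l, c k l * ∫ t in (0 : ℝ)..1, h k l t := by
  rw [intervalIntegral.integral_finsetSum fun k _ => Continuous.intervalIntegrable (by fun_prop) _ _]
  refine Finset.sum_congr rfl fun k _ => ?_
  rw [intervalIntegral.integral_finsetSum fun l _ => Continuous.intervalIntegrable (by fun_prop) _ _]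
  simp only [intervalIntegral.integral_const_mul]

/-- The edges used in the parametrization are εy and εz, so the two-form contributes ε² y_k z_l and
the prefactor 1/ε leaves one power of ε. The remaining mean depends on ε and w through εw alone,
which is what makes the two countings of orders possible. -/
theorem scaledFlux_eq {B : Fin d → Fin d → Cfg d → ℝ} (hB : ∀ k l, Continuous (B k l)) (ε : ℝ)
    (x y z : Cfg d) : scaledFlux B ε x y z =
      ε * ∑ k, ∑ l, y k * z l * triMean (B k l) (x, ε • ((y, z) : Phase d)) := by
  rcases eq_or_ne ε 0 with rfl | hε
  · simp [scaledFlux]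
  have ha : x + (ε / 2) • (y - z) - (x - (ε / 2) • (y + z)) = ε • y := by
    module
  have hb : x + (ε / 2) • (y + z) - (x + (ε / 2) • (y - z)) = ε • z := by
    module
  have hpt : ∀ u s : ℝ, x - (ε / 2) • (y + z) + u • ε • y + (u * s) • ε • z =
      x + (u - 1 / 2) • ε • y + (u * s - 1 / 2) • ε • z := fun u s => by
    module
  have hc : ∀ k l, Continuous fun q : ℝ × ℝ =>
      q.1 * B k l (x + (q.1 - 1 / 2) • ε • y + (q.1 * q.2 - 1 / 2) • ε • z) := fun k l =>
    continuous_fst.mul ((hB k l).comp (by fun_prop))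
  have hc1 : ∀ k l (u : ℝ), Continuous fun s : ℝ =>
      u * B k l (x + (u - 1 / 2) • ε • y + (u * s - 1 / 2) • ε • z) := fun k l u =>
    (hc k l).comp (by fun_prop : Continuous fun s : ℝ => (u, s))
  have hc2 : ∀ k l, Continuous fun u : ℝ => ∫ s in (0 : ℝ)..1,
      u * B k l (x + (u - 1 / 2) • ε • y + (u * s - 1 / 2) • ε • z) := fun k l =>
    intervalIntegral.continuous_parametric_intervalIntegral_of_continuous' (hc k l) 0 1
  rw [scaledFlux, flux, ha, hb, intervalIntegral_triangle]
  have e1 : ∀ u s : ℝ, u * ∑ k, ∑ l, B k l (x - (ε / 2) • (y + z) + u • ε • y + (u * s) • ε • z) *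
      (ε • y) k * (ε • z) l = ∑ k, ∑ l, (ε ^ 2 * (y k * z l)) *
        (u * B k l (x + (u - 1 / 2) • ε • y + (u * s - 1 / 2) • ε • z)) := fun u s => by
    simp only [hpt, Finset.mul_sum, PiLp.smul_apply, smul_eq_mul]
    refine Finset.sum_congr rfl fun k _ => Finset.sum_congr rfl fun l _ => ?_
    ring
  simp only [e1]
  simp only [fun u => intervalIntegral_sum_sum (fun k l => ε ^ 2 * (y k * z l)) fun k l => hc1 k l u]
  rw [intervalIntegral_sum_sum (fun k l => ε ^ 2 * (y k * z l)) hc2]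
  simp only [Finset.mul_sum]
  refine Finset.sum_congr rfl fun k _ => Finset.sum_congr rfl fun l _ => ?_
  have key : ∀ a I : ℝ, ε⁻¹ * (ε ^ 2 * a * I) = ε * (a * I) := fun a I => by field_simp
  exact key _ _

end Flux

/-! ### Kernels depending on `ε` through `ε w` -/

section EpsKernels

variable {d : ℕ}

/-- The map `(x, ((ε, λ), w)) ↦ (x, ε w)`. -/
def scalePt (a : KerArg d) : Cfg d × Phase d := (a.1, a.2.1.1 • a.2.2)

theorem pGrowthDeriv_scalePt : PGrowthDeriv kerWeight (scalePt (d := d)) := by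
  have hx : PGrowthDeriv kerWeight (fun a : KerArg d => ((a.1, 0) : Cfg d × Phase d)) :=
    pGrowthDeriv_clm ((ContinuousLinearMap.inl ℝ (Cfg d) (Phase d)).comp
      (ContinuousLinearMap.fst ℝ (Cfg d) ((ℝ × ℝ) × Phase d)))
  have hs : PGrowth kerWeight (fun a : KerArg d => a.2) :=
    pGrowth_clm (ContinuousLinearMap.snd ℝ (Cfg d) ((ℝ × ℝ) × Phase d)) ⟨1, 1, fun a => by
      simp [kerWeight]⟩
  have hw : PGrowth kerWeight (fun a : KerArg d => a.2.2) :=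
    hs.clm_comp (ContinuousLinearMap.snd ℝ (ℝ × ℝ) (Phase d))
  have he : PGrowth kerWeight (fun a : KerArg d => a.2.1.1) :=
    hs.clm_comp ((ContinuousLinearMap.fst ℝ ℝ ℝ).comp (ContinuousLinearMap.fst ℝ (ℝ × ℝ) (Phase d)))
  have h1 := ((he.smul one_le_kerWeight hw).clm_comp
    (ContinuousLinearMap.inr ℝ (Cfg d) (Phase d))).deriv_growth
  have h2 := hx.add one_le_kerWeight h1
  have e : (scalePt (d := d)) = fun a => ((a.1, 0) : Cfg d × Phase d) +
      ContinuousLinearMap.inr ℝ (Cfg d) (Phase d) (a.2.1.1 • a.2.2) := by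
    funext a; simp [scalePt]
  rw [e]
  exact h2

theorem posWeight_scalePt_le (a : KerArg d) : posWeight (scalePt a) ≤ 1 * kerWeight a ^ 2 := by
  have h1 : ‖a.2.1.1‖ ≤ ‖a.2‖ := (norm_fst_le a.2.1).trans (norm_fst_le a.2)
  have h2 : ‖a.2.2‖ ≤ ‖a.2‖ := norm_snd_le a.2
  simp only [posWeight, scalePt, kerWeight, norm_smul]
  nlinarith [norm_nonneg a.2.1.1, norm_nonneg a.2.2, norm_nonneg a.2,
    mul_le_mul h1 h2 (norm_nonneg _) (norm_nonneg _)]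

theorem PGrowth.scale {b : Cfg d × Phase d → ℂ} (hb : PGrowth posWeight b) :
    PGrowth kerWeight (fun a : KerArg d => b (scalePt a)) :=
  hb.comp one_le_kerWeight one_le_posWeight pGrowthDeriv_scalePt posWeight_scalePt_le

/-- Sums of products of `r` linear functions of `w` and a function of `(x, ε w)`. -/
inductive EKer : ℕ → (KerArg d → ℂ) → Prop
  | base {b : Cfg d × Phase d → ℂ} (hb : PGrowth posWeight b) : EKer 0 (fun a => b (scalePt a))
  | mulW {r : ℕ} {G : KerArg d → ℂ} (v : Phase d) (hG : EKer r G) : EKer (r + 1) (mulW v G)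
  | add {r : ℕ} {G G' : KerArg d → ℂ} (hG : EKer r G) (hG' : EKer r G') :
      EKer r (fun a => G a + G' a)

theorem EKer.wKer {r : ℕ} {G : KerArg d → ℂ} (hG : EKer r G) : WKer r G := by
  induction hG with
  | base hb => exact .base hb.scale
  | mulW v _ ih => exact ih.mulW v
  | add _ _ ih ih' => exact ih.add ih'

theorem EKer.pGrowth {r : ℕ} {G : KerArg d → ℂ} (hG : EKer r G) : PGrowth kerWeight G :=
  hG.wKer.pGrowth

theorem EKer.zero : ∀ r : ℕ, EKer r (fun _ : KerArg d => 0)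
  | 0 => .base (b := fun _ => 0) (pGrowth_const 0)
  | r + 1 => by
    have h := (EKer.zero r).mulW (0 : Phase d)
    rwa [show _root_.mulW (0 : Phase d) (fun _ : KerArg d => (0 : ℂ)) = fun _ => 0 from
      funext fun a => mul_zero _] at h

theorem EKer.sum {r : ℕ} {ι : Type*} (s : Finset ι) {G : ι → KerArg d → ℂ}
    (h : ∀ i ∈ s, EKer r (G i)) : EKer r (fun a => ∑ i ∈ s, G i a) := by
  classical
  induction s using Finset.induction_on with
  | empty => simpa using EKer.zero r
  | insert a s ha ih =>
    simp only [Finset.sum_insert ha]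
    exact (h a (by simp)).add (ih fun i hi => h i (by simp [hi]))

theorem EKer.mul_base {r : ℕ} {G : KerArg d → ℂ} (hG : EKer r G) {b : Cfg d × Phase d → ℂ}
    (hb : PGrowth posWeight b) : EKer r (fun a => b (scalePt a) * G a) := by
  induction hG with
  | base hb' => exact .base (hb.mul one_le_posWeight hb')
  | @mulW r G v _ ih =>
    have : (fun a => b (scalePt a) * _root_.mulW v G a) =
        _root_.mulW v (fun a => b (scalePt a) * G a) := by
      funext a; simp only [_root_.mulW]; ring
    rw [this]
    exact ih.mulW v
  | add _ _ ih ih' =>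
    simp only [mul_add]
    exact ih.add ih'

theorem EKer.mul {r s : ℕ} {G H : KerArg d → ℂ} (hG : EKer r G) (hH : EKer s H) :
    EKer (r + s) (fun a => G a * H a) := by
  induction hG with
  | base hb => rw [zero_add]; exact hH.mul_base hb
  | @mulW r G v _ ih =>
    have : (fun a => _root_.mulW v G a * H a) = _root_.mulW v (fun a => G a * H a) := by
      funext a; simp only [_root_.mulW]; ring
    rw [this, add_right_comm]
    exact ih.mulW v
  | add _ _ ih ih' =>
    simp only [add_mul]
    exact ih.add ih'

theorem EKer.const {c : ℂ} : EKer 0 (fun _ : KerArg d => c) :=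
  .base (b := fun _ => c) (pGrowth_const c)

theorem EKer.const_mul {r : ℕ} {G : KerArg d → ℂ} (hG : EKer r G) (c : ℂ) :
    EKer r (fun a => c * G a) :=
  hG.mul_base (b := fun _ => c) (pGrowth_const c)

theorem EKer.pow {r : ℕ} {G : KerArg d → ℂ} (hG : EKer r G) (k : ℕ) :
    EKer (k * r) (fun a => G a ^ k) := by
  induction k with
  | zero => simpa using EKer.const
  | succ k ih =>
    simp only [pow_succ]
    rw [add_mul, one_mul]
    exact ih.mul hG

/-- The direction of `ε`, respectively `λ`, in the space of parameters. -/
def epsDir (d : ℕ) : Par d := ((1, 0), 0)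
def lamDir (d : ℕ) : Par d := ((0, 1), 0)

theorem hasFDerivAt_scalePt_eps (a : KerArg d) {b : Cfg d × Phase d → ℂ}
    (hb : ContDiff ℝ (⊤ : ℕ∞) b) : dirDeriv (kerDir (epsDir d)) (fun a => b (scalePt a)) a =
      fderiv ℝ b (scalePt a) (0, a.2.2) := by
  have h1 : HasDerivAt (fun t : ℝ => scalePt (a + t • kerDir (epsDir d))) (0, a.2.2) 0 := by
    have e : (fun t : ℝ => scalePt (a + t • kerDir (epsDir d))) =
        fun t : ℝ => scalePt a + t • ((0, a.2.2) : Cfg d × Phase d) := by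
      funext t
      simp [scalePt, kerDir, epsDir, add_smul]
    rw [e]
    simpa using ((hasDerivAt_id (0 : ℝ)).smul_const ((0, a.2.2) : Cfg d × Phase d)).const_add (scalePt a)
  have hs : ContDiff ℝ (⊤ : ℕ∞) (fun a : KerArg d => b (scalePt a)) :=
    hb.comp pGrowthDeriv_scalePt.1
  have h2 : HasDerivAt (fun t : ℝ => a + t • kerDir (epsDir d)) (kerDir (epsDir d)) 0 := by
    simpa using ((hasDerivAt_id (0 : ℝ)).smul_const (kerDir (epsDir d))).const_add a
  have h3 : HasFDerivAt (fun a : KerArg d => b (scalePt a))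
      (fderiv ℝ (fun a : KerArg d => b (scalePt a)) a) (a + (0 : ℝ) • kerDir (epsDir d)) := by
    rw [zero_smul, add_zero]
    exact (hs.differentiable (by simp) a).hasFDerivAt
  have h4 := h3.comp_hasDerivAt (0 : ℝ) h2
  have h5 : HasFDerivAt b (fderiv ℝ b (scalePt a)) (scalePt (a + (0 : ℝ) • kerDir (epsDir d))) := by
    rw [zero_smul, add_zero]
    exact (hb.differentiable (by simp) _).hasFDerivAt
  exact h4.unique (h5.comp_hasDerivAt (0 : ℝ) h1)

/-- The ε-derivative of b(x, εw) is w · ∇b with the gradient in the second slot, still evaluated at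
(x, εw). Hence each ε-derivative produces exactly one more linear factor of w. -/
theorem EKer.dirDeriv_eps {r : ℕ} {G : KerArg d → ℂ} (hG : EKer r G) :
    EKer (r + 1) (dirDeriv (kerDir (epsDir d)) G) := by
  induction hG with
  | @base b hb =>
    have e : dirDeriv (kerDir (epsDir d)) (fun a => b (scalePt a)) = fun a => ∑ l : Fin d,
        (_root_.mulW (stdVec l, 0) (fun a => dirDeriv ((0, (stdVec l, 0)) : Cfg d × Phase d) b
            (scalePt a)) a +
          _root_.mulW (0, stdVec l) (fun a => dirDeriv ((0, (0, stdVec l)) : Cfg d × Phase d) b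
            (scalePt a)) a) := by
      funext a
      rw [hasFDerivAt_scalePt_eps a hb.1]
      have h : ((0, a.2.2) : Cfg d × Phase d) = ∑ l : Fin d,
          (a.2.2.1 l • ((0, (stdVec l, 0)) : Cfg d × Phase d) +
            a.2.2.2 l • ((0, (0, stdVec l)) : Cfg d × Phase d)) := by
        have h1 := stdVec_sum a.2.2.1
        have h2 := stdVec_sum a.2.2.2
        refine Prod.ext ?_ (Prod.ext ?_ ?_)
        · simp [Prod.fst_sum]
        · simp only [Prod.snd_sum, Prod.fst_sum]
          simpa using h1.symm
        · simp only [Prod.snd_sum]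
          simpa using h2.symm
      rw [h, map_sum]
      refine Finset.sum_congr rfl fun l _ => ?_
      simp only [map_add, map_smul, _root_.mulW, pairL_left, pairL_right, dirDeriv, Complex.real_smul]
    rw [e]
    exact .sum _ fun l _ => ((EKer.base (hb.dirDeriv _)).mulW _).add ((EKer.base (hb.dirDeriv _)).mulW _)
  | mulW u hG ih =>
    rw [dirDeriv_mulW hG.pGrowth.1]
    simpa [kerDir, epsDir] using ih.mulW u
  | add hG hG' ih ih' =>
    rw [dirDeriv_add hG.pGrowth.1 hG'.pGrowth.1]
    exact ih.add ih'

theorem EKer.dirDerivs_eps {r : ℕ} {G : KerArg d → ℂ} (hG : EKer r G) (n : ℕ) :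
    EKer (r + n) (dirDerivs (List.replicate n (kerDir (epsDir d))) G) := by
  induction n with
  | zero => exact hG
  | succ n ih => exact ih.dirDeriv_eps

variable {B : Fin d → Fin d → Cfg d → ℝ}

/-- The scaled flux as a function of kernel arguments. -/
def fluxKer (B : Fin d → Fin d → Cfg d → ℝ) (a : KerArg d) : ℂ :=
  scaledFlux B a.2.1.1 a.1 a.2.2.1 a.2.2.2

/-- The scaled flux divided by `ε`. -/
def redFluxKer (B : Fin d → Fin d → Cfg d → ℝ) (a : KerArg d) : ℂ :=
  ∑ k, ∑ l, (a.2.2.1 k : ℂ) * a.2.2.2 l * triMean (B k l) (scalePt a)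

theorem fluxKer_eq (hB : ∀ k l, IsBCInfty (B k l)) (a : KerArg d) :
    fluxKer B a = a.2.1.1 * redFluxKer B a := by
  rw [fluxKer, scaledFlux_eq fun k l => (hB k l).1.continuous, redFluxKer]
  push_cast
  rfl

/-- With ε split off, the flux keeps both free factors y_k and z_l; this counting trades a power of
ε for one extra order ρ. -/
theorem eKer_redFluxKer (hB : ∀ k l, IsBCInfty (B k l)) : EKer 2 (redFluxKer B) := by
  refine .sum _ fun k _ => .sum _ fun l _ => ?_
  have h := ((EKer.base (pGrowth_triMean (hB k l)).ofReal).mulW (0, stdVec l)).mulW (stdVec k, 0)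
  have e : (fun a : KerArg d => (a.2.2.1 k : ℂ) * a.2.2.2 l * triMean (B k l) (scalePt a)) =
      mulW (stdVec k, 0) (mulW (0, stdVec l) fun a => (triMean (B k l) (scalePt a) : ℂ)) := by
    funext a
    simp only [mulW, pairL_left, pairL_right, mul_assoc]
  rw [e]
  exact h

/-- The factor ε is absorbed into εz_l, which is a function of (x, εw) of polynomial growth. Only
y_k remains as a free factor, so γ^k gains kρ without using up any power of ε. -/
theorem eKer_fluxKer (hB : ∀ k l, IsBCInfty (B k l)) : EKer 1 (fluxKer B) := by
  have e : fluxKer B = fun a => ∑ k, ∑ l, mulW (stdVec k, 0) (fun a =>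
      (((scalePt a).2.2 l : ℝ) : ℂ) * triMean (B k l) (scalePt a)) a := by
    funext a
    rw [fluxKer_eq hB, redFluxKer, Finset.mul_sum]
    refine Finset.sum_congr rfl fun k _ => ?_
    rw [Finset.mul_sum]
    refine Finset.sum_congr rfl fun l _ => ?_
    simp only [mulW, pairL_left, scalePt, Prod.smul_snd, PiLp.smul_apply, smul_eq_mul]
    push_cast; ring
  rw [e]
  refine .sum _ fun k _ => .sum _ fun l _ => EKer.mulW _ ?_
  have h1 : PGrowth posWeight (fun p : Cfg d × Phase d => p.2.2 l) :=
    pGrowth_clm ((EuclideanSpace.proj l : Cfg d →L[ℝ] ℝ).comp ((ContinuousLinearMap.snd ℝ (Cfg d) (Cfg d)).comp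
      (ContinuousLinearMap.snd ℝ (Cfg d) (Phase d)))) ⟨1, 1, fun p => by
        have h2 : ‖p.2.2 l‖ ≤ ‖p.2.2‖ := PiLp.norm_apply_le p.2.2 l
        have h3 := norm_snd_le p.2
        change ‖p.2.2 l‖ ≤ 1 * (1 + ‖p.2‖) ^ 1
        linarith⟩
  exact EKer.base (b := fun p => ((p.2.2 l : ℝ) : ℂ) * triMean (B k l) p)
    (h1.ofReal.mul one_le_posWeight (pGrowth_triMean (hB k l)).ofReal)

end EpsKernels

/-! ### Families of symbols -/

section Families

variable {d : ℕ} {ρ : ℝ} {T T' : Type*}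

/-- Families of smooth functions whose symbol seminorms of order `m t` are `O(s t)`, uniformly. -/
def FamBound (S : Set T) (ρ : ℝ) (m : T → ℝ) (R : T → Phase d → ℂ) (s : T → ℝ) : Prop :=
  (∀ t ∈ S, ContDiff ℝ (⊤ : ℕ∞) (R t)) ∧ ∀ I J : List (Fin d), ∃ C : ℝ, 0 ≤ C ∧ ∀ t ∈ S,
    ∀ X : Phase d, ‖partialXXi I J (R t) X‖ ≤ C * s t * japBracket X.2 ^ (m t - J.length * ρ)

variable {S : Set T} {m m' : T → ℝ} {R R' : T → Phase d → ℂ} {s s' : T → ℝ}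

theorem FamBound.isUniformO (h : FamBound S ρ m R s) : IsUniformO S ρ m R s := by
  refine ⟨fun t ht => ⟨h.1 t ht, fun I J => ?_⟩, fun I J => ?_⟩
  · obtain ⟨C, -, hC⟩ := h.2 I J
    exact ⟨C * s t, hC t ht⟩
  · obtain ⟨C, -, hC⟩ := h.2 I J
    exact ⟨C, hC⟩

theorem FamBound.isSymbol (h : FamBound S ρ m R s) {t : T} (ht : t ∈ S) : IsSymbol ρ (m t) (R t) :=
  h.isUniformO.1 t ht

theorem FamBound.congr (h : FamBound S ρ m R s) (e : ∀ t ∈ S, R' t = R t) : FamBound S ρ m R' s := by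
  refine ⟨fun t ht => by rw [e t ht]; exact h.1 t ht, fun I J => ?_⟩
  obtain ⟨C, h0, hC⟩ := h.2 I J
  exact ⟨C, h0, fun t ht => by rw [e t ht]; exact hC t ht⟩

theorem FamBound.comp (h : FamBound S ρ m R s) {S' : Set T'} {φ : T' → T}
    (hφ : ∀ t ∈ S', φ t ∈ S) : FamBound S' ρ (fun t => m (φ t)) (fun t => R (φ t)) (fun t => s (φ t)) := by
  refine ⟨fun t ht => h.1 _ (hφ t ht), fun I J => ?_⟩
  obtain ⟨C, h0, hC⟩ := h.2 I J
  exact ⟨C, h0, fun t ht => hC _ (hφ t ht)⟩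

theorem FamBound.mono (h : FamBound S ρ m R s) (hm : ∀ t ∈ S, m t ≤ m' t)
    (hs : ∀ t ∈ S, s t ≤ s' t) : FamBound S ρ m' R s' := by
  refine ⟨h.1, fun I J => ?_⟩
  obtain ⟨C, h0, hC⟩ := h.2 I J
  refine ⟨C, h0, fun t ht X => ?_⟩
  have h1 := hC t ht X
  have hj := one_le_japBracket X.2
  have hp : 0 < japBracket X.2 ^ (m t - J.length * ρ) := Real.rpow_pos_of_pos (japBracket_pos _) _
  have h2 : 0 ≤ C * s t := nonneg_of_mul_nonneg_left ((norm_nonneg _).trans h1) hp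
  have h3 : C * s t ≤ C * s' t := mul_le_mul_of_nonneg_left (hs t ht) h0
  refine h1.trans (mul_le_mul h3 ?_ hp.le (h2.trans h3))
  exact Real.rpow_le_rpow_of_exponent_le hj (by linarith [hm t ht])

theorem partialXXi_add {f g : Phase d → ℂ} (hf : ContDiff ℝ (⊤ : ℕ∞) f) (hg : ContDiff ℝ (⊤ : ℕ∞) g)
    (I J : List (Fin d)) : partialXXi I J (fun X => f X + g X) =
      fun X => partialXXi I J f X + partialXXi I J g X := by
  rw [partialXXi, dirDerivs_add hf hg, dirDerivs_add (smooth_dirDerivs hf _) (smooth_dirDerivs hg _)]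
  rfl

theorem partialXXi_const_mul {f : Phase d → ℂ} (hf : ContDiff ℝ (⊤ : ℕ∞) f) (c : ℂ)
    (I J : List (Fin d)) : partialXXi I J (fun X => c * f X) = fun X => c * partialXXi I J f X := by
  rw [partialXXi, dirDerivs_const_mul hf, dirDerivs_const_mul (smooth_dirDerivs hf _)]
  rfl

theorem FamBound.add (h : FamBound S ρ m R s) (h' : FamBound S ρ m R' s) :
    FamBound S ρ m (fun t X => R t X + R' t X) s := by
  refine ⟨fun t ht => (h.1 t ht).add (h'.1 t ht), fun I J => ?_⟩
  obtain ⟨C, h0, hC⟩ := h.2 I J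
  obtain ⟨C', h0', hC'⟩ := h'.2 I J
  refine ⟨C + C', add_nonneg h0 h0', fun t ht X => ?_⟩
  rw [partialXXi_add (h.1 t ht) (h'.1 t ht), add_mul, add_mul]
  exact (norm_add_le _ _).trans (add_le_add (hC t ht X) (hC' t ht X))

theorem FamBound.mul (h : FamBound S ρ m R s) {c : T → ℂ}
    (hc : ∀ t ∈ S, ‖c t‖ * s t ≤ s' t) : FamBound S ρ m (fun t X => c t * R t X) s' := by
  refine ⟨fun t ht => contDiff_const.mul (h.1 t ht), fun I J => ?_⟩
  obtain ⟨C, h0, hC⟩ := h.2 I J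
  refine ⟨C, h0, fun t ht X => ?_⟩
  rw [partialXXi_const_mul (h.1 t ht), norm_mul]
  have hp : 0 ≤ japBracket X.2 ^ (m t - J.length * ρ) := Real.rpow_nonneg (japBracket_pos _).le _
  calc _ ≤ ‖c t‖ * (C * s t * japBracket X.2 ^ (m t - J.length * ρ)) :=
        mul_le_mul_of_nonneg_left (hC t ht X) (norm_nonneg _)
    _ = C * (‖c t‖ * s t) * japBracket X.2 ^ (m t - J.length * ρ) := by ring
    _ ≤ _ := mul_le_mul_of_nonneg_right (mul_le_mul_of_nonneg_left (hc t ht) h0) hp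

theorem famBound_zero : FamBound S ρ m (fun _ (_ : Phase d) => 0) s := by
  refine ⟨fun t _ => contDiff_const, fun I J => ⟨0, le_rfl, fun t _ X => ?_⟩⟩
  have h := partialXXi_const_mul (contDiff_const (c := (0 : ℂ)) (E := Phase d) (𝕜 := ℝ)) 0 I J
  simp only [mul_zero, zero_mul] at h
  rw [h]; simp

theorem FamBound.sum {ι : Type*} {A : Finset ι} {R : ι → T → Phase d → ℂ}
    (h : ∀ i ∈ A, FamBound S ρ m (R i) s) : FamBound S ρ m (fun t X => ∑ i ∈ A, R i t X) s := by
  classical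
  induction A using Finset.induction_on with
  | empty => simpa using famBound_zero
  | insert a A ha ih =>
    simp only [Finset.sum_insert ha]
    exact (h a (by simp)).add (ih fun i hi => h i (by simp [hi]))

theorem partialXXi_restrict {H : Par d → ℂ} (hH : ContDiff ℝ (⊤ : ℕ∞) H) (τ : ℝ × ℝ)
    (I J : List (Fin d)) (X : Phase d) : partialXXi I J (fun X => H (τ, X)) X =
      dirDerivs (I.map parX) (dirDerivs (J.map parXi) H) (τ, X) := by
  have e : ∀ G : Par d → ℂ, (fun X : Phase d => G (τ, X)) =
      fun X => G ((τ, 0) + ContinuousLinearMap.inr ℝ (ℝ × ℝ) (Phase d) X) := fun G => by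
    funext X; simp
  have key : ∀ (G : Par d → ℂ), ContDiff ℝ (⊤ : ℕ∞) G → ∀ vs : List (Phase d),
      dirDerivs vs (fun X => G (τ, X)) =
        fun X => dirDerivs (vs.map fun v => ((0, v) : Par d)) G (τ, X) := fun G hG vs => by
    rw [e G, dirDerivs_comp_affine hG, e]
    rfl
  rw [partialXXi, key H hH, key _ (smooth_dirDerivs hH _), List.map_map, List.map_map]
  rfl

theorem UnifSym.famBound {M : ℝ} {H : Par d → ℂ} (h : UnifSym ρ M H) :
    FamBound unitSq ρ (fun _ => M) (fun τ X => H (τ, X)) (fun _ => 1) := by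
  refine ⟨fun τ _ => h.1.comp (by fun_prop), fun I J => ?_⟩
  obtain ⟨C, h0, hC⟩ := h.2 I J
  refine ⟨C, h0, fun τ hτ X => ?_⟩
  rw [partialXXi_restrict h.1, mul_one]
  exact hC τ hτ X

theorem iteratedDeriv_line {V : Type*} [NormedAddCommGroup V] [NormedSpace ℝ V] {H : V → ℂ}
    (hH : ContDiff ℝ (⊤ : ℕ∞) H) (P v : V) (k : ℕ) :
    iteratedDeriv k (fun t : ℝ => H (P + t • v)) = fun t =>
      dirDerivs (List.replicate k v) H (P + t • v) := by
  induction k with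
  | zero => simp [dirDerivs_nil]
  | succ k ih =>
    rw [iteratedDeriv_succ, ih]
    funext t
    have h1 : HasDerivAt (fun t : ℝ => P + t • v) v t := by
      simpa using ((hasDerivAt_id t).smul_const v).const_add P
    exact (((smooth_dirDerivs hH (List.replicate k v)).differentiable (by simp)
      (P + t • v)).hasFDerivAt.comp_hasDerivAt t h1).deriv

theorem norm_sub_taylor_le {V : Type*} [NormedAddCommGroup V] [NormedSpace ℝ V] {H : V → ℂ}
    (hH : ContDiff ℝ (⊤ : ℕ∞) H) (P v : V) (K : ℕ) {C t : ℝ} (ht : t ∈ Set.Icc (0 : ℝ) 1)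
    (hC : ∀ u ∈ Set.Icc (0 : ℝ) 1, ‖dirDerivs (List.replicate (K + 1) v) H (P + u • v)‖ ≤ C) :
    ‖H (P + t • v) - ∑ k ∈ Finset.range (K + 1),
      ((t : ℂ) ^ k / (k.factorial : ℂ)) * dirDerivs (List.replicate k v) H P‖ ≤ C * t ^ (K + 1) := by
  set f : ℝ → ℂ := fun t => H (P + t • v) with hf
  have hfs : ContDiff ℝ (⊤ : ℕ∞) f := hH.comp (by fun_prop)
  have hd : ∀ k, ∀ u ∈ Set.Icc (0 : ℝ) 1, iteratedDerivWithin k f (Set.Icc 0 1) u =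
      dirDerivs (List.replicate k v) H (P + u • v) := fun k u hu => by
    rw [iteratedDerivWithin_eq_iteratedDeriv (uniqueDiffOn_Icc zero_lt_one)
      ((hfs.of_le (by exact_mod_cast le_top)).contDiffAt) hu, hf, iteratedDeriv_line hH]
  have key := taylor_mean_remainder_bound (f := f) (n := K) (C := C) zero_le_one
    ((hfs.of_le (by exact_mod_cast le_top)).contDiffOn) ht fun u hu => by
      rw [hd _ u hu]; exact hC u hu
  rw [taylor_within_apply] at key
  have h0 : 0 ≤ C := (norm_nonneg _).trans (hC 0 ⟨le_rfl, zero_le_one⟩)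
  have e : ∑ k ∈ Finset.range (K + 1), ((k.factorial : ℝ)⁻¹ * (t - 0) ^ k) •
      iteratedDerivWithin k f (Set.Icc 0 1) 0 = ∑ k ∈ Finset.range (K + 1),
      ((t : ℂ) ^ k / (k.factorial : ℂ)) * dirDerivs (List.replicate k v) H P := by
    refine Finset.sum_congr rfl fun k _ => ?_
    rw [hd k 0 ⟨le_rfl, zero_le_one⟩, zero_smul, add_zero, Complex.real_smul]
    push_cast
    ring
  rw [e] at key
  refine key.trans ?_
  rw [sub_zero]
  exact div_le_self (mul_nonneg h0 (pow_nonneg ht.1 _))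
    (by exact_mod_cast Nat.one_le_iff_ne_zero.2 (Nat.factorial_ne_zero K))

/-- Taylor expansion of a family of symbols in a parameter. -/
theorem famBound_taylor {H : Par d → ℂ} (hH : ContDiff ℝ (⊤ : ℕ∞) H) (v : ℝ × ℝ) (K : ℕ)
    {τ : T → ℝ × ℝ} {t : T → ℝ} (ht : ∀ a ∈ S, t a ∈ Set.Icc (0 : ℝ) 1)
    (h : FamBound (S ×ˢ Set.Icc (0 : ℝ) 1) ρ (fun q => m q.1)
      (fun q X => dirDerivs (List.replicate (K + 1) ((v, 0) : Par d)) H (τ q.1 + q.2 • v, X))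
      (fun q => s q.1)) :
    FamBound S ρ m (fun a X => H (τ a + t a • v, X) - ∑ k ∈ Finset.range (K + 1),
      ((t a : ℂ) ^ k / (k.factorial : ℂ)) * dirDerivs (List.replicate k ((v, 0) : Par d)) H (τ a, X))
      (fun a => s a * t a ^ (K + 1)) := by
  have hr : ∀ (G : Par d → ℂ) (_ : ContDiff ℝ (⊤ : ℕ∞) G) (τ : ℝ × ℝ),
      ContDiff ℝ (⊤ : ℕ∞) (fun X => G (τ, X)) := fun G hG τ => hG.comp (by fun_prop)
  have hsm : ∀ a, ContDiff ℝ (⊤ : ℕ∞) fun X => ∑ k ∈ Finset.range (K + 1),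
      ((t a : ℂ) ^ k / (k.factorial : ℂ)) *
        dirDerivs (List.replicate k ((v, 0) : Par d)) H (τ a, X) := fun a =>
    ContDiff.sum fun k _ => contDiff_const.mul (hr _ (smooth_dirDerivs hH _) _)
  refine ⟨fun a _ => (hr H hH _).sub (hsm a), fun I J => ?_⟩
  obtain ⟨C, h0, hC⟩ := h.2 I J
  refine ⟨C, h0, fun a ha X => ?_⟩
  have hJ := smooth_dirDerivs hH (J.map (parXi (d := d)))
  -- Derivatives in X commute with those in the parameter. Hence ∂_x^I ∂_ξ^J of the Taylor remainder
  -- of H is the Taylor remainder of ∂_x^I ∂_ξ^J H, and the scalar formula applies at each point.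
  have e : partialXXi I J (fun X => H (τ a + t a • v, X) - ∑ k ∈ Finset.range (K + 1),
      ((t a : ℂ) ^ k / (k.factorial : ℂ)) *
        dirDerivs (List.replicate k ((v, 0) : Par d)) H (τ a, X)) X =
      dirDerivs (I.map parX) (dirDerivs (J.map parXi) H) ((τ a, X) + t a • ((v, 0) : Par d)) -
        ∑ k ∈ Finset.range (K + 1), ((t a : ℂ) ^ k / (k.factorial : ℂ)) *
          dirDerivs (List.replicate k ((v, 0) : Par d))
            (dirDerivs (I.map parX) (dirDerivs (J.map parXi) H)) (τ a, X) := by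
    rw [partialXXi, dirDerivs_sub (hr H hH _) (hsm a), dirDerivs_sub
      (smooth_dirDerivs (hr H hH _) _) (smooth_dirDerivs (hsm a) _),
      dirDerivs_sum _ fun k _ => contDiff_const.mul (hr _ (smooth_dirDerivs hH _) _),
      dirDerivs_sum _ fun k _ => smooth_dirDerivs
        (contDiff_const.mul (hr _ (smooth_dirDerivs hH _) _)) _]
    have e1 := partialXXi_restrict hH (τ a + t a • v) I J X
    rw [partialXXi] at e1
    simp only [e1]
    congr 1
    · simp
    · refine Finset.sum_congr rfl fun k _ => ?_
      have e2 := congrFun (partialXXi_const_mul (hr _ (smooth_dirDerivs hH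
        (List.replicate k ((v, 0) : Par d))) (τ a)) ((t a : ℂ) ^ k / (k.factorial : ℂ)) I J) X
      rw [partialXXi] at e2
      simp only [e2, partialXXi_restrict (smooth_dirDerivs hH _)]
      rw [dirDerivs_comm hH, dirDerivs_comm hJ]
  rw [e]
  refine (norm_sub_taylor_le (smooth_dirDerivs hJ _) (τ a, X) ((v, 0) : Par d) K (ht a ha)
    (C := C * s a * japBracket X.2 ^ (m a - J.length * ρ)) fun u hu => ?_).trans (le_of_eq (by ring))
  have h1 := hC (a, u) ⟨ha, hu⟩ X
  rw [partialXXi_restrict (smooth_dirDerivs hH _), dirDerivs_comm hH, dirDerivs_comm hJ] at h1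
  have e3 : ((τ a, X) + u • ((v, 0) : Par d)) = (τ a + u • v, X) := by simp
  rw [e3]
  exact h1

end Families

/-! ### Parameter derivatives of the product -/

section Params

variable {d : ℕ} {ρ : ℝ}

theorem dirDeriv_eq_of_hasDerivAt {V : Type*} [NormedAddCommGroup V] [NormedSpace ℝ V] {H : V → ℂ}
    (hH : ContDiff ℝ (⊤ : ℕ∞) H) {a v : V} {c : ℂ}
    (h : HasDerivAt (fun t : ℝ => H (a + t • v)) c 0) : dirDeriv v H a = c := by
  have h2 : HasDerivAt (fun t : ℝ => a + t • v) v 0 := by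
    simpa using ((hasDerivAt_id (0 : ℝ)).smul_const v).const_add a
  have h3 : HasFDerivAt H (fderiv ℝ H a) (a + (0 : ℝ) • v) := by
    rw [zero_smul, add_zero]
    exact (hH.differentiable (by simp) a).hasFDerivAt
  exact (h3.comp_hasDerivAt (0 : ℝ) h2).unique h

theorem oscInt_zero_right {G : KerArg d → ℂ} (hG : PGrowth kerWeight G) (P : Par d) :
    oscInt G (fun _ => 0) P = 0 := by
  simpa using oscInt_const_mul_right hG 0 (isDouble_zero (d := d) 0 0) P

theorem dirDeriv_zero_dir {V : Type*} [NormedAddCommGroup V] [NormedSpace ℝ V] (H : V → ℂ) :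
    dirDeriv 0 H = fun _ => 0 := by
  funext a; simp [dirDeriv]

/-- The shifted points do not involve λ, so only the kernel is differentiated. -/
theorem dirDeriv_lam_oscInt {G : KerArg d → ℂ} (hG : PGrowth kerWeight G) {M : ℝ} {p : ℕ}
    {F : Phase d × Phase d → ℂ} (hF : IsDouble M p F) :
    dirDeriv (lamDir d) (oscInt G F) = oscInt (dirDeriv (kerDir (lamDir d)) G) F := by
  rw [dirDeriv_oscInt hG hF]
  funext P
  have e : ((lamDir d).2, (lamDir d).2) = (0 : Phase d × Phase d) := rfl
  rw [e, dirDeriv_zero_dir, oscInt_zero_right hG]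
  simp [lamDir]

theorem dirDerivs_lam_oscInt {G : KerArg d → ℂ} (hG : PGrowth kerWeight G) {M : ℝ} {p : ℕ}
    {F : Phase d × Phase d → ℂ} (hF : IsDouble M p F) (n : ℕ) :
    dirDerivs (List.replicate n (lamDir d)) (oscInt G F) =
      oscInt (dirDerivs (List.replicate n (kerDir (lamDir d))) G) F := by
  have hg : ∀ n, PGrowth kerWeight (dirDerivs (List.replicate n (kerDir (lamDir d))) G) := fun n => by
    induction n with
    | zero => exact hG
    | succ n ih => exact ih.dirDeriv _
  induction n with
  | zero => rfl
  | succ n ih =>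
    rw [List.replicate_succ, dirDerivs_cons, ih, dirDeriv_lam_oscInt (hg n) hF]
    rfl

/-- The operator `i 𝓛₀`. -/
def iL0 (F : Phase d × Phase d → ℂ) : Phase d × Phase d → ℂ := fun e => Complex.I * opL0 F e

theorem isDiffOp_iL0 : IsDiffOp (iL0 (d := d)) := isDiffOp_opL0.const_mul Complex.I

theorem iL0_iterate {F : Phase d × Phase d → ℂ} (hF : ContDiff ℝ (⊤ : ℕ∞) F) (n : ℕ) :
    iL0^[n] F = fun e => Complex.I ^ n * opL0^[n] F e := by
  induction n with
  | zero => simp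
  | succ n ih =>
    rw [Function.iterate_succ_apply', ih]
    funext e
    rw [iL0, isDiffOp_opL0.map_const_mul ((isDiffOp_opL0.iterate n).smooth hF),
      Function.iterate_succ_apply']
    ring

theorem BiSym.iL0_iterate {M : ℝ} {F : Phase d × Phase d → ℂ} (hF : BiSym ρ M F) (n : ℕ) :
    BiSym ρ (M - n * ρ) (iL0^[n] F) := by
  rw [_root_.iL0_iterate hF.1]
  exact (hF.opL0_iterate n).const_mul _

theorem dirDeriv_eps_oscInt {G : KerArg d → ℂ} (hG : PGrowth kerWeight G) {M : ℝ} {p : ℕ}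
    {F : Phase d × Phase d → ℂ} (hF : IsDouble M p F) :
    dirDeriv (epsDir d) (oscInt G F) = fun P => oscInt (dirDeriv (kerDir (epsDir d)) G) F P +
      oscInt G (iL0 F) P := by
  rw [dirDeriv_oscInt hG hF]
  funext P
  have e : ((epsDir d).2, (epsDir d).2) = (0 : Phase d × Phase d) := rfl
  rw [e, dirDeriv_zero_dir, oscInt_zero_right hG]
  simp [epsDir]
  rfl

/-- The derivative in ε is a sum of two operations on different arguments, differentiation of the
kernel and i𝓛₀ on F. They do not interfere, which gives the binomial formula. -/
theorem dirDerivs_eps_oscInt {G : KerArg d → ℂ} (hG : PGrowth kerWeight G) {M : ℝ} {p : ℕ}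
    {F : Phase d × Phase d → ℂ} (hF : IsDouble M p F) (n : ℕ) :
    dirDerivs (List.replicate n (epsDir d)) (oscInt G F) = fun P =>
      ∑ q ∈ Finset.HasAntidiagonal.antidiagonal n, (n.choose q.1 : ℂ) *
        oscInt (dirDerivs (List.replicate q.1 (kerDir (epsDir d))) G) (iL0^[q.2] F) P := by
  have hg : ∀ n, PGrowth kerWeight (dirDerivs (List.replicate n (kerDir (epsDir d))) G) := fun n => by
    induction n with
    | zero => exact hG
    | succ n ih => exact ih.dirDeriv _
  have hf : ∀ n, IsDouble M p (iL0^[n] F) := fun n => hF.diffOp (isDiffOp_iL0.iterate n)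
  induction n with
  | zero => funext P; simp [dirDerivs_nil]
  | succ n ih =>
    rw [List.replicate_succ, dirDerivs_cons, ih, dirDeriv_sum _ fun q _ =>
      contDiff_const.mul (smooth_oscInt (hg q.1) (hf q.2))]
    funext P
    have e : ∀ q : ℕ × ℕ, dirDeriv (epsDir d) (fun P => (n.choose q.1 : ℂ) *
        oscInt (dirDerivs (List.replicate q.1 (kerDir (epsDir d))) G) (iL0^[q.2] F) P) P =
        (n.choose q.1 : ℂ) *
          oscInt (dirDerivs (List.replicate (q.1 + 1) (kerDir (epsDir d))) G) (iL0^[q.2] F) P +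
        (n.choose q.1 : ℂ) *
          oscInt (dirDerivs (List.replicate q.1 (kerDir (epsDir d))) G) (iL0^[q.2 + 1] F) P :=
      fun q => by
        rw [dirDeriv_const_mul (smooth_oscInt (hg q.1) (hf q.2)),
          dirDeriv_eps_oscInt (hg q.1) (hf q.2), Function.iterate_succ_apply']
        exact mul_add _ _ _
    simp only [e]
    rw [Finset.sum_add_distrib, Finset.sum_antidiagonal_choose_succ_mul fun i j =>
      oscInt (dirDerivs (List.replicate i (kerDir (epsDir d))) G) (iL0^[j] F) P, add_comm]
    congr 1
    refine Finset.sum_congr rfl fun q hq => ?_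
    rw [Finset.HasAntidiagonal.mem_antidiagonal] at hq
    rw [← hq, Nat.choose_symm_add]

end Params

/-! ### The magnetic kernels -/

section Magnetic

variable {d : ℕ} {ρ : ℝ} {B : Fin d → Fin d → Cfg d → ℝ}

theorem pGrowth_exp_neg_I : PGrowth (fun _ : ℝ => (1 : ℝ))
    (fun r : ℝ => Complex.exp (-(Complex.I * (r : ℂ)))) := by
  have hs : ContDiff ℝ (⊤ : ℕ∞) (fun r : ℝ => Complex.exp (-(Complex.I * (r : ℂ)))) :=
    Complex.contDiff_exp.comp ((contDiff_const.mul Complex.ofRealCLM.contDiff).neg)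
  refine ⟨hs, fun n => ⟨1, 0, fun r => ?_⟩⟩
  have h : ∀ n, iteratedDeriv n (fun r : ℝ => Complex.exp (-(Complex.I * (r : ℂ)))) =
      fun r : ℝ => (-Complex.I) ^ n * Complex.exp (-(Complex.I * (r : ℂ))) := fun n => by
    induction n with
    | zero => simp
    | succ n ih =>
      rw [iteratedDeriv_succ, ih]
      funext r
      have h1 : HasDerivAt (fun r : ℝ => -(Complex.I * (r : ℂ))) (-Complex.I) r := by
        have h0 := ((Complex.ofRealCLM.hasDerivAt (x := r)).const_mul Complex.I).neg
        simp only [Complex.ofRealCLM_apply, Complex.ofReal_one, mul_one] at h0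
        exact h0
      have h2 := (h1.cexp.const_mul ((-Complex.I) ^ n)).deriv
      rw [h2]; ring
  rw [norm_iteratedFDeriv_eq_norm_iteratedDeriv, h, norm_mul, norm_exp_neg_I_mul_ofReal]
  simp

/-- The factor `e^{-iλγ}` as a function of kernel arguments. -/
def magKer (B : Fin d → Fin d → Cfg d → ℝ) (a : KerArg d) : ℂ :=
  magKernel B a.2.1.1 a.2.1.2 a.1 a.2.2.1 a.2.2.2

theorem magKer_eq (a : KerArg d) : magKer B a = Complex.exp (-(Complex.I *
    ((a.2.1.2 * scaledFlux B a.2.1.1 a.1 a.2.2.1 a.2.2.2 : ℝ) : ℂ))) := by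
  rw [magKer, magKernel, neg_mul]

/-- The exponent λγ is real and e^{-ir} has bounded derivatives, so the exponential costs only
powers of the derivatives of λγ. -/
theorem pGrowth_magKer (hB : ∀ k l, IsBCInfty (B k l)) : PGrowth kerWeight (magKer B) := by
  have hγ : PGrowth kerWeight
      (fun a : KerArg d => scaledFlux B a.2.1.1 a.1 a.2.2.1 a.2.2.2) := by
    have := (eKer_fluxKer hB).pGrowth.clm_comp Complex.reCLM
    simpa [fluxKer] using this
  have hl : PGrowth kerWeight (fun a : KerArg d => a.2.1.2) :=
    pGrowth_clm ((ContinuousLinearMap.snd ℝ ℝ ℝ).comp ((ContinuousLinearMap.fst ℝ (ℝ × ℝ) (Phase d)).comp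
      (ContinuousLinearMap.snd ℝ (Cfg d) ((ℝ × ℝ) × Phase d)))) ⟨1, 1, fun a => by
        have h1 : ‖a.2.1.2‖ ≤ ‖a.2‖ := (norm_snd_le a.2.1).trans (norm_fst_le a.2)
        change ‖a.2.1.2‖ ≤ 1 * (1 + ‖a.2‖) ^ 1
        linarith⟩
  have h := pGrowth_exp_neg_I.comp one_le_kerWeight (fun _ => le_rfl)
    (hl.smul one_le_kerWeight hγ).deriv_growth (A := 1) (r := 0) (fun q => by simp)
  have e : magKer B = fun a => Complex.exp (-(Complex.I *
      ((a.2.1.2 • scaledFlux B a.2.1.1 a.1 a.2.2.1 a.2.2.2 : ℝ) : ℂ))) := funext fun a => magKer_eq a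
  rw [e]
  exact h

theorem dirDeriv_lam_fluxPow (hB : ∀ k l, IsBCInfty (B k l)) (k : ℕ) (a : KerArg d) :
    dirDeriv (kerDir (lamDir d)) (fun a => (-Complex.I * fluxKer B a) ^ k) a = 0 := by
  have hs : ContDiff ℝ (⊤ : ℕ∞) (fun a => (-Complex.I * fluxKer B a) ^ k) :=
    (contDiff_const.mul (eKer_fluxKer hB).pGrowth.1).pow k
  refine dirDeriv_eq_of_hasDerivAt hs ?_
  simpa [fluxKer, kerDir, lamDir] using hasDerivAt_const (0 : ℝ) ((-Complex.I * fluxKer B a) ^ k)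

theorem dirDeriv_lam_magKer (hB : ∀ k l, IsBCInfty (B k l)) (a : KerArg d) :
    dirDeriv (kerDir (lamDir d)) (magKer B) a = -Complex.I * fluxKer B a * magKer B a := by
  refine dirDeriv_eq_of_hasDerivAt (pGrowth_magKer hB).1 ?_
  have e : (fun t : ℝ => magKer B (a + t • kerDir (lamDir d))) = fun t : ℝ =>
      Complex.exp (-(Complex.I * ((a.2.1.2 + t : ℂ) * fluxKer B a))) := by
    funext t
    rw [magKer_eq]
    simp [kerDir, lamDir, fluxKer]
  rw [e]
  have h1 : HasDerivAt (fun t : ℝ => -(Complex.I * ((a.2.1.2 + t : ℂ) * fluxKer B a)))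
      (-(Complex.I * (1 * fluxKer B a))) 0 :=
    (((((Complex.ofRealCLM.hasDerivAt (x := (0 : ℝ))).const_add (a.2.1.2 : ℂ)).mul_const
      (fluxKer B a)).const_mul Complex.I).neg)
  have h2 := h1.cexp
  have e2 : Complex.exp (-(Complex.I * ((a.2.1.2 + (0 : ℝ) : ℂ) * fluxKer B a))) = magKer B a := by
    rw [magKer_eq]
    simp [fluxKer]
  rw [e2] at h2
  convert h2 using 1
  ring

theorem dirDerivs_lam_magKer (hB : ∀ k l, IsBCInfty (B k l)) (k : ℕ) :
    dirDerivs (List.replicate k (kerDir (lamDir d))) (magKer B) =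
      fun a => (-Complex.I * fluxKer B a) ^ k * magKer B a := by
  induction k with
  | zero => funext a; simp [dirDerivs_nil]
  | succ k ih =>
    have hs : ContDiff ℝ (⊤ : ℕ∞) (fun a => (-Complex.I * fluxKer B a) ^ k) :=
      (contDiff_const.mul (eKer_fluxKer hB).pGrowth.1).pow k
    rw [List.replicate_succ, dirDerivs_cons, ih, dirDeriv_mul hs (pGrowth_magKer hB).1]
    funext a
    simp only [dirDeriv_lam_fluxPow hB, dirDeriv_lam_magKer hB]
    ring

/-- The kernel of the `k`-th term of the `λ`-expansion. -/
def magTermKer (B : Fin d → Fin d → Cfg d → ℝ) (k : ℕ) (a : KerArg d) : ℂ :=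
  (-Complex.I) ^ k / (k.factorial : ℂ) * fluxKer B a ^ k

theorem eKer_magTermKer (hB : ∀ k l, IsBCInfty (B k l)) (k : ℕ) : EKer k (magTermKer B k) := by
  have h := ((eKer_fluxKer hB).pow k).const_mul ((-Complex.I) ^ k / (k.factorial : ℂ))
  rw [mul_one] at h
  exact h

variable {m₁ m₂ : ℝ} {f g : Phase d → ℂ}

theorem isOscIntegral_magKer (hB : ∀ k l, IsBCInfty (B k l)) (hρ : 0 ≤ ρ) (hf : IsSymbol ρ m₁ f)
    (hg : IsSymbol ρ m₂ g) (ε lam : ℝ) (X : Phase d) :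
    IsOscIntegral ε (magKernel B ε lam) f g X
      (oscInt (magKer B) (fun e => f e.1 * g e.2) ((ε, lam), X)) :=
  isOscIntegral_oscInt (pGrowth_magKer hB) hρ hf hg (ε, lam) X

theorem isOscIntegral_magTermKer (hB : ∀ k l, IsBCInfty (B k l)) (hρ : 0 ≤ ρ) (hf : IsSymbol ρ m₁ f)
    (hg : IsSymbol ρ m₂ g) (k : ℕ) (ε lam : ℝ) (X : Phase d) :
    IsOscIntegral ε (magKernelTerm B k ε) f g X
      (oscInt (magTermKer B k) (fun e => f e.1 * g e.2) ((ε, lam), X)) :=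
  isOscIntegral_oscInt (eKer_magTermKer hB k).pGrowth hρ hf hg (ε, lam) X

theorem magWeyl_eq (hB : ∀ k l, IsBCInfty (B k l)) (hρ : 0 ≤ ρ) (hf : IsSymbol ρ m₁ f)
    (hg : IsSymbol ρ m₂ g) (ε lam : ℝ) (X : Phase d) : magWeyl B f g ε lam X =
      oscInt (magKer B) (fun e => f e.1 * g e.2) ((ε, lam), X) :=
  oscIntegral_eq (isOscIntegral_magKer hB hρ hf hg ε lam X)

theorem lamTerm_eq (hB : ∀ k l, IsBCInfty (B k l)) (hρ : 0 ≤ ρ) (hf : IsSymbol ρ m₁ f)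
    (hg : IsSymbol ρ m₂ g) (k : ℕ) (ε lam : ℝ) (X : Phase d) : lamTerm B f g k ε X =
      oscInt (magTermKer B k) (fun e => f e.1 * g e.2) ((ε, lam), X) :=
  oscIntegral_eq (isOscIntegral_magTermKer hB hρ hf hg k ε lam X)

theorem famBound_magWeyl (hB : ∀ k l, IsBCInfty (B k l)) (hρ : 0 ≤ ρ) (hf : IsSymbol ρ m₁ f)
    (hg : IsSymbol ρ m₂ g) : FamBound unitSq ρ (fun _ => m₁ + m₂)
      (fun τ => magWeyl B f g τ.1 τ.2) (fun _ => 1) := by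
  have h := (unifSym_oscInt (WKer.base (pGrowth_magKer hB)) (biSym_tensor hρ hf hg)).famBound
  refine (h.congr fun τ _ => funext fun X => magWeyl_eq hB hρ hf hg τ.1 τ.2 X).mono
    (fun _ _ => by simp) fun _ _ => le_rfl

/-- The powers of the flux contain the same power of `ε`. -/
theorem oscInt_fluxKer_pow (hB : ∀ k l, IsBCInfty (B k l)) {H : KerArg d → ℂ}
    (hH : PGrowth kerWeight H) {M : ℝ} {p : ℕ} {F : Phase d × Phase d → ℂ} (hF : IsDouble M p F)
    (c : ℂ) (k : ℕ) (P : Par d) : oscInt (fun a => (c * fluxKer B a) ^ k * H a) F P =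
      (c * P.1.1) ^ k * oscInt (fun a => redFluxKer B a ^ k * H a) F P := by
  have hκ := (eKer_redFluxKer hB).pGrowth.pow one_le_kerWeight k
  rw [← oscInt_const_mul_left _ (hκ.mul one_le_kerWeight hH) hF]
  refine oscInt_congr _ _ fun w => ?_
  simp only [fluxKer_eq hB, mul_pow]
  ring

theorem wKer_redFluxKer_pow (hB : ∀ k l, IsBCInfty (B k l)) {H : KerArg d → ℂ}
    (hH : PGrowth kerWeight H) (k : ℕ) : WKer (k * 2) (fun a => redFluxKer B a ^ k * H a) :=
  ((eKer_redFluxKer hB).pow k).wKer.mul hH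

/-- The gain 2kρ comes from writing γ^k as ε^k times a kernel with 2k factors of w; here ε^k is
merely bounded by 1. -/
theorem famBound_lamTerm (hB : ∀ k l, IsBCInfty (B k l)) (hρ : 0 ≤ ρ) (hf : IsSymbol ρ m₁ f)
    (hg : IsSymbol ρ m₂ g) (k : ℕ) : FamBound (Set.Icc (0 : ℝ) 1) ρ (fun _ => m₁ + m₂ - 2 * k * ρ)
      (fun ε => lamTerm B f g k ε) (fun _ => 1) := by
  have hF := biSym_tensor hρ hf hg
  obtain ⟨p, hFd⟩ := hF.isDouble
  have h := (unifSym_oscInt (wKer_redFluxKer_pow hB (pGrowth_const (1 : ℂ)) k) hF).famBound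
  have h1 := h.comp (S' := Set.Icc (0 : ℝ) 1) (φ := fun ε => (ε, (0 : ℝ)))
    fun ε hε => ⟨hε, le_rfl, zero_le_one⟩
  have h2 := h1.mul (s' := fun _ => 1)
    (c := fun ε : ℝ => ((k.factorial : ℂ))⁻¹ * (-Complex.I * (ε : ℂ)) ^ k) fun ε hε => by
      rw [mul_one, norm_mul, norm_pow, norm_mul, norm_neg, Complex.norm_I, one_mul,
        Complex.norm_real, Real.norm_of_nonneg hε.1, norm_inv, Complex.norm_natCast]
      refine mul_le_one₀ (inv_le_one_of_one_le₀ ?_) (pow_nonneg hε.1 _) (pow_le_one₀ hε.1 hε.2)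
      exact_mod_cast Nat.one_le_iff_ne_zero.2 (Nat.factorial_ne_zero k)
  refine (h2.congr fun ε _ => funext fun X => ?_).mono (fun _ _ => ?_) fun _ _ => le_rfl
  · have h3 := oscInt_fluxKer_pow hB (pGrowth_const (1 : ℂ)) hFd (-Complex.I) k ((ε, 0), X)
    rw [lamTerm_eq hB hρ hf hg k ε 0 X, mul_assoc, ← h3, ← oscInt_const_mul_left _ _ hFd]
    · refine oscInt_congr _ _ fun w => ?_
      simp only [magTermKer, mul_pow]
      ring
    · exact ((((eKer_fluxKer hB).pGrowth.const_mul _).pow one_le_kerWeight k).mul one_le_kerWeight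
        (pGrowth_const _))
  · push_cast
    exact le_of_eq (by ring)

/-- The `λ`-expansion; its remainder has additional powers of `ε`. -/
theorem famBound_lam_expansion (hB : ∀ k l, IsBCInfty (B k l)) (hρ : 0 ≤ ρ) (hf : IsSymbol ρ m₁ f)
    (hg : IsSymbol ρ m₂ g) (K : ℕ) : FamBound unitSq ρ (fun _ => m₁ + m₂ - 2 * (K + 1) * ρ)
      (fun τ X => magWeyl B f g τ.1 τ.2 X -
        ∑ k ∈ Finset.range (K + 1), (τ.2 : ℂ) ^ k * lamTerm B f g k τ.1 X)
      (fun τ => τ.1 ^ (K + 1) * τ.2 ^ (K + 1)) := by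
  have hF := biSym_tensor hρ hf hg
  obtain ⟨p, hFd⟩ := hF.isDouble
  have hG := pGrowth_magKer hB
  have hpow : ∀ k, PGrowth kerWeight (fun a => (-Complex.I * fluxKer B a) ^ k * magKer B a) :=
    fun k => (((eKer_fluxKer hB).pGrowth.const_mul _).pow one_le_kerWeight k).mul one_le_kerWeight hG
  have h := (unifSym_oscInt (wKer_redFluxKer_pow hB hG (K + 1)) hF).famBound
  have h1 := h.comp (S' := unitSq ×ˢ Set.Icc (0 : ℝ) 1)
    (φ := fun q : (ℝ × ℝ) × ℝ => (q.1.1, q.2)) fun q hq => ⟨hq.1.1, hq.2⟩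
  have h2 := h1.mul (s' := fun q => q.1.1 ^ (K + 1))
    (c := fun q : (ℝ × ℝ) × ℝ => (-Complex.I * (q.1.1 : ℂ)) ^ (K + 1)) fun q hq => by
      rw [mul_one, norm_pow, norm_mul, norm_neg, Complex.norm_I, one_mul,
        Complex.norm_real, Real.norm_of_nonneg hq.1.1.1]
  -- Taylor expansion at λ = 0. The (K+1)-st derivative has the kernel (-iγ)^{K+1} e^{-iλγ}, that is
  -- (-iε)^{K+1} times a kernel with 2(K+1) factors of w.
  have h3 := famBound_taylor (S := unitSq) (T := ℝ × ℝ) (ρ := ρ)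
    (m := fun _ => m₁ + m₂ - ((K + 1) * 2 : ℕ) * ρ) (s := fun τ => τ.1 ^ (K + 1))
    (H := oscInt (magKer B) fun e => f e.1 * g e.2) (smooth_oscInt hG hFd) (0, 1) K
    (τ := fun τ => (τ.1, 0)) (t := fun τ => τ.2) (fun τ hτ => hτ.2) (h2.congr fun q _ => by
      funext X
      change dirDerivs (List.replicate (K + 1) (lamDir d)) _ _ = _
      rw [dirDerivs_lam_oscInt hG hFd, dirDerivs_lam_magKer hB, oscInt_fluxKer_pow hB hG hFd]
      simp)
  refine (h3.congr fun τ _ => funext fun X => ?_).mono (fun _ _ => ?_) fun _ _ => le_rfl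
  · rw [magWeyl_eq hB hρ hf hg]
    congr 1
    · simp
    · refine Finset.sum_congr rfl fun k _ => ?_
      change _ = _ * dirDerivs (List.replicate k (lamDir d)) _ _
      rw [dirDerivs_lam_oscInt hG hFd, dirDerivs_lam_magKer hB, lamTerm_eq hB hρ hf hg k τ.1 0 X,
        div_mul_eq_mul_div, mul_div_assoc, div_eq_inv_mul, ← oscInt_const_mul_left _ (hpow k) hFd]
      congr 1
      refine oscInt_congr _ _ fun w => ?_
      simp only [magTermKer, magKer_eq]
      simp
      ring
  · push_cast
    exact le_of_eq (by ring)

/-- Bounds for the `ε`-derivatives of the terms of the `λ`-expansion. -/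
theorem famBound_eps_lamTerm (hB : ∀ k l, IsBCInfty (B k l)) (hρ : 0 ≤ ρ) (hf : IsSymbol ρ m₁ f)
    (hg : IsSymbol ρ m₂ g) (k n : ℕ) : FamBound unitSq ρ (fun _ => m₁ + m₂ - (n + k) * ρ)
      (fun τ X => dirDerivs (List.replicate n (epsDir d))
        (oscInt (magTermKer B k) fun e => f e.1 * g e.2) (τ, X)) (fun _ => 1) := by
  have hF := biSym_tensor hρ hf hg
  obtain ⟨p, hFd⟩ := hF.isDouble
  rw [dirDerivs_eps_oscInt (eKer_magTermKer hB k).pGrowth hFd]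
  -- The gains add up: k from γ^k, q.1 from the ε-derivatives of the kernel and q.2 from the powers
  -- of 𝓛₀, where q.1 + q.2 = n.
  have key : ∀ q ∈ Finset.HasAntidiagonal.antidiagonal n, UnifSym ρ (m₁ + m₂ - (n + k) * ρ)
      (oscInt (dirDerivs (List.replicate q.1 (kerDir (epsDir d))) (magTermKer B k))
        (iL0^[q.2] fun e => f e.1 * g e.2)) := fun q hq => by
    have h := unifSym_oscInt ((eKer_magTermKer hB k).dirDerivs_eps q.1).wKer (hF.iL0_iterate q.2)
    rw [Finset.HasAntidiagonal.mem_antidiagonal] at hq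
    have e : m₁ + m₂ - q.2 * ρ - ((k + q.1 : ℕ) : ℝ) * ρ = m₁ + m₂ - (n + k) * ρ := by
      rw [← hq]; push_cast; ring
    rwa [e] at h
  exact (UnifSym.sum _ fun q hq => (key q hq).const_mul _).famBound

end Magnetic

/-! ### Polynomials in `w` as differential operators -/

section MulRep

variable {d : ℕ}

/-- Multiplication of the kernel by `Q(w)` amounts to applying `D` to the function. -/
structure MulRep (Q : Phase d → ℂ) (D : (Phase d × Phase d → ℂ) → Phase d × Phase d → ℂ) : Prop where
  isDiffOp : IsDiffOp D
  pGrowth : PGrowth kerWeight (fun a : KerArg d => Q a.2.2)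
  eq : ∀ {H : KerArg d → ℂ}, PGrowth kerWeight H → ∀ {M : ℝ} {p : ℕ} {F : Phase d × Phase d → ℂ},
    IsDouble M p F → ∀ P, oscInt (fun a => Q a.2.2 * H a) F P = oscInt H (D F) P

theorem MulRep.one : MulRep (d := d) (fun _ => 1) (fun F => F) :=
  ⟨isDiffOp_id, pGrowth_const 1, fun _ _ _ _ _ P => by simp⟩

theorem MulRep.congr {Q : Phase d → ℂ} {D D' : (Phase d × Phase d → ℂ) → Phase d × Phase d → ℂ}
    (h : MulRep Q D) (e : D' = D) : MulRep Q D' := e ▸ h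

theorem MulRep.mul {Q Q' : Phase d → ℂ} {D D' : (Phase d × Phase d → ℂ) → Phase d × Phase d → ℂ}
    (h : MulRep Q D) (h' : MulRep Q' D') : MulRep (fun w => Q w * Q' w) (fun F => D (D' F)) := by
  refine ⟨h.isDiffOp.comp h'.isDiffOp, h.pGrowth.mul one_le_kerWeight h'.pGrowth,
    fun {H} hH {M p F} hF P => ?_⟩
  have e : (fun a : KerArg d => Q a.2.2 * Q' a.2.2 * H a) =
      fun a => Q' a.2.2 * (Q a.2.2 * H a) := by funext a; ring
  rw [e, h'.eq (h.pGrowth.mul one_le_kerWeight hH) hF, h.eq hH (hF.diffOp h'.isDiffOp)]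

theorem MulRep.pow {Q : Phase d → ℂ} {D : (Phase d × Phase d → ℂ) → Phase d × Phase d → ℂ}
    (h : MulRep Q D) (k : ℕ) : MulRep (fun w => Q w ^ k) (D^[k]) := by
  induction k with
  | zero => simp only [pow_zero]; exact MulRep.one
  | succ k ih =>
    have := h.mul ih
    simp only [pow_succ']
    simpa only [← Function.iterate_succ_apply'] using this

theorem MulRep.const_mul {Q : Phase d → ℂ} {D : (Phase d × Phase d → ℂ) → Phase d × Phase d → ℂ}
    (h : MulRep Q D) (c : ℂ) : MulRep (fun w => c * Q w) (fun F e => c * D F e) := by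
  refine ⟨h.isDiffOp.const_mul c, h.pGrowth.const_mul c, fun {H} hH {M p F} hF P => ?_⟩
  simp only [mul_assoc]
  rw [oscInt_const_mul_left c (h.pGrowth.mul one_le_kerWeight hH) hF, h.eq hH hF,
    oscInt_const_mul_right hH c (hF.diffOp h.isDiffOp)]

theorem MulRep.sum {ι : Type*} (s : Finset ι) {Q : ι → Phase d → ℂ}
    {D : ι → (Phase d × Phase d → ℂ) → Phase d × Phase d → ℂ} (h : ∀ i ∈ s, MulRep (Q i) (D i)) :
    MulRep (fun w => ∑ i ∈ s, Q i w) (fun F e => ∑ i ∈ s, D i F e) := by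
  refine ⟨.sum s fun i hi => (h i hi).isDiffOp, .sum one_le_kerWeight fun i hi => (h i hi).pGrowth,
    fun {H} hH {M p F} hF P => ?_⟩
  simp only [Finset.sum_mul]
  rw [oscInt_sum_left s (fun i hi => (h i hi).pGrowth.mul one_le_kerWeight hH) hF,
    oscInt_sum_right hH s fun i hi => hF.diffOp (h i hi).isDiffOp]
  exact Finset.sum_congr rfl fun i hi => (h i hi).eq hH hF P

/-- The generating case of the correspondence, namely integration by parts; sums and products carry
it to all polynomials in w. -/
theorem MulRep.pairL (v : Phase d) : MulRep (fun w => (pairL d w v : ℂ))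
    (fun F e => -Complex.I * dirDeriv (thetaDir v) F e) := by
  refine ⟨(isDiffOp_dirDeriv _).const_mul _, ?_, fun {H} hH {M p F} hF P => oscInt_mulW hH v hF P⟩
  have := (pGrowth_const (σ := kerWeight) (E := KerArg d) (1 : ℂ)).mulW v
  have e : mulW v (fun _ => 1) = fun a : KerArg d => (_root_.pairL d a.2.2 v : ℂ) := by
    funext a; simp [mulW]
  exact e ▸ this

/-- The product of the linear functions given by a list of vectors. -/
def monW (vs : List (Phase d)) (w : Phase d) : ℂ := (vs.map fun v => (_root_.pairL d w v : ℂ)).prod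

theorem rep_monW (vs : List (Phase d)) : MulRep (monW vs)
    (fun F e => (-Complex.I) ^ vs.length * dirDerivs (vs.map thetaDir) F e) := by
  induction vs with
  | nil =>
    have e : monW ([] : List (Phase d)) = fun _ => 1 := by funext w; simp [monW]
    rw [e]
    exact MulRep.one.congr (by funext F e; simp [dirDerivs_nil])
  | cons v vs ih =>
    have h := (MulRep.pairL v).mul ih
    refine ⟨(isDiffOp_dirDerivs _).const_mul _, ?_, fun {H} hH {M p F} hF P => ?_⟩
    · simpa [monW] using h.pGrowth
    · have h1 := h.eq hH hF P
      have e : (fun e => -Complex.I * dirDeriv (thetaDir v) (fun e => (-Complex.I) ^ vs.length *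
          dirDerivs (vs.map thetaDir) F e) e) = fun e => (-Complex.I) ^ (v :: vs).length *
          dirDerivs ((v :: vs).map thetaDir) F e := by
        funext e
        rw [dirDeriv_const_mul (smooth_dirDerivs hF.1 _), List.map_cons, dirDerivs_cons,
          List.length_cons, pow_succ]
        ring
      rw [e] at h1
      simpa [monW] using h1

/-- The vectors `(e_k, 0)` and `(0, e_l)`. -/
def leftVec (k : Fin d) : Phase d := (stdVec k, 0)
def rightVec (l : Fin d) : Phase d := (0, stdVec l)

/-- The polynomial `𝓛_j(x, y, z)`. -/
def magPoly (B : Fin d → Fin d → Cfg d → ℝ) (x : Cfg d) (j : ℕ) (w : Phase d) : ℂ :=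
  (1 / (j.factorial : ℂ)) * (-1 / 2 : ℂ) ^ (j + 1) * (1 / ((j : ℂ) + 1) ^ 2) *
    ∑ k : Fin d, ∑ l : Fin d, ∑ μ : Fin (j - 1) → Fin d,
      (iteratedFDeriv ℝ (j - 1) (B k l) x (fun r => stdVec (μ r)) : ℂ) *
        ∑ c ∈ Finset.Icc 1 j, ((j + 1).choose c : ℂ) *
          ((1 - (-1 : ℂ) ^ (j + 1)) * c - (1 - (-1 : ℂ) ^ c) * (j + 1)) *
          monW ([leftVec k, rightVec l] ++ ((List.ofFn μ).take (c - 1)).map leftVec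
              ++ ((List.ofFn μ).drop (c - 1)).map rightVec) w

/-- Each monomial of 𝓛_j has j + 1 linear factors, whose substitution by -i∂_η and -i∂_ζ yields the
power (-i)^{j+1} in the operator. The coefficients are frozen at x, hence constant. -/
theorem rep_magPoly (B : Fin d → Fin d → Cfg d → ℝ) (x : Cfg d) (j : ℕ) :
    MulRep (magPoly B x j) (opLMag B x j) := by
  refine (MulRep.sum _ fun k _ => MulRep.sum _ fun l _ => MulRep.sum _ fun μ _ =>
    (MulRep.sum _ fun c hc => ?_).const_mul _).const_mul _
  replace hc := Finset.mem_Icc.1 hc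
  have h := rep_monW ([leftVec k, rightVec l] ++ ((List.ofFn μ).take (c - 1)).map leftVec
          ++ ((List.ofFn μ).drop (c - 1)).map rightVec)
  have hl : ([leftVec k, rightVec l] ++ ((List.ofFn μ).take (c - 1)).map leftVec
          ++ ((List.ofFn μ).drop (c - 1)).map rightVec).length = j + 1 := by
    -- The truncated j - 1 causes no harm: a summation index c between 1 and j exists only for j ≥
    -- 1.
    simp only [List.length_append, List.length_map, List.length_take, List.length_drop,
      List.length_ofFn, List.length_cons, List.length_nil]
    omega
  have hm : ([leftVec k, rightVec l] ++ ((List.ofFn μ).take (c - 1)).map leftVec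
          ++ ((List.ofFn μ).drop (c - 1)).map rightVec).map thetaDir = [vecEta k, vecZeta l]
          ++ ((List.ofFn μ).take (c - 1)).map vecEta
          ++ ((List.ofFn μ).drop (c - 1)).map vecZeta := by
    simp only [List.map_append, List.map_map, List.map_cons, List.map_nil]
    rfl
  rw [hl, hm] at h
  exact h.const_mul _

theorem rep_foldr {ι : Type*} (L : List ι) {Q : ι → Phase d → ℂ}
    {D : ι → (Phase d × Phase d → ℂ) → Phase d × Phase d → ℂ} (h : ∀ i, MulRep (Q i) (D i)) :
    MulRep (fun w => (L.map fun i => Q i w).prod) (fun F => L.foldr (fun i H => D i H) F) := by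
  induction L with
  | nil => simp only [List.map_nil, List.prod_nil, List.foldr_nil]; exact MulRep.one
  | cons i L ih => simpa using (h i).mul ih

variable {B : Fin d → Fin d → Cfg d → ℝ}

/-- The composition of the magnetic operators is represented by the product of the polynomials. -/
theorem opLProd_diag (x : Cfg d) {n : ℕ} (κ : Fin (n + 1) → ℕ) {M : ℝ} {p : ℕ}
    {F : Phase d × Phase d → ℂ} (hF : IsDouble M p F) (X : Phase d) :
    opLProd B x κ F (X, X) = oscInt (fun a => ∏ j : Fin n, magPoly B x (j + 1) a.2.2 ^ κ j.succ)
      (opL0^[κ 0] F) ((0, 0), X) := by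
  have hR := rep_foldr (List.finRange n)
    fun j : Fin n => (rep_magPoly B x (j + 1)).pow (κ j.succ)
  have h1 := hR.eq (pGrowth_const (1 : ℂ)) (hF.diffOp (isDiffOp_opL0.iterate (κ 0))) ((0, 0), X)
  -- At ε = 0 the integral with constant kernel evaluates the differentiated function at (X, X), so
  -- a kernel polynomial in w gives a differential operator restricted to the diagonal.
  rw [oscInt_one ((hF.diffOp (isDiffOp_opL0.iterate (κ 0))).diffOp hR.isDiffOp)] at h1
  simp only [mul_one] at h1
  have e : opLProd B x κ F = opL0^[κ 0] ((List.finRange n).foldr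
      (fun (j : Fin n) H => (opLMag B x (j + 1))^[κ j.succ] H) F) := by
    rw [opLProd, List.finRange_succ, List.foldr_cons, List.foldr_map]
    rfl
  -- In the definition of the (n,k) term the power of 𝓛₀ stands outermost; constant coefficients
  -- allow it to be moved onto F.
  rw [e, (isDiffOp_opL0.iterate (κ 0)).comm hR.isDiffOp hF.1, ← h1]
  refine oscInt_congr _ _ fun w => ?_
  simp only
  rw [Fin.prod_univ_def]

end MulRep

/-! ### Taylor coefficients of powers -/

section TaylorPower

/-- The Taylor series at the origin. -/
def taylorSeries (f : ℝ → ℂ) : PowerSeries ℂ :=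
  PowerSeries.mk fun n => iteratedDeriv n f 0 / (n.factorial : ℂ)

theorem taylorSeries_mul {f g : ℝ → ℂ} (hf : ContDiff ℝ (⊤ : ℕ∞) f) (hg : ContDiff ℝ (⊤ : ℕ∞) g) :
    taylorSeries (fun t => f t * g t) = taylorSeries f * taylorSeries g := by
  ext n
  rw [PowerSeries.coeff_mul, taylorSeries, PowerSeries.coeff_mk]
  have h := iteratedDeriv_mul (n := n) (x := (0 : ℝ))
    (hf.contDiffAt.of_le (by exact_mod_cast le_top)) (hg.contDiffAt.of_le (by exact_mod_cast le_top))
  rw [show (fun t => f t * g t) = f * g from rfl, h, Finset.Nat.sum_antidiagonal_eq_sum_range_succ_mk,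
    Finset.sum_div]
  refine Finset.sum_congr rfl fun i hi => ?_
  have hi' : i ≤ n := Nat.lt_succ_iff.1 (Finset.mem_range.1 hi)
  simp only [taylorSeries, PowerSeries.coeff_mk]
  rw [Nat.cast_choose ℂ hi']
  have h1 : (n.factorial : ℂ) ≠ 0 := by exact_mod_cast Nat.factorial_ne_zero n
  field_simp

theorem taylorSeries_pow {f : ℝ → ℂ} (hf : ContDiff ℝ (⊤ : ℕ∞) f) (k : ℕ) :
    taylorSeries (fun t => f t ^ k) = taylorSeries f ^ k := by
  induction k with
  | zero =>
    ext n
    simp only [pow_zero, taylorSeries, PowerSeries.coeff_mk, PowerSeries.coeff_one]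
    rcases Nat.eq_zero_or_pos n with rfl | hn
    · simp
    · rw [if_neg hn.ne']
      have : iteratedDeriv n (fun _ : ℝ => (1 : ℂ)) 0 = 0 := by
        rw [iteratedDeriv_const, if_neg hn.ne']
      rw [this, zero_div]
  | succ k ih =>
    simp only [pow_succ]
    rw [taylorSeries_mul (hf.pow k) hf, ih]

/-- The Taylor coefficients of a power, in terms of the coefficients of the function. -/
theorem iteratedDeriv_pow_eq {f : ℝ → ℂ} (hf : ContDiff ℝ (⊤ : ℕ∞) f) {c : ℕ → ℂ} (h0 : f 0 = 0)
    {n : ℕ} (hc : ∀ j < n, iteratedDeriv (j + 1) f 0 = ((j + 1).factorial : ℂ) * c j) (k : ℕ)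
    {a : ℕ} (ha : a ≤ n) : iteratedDeriv a (fun t => f t ^ k) 0 = (a.factorial : ℂ) *
      ∑ κ ∈ (Finset.piAntidiag (Finset.univ : Finset (Fin n)) k).filter
          fun κ => ∑ j : Fin n, ((j : ℕ) + 1) * κ j = a,
        (Nat.multinomial Finset.univ κ : ℂ) * ∏ j : Fin n, c j ^ κ j := by
  have hfac : ∀ n : ℕ, (n.factorial : ℂ) ≠ 0 := fun n => by exact_mod_cast Nat.factorial_ne_zero n
  have h1 : iteratedDeriv a (fun t => f t ^ k) 0 = (a.factorial : ℂ) *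
      PowerSeries.coeff a (taylorSeries f ^ k) := by
    rw [← taylorSeries_pow hf, taylorSeries, PowerSeries.coeff_mk, mul_div_cancel₀ _ (hfac a)]
  -- Coefficients up to degree n of a power depend only on those of the base up to degree n.
  -- Truncation leaves a finite sum of monomials, without constant term as f vanishes at 0, to which
  -- the multinomial theorem applies.
  have h2 : PowerSeries.trunc (n + 1) (taylorSeries f) =
      ∑ j : Fin n, Polynomial.monomial ((j : ℕ) + 1) (c j) := by
    ext i
    rw [PowerSeries.coeff_trunc, Polynomial.finsetSum_coeff]
    simp only [Polynomial.coeff_monomial, taylorSeries, PowerSeries.coeff_mk]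
    rcases i with - | i
    · simp [h0]
    · split_ifs with hi
      · have hi' : i < n := by omega
        rw [Finset.sum_eq_single (⟨i, hi'⟩ : Fin n), if_pos rfl, hc i hi',
          mul_div_cancel_left₀ _ (hfac _)]
        · intro j _ hj
          rw [if_neg]
          intro h
          exact hj (Fin.ext (by simpa using h))
        · simp
      · refine (Finset.sum_eq_zero fun j _ => if_neg ?_).symm
        have := j.2
        omega
  have h3 : PowerSeries.coeff a (taylorSeries f ^ k) =
      ((∑ j : Fin n, Polynomial.monomial ((j : ℕ) + 1) (c j)) ^ k).coeff a := by
    have h4 := PowerSeries.trunc_trunc_pow (taylorSeries f) (n + 1) k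
    have h5 := congrArg (fun p => Polynomial.coeff p a) h4
    simp only [PowerSeries.coeff_trunc, if_pos (Nat.lt_succ_of_le ha)] at h5
    rw [← h5, h2, ← Polynomial.coe_pow, Polynomial.coeff_coe]
  rw [h1, h3, Finset.sum_pow_eq_sum_piAntidiag, Polynomial.finsetSum_coeff, Finset.sum_filter]
  congr 1
  refine Finset.sum_congr rfl fun κ _ => ?_
  have h6 : ∏ j : Fin n, Polynomial.monomial ((j : ℕ) + 1) (c j) ^ κ j =
      Polynomial.monomial (∑ j : Fin n, ((j : ℕ) + 1) * κ j) (∏ j : Fin n, c j ^ κ j) := by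
    simp only [Polynomial.monomial_pow]
    induction (Finset.univ : Finset (Fin n)) using Finset.induction_on with
    | empty => simp
    | insert i s hi ih => 
      rw [Finset.prod_insert hi, Finset.sum_insert hi, Finset.prod_insert hi, ih,
        Polynomial.monomial_mul_monomial]
  rw [h6, ← Polynomial.C_eq_natCast, Polynomial.coeff_C_mul, Polynomial.coeff_monomial]
  simp

end TaylorPower

/-! ### Taylor coefficients of the scaled flux -/

section FluxTaylor

theorem iteratedDeriv_integral {A : ℝ × ℝ → ℂ} (hA : ContDiff ℝ (⊤ : ℕ∞) A) (p : ℕ) :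
    iteratedDeriv p (fun e : ℝ => ∫ t in (0 : ℝ)..1, A (t, e)) =
      fun e => ∫ t in (0 : ℝ)..1, dirDerivs (List.replicate p ((0, 1) : ℝ × ℝ)) A (t, e) := by
  induction p with
  | zero => simp [dirDerivs_nil]
  | succ p ih =>
    rw [iteratedDeriv_succ, ih]
    funext e
    have hD := smooth_dirDerivs hA (List.replicate p ((0, 1) : ℝ × ℝ))
    have h := (hasFDerivAt_integral_smooth hD e).hasDerivAt.deriv
    rw [h, ContinuousLinearMap.intervalIntegral_apply]
    · rfl
    · have h2 : Continuous fun t : ℝ => sndDeriv (dirDerivs (List.replicate p ((0, 1) : ℝ × ℝ)) A) (t, e) :=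
        (contDiff_sndDeriv hD).continuous.comp (by fun_prop)
      exact h2.intervalIntegrable _ _

variable {d : ℕ}

theorem dirDerivs_replicate_add {V : Type*} [NormedAddCommGroup V] [NormedSpace ℝ V] {F : V → ℂ}
    (hF : ContDiff ℝ (⊤ : ℕ∞) F) (y z : V) (α β : ℝ) (p : ℕ) (x : V) :
    dirDerivs (List.replicate p (α • y + β • z)) F x =
      ∑ q ∈ Finset.HasAntidiagonal.antidiagonal p, (p.choose q.1 : ℂ) *
        (((α ^ q.1 * β ^ q.2 : ℝ) : ℂ) *
          dirDerivs (List.replicate q.1 y ++ List.replicate q.2 z) F x) := by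
  induction p generalizing x with
  | zero => simp [dirDerivs_nil]
  | succ p ih =>
    have hs : ∀ a b, ContDiff ℝ (⊤ : ℕ∞)
        (dirDerivs (List.replicate a y ++ List.replicate b z) F) := fun a b => smooth_dirDerivs hF _
    rw [List.replicate_succ, dirDerivs_cons, funext ih]
    have h1 : dirDeriv (α • y + β • z) (fun x => ∑ q ∈ Finset.HasAntidiagonal.antidiagonal p,
        (p.choose q.1 : ℂ) * (((α ^ q.1 * β ^ q.2 : ℝ) : ℂ) *
          dirDerivs (List.replicate q.1 y ++ List.replicate q.2 z) F x)) x =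
        ∑ q ∈ Finset.HasAntidiagonal.antidiagonal p,
        (p.choose q.1 : ℂ) * (((α ^ q.1 * β ^ q.2 : ℝ) : ℂ) *
          (α * dirDerivs (List.replicate (q.1 + 1) y ++ List.replicate q.2 z) F x +
            β * dirDerivs (List.replicate q.1 y ++ List.replicate (q.2 + 1) z) F x)) := by
      rw [dirDeriv_sum _ fun q _ => contDiff_const.mul (contDiff_const.mul (hs _ _))]
      refine Finset.sum_congr rfl fun q _ => ?_
      rw [dirDeriv_const_mul (contDiff_const.mul (hs _ _))]
      simp only [dirDeriv_const_mul (hs _ _)]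
      congr 2
      have h2 : dirDerivs (List.replicate q.1 y ++ List.replicate (q.2 + 1) z) F =
          dirDeriv z (dirDerivs (List.replicate q.1 y ++ List.replicate q.2 z) F) := by
        rw [← dirDerivs_cons]
        refine dirDerivs_perm hF ?_
        rw [List.replicate_succ]
        exact List.perm_middle
      rw [h2]
      simp only [dirDeriv, map_add, map_smul, Complex.real_smul, List.replicate_succ,
        List.cons_append, dirDerivs_cons]
    rw [h1, Finset.sum_antidiagonal_choose_succ_mul (fun a b => ((α ^ a * β ^ b : ℝ) : ℂ) *
      dirDerivs (List.replicate a y ++ List.replicate b z) F x), ← Finset.sum_add_distrib]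
    refine Finset.sum_congr rfl fun q hq => ?_
    have hq' := Finset.HasAntidiagonal.mem_antidiagonal.1 hq
    rw [show p.choose q.2 = p.choose q.1 by rw [← hq', Nat.choose_symm_add]]
    push_cast
    ring

/-- The moments of the triangle. -/
theorem integral_triangle_moment (s q : ℕ) :
    ∫ u in (0 : ℝ)..1, ∫ v in (0 : ℝ)..1, u * ((u - 1 / 2) ^ s * (u * v - 1 / 2) ^ q) =
      (((1 / 2 : ℝ) ^ (s + q + 2) - (-1 / 2) ^ (s + q + 2)) / (s + q + 2) -
        (-1 / 2) ^ (q + 1) * (((1 / 2) ^ (s + 1) - (-1 / 2) ^ (s + 1)) / (s + 1))) / (q + 1) := by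
  have h1 : ∀ u : ℝ, ∫ v in (0 : ℝ)..1, u * ((u - 1 / 2) ^ s * (u * v - 1 / 2) ^ q) =
      ((u - 1 / 2) ^ (s + q + 1) - (-1 / 2) ^ (q + 1) * (u - 1 / 2) ^ s) / (q + 1) := fun u => by
    have h2 := intervalIntegral.mul_integral_comp_mul_sub (a := 0) (b := 1) (f := fun v : ℝ => v ^ q) u (1 / 2)
    have e : (fun v : ℝ => u * ((u - 1 / 2) ^ s * (u * v - 1 / 2) ^ q)) =
        fun v => (u - 1 / 2) ^ s * (u * (u * v - 1 / 2) ^ q) := by funext v; ring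
    rw [e, intervalIntegral.integral_const_mul, intervalIntegral.integral_const_mul, h2, integral_pow]
    have e2 : u * 0 - 1 / 2 = (-1 / 2 : ℝ) := by norm_num
    rw [e2, mul_one]
    ring
  have h3 : ∀ n : ℕ, ∫ u in (0 : ℝ)..1, (u - 1 / 2) ^ n =
      ((1 / 2 : ℝ) ^ (n + 1) - (-1 / 2) ^ (n + 1)) / (n + 1) := fun n => by
    have h4 := intervalIntegral.integral_comp_sub_right (a := 0) (b := 1) (fun v : ℝ => v ^ n) (1 / 2)
    rw [h4, integral_pow]
    norm_num
  simp only [h1]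
  rw [intervalIntegral.integral_div, intervalIntegral.integral_sub, intervalIntegral.integral_const_mul,
    h3, h3]
  · push_cast
    ring_nf
  · exact (by fun_prop : Continuous fun u : ℝ => (u - 1 / 2) ^ (s + q + 1)).intervalIntegrable _ _
  · exact (by fun_prop : Continuous fun u : ℝ => (-1 / 2) ^ (q + 1) * (u - 1 / 2) ^ s).intervalIntegrable _ _

/-- With j = s + q + 1 and c = s + 1 the right side is minus the numerical coefficient in 𝓛_j. The
left side combines the Taylor factor and the binomial coefficient of a mixed derivative with the
moment of the triangle. -/
theorem moment_coeff (s q : ℕ) :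
    ((s + q).choose s : ℂ) / ((s + q).factorial : ℂ) *
      ((∫ u in (0 : ℝ)..1, ∫ v in (0 : ℝ)..1, u * ((u - 1 / 2) ^ s * (u * v - 1 / 2) ^ q) : ℝ) : ℂ) =
    -((1 / ((s + q + 1).factorial : ℂ)) * (-1 / 2 : ℂ) ^ (s + q + 2) *
      (1 / (((s + q + 1 : ℕ) : ℂ) + 1) ^ 2)) *
      (((s + q + 2).choose (s + 1) : ℂ) * ((1 - (-1 : ℂ) ^ (s + q + 2)) * ((s + 1 : ℕ) : ℂ) -
        (1 - (-1 : ℂ) ^ (s + 1)) * (((s + q + 1 : ℕ) : ℂ) + 1))) := by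
  have h : ∀ n : ℕ, (1 / 2 : ℂ) ^ n = (-1) ^ n * (-1 / 2) ^ n := fun n => by
    rw [← mul_pow]; norm_num
  rw [integral_triangle_moment, Nat.cast_choose ℂ (Nat.le_add_right s q),
    Nat.cast_choose ℂ (show s + 1 ≤ s + q + 2 by omega), Nat.add_sub_cancel_left,
    show s + q + 2 - (s + 1) = q + 1 by omega]
  have hfac : ∀ n : ℕ, (n.factorial : ℂ) ≠ 0 := fun n => by exact_mod_cast Nat.factorial_ne_zero n
  have h1 := hfac s
  have h2 := hfac q
  have h3 := hfac (s + q)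
  have h4 : (s : ℂ) + 1 ≠ 0 := by exact_mod_cast Nat.succ_ne_zero s
  have h5 : (q : ℂ) + 1 ≠ 0 := by exact_mod_cast Nat.succ_ne_zero q
  have h6 : (s : ℂ) + q + 1 ≠ 0 := by exact_mod_cast Nat.succ_ne_zero (s + q)
  have h7 : (s : ℂ) + q + 2 ≠ 0 := by exact_mod_cast Nat.succ_ne_zero (s + q + 1)
  rw [show s + q + 2 = (s + q + 1) + 1 from rfl, Nat.factorial_succ (s + q + 1),
    Nat.factorial_succ (s + q), Nat.factorial_succ s, Nat.factorial_succ q]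
  push_cast
  rw [h (s + q + 1 + 1), h (s + 1)]
  have h8 : (-1 / 2 : ℂ) ^ (s + q + 1 + 1) = (-1 / 2) ^ (q + 1) * (-1 / 2) ^ (s + 1) := by
    rw [← pow_add]; congr 1; omega
  rw [h8]
  have h9 : (s : ℂ) + q + 1 + 1 = s + q + 2 := by ring
  rw [h9]
  -- Once all powers are expressed through those of -1/2 and -1, the claim is an identity of
  -- rational functions in which these powers are independent symbols.
  generalize (-1 / 2 : ℂ) ^ (q + 1) = a
  generalize (-1 / 2 : ℂ) ^ (s + 1) = b
  generalize (-1 : ℂ) ^ (s + q + 1 + 1) = e1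
  generalize (-1 : ℂ) ^ (s + 1) = e2
  field_simp
  ring

/-- Derivatives at `0` of the mean of `b` over a scaled triangle. -/
theorem iteratedDeriv_triMean {b : Cfg d → ℝ} (hb : ContDiff ℝ (⊤ : ℕ∞) b) (x y z : Cfg d) (p : ℕ) :
    iteratedDeriv p (fun e : ℝ => (triMean b (x, e • ((y, z) : Phase d)) : ℂ)) 0 =
      ∑ q ∈ Finset.HasAntidiagonal.antidiagonal p, (p.choose q.1 : ℂ) *
        (((∫ u in (0 : ℝ)..1, ∫ v in (0 : ℝ)..1,
          u * ((u - 1 / 2) ^ q.1 * (u * v - 1 / 2) ^ q.2) : ℝ) : ℂ) *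
          dirDerivs (List.replicate q.1 y ++ List.replicate q.2 z) (fun x => (b x : ℂ)) x) := by
  have hbc : ContDiff ℝ (⊤ : ℕ∞) fun x => (b x : ℂ) := Complex.ofRealCLM.contDiff.comp hb
  -- A point of the scaled triangle is x + e · dir(u, v). The p-th derivative at e = 0 is therefore
  -- the p-th derivative of b at x along dir(u, v); expanding it in y and z leaves only moments of
  -- the triangle.
  set dir : ℝ → ℝ → Cfg d := fun u v => (u - 1 / 2) • y + (u * v - 1 / 2) • z with hdir
  set A2 : ℝ × ℝ × ℝ → ℂ := fun r => (r.2.1 : ℂ) * (b (x + r.2.2 • dir r.2.1 r.1) : ℂ) with hA2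
  have hA2s : ContDiff ℝ (⊤ : ℕ∞) A2 := by
    refine (Complex.ofRealCLM.contDiff.comp (by fun_prop : ContDiff ℝ (⊤ : ℕ∞) fun r : ℝ × ℝ × ℝ => r.2.1)).mul
      (hbc.comp ?_)
    simp only [hdir]
    fun_prop
  set A1 : ℝ × ℝ → ℂ := fun r => ∫ v in (0 : ℝ)..1, A2 (v, r) with hA1
  have hA1s : ContDiff ℝ (⊤ : ℕ∞) A1 := contDiff_integral_smooth hA2s
  have e0 : (fun e : ℝ => (triMean b (x, e • ((y, z) : Phase d)) : ℂ)) =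
      fun e => ∫ u in (0 : ℝ)..1, A1 (u, e) := by
    funext e
    rw [triMean, ← intervalIntegral.integral_ofReal]
    refine intervalIntegral.integral_congr fun u _ => ?_
    simp only [hA1, hA2]
    rw [← intervalIntegral.integral_ofReal]
    refine intervalIntegral.integral_congr fun v _ => ?_
    simp only [hdir, Prod.smul_mk]
    push_cast
    congr 3
    module
  rw [e0, iteratedDeriv_integral hA1s]
  have e1 : ∀ u : ℝ, dirDerivs (List.replicate p ((0, 1) : ℝ × ℝ)) A1 (u, 0) =
      ∫ v in (0 : ℝ)..1, (u : ℂ) * dirDerivs (List.replicate p (dir u v)) (fun x => (b x : ℂ)) x := by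
    intro u
    have h1 := congrFun (iteratedDeriv_line hA1s ((u, 0) : ℝ × ℝ) (0, 1) p) 0
    simp only [zero_smul, add_zero] at h1
    rw [← h1]
    have h2 : (fun t : ℝ => A1 ((u, 0) + t • ((0, 1) : ℝ × ℝ))) =
        fun t => ∫ v in (0 : ℝ)..1, (fun r : ℝ × ℝ => A2 (r.1, u, r.2)) (v, t) := by
      funext t
      simp [hA1]
    have hs : ContDiff ℝ (⊤ : ℕ∞) (fun r : ℝ × ℝ => A2 (r.1, u, r.2)) := hA2s.comp (by fun_prop)
    rw [h2, iteratedDeriv_integral hs]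
    refine intervalIntegral.integral_congr fun v _ => ?_
    have h3 := congrFun (iteratedDeriv_line hs ((v, 0) : ℝ × ℝ) (0, 1) p) 0
    simp only [zero_smul, add_zero] at h3
    rw [← h3]
    have h4 : (fun t : ℝ => A2 (((v, 0) + t • ((0, 1) : ℝ × ℝ)).1, u, ((v, 0) + t • ((0, 1) : ℝ × ℝ)).2)) =
        fun t => (u : ℂ) * (b (x + t • dir u v) : ℂ) := by
      funext t; simp [hA2]
    rw [h4, iteratedDeriv_const_mul_field, iteratedDeriv_line hbc]
    simp
  simp only [e1]
  simp only [hdir, dirDerivs_replicate_add hbc]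
  have e2 : ∀ u v : ℝ, (u : ℂ) * ∑ q ∈ Finset.HasAntidiagonal.antidiagonal p, (p.choose q.1 : ℂ) *
      ((((u - 1 / 2) ^ q.1 * (u * v - 1 / 2) ^ q.2 : ℝ) : ℂ) *
        dirDerivs (List.replicate q.1 y ++ List.replicate q.2 z) (fun x => (b x : ℂ)) x) =
      ∑ q ∈ Finset.HasAntidiagonal.antidiagonal p,
        ((u * ((u - 1 / 2) ^ q.1 * (u * v - 1 / 2) ^ q.2) : ℝ) : ℂ) * ((p.choose q.1 : ℂ) *
        dirDerivs (List.replicate q.1 y ++ List.replicate q.2 z) (fun x => (b x : ℂ)) x) := fun u v => by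
    rw [Finset.mul_sum]
    refine Finset.sum_congr rfl fun q _ => ?_
    push_cast
    ring
  simp only [e2]
  have hc : ∀ q : ℕ × ℕ, Continuous fun r : ℝ × ℝ =>
      ((r.1 * ((r.1 - 1 / 2) ^ q.1 * (r.1 * r.2 - 1 / 2) ^ q.2) : ℝ) : ℂ) := fun q =>
    Complex.continuous_ofReal.comp (by fun_prop)
  have e3 : ∀ u : ℝ, (∫ v in (0 : ℝ)..1, ∑ q ∈ Finset.HasAntidiagonal.antidiagonal p,
        ((u * ((u - 1 / 2) ^ q.1 * (u * v - 1 / 2) ^ q.2) : ℝ) : ℂ) * ((p.choose q.1 : ℂ) *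
        dirDerivs (List.replicate q.1 y ++ List.replicate q.2 z) (fun x => (b x : ℂ)) x)) =
      ∑ q ∈ Finset.HasAntidiagonal.antidiagonal p,
        (∫ v in (0 : ℝ)..1, ((u * ((u - 1 / 2) ^ q.1 * (u * v - 1 / 2) ^ q.2) : ℝ) : ℂ)) *
        ((p.choose q.1 : ℂ) *
        dirDerivs (List.replicate q.1 y ++ List.replicate q.2 z) (fun x => (b x : ℂ)) x) := fun u => by
    rw [intervalIntegral.integral_finsetSum]
    · simp only [intervalIntegral.integral_mul_const]
    · intro q _
      exact (((hc q).comp (by fun_prop : Continuous fun v : ℝ => (u, v))).mul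
        continuous_const).intervalIntegrable _ _
  simp only [e3]
  rw [intervalIntegral.integral_finsetSum]
  · refine Finset.sum_congr rfl fun q _ => ?_
    rw [intervalIntegral.integral_mul_const]
    simp only [intervalIntegral.integral_ofReal]
    ring
  · intro q _
    have := intervalIntegral.continuous_parametric_intervalIntegral_of_continuous'
      (f := fun u v : ℝ => ((u * ((u - 1 / 2) ^ q.1 * (u * v - 1 / 2) ^ q.2) : ℝ) : ℂ)) (μ := volume)
      (hc q) 0 1
    exact (this.mul continuous_const).intervalIntegrable _ _

end FluxTaylor

/-! ### Identification of the flux coefficients with the polynomials 𝓛_j -/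

section FluxTaylor

variable {d : ℕ}

theorem prod_take_mul_prod_drop_ofFn {ι M : Type*} [CommMonoid M] {p : ℕ} (μ : Fin p → ι) (s : ℕ)
    (h h' : ι → M) : (((List.ofFn μ).take s).map h).prod * (((List.ofFn μ).drop s).map h').prod =
      ∏ r : Fin p, (if (r : ℕ) < s then h else h') (μ r) := by
  rw [← List.prod_ofFn,
    ← List.prod_take_mul_prod_drop (List.ofFn fun r : Fin p => (if (r : ℕ) < s then h else h') (μ r)) s]
  refine congrArg₂ (fun a b : M => a * b) (congrArg List.prod ?_) (congrArg List.prod ?_)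
  · refine List.ext_getElem (by simp) fun i h1 h2 => ?_
    have : i < s := by simp at h1; omega
    simp [this]
  · refine List.ext_getElem (by simp) fun i h1 h2 => ?_
    simp

/-- Expansion of directional derivatives along two vectors into partial derivatives. -/
theorem dirDerivs_replicate_eq_sum {F : Cfg d → ℂ} (hF : ContDiff ℝ (⊤ : ℕ∞) F) (y z x : Cfg d)
    {s q p : ℕ} (hp : s + q = p) :
    dirDerivs (List.replicate s y ++ List.replicate q z) F x = ∑ μ : Fin p → Fin d,
      iteratedFDeriv ℝ p F x (fun r => stdVec (μ r)) *
        ((((List.ofFn μ).take s).map fun i => (y i : ℂ)).prod *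
          (((List.ofFn μ).drop s).map fun i => (z i : ℂ)).prod) := by
  set m : Fin p → Cfg d := fun r => if (r : ℕ) < s then y else z with hm
  have hl : List.replicate s y ++ List.replicate q z = List.ofFn m := by
    refine List.ext_getElem (by simp [hp]) fun i h1 h2 => ?_
    simp only [List.getElem_append, List.length_replicate, List.getElem_replicate,
      List.getElem_ofFn, hm]
    split_ifs <;> rfl
  have hs : m = fun r => ∑ i, m r i • stdVec i := funext fun r => (stdVec_sum (m r)).symm
  rw [hl, ← iteratedFDeriv_apply_eq_dirDerivs hF]
  conv_lhs => rw [hs]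
  rw [ContinuousMultilinearMap.map_sum]
  refine Finset.sum_congr rfl fun μ _ => ?_
  rw [ContinuousMultilinearMap.map_smul_univ, prod_take_mul_prod_drop_ofFn, Complex.real_smul,
    mul_comm, Complex.ofReal_prod]
  congr 1
  refine Finset.prod_congr rfl fun r _ => ?_
  simp only [hm]
  split_ifs <;> rfl

/-- By multilinearity the sum over index tuples μ reassembles, for each c = s + 1, the derivative of
B taken s times along y and p - s times along z. This is the form in which the Taylor coefficients
of the flux appear. -/
theorem magPoly_succ {B : Fin d → Fin d → Cfg d → ℝ} (hB : ∀ k l, ContDiff ℝ (⊤ : ℕ∞) (B k l))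
    (x : Cfg d) (p : ℕ) (w : Phase d) :
    magPoly B x (p + 1) w = ∑ k : Fin d, ∑ l : Fin d, (w.1 k : ℂ) * (w.2 l : ℂ) *
      ∑ q ∈ Finset.HasAntidiagonal.antidiagonal p,
        ((1 / ((p + 1).factorial : ℂ)) * (-1 / 2 : ℂ) ^ (p + 2) * (1 / (((p + 1 : ℕ) : ℂ) + 1) ^ 2)) *
        (((p + 2).choose (q.1 + 1) : ℂ) * ((1 - (-1 : ℂ) ^ (p + 2)) * ((q.1 + 1 : ℕ) : ℂ) -
        (1 - (-1 : ℂ) ^ (q.1 + 1)) * (((p + 1 : ℕ) : ℂ) + 1))) *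
        dirDerivs (List.replicate q.1 w.1 ++ List.replicate q.2 w.2) (fun x => (B k l x : ℂ)) x := by
  have h0 : magPoly B x (p + 1) w =
      (1 / ((p + 1).factorial : ℂ)) * (-1 / 2 : ℂ) ^ (p + 2) * (1 / (((p + 1 : ℕ) : ℂ) + 1) ^ 2) *
      ∑ k : Fin d, ∑ l : Fin d, ∑ μ : Fin p → Fin d,
      (iteratedFDeriv ℝ p (B k l) x (fun r => stdVec (μ r)) : ℂ) *
        ∑ c ∈ Finset.Icc 1 (p + 1), ((p + 2).choose c : ℂ) *
          ((1 - (-1 : ℂ) ^ (p + 2)) * c - (1 - (-1 : ℂ) ^ c) * (((p + 1 : ℕ) : ℂ) + 1)) *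
          monW ([leftVec k, rightVec l] ++ ((List.ofFn μ).take (c - 1)).map leftVec
              ++ ((List.ofFn μ).drop (c - 1)).map rightVec) w := rfl
  rw [h0, Finset.mul_sum]
  refine Finset.sum_congr rfl fun k _ => ?_
  rw [Finset.mul_sum]
  refine Finset.sum_congr rfl fun l _ => ?_
  have hb : ContDiff ℝ (⊤ : ℕ∞) fun x => (B k l x : ℂ) := Complex.ofRealCLM.contDiff.comp (hB k l)
  have hit : ∀ m : Fin p → Cfg d, (iteratedFDeriv ℝ p (B k l) x m : ℂ) =
      iteratedFDeriv ℝ p (fun x => (B k l x : ℂ)) x m := fun m => by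
    have := Complex.ofRealCLM.iteratedFDeriv_comp_left (x := x) (i := p) (n := (⊤ : ℕ∞))
      (hB k l).contDiffAt (by exact_mod_cast le_top)
    change _ = iteratedFDeriv ℝ p (Complex.ofRealCLM ∘ B k l) x m
    rw [this]
    rfl
  rw [show Finset.Icc 1 (p + 1) = Finset.Ico 1 (p + 2) by ext; simp; omega]
  simp only [Finset.sum_Ico_eq_sum_range, Nat.add_sub_cancel_left, show p + 2 - 1 = p + 1 by omega]
  simp only [Finset.mul_sum]
  rw [Finset.Nat.sum_antidiagonal_eq_sum_range_succ_mk, Finset.sum_comm]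
  refine Finset.sum_congr rfl fun s hs => ?_
  have hs' : s ≤ p := Nat.lt_succ_iff.1 (Finset.mem_range.1 hs)
  simp only
  rw [dirDerivs_replicate_eq_sum hb w.1 w.2 x (show s + (p - s) = p by omega), Finset.mul_sum,
    Finset.mul_sum]
  refine Finset.sum_congr rfl fun μ _ => ?_
  rw [hit]
  have hmon : monW ([leftVec k, rightVec l] ++ ((List.ofFn μ).take s).map leftVec
      ++ ((List.ofFn μ).drop s).map rightVec) w = (w.1 k : ℂ) * (w.2 l : ℂ) *
        ((((List.ofFn μ).take s).map fun i => (w.1 i : ℂ)).prod *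
          (((List.ofFn μ).drop s).map fun i => (w.2 i : ℂ)).prod) := by
    simp only [monW, List.map_append, List.map_map, List.prod_append, List.map_cons, List.map_nil,
      List.prod_cons, List.prod_nil, Function.comp_def, leftVec, rightVec, pairL_left, pairL_right,
      mul_one]
    ring
  rw [hmon, Nat.add_comm 1 s]
  push_cast
  ring

/-- Leibniz' rule has only two terms because the first factor is linear; at t = 0 just (p + 1)
κ^{(p)}(0) is left, which raises p! to (p + 1)!. -/
theorem iteratedDeriv_ofReal_mul {κ : ℝ → ℂ} (hκ : ContDiff ℝ (⊤ : ℕ∞) κ) (p : ℕ) :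
    iteratedDeriv (p + 1) (fun t : ℝ => (t : ℂ) * κ t) =
      fun t : ℝ => (t : ℂ) * iteratedDeriv (p + 1) κ t + (p + 1) * iteratedDeriv p κ t := by
  have hd : ∀ n t, HasDerivAt (iteratedDeriv n κ) (iteratedDeriv (n + 1) κ t) t := fun n t => by
    rw [iteratedDeriv_succ]
    exact ((hκ.differentiable_iteratedDeriv n (by exact_mod_cast ENat.natCast_lt_top n)) t).hasDerivAt
  have ht : ∀ t : ℝ, HasDerivAt (fun t : ℝ => (t : ℂ)) 1 t := fun t =>
    Complex.ofRealCLM.hasDerivAt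
  induction p with
  | zero =>
    rw [zero_add, iteratedDeriv_one]
    funext t
    have := ((ht t).mul (hd 0 t)).deriv
    simp only [iteratedDeriv_zero] at this
    refine this.trans ?_
    simp; ring
  | succ p ih =>
    rw [iteratedDeriv_succ, ih]
    funext t
    refine (((ht t).mul (hd (p + 1) t)).add ((hd p t).const_mul ((p : ℂ) + 1))).deriv.trans ?_
    push_cast
    ring

variable {B : Fin d → Fin d → Cfg d → ℝ}

/-- The Taylor coefficients of the scaled flux at `ε = 0` are the polynomials `-𝓛_j`. -/
theorem iteratedDeriv_fluxKer (hB : ∀ k l, IsBCInfty (B k l)) (x : Cfg d) (lam : ℝ) (w : Phase d)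
    (p : ℕ) : iteratedDeriv (p + 1) (fun ε : ℝ => fluxKer B (x, ((ε, lam), w))) 0 =
      ((p + 1).factorial : ℂ) * -magPoly B x (p + 1) w := by
  have hT : ∀ k l, ContDiff ℝ (⊤ : ℕ∞) fun ε : ℝ =>
      (triMean (B k l) (x, ε • ((w.1, w.2) : Phase d)) : ℂ) := fun k l =>
    Complex.ofRealCLM.contDiff.comp ((pGrowth_triMean (hB k l)).1.comp (by fun_prop))
  have hκ : ∀ k l, ContDiff ℝ (⊤ : ℕ∞) fun ε : ℝ => (w.1 k : ℂ) * w.2 l *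
      (triMean (B k l) (x, ε • ((w.1, w.2) : Phase d)) : ℂ) := fun k l => contDiff_const.mul (hT k l)
  have e : (fun ε : ℝ => fluxKer B (x, ((ε, lam), w))) = fun ε : ℝ => (ε : ℂ) *
      ∑ k, ∑ l, (w.1 k : ℂ) * w.2 l * (triMean (B k l) (x, ε • ((w.1, w.2) : Phase d)) : ℂ) := by
    funext ε
    rw [fluxKer_eq hB]
    rfl
  rw [e, iteratedDeriv_ofReal_mul (ContDiff.sum fun k _ => ContDiff.sum fun l _ => hκ k l)]
  simp only [Complex.ofReal_zero, zero_mul, zero_add]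
  have h1 : ∀ n : ℕ, ((n : WithTop ℕ∞)) ≤ ((⊤ : ℕ∞) : WithTop ℕ∞) := fun n => by exact_mod_cast le_top
  rw [iteratedDeriv_fun_sum fun k _ => ((ContDiff.sum fun l _ => hκ k l).of_le (h1 p)).contDiffAt,
    magPoly_succ fun k l => (hB k l).1, ← Finset.sum_neg_distrib, Finset.mul_sum, Finset.mul_sum]
  refine Finset.sum_congr rfl fun k _ => ?_
  rw [iteratedDeriv_fun_sum fun l _ => ((hκ k l).of_le (h1 p)).contDiffAt, ← Finset.sum_neg_distrib,
    Finset.mul_sum, Finset.mul_sum]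
  refine Finset.sum_congr rfl fun l _ => ?_
  rw [iteratedDeriv_const_mul_field, iteratedDeriv_triMean (hB k l).1, Finset.mul_sum, Finset.mul_sum,
    Finset.mul_sum, ← Finset.sum_neg_distrib, Finset.mul_sum]
  refine Finset.sum_congr rfl fun q hq => ?_
  have hq' : q.1 + q.2 = p := Finset.HasAntidiagonal.mem_antidiagonal.1 hq
  have hm := moment_coeff q.1 q.2
  rw [hq'] at hm
  have hfac : (p.factorial : ℂ) ≠ 0 := by exact_mod_cast Nat.factorial_ne_zero p
  rw [div_mul_eq_mul_div, div_eq_iff hfac] at hm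
  rw [← mul_assoc (p.choose q.1 : ℂ), hm, Nat.factorial_succ]
  push_cast
  ring

end FluxTaylor

/-! ### The (n,k) terms as Taylor coefficients -/

section Terms

variable {d : ℕ} {B : Fin d → Fin d → Cfg d → ℝ}

/-- The bound n on the entries follows from the weighted equation, so it imposes no additional
restriction. -/
theorem mem_expIndices_cons {n k b : ℕ} {κ : Fin n → ℕ} :
    (Fin.cons b κ : Fin (n + 1) → ℕ) ∈ expIndices n k ↔
      b + ∑ j : Fin n, ((j : ℕ) + 1) * κ j = n ∧ ∑ j, κ j = k := by
  rw [expIndices, Finset.mem_filter, Fintype.mem_piFinset]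
  simp only [Fin.cons_zero, Fin.sum_univ_succ, Fin.val_zero, zero_mul, zero_add, Fin.cons_succ,
    Fin.val_succ]
  refine ⟨fun h => h.2, fun h => ⟨fun j => ?_, h⟩⟩
  rw [Finset.mem_range, Nat.lt_succ_iff]
  refine Fin.cases ?_ (fun j => ?_) j
  · rw [Fin.cons_zero]; omega
  · rw [Fin.cons_succ]
    have h1 : ((j : ℕ) + 1) * κ j ≤ ∑ j : Fin n, ((j : ℕ) + 1) * κ j :=
      Finset.single_le_sum (f := fun j : Fin n => ((j : ℕ) + 1) * κ j)
        (fun _ _ => Nat.zero_le _) (Finset.mem_univ j)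
    nlinarith [h.1]

/-- Every magnetic factor carries weight at least one, so ∑ k_j ≤ ∑ j k_j ≤ n. This is the
combinatorial form of γ = O(ε). -/
theorem expIndices_eq_empty {n k : ℕ} (h : n < k) : expIndices n k = ∅ := by
  refine Finset.eq_empty_of_forall_notMem fun κ hκ => ?_
  rw [← Fin.cons_self_tail κ, mem_expIndices_cons] at hκ
  have h1 : ∑ j : Fin n, Fin.tail κ j ≤ ∑ j : Fin n, ((j : ℕ) + 1) * Fin.tail κ j :=
    Finset.sum_le_sum fun j _ => Nat.le_mul_of_pos_left _ (Nat.succ_pos _)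
  omega

theorem nkTerm_eq_zero {f g : Phase d → ℂ} {n k : ℕ} (h : n < k) (X : Phase d) :
    nkTerm B f g n k X = 0 := by
  rw [nkTerm, expIndices_eq_empty h, Finset.sum_empty]

/-- The tuples `(k_1, …, k_n)` with `∑ j k_j = a` and `∑ k_j = k`. -/
def magIndices (n k a : ℕ) : Finset (Fin n → ℕ) :=
  (Finset.piAntidiag (Finset.univ : Finset (Fin n)) k).filter
    fun κ => ∑ j : Fin n, ((j : ℕ) + 1) * κ j = a

theorem mem_magIndices {n k a : ℕ} {κ : Fin n → ℕ} : κ ∈ magIndices n k a ↔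
    ∑ j, κ j = k ∧ ∑ j : Fin n, ((j : ℕ) + 1) * κ j = a := by
  simp [magIndices, Finset.mem_piAntidiag]

/-- Grouping by b = k_0 splits n = a + b into the order a supplied by the flux and the power b of
𝓛₀, matching the Leibniz sum for the ε-derivatives. -/
theorem sum_expIndices (n k : ℕ) (T : (Fin n → ℕ) → ℕ → ℂ) :
    ∑ κ ∈ expIndices n k, T (Fin.tail κ) (κ 0) =
      ∑ q ∈ Finset.HasAntidiagonal.antidiagonal n, ∑ κ ∈ magIndices n k q.1, T κ q.2 := by
  rw [Finset.sum_sigma']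
  refine Finset.sum_bij' (fun κ _ => ⟨(n - κ 0, κ 0), Fin.tail κ⟩) (fun p _ => Fin.cons p.1.2 p.2)
    ?_ ?_ ?_ ?_ ?_
  · intro κ hκ
    rw [← Fin.cons_self_tail κ, mem_expIndices_cons] at hκ
    simp only [Finset.mem_sigma, Finset.HasAntidiagonal.mem_antidiagonal, mem_magIndices]
    omega
  · rintro ⟨⟨a, b⟩, κ⟩ hp
    simp only [Finset.mem_sigma, Finset.HasAntidiagonal.mem_antidiagonal, mem_magIndices] at hp
    rw [mem_expIndices_cons]
    simp only
    omega
  · intro κ _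
    exact Fin.cons_self_tail κ
  · rintro ⟨⟨a, b⟩, κ⟩ hp
    simp only [Finset.mem_sigma, Finset.HasAntidiagonal.mem_antidiagonal, mem_magIndices] at hp
    simp only [Fin.cons_zero, Fin.tail_cons]
    rw [show n - b = a by omega]
  · intro κ _
    rfl

/-- The `ε`-derivatives of the kernels at `ε = 0`. -/
theorem dirDerivs_eps_magTermKer (hB : ∀ k l, IsBCInfty (B k l)) (x : Cfg d) (lam : ℝ) (w : Phase d)
    (k : ℕ) {n a : ℕ} (ha : a ≤ n) :
    dirDerivs (List.replicate a (kerDir (epsDir d))) (magTermKer B k) (x, ((0, lam), w)) =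
      ∑ κ ∈ magIndices n k a, Complex.I ^ k * (a.factorial : ℂ) /
        ((∏ j, (κ j).factorial : ℕ) : ℂ) * ∏ j : Fin n, magPoly B x (j + 1) w ^ κ j := by
  have hγ : ContDiff ℝ (⊤ : ℕ∞) fun ε : ℝ => fluxKer B (x, ((ε, lam), w)) :=
    (eKer_fluxKer hB).pGrowth.1.comp (by fun_prop)
  have h1 := congrFun (iteratedDeriv_line (eKer_magTermKer hB k).pGrowth.1
    ((x, ((0, lam), w)) : KerArg d) (kerDir (epsDir d)) a) 0
  simp only [zero_smul, add_zero] at h1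
  rw [← h1]
  have e : (fun t : ℝ => magTermKer B k (((x, ((0, lam), w)) : KerArg d) + t • kerDir (epsDir d))) =
      fun t => (-Complex.I) ^ k / (k.factorial : ℂ) * fluxKer B (x, ((t, lam), w)) ^ k := by
    funext t
    simp [magTermKer, kerDir, epsDir]
  rw [e, iteratedDeriv_const_mul_field, iteratedDeriv_pow_eq hγ (c := fun j => -magPoly B x (j + 1) w)
    (by simp [fluxKer, scaledFlux]) (fun j _ => iteratedDeriv_fluxKer hB x lam w j) k ha,
    Finset.mul_sum, Finset.mul_sum]
  refine Finset.sum_congr rfl fun κ hκ => ?_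
  have hk := (mem_magIndices.1 hκ).1
  have hm : ((∏ j, (κ j).factorial : ℕ) : ℂ) * (Nat.multinomial Finset.univ κ : ℂ) = k.factorial := by
    rw [← Nat.cast_mul, Nat.multinomial_spec, hk]
  have hf1 : (k.factorial : ℂ) ≠ 0 := by exact_mod_cast Nat.factorial_ne_zero k
  have hf2 : ((∏ j, (κ j).factorial : ℕ) : ℂ) ≠ 0 := by
    exact_mod_cast Finset.prod_ne_zero_iff.2 fun j _ => Nat.factorial_ne_zero (κ j)
  have hs : ∏ j : Fin n, (-magPoly B x (j + 1) w) ^ κ j =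
      (-1) ^ k * ∏ j : Fin n, magPoly B x (j + 1) w ^ κ j := by
    rw [← hk, ← Finset.prod_pow_eq_pow_sum, ← Finset.prod_mul_distrib]
    exact Finset.prod_congr rfl fun j _ => by rw [neg_pow]
  -- The flux coefficients are -𝓛_j, and their k signs turn (-i)^k into the i^k of the (n,k) term.
  have hi : (-Complex.I) ^ k * (-1) ^ k = Complex.I ^ k := by
    rw [← mul_pow]; simp
  rw [hs, ← hi]
  have hmm : (Nat.multinomial Finset.univ κ : ℂ) = k.factorial / ((∏ j, (κ j).factorial : ℕ) : ℂ) := by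
    rw [eq_div_iff hf2, mul_comm]; exact hm
  rw [hmm]
  field_simp

/-- The `(n,k)` terms are the Taylor coefficients in `ε` of the terms of the `λ`-expansion. -/
theorem nkTerm_eq (hB : ∀ k l, IsBCInfty (B k l)) {f g : Phase d → ℂ} {M : ℝ} {p : ℕ}
    (hF : IsDouble M p fun e : Phase d × Phase d => f e.1 * g e.2) (n k : ℕ) (X : Phase d) :
    nkTerm B f g n k X = (n.factorial : ℂ)⁻¹ * dirDerivs (List.replicate n (epsDir d))
      (oscInt (magTermKer B k) fun e => f e.1 * g e.2) ((0, 0), X) := by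
  set F : Phase d × Phase d → ℂ := fun e => f e.1 * g e.2 with hFdef
  rw [dirDerivs_eps_oscInt (eKer_magTermKer hB k).pGrowth hF]
  set T : (Fin n → ℕ) → ℕ → ℂ := fun κ b => oscInt
    (fun a => ∏ j : Fin n, magPoly B X.1 (j + 1) a.2.2 ^ κ j) (opL0^[b] F) ((0, 0), X) with hT
  have hL : nkTerm B f g n k X = ∑ κ ∈ expIndices n k, Complex.I ^ (k + κ 0) /
      (((κ 0).factorial * ∏ j, (Fin.tail κ j).factorial : ℕ) : ℂ) * T (Fin.tail κ) (κ 0) := by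
    rw [nkTerm]
    refine Finset.sum_congr rfl fun κ _ => ?_
    rw [opLProd_diag X.1 κ hF X, Fin.prod_univ_succ]
    rfl
  rw [hL, sum_expIndices n k fun κ b => Complex.I ^ (k + b) /
    ((b.factorial * ∏ j, (κ j).factorial : ℕ) : ℂ) * T κ b, Finset.mul_sum]
  refine Finset.sum_congr rfl fun q hq => ?_
  have hq' : q.1 + q.2 = n := Finset.HasAntidiagonal.mem_antidiagonal.1 hq
  have hFb : IsDouble M p (opL0^[q.2] F) := hF.diffOp (isDiffOp_opL0.iterate q.2)
  have hP : ∀ κ : Fin n → ℕ, PGrowth kerWeight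
      (fun a : KerArg d => ∏ j : Fin n, magPoly B X.1 (j + 1) a.2.2 ^ κ j) := fun κ => by
    have := (rep_foldr (List.finRange n) fun j : Fin n =>
      (rep_magPoly B X.1 (j + 1)).pow (κ j)).pGrowth
    simpa only [Fin.prod_univ_def] using this
  have h1 : oscInt (dirDerivs (List.replicate q.1 (kerDir (epsDir d))) (magTermKer B k))
      (iL0^[q.2] F) ((0, 0), X) = Complex.I ^ q.2 * ∑ κ ∈ magIndices n k q.1,
        Complex.I ^ k * (q.1.factorial : ℂ) / ((∏ j, (κ j).factorial : ℕ) : ℂ) * T κ q.2 := by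
    have hG : PGrowth kerWeight (dirDerivs (List.replicate q.1 (kerDir (epsDir d))) (magTermKer B k)) :=
      ((eKer_magTermKer hB k).dirDerivs_eps q.1).pGrowth
    rw [iL0_iterate hF.1, oscInt_const_mul_right hG _ hFb]
    congr 1
    rw [oscInt_congr (G' := fun a => ∑ κ ∈ magIndices n k q.1, Complex.I ^ k * (q.1.factorial : ℂ) /
      ((∏ j, (κ j).factorial : ℕ) : ℂ) * ∏ j : Fin n, magPoly B X.1 (j + 1) a.2.2 ^ κ j) _ _
      fun w => dirDerivs_eps_magTermKer hB X.1 0 w k (by omega),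
      oscInt_sum_left _ (fun κ _ => (hP κ).const_mul _) hFb]
    refine Finset.sum_congr rfl fun κ _ => ?_
    rw [oscInt_const_mul_left _ (hP κ) hFb]
  rw [h1, Finset.mul_sum, Finset.mul_sum, Finset.mul_sum]
  refine Finset.sum_congr rfl fun κ _ => ?_
  have hfac : ∀ n : ℕ, (n.factorial : ℂ) ≠ 0 := fun n => by exact_mod_cast Nat.factorial_ne_zero n
  have hf2 : ((∏ j, (κ j).factorial : ℕ) : ℂ) ≠ 0 := by
    exact_mod_cast Finset.prod_ne_zero_iff.2 fun j _ => Nat.factorial_ne_zero (κ j)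
  -- The binomial coefficient cancels 1/n! and the a! from the kernel derivative, leaving the 1/k_0!
  -- of the definition.
  have hc : (n.choose q.1 : ℂ) = n.factorial / (q.1.factorial * q.2.factorial) := by
    rw [← hq', Nat.cast_choose ℂ (Nat.le_add_right _ _), Nat.add_sub_cancel_left]
  rw [hc, Nat.cast_mul, pow_add]
  have := hfac n
  have := hfac q.1
  have := hfac q.2
  generalize ((∏ j, (κ j).factorial : ℕ) : ℂ) = D at hf2 ⊢
  field_simp

end Terms

/-! ### Asymptotic expansions -/

section Expansions

variable {d : ℕ}

theorem hasExpansion_of_bound {F : ℝ → Phase d → ℂ} {a : ℕ → Phase d → ℂ}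
    (h : ∀ (N : ℕ) (X : Phase d), ∃ C : ℝ, ∀ t ∈ Set.Ioc (0 : ℝ) 1,
      ‖F t X - ∑ n ∈ Finset.range (N + 1), (t : ℂ) ^ n * a n X‖ ≤ C * t ^ (N + 1)) :
    HasExpansion F a := by
  intro N X
  obtain ⟨C, hC⟩ := h N X
  have hev : ∀ᶠ t in 𝓝[>] (0 : ℝ), t ∈ Set.Ioc (0 : ℝ) 1 := Ioc_mem_nhdsGT one_pos
  have h1 : (fun t : ℝ => F t X - ∑ n ∈ Finset.range (N + 1), (t : ℂ) ^ n * a n X)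
      =O[𝓝[>] 0] fun t : ℝ => t ^ (N + 1) := by
    refine Asymptotics.IsBigO.of_bound C ?_
    filter_upwards [hev] with t ht
    rw [Real.norm_of_nonneg (pow_nonneg ht.1.le _)]
    exact hC t ht
  refine h1.trans_isLittleO ?_
  have h2 : (fun t : ℝ => t ^ (N + 1)) =o[𝓝 0] fun t : ℝ => t ^ N :=
    Asymptotics.isLittleO_pow_pow (Nat.lt_succ_self N)
  exact h2.mono nhdsWithin_le_nhds

/-- Once the lower coefficients agree, the difference of the expansions to order n is t^n times a
constant and also o(t^n). Agreement of the functions is required on (0,1] only, which is all that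
the first expansion of an iterated one provides. -/
theorem HasExpansion.unique {F F' : ℝ → Phase d → ℂ} {a a' : ℕ → Phase d → ℂ}
    (h : HasExpansion F a) (h' : HasExpansion F' a') (e : ∀ t ∈ Set.Ioc (0 : ℝ) 1, F t = F' t) :
    a = a' := by
  funext n X
  induction n using Nat.strong_induction_on with
  | _ n ih =>
    have hev : ∀ᶠ t in 𝓝[>] (0 : ℝ), t ∈ Set.Ioc (0 : ℝ) 1 := Ioc_mem_nhdsGT one_pos
    have h1 := (h' n X).sub (h n X)
    have h2 : (fun t : ℝ => (t : ℂ) ^ n * (a n X - a' n X)) =o[𝓝[>] 0] fun t : ℝ => t ^ n := by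
      refine h1.congr' ?_ EventuallyEq.rfl
      filter_upwards [hev] with t ht
      rw [e t ht, Finset.sum_range_succ, Finset.sum_range_succ,
        ← Finset.sum_congr rfl fun i hi =>
          congrArg ((t : ℂ) ^ i * ·) (ih i (Finset.mem_range.1 hi))]
      ring
    have h3 : ∀ c > 0, ‖a n X - a' n X‖ ≤ c := fun c hc => by
      obtain ⟨t, ht, ht'⟩ := ((Asymptotics.isLittleO_iff.1 h2 hc).and hev).exists
      rw [norm_mul, norm_pow, Complex.norm_real, norm_pow, mul_comm] at ht
      exact le_of_mul_le_mul_right ht (pow_pos (norm_pos_iff.2 ht'.1.ne') n)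
    exact sub_eq_zero.1 (norm_le_zero_iff.1 (le_of_forall_pos_le_add fun c hc => by
      rw [zero_add]; exact h3 c hc))

/-- Uniqueness is applied twice: first the intermediate coefficients are determined for ε in (0,1],
then their own coefficients. -/
theorem isLamThenEpsExpansion_iff {F : ℝ → ℝ → Phase d → ℂ} {a₀ : ℕ → ℕ → Phase d → ℂ}
    {b : ℕ → ℝ → Phase d → ℂ}
    (h : ∀ ε ∈ Set.Ioc (0 : ℝ) 1, HasExpansion (fun lam => F ε lam) (fun k => b k ε))
    (h' : ∀ k, HasExpansion (b k) (fun n => a₀ n k)) (a : ℕ → ℕ → Phase d → ℂ) :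
    IsLamThenEpsExpansion F a ↔ a = a₀ := by
  constructor
  · rintro ⟨b', h1, h2⟩
    have hb : ∀ k, ∀ ε ∈ Set.Ioc (0 : ℝ) 1, b' k ε = b k ε := fun k ε hε =>
      congrFun ((h1 ε hε).unique (h ε hε) fun _ _ => rfl) k
    funext n k
    exact congrFun ((h2 k).unique (h' k) (hb k)) n
  · rintro rfl
    exact ⟨b, h, h'⟩

theorem isEpsThenLamExpansion_iff {F : ℝ → ℝ → Phase d → ℂ} {a₀ : ℕ → ℕ → Phase d → ℂ}
    {c : ℕ → ℝ → Phase d → ℂ}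
    (h : ∀ lam ∈ Set.Ioc (0 : ℝ) 1, HasExpansion (fun ε => F ε lam) (fun n => c n lam))
    (h' : ∀ n, HasExpansion (c n) (fun k => a₀ n k)) (a : ℕ → ℕ → Phase d → ℂ) :
    IsEpsThenLamExpansion F a ↔ a = a₀ := by
  have h1 := isLamThenEpsExpansion_iff (F := fun lam ε => F ε lam) (a₀ := fun k n => a₀ n k) h h'
    (fun k n => a n k)
  refine Iff.trans ?_ (h1.trans ⟨fun e => ?_, fun e => by rw [e]⟩)
  · exact Iff.rfl
  · funext n k
    exact congrFun (congrFun e k) n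

theorem FamBound.exists_norm_le {ρ : ℝ} {T : Type*} {S : Set T} {m : T → ℝ} {R : T → Phase d → ℂ}
    {s : T → ℝ} (h : FamBound S ρ m R s) (X : Phase d) {m₀ : ℝ} (hm : ∀ t ∈ S, m t = m₀) :
    ∃ C : ℝ, ∀ t ∈ S, ‖R t X‖ ≤ C * s t := by
  obtain ⟨C, -, hC⟩ := h.2 [] []
  refine ⟨C * japBracket X.2 ^ m₀, fun t ht => ?_⟩
  have := hC t ht X
  simp only [partialXXi, List.map_nil, dirDerivs_nil, List.length_nil, Nat.cast_zero, zero_mul,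
    sub_zero, hm t ht] at this
  linarith

/-- A function with finitely many values splits the family into finitely many subfamilies, whose
constants can be summed. It serves for the precision statement, where the symbol order depends on
the bounded integer N(ε, λ, ε_c). -/
theorem FamBound.of_fibers {ρ : ℝ} {T : Type*} {S : Set T} {m : T → ℝ} {R : T → Phase d → ℂ}
    {s : T → ℝ} (hs : ∀ t ∈ S, 0 ≤ s t) (φ : T → ℕ) (K : ℕ) (hφ : ∀ t ∈ S, φ t ≤ K)
    (h : ∀ n ≤ K, FamBound {t | t ∈ S ∧ φ t = n} ρ m R s) : FamBound S ρ m R s := by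
  refine ⟨fun t ht => (h (φ t) (hφ t ht)).1 t ⟨ht, rfl⟩, fun I J => ?_⟩
  have h1 : ∀ n, ∃ C : ℝ, 0 ≤ C ∧ (n ≤ K → ∀ t ∈ S, φ t = n → ∀ X : Phase d,
      ‖partialXXi I J (R t) X‖ ≤ C * s t * japBracket X.2 ^ (m t - J.length * ρ)) := fun n => by
    by_cases hn : n ≤ K
    · obtain ⟨C, h0, hC⟩ := (h n hn).2 I J
      exact ⟨C, h0, fun _ t ht e => hC t ⟨ht, e⟩⟩
    · exact ⟨0, le_rfl, fun h' => absurd h' hn⟩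
  choose C h0 hC using h1
  refine ⟨∑ n ∈ Finset.range (K + 1), C n, Finset.sum_nonneg fun n _ => h0 n, fun t ht X => ?_⟩
  refine (hC (φ t) (hφ t ht) t ht rfl X).trans (mul_le_mul_of_nonneg_right
    (mul_le_mul_of_nonneg_right ?_ (hs t ht)) (Real.rpow_nonneg (japBracket_pos _).le _))
  exact Finset.single_le_sum (f := C) (fun n _ => h0 n)
    (Finset.mem_range.2 (Nat.lt_succ_of_le (hφ t ht)))

end Expansions

/-! ### The expansions of the product -/

section Product

variable {d : ℕ} {ρ m₁ m₂ : ℝ} {B : Fin d → Fin d → Cfg d → ℝ} {f g : Phase d → ℂ}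

theorem famBound_nkTerm (hB : ∀ k l, IsBCInfty (B k l)) (hρ : 0 ≤ ρ) (hf : IsSymbol ρ m₁ f)
    (hg : IsSymbol ρ m₂ g) {T : Type*} (S : Set T) (n k : ℕ) :
    FamBound S ρ (fun _ => m₁ + m₂ - (n + k) * ρ) (fun _ => nkTerm B f g n k) (fun _ => 1) := by
  have h := (famBound_eps_lamTerm hB hρ hf hg k n).comp (S' := S) (φ := fun _ => (0, 0))
    fun _ _ => ⟨⟨le_rfl, zero_le_one⟩, ⟨le_rfl, zero_le_one⟩⟩
  refine (h.mul (c := fun _ => (n.factorial : ℂ)⁻¹) (s' := fun _ => 1) fun _ _ => ?_).congr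
    fun _ _ => funext fun X => nkTerm_eq hB (isDouble_tensor hρ hf hg) n k X
  rw [mul_one, norm_inv, Complex.norm_natCast]
  refine inv_le_one_of_one_le₀ ?_
  exact_mod_cast Nat.one_le_iff_ne_zero.2 (Nat.factorial_ne_zero n)

theorem famBound_eps_expansion (hB : ∀ k l, IsBCInfty (B k l)) (hρ : 0 ≤ ρ) (hf : IsSymbol ρ m₁ f)
    (hg : IsSymbol ρ m₂ g) (k M : ℕ) :
    FamBound (Set.Icc (0 : ℝ) 1) ρ (fun _ => m₁ + m₂ - (M + 1 + k) * ρ)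
      (fun ε X => lamTerm B f g k ε X
        - ∑ n ∈ Finset.range (M + 1), (ε : ℂ) ^ n * nkTerm B f g n k X)
      (fun ε => ε ^ (M + 1)) := by
  have hF := isDouble_tensor hρ hf hg
  have h := (famBound_eps_lamTerm hB hρ hf hg k (M + 1)).comp
    (S' := Set.Icc (0 : ℝ) 1 ×ˢ Set.Icc (0 : ℝ) 1) (φ := fun q : ℝ × ℝ => (q.2, 0))
    fun q hq => ⟨hq.2, ⟨le_rfl, zero_le_one⟩⟩
  have h1 := famBound_taylor (S := Set.Icc (0 : ℝ) 1) (T := ℝ) (ρ := ρ)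
    (m := fun _ => m₁ + m₂ - ((M + 1 : ℕ) + k) * ρ) (s := fun _ => 1)
    (H := oscInt (magTermKer B k) fun e => f e.1 * g e.2)
    (smooth_oscInt (eKer_magTermKer hB k).pGrowth hF) (1, 0) M
    (τ := fun _ => (0, 0)) (t := fun ε => ε) (fun ε hε => hε) (h.congr fun q _ => by
      funext X
      simp only [Prod.smul_mk, smul_eq_mul, mul_one, mul_zero, Prod.mk_add_mk, zero_add, add_zero]
      rfl)
  refine (h1.congr fun ε _ => funext fun X => ?_).mono (fun _ _ => ?_) fun _ _ => ?_
  · rw [lamTerm_eq hB hρ hf hg k ε 0 X]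
    congr 1
    · simp
    · refine Finset.sum_congr rfl fun n _ => ?_
      rw [nkTerm_eq hB hF]
      change _ = _ * dirDerivs (List.replicate n (epsDir d)) _ _
      ring
  · push_cast
    exact le_rfl
  · rw [one_mul]

theorem sum_range_nkTerm (lam : ℂ) (n : ℕ) {K : ℕ} (h : n ≤ K) (X : Phase d) :
    ∑ k ∈ Finset.range (K + 1), lam ^ k * nkTerm B f g n k X =
      ∑ k ∈ Finset.range (n + 1), lam ^ k * nkTerm B f g n k X := by
  refine (Finset.sum_subset (Finset.range_mono (by omega)) fun k _ hk => ?_).symm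
  rw [nkTerm_eq_zero (by simpa using hk), mul_zero]

theorem sum_range_nkTerm' (ε lam : ℂ) (n : ℕ) {K : ℕ} (h : n ≤ K) (X : Phase d) :
    ∑ k ∈ Finset.range (K + 1), ε ^ n * lam ^ k * nkTerm B f g n k X =
      ∑ k ∈ Finset.range (n + 1), ε ^ n * lam ^ k * nkTerm B f g n k X := by
  simp only [mul_assoc, ← Finset.mul_sum]
  rw [sum_range_nkTerm lam n h]

theorem norm_pow_mul_pow_le {ε lam : ℝ} (hε : ε ∈ Set.Icc (0 : ℝ) 1) (hl : lam ∈ Set.Icc (0 : ℝ) 1)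
    (n k : ℕ) : ‖(ε : ℂ) ^ n * (lam : ℂ) ^ k‖ ≤ ε ^ n := by
  rw [norm_mul, norm_pow, norm_pow, Complex.norm_real, Complex.norm_real, Real.norm_of_nonneg hε.1,
    Real.norm_of_nonneg hl.1]
  exact mul_le_of_le_one_right (pow_nonneg hε.1 _) (pow_le_one₀ hl.1 hl.2)

theorem norm_pow_mul_pow_le_max {ε lam : ℝ} (hε : ε ∈ Set.Icc (0 : ℝ) 1)
    (hl : lam ∈ Set.Icc (0 : ℝ) 1) {n k N : ℕ} (h : N ≤ n + k) :
    ‖(ε : ℂ) ^ n * (lam : ℂ) ^ k‖ ≤ max ε lam ^ N := by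
  rw [norm_mul, norm_pow, norm_pow, Complex.norm_real, Complex.norm_real, Real.norm_of_nonneg hε.1,
    Real.norm_of_nonneg hl.1]
  have h0 : 0 ≤ max ε lam := hε.1.trans (le_max_left _ _)
  calc ε ^ n * lam ^ k ≤ max ε lam ^ n * max ε lam ^ k :=
        mul_le_mul (pow_le_pow_left₀ hε.1 (le_max_left _ _) n)
          (pow_le_pow_left₀ hl.1 (le_max_right _ _) k) (pow_nonneg hl.1 _) (pow_nonneg h0 _)
    _ = max ε lam ^ (n + k) := (pow_add _ _ _).symm
    _ ≤ _ := pow_le_pow_of_le_one h0 (max_le hε.2 hl.2) h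

/-- The direct two-parameter expansion. -/
theorem famBound_two_parameter (hB : ∀ k l, IsBCInfty (B k l)) (hρ : 0 ≤ ρ) (hf : IsSymbol ρ m₁ f)
    (hg : IsSymbol ρ m₂ g) (N : ℕ) : FamBound unitSq ρ (fun _ => m₁ + m₂ - (N + 1) * ρ)
      (fun τ X => magWeyl B f g τ.1 τ.2 X - ∑ n ∈ Finset.range (N + 1), ∑ k ∈ Finset.range (n + 1),
        (τ.1 : ℂ) ^ n * (τ.2 : ℂ) ^ k * nkTerm B f g n k X) (fun τ => τ.1 ^ (N + 1)) := by
  have hN : 0 ≤ ((N : ℝ) + 1) * ρ := by positivity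
  -- The remainder of the λ-expansion to order N already contains ε^{N+1} and gains 2(N+1)ρ, more
  -- than is needed.
  have h1 := (famBound_lam_expansion hB hρ hf hg N).mono
    (m' := fun _ => m₁ + m₂ - (N + 1) * ρ) (s' := fun τ => τ.1 ^ (N + 1))
    (fun _ _ => by linarith) fun τ hτ => mul_le_of_le_one_right (pow_nonneg hτ.1.1 _)
      (pow_le_one₀ hτ.2.1 hτ.2.2)
  -- The remainders of the ε-expansions of the first N + 1 terms; their additional gain kρ is
  -- discarded to reach a common order.
  have h2 : FamBound unitSq ρ (fun _ => m₁ + m₂ - (N + 1) * ρ)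
      (fun τ X => ∑ k ∈ Finset.range (N + 1), (τ.2 : ℂ) ^ k * (lamTerm B f g k τ.1 X
        - ∑ n ∈ Finset.range (N + 1), (τ.1 : ℂ) ^ n * nkTerm B f g n k X))
      (fun τ => τ.1 ^ (N + 1)) := by
    refine FamBound.sum fun k _ => ?_
    have h3 := (famBound_eps_expansion hB hρ hf hg k N).comp (S' := unitSq) (φ := Prod.fst)
      fun τ hτ => hτ.1
    refine (h3.mul (c := fun τ : ℝ × ℝ => (τ.2 : ℂ) ^ k) (s' := fun τ => τ.1 ^ (N + 1))
      fun τ hτ => ?_).mono (fun _ _ => ?_) fun _ _ => le_rfl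
    · rw [norm_pow, Complex.norm_real, Real.norm_of_nonneg hτ.2.1]
      exact mul_le_of_le_one_left (pow_nonneg hτ.1.1 _) (pow_le_one₀ hτ.2.1 hτ.2.2)
    · have : 0 ≤ (k : ℝ) * ρ := by positivity
      linarith
  refine (h1.add h2).congr fun τ _ => funext fun X => ?_
  -- The triangular and the square sum agree because the (n,k) terms with k > n vanish.
  have e : ∑ n ∈ Finset.range (N + 1), ∑ k ∈ Finset.range (n + 1),
      (τ.1 : ℂ) ^ n * (τ.2 : ℂ) ^ k * nkTerm B f g n k X = ∑ k ∈ Finset.range (N + 1),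
        (τ.2 : ℂ) ^ k * ∑ n ∈ Finset.range (N + 1), (τ.1 : ℂ) ^ n * nkTerm B f g n k X := by
    rw [Finset.sum_congr rfl fun n hn => (sum_range_nkTerm' (τ.1 : ℂ) (τ.2 : ℂ) n
      (Nat.lt_succ_iff.1 (Finset.mem_range.1 hn)) X).symm, Finset.sum_comm]
    refine Finset.sum_congr rfl fun k _ => ?_
    rw [Finset.mul_sum]
    exact Finset.sum_congr rfl fun n _ => by ring
  simp only [e, mul_sub, Finset.sum_sub_distrib]
  ring

theorem sum_antidiagonal_range (F : ℕ → ℕ → ℂ) (N : ℕ) :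
    ∑ l ∈ Finset.range (N + 1), ∑ q ∈ Finset.HasAntidiagonal.antidiagonal l, F q.1 q.2 =
      ∑ n ∈ Finset.range (N + 1), ∑ k ∈ Finset.range (N + 1), if n + k ≤ N then F n k else 0 := by
  rw [← Finset.sum_product', ← Finset.sum_filter, ← Finset.sum_fiberwise_of_maps_to
    (g := fun q : ℕ × ℕ => q.1 + q.2) (t := Finset.range (N + 1))]
  · refine Finset.sum_congr rfl fun l hl => Finset.sum_congr ?_ fun _ _ => rfl
    ext q
    simp only [Finset.HasAntidiagonal.mem_antidiagonal, Finset.mem_filter, Finset.mem_product,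
      Finset.mem_range] at hl ⊢
    omega
  · intro q hq
    simp only [Finset.mem_filter, Finset.mem_product, Finset.mem_range] at hq ⊢
    omega

/-- The expansion by total order. -/
theorem famBound_total_order (hB : ∀ k l, IsBCInfty (B k l)) (hρ : 0 ≤ ρ) (hf : IsSymbol ρ m₁ f)
    (hg : IsSymbol ρ m₂ g) (N : ℕ) : FamBound unitSq ρ (fun _ => m₁ + m₂ - (N + 1) * ρ)
      (fun τ X => magWeyl B f g τ.1 τ.2 X - ∑ l ∈ Finset.range (N + 1),
        ∑ q ∈ Finset.HasAntidiagonal.antidiagonal l,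
          (τ.1 : ℂ) ^ q.1 * (τ.2 : ℂ) ^ q.2 * nkTerm B f g q.1 q.2 X)
      (fun τ => max τ.1 τ.2 ^ (N + 1)) := by
  have h1 := (famBound_two_parameter hB hρ hf hg N).mono
    (m' := fun _ => m₁ + m₂ - (N + 1) * ρ) (s' := fun τ => max τ.1 τ.2 ^ (N + 1))
    (fun _ _ => le_rfl) fun τ hτ => pow_le_pow_left₀ hτ.1.1 (le_max_left _ _) _
  -- The two partial sums differ by the terms with n, k ≤ N and n + k > N. Each has a coefficient of
  -- size at most max(ε, λ)^{N+1} and lies in the class of order m - (n + k)ρ ≤ m - (N + 1)ρ.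
  have h2 : FamBound unitSq ρ (fun _ => m₁ + m₂ - (N + 1) * ρ)
      (fun τ X => ∑ n ∈ Finset.range (N + 1), ∑ k ∈ Finset.range (N + 1),
        (if n + k ≤ N then 0 else (τ.1 : ℂ) ^ n * (τ.2 : ℂ) ^ k) * nkTerm B f g n k X)
      (fun τ => max τ.1 τ.2 ^ (N + 1)) := by
    refine FamBound.sum fun n _ => FamBound.sum fun k _ => ?_
    by_cases hnk : n + k ≤ N
    · simp only [if_pos hnk, zero_mul]
      exact famBound_zero
    · simp only [if_neg hnk]
      refine ((famBound_nkTerm hB hρ hf hg unitSq n k).mul (s' := fun τ => max τ.1 τ.2 ^ (N + 1))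
        fun τ hτ => ?_).mono (fun _ _ => ?_) fun _ _ => le_rfl
      · rw [mul_one]
        exact norm_pow_mul_pow_le_max hτ.1 hτ.2 (by omega)
      · have : ((N : ℝ) + 1) * ρ ≤ (n + k) * ρ :=
          mul_le_mul_of_nonneg_right (by exact_mod_cast not_le.1 hnk) hρ
        linarith
  refine (h1.add h2).congr fun τ _ => funext fun X => ?_
  rw [sum_antidiagonal_range fun n k => (τ.1 : ℂ) ^ n * (τ.2 : ℂ) ^ k * nkTerm B f g n k X,
    Finset.sum_congr rfl fun n hn => (sum_range_nkTerm' (τ.1 : ℂ) (τ.2 : ℂ) n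
      (Nat.lt_succ_iff.1 (Finset.mem_range.1 hn)) X).symm, sub_add, ← Finset.sum_sub_distrib]
  congr 1
  refine Finset.sum_congr rfl fun n _ => ?_
  rw [← Finset.sum_sub_distrib]
  refine Finset.sum_congr rfl fun k _ => ?_
  split_ifs <;> ring

theorem isSemiclassicalSymbol_magWeyl (hB : ∀ k l, IsBCInfty (B k l)) (hρ : 0 ≤ ρ)
    (hf : IsSymbol ρ m₁ f) (hg : IsSymbol ρ m₂ g) :
    IsSemiclassicalSymbol ρ (m₁ + m₂) 1 1 (magWeyl B f g) (nkTerm B f g) := by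
  have hsub : ∀ ε ∈ Set.Ico (0 : ℝ) 1, ∀ lam ∈ Set.Ico (0 : ℝ) 1, (ε, lam) ∈ unitSq :=
    fun ε hε lam hl => ⟨⟨hε.1, hε.2.le⟩, ⟨hl.1, hl.2.le⟩⟩
  refine ⟨fun ε hε lam hl => ?_, fun n k => ?_, fun N => ⟨fun ε hε lam hl => ?_, fun I J => ?_⟩⟩
  · have := (famBound_magWeyl hB hρ hf hg).isSymbol (hsub ε hε lam hl)
    exact this
  · have := (famBound_nkTerm hB hρ hf hg (Set.univ : Set Unit) n k).isSymbol (Set.mem_univ ())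
    exact this
  · have := (famBound_total_order hB hρ hf hg N).isSymbol (hsub ε hε lam hl)
    exact this
  · have hN : 0 ≤ ((N : ℝ) + 1) * ρ := by positivity
    have h := (famBound_total_order hB hρ hf hg N).mono (m' := fun _ => m₁ + m₂)
      (fun _ _ => by linarith) fun _ _ => le_rfl
    obtain ⟨C, hC⟩ := h.isUniformO.2 I J
    refine ⟨C, fun ε hε lam hl => ?_⟩
    have := hC (ε, lam) (hsub ε hε lam hl)
    exact this

/-- The two-parameter expansion to order N leaves ε^{N+1} ≤ ε_c. The surplus terms have n > N, hence
coefficients at most ε^n ≤ ε_c and order at most m - (N + 1)ρ. Cutting k at Nlam ≥ N loses nothing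
from the terms with n ≤ N, since those with k > n vanish. -/
theorem famBound_precision (hB : ∀ k l, IsBCInfty (B k l)) (hρ : 0 ≤ ρ) (hf : IsSymbol ρ m₁ f)
    (hg : IsSymbol ρ m₂ g) {N Nε Nlam : ℕ} (hε : N ≤ Nε) (hl : N ≤ Nlam)
    {S : Set (ℝ × ℝ × ℝ × ℕ)} (hN : ∀ p ∈ S, p.2.2.2 = N) (hu : ∀ p ∈ S, (p.1, p.2.1) ∈ unitSq)
    (hpow : ∀ p ∈ S, ∀ n, N < n → p.1 ^ n ≤ p.2.2.1) :
    FamBound S ρ (fun p => m₁ + m₂ - (p.2.2.2 + 1) * ρ)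
      (fun p X => magWeyl B f g p.1 p.2.1 X - ∑ n ∈ Finset.range (Nε + 1),
        ∑ k ∈ Finset.range (Nlam + 1), (p.1 : ℂ) ^ n * (p.2.1 : ℂ) ^ k * nkTerm B f g n k X)
      (fun p => p.2.2.1) := by
  have h1 := ((famBound_two_parameter hB hρ hf hg N).comp (φ := fun p : ℝ × ℝ × ℝ × ℕ => (p.1, p.2.1))
    hu).mono (m' := fun p => m₁ + m₂ - (p.2.2.2 + 1) * ρ) (s' := fun p => p.2.2.1)
      (fun p hp => by rw [hN p hp]) fun p hp => hpow p hp _ (Nat.lt_succ_self N)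
  have h2 : FamBound S ρ (fun p => m₁ + m₂ - (p.2.2.2 + 1) * ρ)
      (fun p X => ∑ n ∈ Finset.Ico (N + 1) (Nε + 1), ∑ k ∈ Finset.range (Nlam + 1),
        (-((p.1 : ℂ) ^ n * (p.2.1 : ℂ) ^ k)) * nkTerm B f g n k X) (fun p => p.2.2.1) := by
    refine FamBound.sum fun n hn => FamBound.sum fun k _ => ?_
    have hn' : N + 1 ≤ n := (Finset.mem_Ico.1 hn).1
    refine ((famBound_nkTerm hB hρ hf hg S n k).mul (s' := fun p => p.2.2.1)
      fun p hp => ?_).mono (fun p hp => ?_) fun _ _ => le_rfl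
    · rw [mul_one, norm_neg]
      exact (norm_pow_mul_pow_le (hu p hp).1 (hu p hp).2 n k).trans (hpow p hp n hn')
    · have : ((N : ℝ) + 1) * ρ ≤ (n + k) * ρ := by
        refine mul_le_mul_of_nonneg_right ?_ hρ
        have : ((N : ℝ) + 1) ≤ n := by exact_mod_cast hn'
        have : (0 : ℝ) ≤ k := k.cast_nonneg
        linarith
      rw [hN p hp]
      linarith
  refine (h1.add h2).congr fun p hp => funext fun X => ?_
  rw [Finset.sum_congr rfl fun n hn => (sum_range_nkTerm' (p.1 : ℂ) (p.2.1 : ℂ) n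
      ((Nat.lt_succ_iff.1 (Finset.mem_range.1 hn)).trans hl) X).symm,
    ← Finset.sum_range_add_sum_Ico _ (Nat.succ_le_succ hε)]
  simp only [neg_mul, Finset.sum_neg_distrib]
  ring

theorem isPrecisionClose_magWeyl (hB : ∀ k l, IsBCInfty (B k l)) (hρ : 0 ≤ ρ)
    (hf : IsSymbol ρ m₁ f) (hg : IsSymbol ρ m₂ g) (Nε Nlam : ℕ) :
    IsPrecisionClose ρ (m₁ + m₂) (magWeyl B f g) (nkTerm B f g) Nε Nlam := by
  refine FamBound.isUniformO (FamBound.of_fibers ?_ (fun p => p.2.2.2) Nε ?_ fun N hN => ?_)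
  · rintro p ⟨h0, -, ⟨nc, kc, h1, -⟩, -⟩
    exact (pow_nonneg h0.1.le _).trans h1.le
  · rintro p ⟨-, -, -, h, -⟩
    exact h
  -- If N exceeds Nlam, no admissible parameters have this order and the bound is vacuous.
  by_cases hl : N ≤ Nlam
  · refine famBound_precision hB hρ hf hg hN hl ?_ ?_ ?_
    · rintro p ⟨-, h⟩
      exact h
    · rintro p ⟨⟨h0, h1, -⟩, -⟩
      exact ⟨⟨h0.1.le, h0.2.le⟩, ⟨h1.1.le, h1.2.le⟩⟩
    · rintro p ⟨⟨h0, -, ⟨nc, kc, h1, -, -, -, h2⟩, -⟩, h3⟩ n hn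
      have h3' : p.2.2.2 = N := h3
      -- By definition of n_c one has ε^{n_c+1} < ε_c, and N = max{n_c, k_c} ≥ n_c passes this on to
      -- every power beyond N.
      have h4 : nc ≤ N := by rw [← h3', h2]; exact le_max_left _ _
      exact (pow_le_pow_of_le_one h0.1.le h0.2.le (by omega)).trans h1.le
  · have hempty : ∀ p : ℝ × ℝ × ℝ × ℕ, p.2.2.2 ≤ Nlam → p.2.2.2 = N → False := fun p h h' => by
      omega
    exact ⟨fun p hp => (hempty p hp.1.2.2.2.2 hp.2).elim,
      fun _ _ => ⟨0, le_rfl, fun p hp => (hempty p hp.1.2.2.2.2 hp.2).elim⟩⟩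

theorem hasExpansion_magWeyl_lam (hB : ∀ k l, IsBCInfty (B k l)) (hρ : 0 ≤ ρ)
    (hf : IsSymbol ρ m₁ f) (hg : IsSymbol ρ m₂ g) {ε : ℝ} (hε : ε ∈ Set.Ioc (0 : ℝ) 1) :
    HasExpansion (fun lam => magWeyl B f g ε lam) (fun k => lamTerm B f g k ε) := by
  refine hasExpansion_of_bound fun N X => ?_
  obtain ⟨C, hC⟩ := (famBound_lam_expansion hB hρ hf hg N).exists_norm_le X fun _ _ => rfl
  refine ⟨C * ε ^ (N + 1), fun t ht => ?_⟩
  have := hC (ε, t) ⟨⟨hε.1.le, hε.2⟩, ⟨ht.1.le, ht.2⟩⟩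
  rwa [← mul_assoc] at this

theorem hasExpansion_lamTerm (hB : ∀ k l, IsBCInfty (B k l)) (hρ : 0 ≤ ρ)
    (hf : IsSymbol ρ m₁ f) (hg : IsSymbol ρ m₂ g) (k : ℕ) :
    HasExpansion (lamTerm B f g k) (fun n => nkTerm B f g n k) := by
  refine hasExpansion_of_bound fun N X => ?_
  obtain ⟨C, hC⟩ := (famBound_eps_expansion hB hρ hf hg k N).exists_norm_le X fun _ _ => rfl
  exact ⟨C, fun t ht => hC t ⟨ht.1.le, ht.2⟩⟩

theorem hasExpansion_magWeyl_eps (hB : ∀ k l, IsBCInfty (B k l)) (hρ : 0 ≤ ρ)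
    (hf : IsSymbol ρ m₁ f) (hg : IsSymbol ρ m₂ g) {lam : ℝ} (hl : lam ∈ Set.Ioc (0 : ℝ) 1) :
    HasExpansion (fun ε => magWeyl B f g ε lam)
      (fun n X => ∑ k ∈ Finset.range (n + 1), (lam : ℂ) ^ k * nkTerm B f g n k X) := by
  refine hasExpansion_of_bound fun N X => ?_
  obtain ⟨C, hC⟩ := (famBound_two_parameter hB hρ hf hg N).exists_norm_le X fun _ _ => rfl
  refine ⟨C, fun t ht => ?_⟩
  have := hC (t, lam) ⟨⟨ht.1.le, ht.2⟩, ⟨hl.1.le, hl.2⟩⟩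
  simpa only [Finset.mul_sum, mul_assoc] using this

/-- The n-th coefficient of the ε-expansion is a polynomial in λ, hence its own expansion; the terms
beyond its degree vanish. -/
theorem hasExpansion_sum_nkTerm (n : ℕ) :
    HasExpansion (fun lam X => ∑ k ∈ Finset.range (n + 1), (lam : ℂ) ^ k * nkTerm B f g n k X)
      (fun k => nkTerm B f g n k) := by
  refine hasExpansion_of_bound fun N X => ⟨∑ k ∈ Finset.Ico (N + 1) (n + N + 1),
    ‖nkTerm B f g n k X‖, fun t ht => ?_⟩
  -- Padding the polynomial with zero terms up to degree n + N treats the cases N < n and N ≥ n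
  -- alike.
  rw [← sum_range_nkTerm (t : ℂ) n (Nat.le_add_right n N),
    ← Finset.sum_range_add_sum_Ico _ (show N + 1 ≤ n + N + 1 by omega), add_sub_cancel_left,
    Finset.sum_mul]
  refine (norm_sum_le _ _).trans (Finset.sum_le_sum fun k hk => ?_)
  rw [norm_mul, norm_pow, Complex.norm_real, Real.norm_of_nonneg ht.1.le, mul_comm]
  exact mul_le_mul_of_nonneg_left (pow_le_pow_of_le_one ht.1.le ht.2 (Finset.mem_Ico.1 hk).1)
    (norm_nonneg _)

end Product

end

theorem mainTheorem4 {d : ℕ} (B : Fin d → Fin d → Cfg d → ℝ) (hB : IsMagneticField B)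
    (ρ m₁ m₂ : ℝ) (hρ : ρ ∈ Set.Icc (0 : ℝ) 1) (f g : Phase d → ℂ)
    (hf : IsSymbol ρ m₁ f) (hg : IsSymbol ρ m₂ g) :
    -- the product and the terms of the expansions exist and lie in the right symbol classes
    (∀ ε ∈ Set.Icc (0 : ℝ) 1, ∀ lam ∈ Set.Icc (0 : ℝ) 1,
      (∀ X, IsOscIntegral ε (magKernel B ε lam) f g X (magWeyl B f g ε lam X)) ∧
      IsSymbol ρ (m₁ + m₂) (magWeyl B f g ε lam)) ∧
    (∀ ε ∈ Set.Icc (0 : ℝ) 1, ∀ k : ℕ,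
      (∀ X, IsOscIntegral ε (magKernelTerm B k ε) f g X (lamTerm B f g k ε X)) ∧
      IsSymbol ρ (m₁ + m₂ - 2 * k * ρ) (lamTerm B f g k ε)) ∧
    (∀ n k : ℕ, IsSymbol ρ (m₁ + m₂ - (n + k) * ρ) (nkTerm B f g n k)) ∧
    -- the expansion in `λ`, uniformly in `ε`
    (∀ K : ℕ, IsUniformO (Set.Icc (0 : ℝ) 1 ×ˢ Set.Icc (0 : ℝ) 1) ρ
      (fun _ => m₁ + m₂ - 2 * (K + 1) * ρ)
      (fun p X => magWeyl B f g p.1 p.2 X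
        - ∑ k ∈ Finset.range (K + 1), (p.2 : ℂ) ^ k * lamTerm B f g k p.1 X)
      (fun p => p.2 ^ (K + 1))) ∧
    -- each term of the expansion in `λ` expands in `ε`, with the `(n,k)` terms as coefficients
    (∀ k M : ℕ, IsUniformO (Set.Icc (0 : ℝ) 1) ρ
      (fun _ => m₁ + m₂ - (M + 1 + k) * ρ)
      (fun ε X => lamTerm B f g k ε X
        - ∑ n ∈ Finset.range (M + 1), (ε : ℂ) ^ n * nkTerm B f g n k X)
      (fun ε => ε ^ (M + 1))) ∧
    -- the direct two-parameter expansion, which has the same terms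
    (∀ N : ℕ, IsUniformO (Set.Icc (0 : ℝ) 1 ×ˢ Set.Icc (0 : ℝ) 1) ρ
      (fun _ => m₁ + m₂ - (N + 1) * ρ)
      (fun p X => magWeyl B f g p.1 p.2 X
        - ∑ n ∈ Finset.range (N + 1), ∑ k ∈ Finset.range (n + 1),
          (p.1 : ℂ) ^ n * (p.2 : ℂ) ^ k * nkTerm B f g n k X)
      (fun p => p.1 ^ (N + 1))) ∧
    -- the product is a two-parameter symbol, and its resummations are close in precision
    IsSemiclassicalSymbol ρ (m₁ + m₂) 1 1 (magWeyl B f g) (nkTerm B f g) ∧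
    (∀ Nε Nlam : ℕ, IsPrecisionClose ρ (m₁ + m₂) (magWeyl B f g) (nkTerm B f g) Nε Nlam) ∧
    -- both iterated expansions have exactly the `(n,k)` terms as coefficients
    (∀ a : ℕ → ℕ → Phase d → ℂ,
      (IsLamThenEpsExpansion (magWeyl B f g) a ↔ a = nkTerm B f g) ∧
      (IsEpsThenLamExpansion (magWeyl B f g) a ↔ a = nkTerm B f g)) := by
  have hB' := hB.bcInfty
  have h0 := hρ.1
  refine ⟨fun ε hε lam hl => ⟨fun X => ?_, ?_⟩, fun ε hε k => ⟨fun X => ?_, ?_⟩, fun n k => ?_,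
    fun K => ?_, fun k M => (famBound_eps_expansion hB' h0 hf hg k M).isUniformO,
    fun N => (famBound_two_parameter hB' h0 hf hg N).isUniformO,
    isSemiclassicalSymbol_magWeyl hB' h0 hf hg, isPrecisionClose_magWeyl hB' h0 hf hg,
    fun a => ⟨?_, ?_⟩⟩
  · rw [magWeyl_eq hB' h0 hf hg]
    exact isOscIntegral_magKer hB' h0 hf hg ε lam X
  · exact (famBound_magWeyl hB' h0 hf hg).isSymbol (t := (ε, lam)) ⟨hε, hl⟩
  -- This kernel does not involve λ, so the parameter λ of the oscillatory integral may be set to 0.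
  · rw [lamTerm_eq hB' h0 hf hg k ε 0]
    exact isOscIntegral_magTermKer hB' h0 hf hg k ε 0 X
  · exact (famBound_lamTerm hB' h0 hf hg k).isSymbol hε
  · exact (famBound_nkTerm hB' h0 hf hg (Set.univ : Set Unit) n k).isSymbol (Set.mem_univ ())
  · refine ((famBound_lam_expansion hB' h0 hf hg K).mono (fun _ _ => le_rfl)
      fun τ hτ => ?_).isUniformO
    -- The additional factor ε^{K+1} ≤ 1 in the remainder is dropped here.
    exact mul_le_of_le_one_left (pow_nonneg hτ.2.1 _) (pow_le_one₀ hτ.1.1 hτ.1.2)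
  · exact isLamThenEpsExpansion_iff (fun ε hε => hasExpansion_magWeyl_lam hB' h0 hf hg hε)
      (hasExpansion_lamTerm hB' h0 hf hg) a
  · exact isEpsThenLamExpansion_iff (fun lam hl => hasExpansion_magWeyl_eps hB' h0 hf hg hl)
      hasExpansion_sum_nkTerm a
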